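/- **Setting.** Let $P=(p_1,\dots,p_n)$ be a sequence of $n$ points in $\mathbb R^2$ in general position, i.e. no two points share an $x$-coordinate or a $y$-coordinate. For a subsequence $Q$ of $P$ (points keep their index in $P$), the upper hull $\mathrm{UH}(Q)$ is the part of the boundary of $\mathrm{conv}(Q)$ that runs clockwise from the leftmost to the rightmost point of $Q$; it is represented by the sequence of its vertices, from left to right. $P$ fulfils the (upper) convex-hull promise if for any two vertices $p,q$ of $\mathrm{UH}(P)$ we have $\mathrm{index}(p)<\mathrm{index}(q)\iff x(p)<x(q)$; this holds in particular if the equivalence holds for all pairs of vertices of $\mathrm{conv}(P)$. For a finite set $L=\{\ell_1<\dots<\ell_k\}$ of vertical lines (identified with their $x$-values, $\ell_0=-\infty$, $\ell_{k+1}=\infty$), the $i$-th slab, $0\le i\le k$, is $\gamma_i=\{\ell_i\le x<\ell_{i+1}\}$. The bridge of $Q$ across $\ell_i$ is the edge $v_i^-v_i^+$ of $\mathrm{UH}(Q)$ with $x(v_i^-)<\ell_i\le x(v_i^+)$, if there is one. The safe set $Q^{(\gamma_i)}$ consists of the points $p\in Q\cap\gamma_i$ with $\mathrm{index}(v_i^+)\le\mathrm{index}(p)\le\mathrm{index}(v_{i+1}^-)$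 and $x(v_i^+)\le x(p)\le x(v_{i+1}^-)$, where a condition that refers to a bridge that does not exist is void. **Algorithm 1** (parameter $b$, constant $K$), on a subsequence $Q$: if $|Q|\le b$, compute and return $\mathrm{UH}(Q)$ directly. Otherwise find a set $L$ of at most $Kb$ vertical lines each of whose slabs contains at most $K|Q|/b$ points of $Q$; for every slab $\gamma$ of $L$, from left to right, call the algorithm recursively on $Q^{(\gamma)}$ (in index order); return the concatenation of the results (consecutive nonempty results being joined by the bridges across the lines of $L$). **Model.** A real RAM: a single finite deterministic program for all $n$, acting on $w$-bit words (arithmetic modulo $2^w$, truncated subtraction, rounded division) and on exact reals (with $+,-,\times,\div$ and comparison, and no conversion of reals to words), with indirectly addressed memory and recursive procedures; every operation, memory access, test and procedure call costs one step. The input consists of $n$ and the coordinates of $p_1,\dots,p_n$ in this order; the output is the list of indices of the vertices of the upper hull. **Theorem.** There are a real RAM program and absolute constants $\kappa,K\in\mathbb N$ and $C$ such that the following holds for every $n\ge 0$, every sequence $P$ of $n$ points in the plane in general position that fulfils the upper convex-hull promise, and every word length $w$ with $2^w\ge(n+2)^\kappa$. For some integer $b$ with $\sqrt{\log_2 n}\le\log_2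 b\le\sqrt{\log_2 n}+1$ (read $\log_2 0$ as $0$), the program executes Algorithm 1 with parameter $b$ on $P$ (that is, it calls its recursive procedure exactly once from its main part, on $P$, and the tree of the calls of this procedure, with their arguments and results, is that of a run of Algorithm 1), it halts with output $\mathrm{UH}(P)$, and it takes at most $C\,(n\sqrt{\log_2 n}+1)$ steps, i.e. $O(n\sqrt{\log n})$ time. -/

import Mathlib

/-! ### Planar point sequences, upper hulls, promises -/

namespace PlanarHull

/-- No two points of the sequence share an `x`- or a `y`-coordinate. -/
def GeneralPosition {n : ℕ} (P : Fin n → ℝ × ℝ) : Prop :=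
  (Function.Injective fun i => (P i).1) ∧ Function.Injective fun i => (P i).2

/-- The point set of the subsequence of `P` given by the list `Q` of indices. -/
def pts {n : ℕ} (P : Fin n → ℝ × ℝ) (Q : List (Fin n)) : Set (ℝ × ℝ) :=
  P '' {i | i ∈ Q}

/-- `P i` is a vertex of the convex hull of the subsequence `Q`. -/
def IsHullVertex {n : ℕ} (P : Fin n → ℝ × ℝ) (Q : List (Fin n)) (i : Fin n) : Prop :=
  i ∈ Q ∧ P i ∈ (convexHull ℝ (pts P Q)).extremePoints ℝ

/-- `P i` is a vertex of the upper hull of `Q`: a vertex of the convex hull with no point of the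
convex hull vertically above it. -/
def IsUpperVertex {n : ℕ} (P : Fin n → ℝ × ℝ) (Q : List (Fin n)) (i : Fin n) : Prop :=
  IsHullVertex P Q i ∧ ∀ y, (P i).2 < y → ((P i).1, y) ∉ convexHull ℝ (pts P Q)

/-- `H` is the upper hull of `Q`, represented by the sequence of (the indices of) its vertices in
clockwise order, that is, from left to right. -/
def IsUpperHull {n : ℕ} (P : Fin n → ℝ × ℝ) (Q H : List (Fin n)) : Prop :=
  H.Pairwise (fun i j => (P i).1 < (P j).1) ∧ ∀ i, i ∈ H ↔ IsUpperVertex P Q i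

/-- Convex hull promise: on the vertices of the convex hull, index order is `x`-order. -/
def ConvexHullPromise {n : ℕ} (P : Fin n → ℝ × ℝ) : Prop :=
  ∀ i j, IsHullVertex P (List.finRange n) i → IsHullVertex P (List.finRange n) j →
    (i < j ↔ (P i).1 < (P j).1)

/-- Upper convex hull promise: on the vertices of the upper hull, index order is `x`-order. -/
def UpperHullPromise {n : ℕ} (P : Fin n → ℝ × ℝ) : Prop :=
  ∀ i j, IsUpperVertex P (List.finRange n) i → IsUpperVertex P (List.finRange n) j →
    (i < j ↔ (P i).1 < (P j).1)

theorem ConvexHullPromise.upper {n : ℕ} {P : Fin n → ℝ × ℝ} (h : ConvexHullPromise P) :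
    UpperHullPromise P :=
  fun i j hi hj => h i j hi.1 hj.1

/-! ### Slabs, bridges and safe points -/

/-- `(u, v)` is the bridge of `Q` across the vertical line `x = l`: the edge of the upper hull of
`Q` that meets the line, where edges are half-open (they contain their right endpoint only). -/
def IsBridge {n : ℕ} (P : Fin n → ℝ × ℝ) (Q : List (Fin n)) (l : ℝ) (u v : Fin n) : Prop :=
  IsUpperVertex P Q u ∧ IsUpperVertex P Q v ∧ (P u).1 < l ∧ l ≤ (P v).1 ∧
    ∀ w, IsUpperVertex P Q w → (P w).1 ≤ (P u).1 ∨ (P v).1 ≤ (P w).1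

/-- The left line of the `i`-th slab (`i = 0, …, L.length`) of the increasing list of lines `L`;
`none` stands for `-∞`. -/
def leftLine (L : List ℝ) (i : ℕ) : Option ℝ := if i = 0 then none else L[i - 1]?

/-- The right line of the `i`-th slab; `none` stands for `+∞`. -/
def rightLine (L : List ℝ) (i : ℕ) : Option ℝ := L[i]?

/-- `P p` lies in the `i`-th slab, closed on the left and open on the right. -/
def InSlab {n : ℕ} (P : Fin n → ℝ × ℝ) (L : List ℝ) (i : ℕ) (p : Fin n) : Prop :=
  (∀ l, leftLine L i = some l → l ≤ (P p).1) ∧ ∀ l, rightLine L i = some l → (P p).1 < l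

/-- `P p` is a safe point of the `i`-th slab: it lies in the slab and, in index order as well as in
`x`-order, it is not before the right endpoint of the bridge across the left line of the slab and
not after the left endpoint of the bridge across its right line. -/
def IsSafe {n : ℕ} (P : Fin n → ℝ × ℝ) (Q : List (Fin n)) (L : List ℝ) (i : ℕ) (p : Fin n) :
    Prop :=
  InSlab P L i p ∧
  (∀ l u v, leftLine L i = some l → IsBridge P Q l u v → v ≤ p ∧ (P v).1 ≤ (P p).1) ∧
  (∀ l u v, rightLine L i = some l → IsBridge P Q l u v → p ≤ u ∧ (P p).1 ≤ (P u).1)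

open Classical in
/-- The points of `Q` in the `i`-th slab, in the order of `Q`. -/
noncomputable def slab {n : ℕ} (P : Fin n → ℝ × ℝ) (Q : List (Fin n)) (L : List ℝ) (i : ℕ) :
    List (Fin n) :=
  Q.filter fun p => decide (InSlab P L i p)

open Classical in
/-- The safe points of `Q` in the `i`-th slab, in the order of `Q`. -/
noncomputable def safe {n : ℕ} (P : Fin n → ℝ × ℝ) (Q : List (Fin n)) (L : List ℝ) (i : ℕ) :
    List (Fin n) :=
  Q.filter fun p => decide (IsSafe P Q L i p)

end PlanarHull

/-! ### A real RAM with a step count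

Data are `w`-bit words and exact reals, kept in word registers and in finitely many (the program
text is finite) unbounded arrays of words and of reals. Every operation, memory access, test and
procedure call costs one step. There is no conversion of reals to words. -/

namespace RealRAM

structure State where
  reg : ℕ → ℕ
  word : ℕ → ℕ → ℕ
  real : ℕ → ℕ → ℝ

/-- Word expressions; `get a e` reads cell `e` of word array `a`. -/
inductive WExp where
  | const (c : ℕ)
  | reg (r : ℕ)
  | get (a : ℕ) (e : WExp)
  | add (e f : WExp)
  | sub (e f : WExp)
  | mul (e f : WExp)
  | div (e f : WExp)

/-- Real expressions; `get a e` reads cell `e` of real array `a`. -/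
inductive RExp where
  | const (c : ℤ)
  | get (a : ℕ) (e : WExp)
  | add (e f : RExp)
  | sub (e f : RExp)
  | mul (e f : RExp)
  | div (e f : RExp)

inductive Test where
  | wordLt (e f : WExp)
  | wordEq (e f : WExp)
  | realLt (e f : RExp)

/-- Word arithmetic on `w`-bit words: results are reduced modulo `2 ^ w`, subtraction is
truncated at `0`, division rounds down. -/
def WExp.eval (w : ℕ) (s : State) : WExp → ℕ
  | const c => c % 2 ^ w
  | reg r => s.reg r
  | get a e => s.word a (e.eval w s)
  | add e f => (e.eval w s + f.eval w s) % 2 ^ w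
  | sub e f => e.eval w s - f.eval w s
  | mul e f => (e.eval w s * f.eval w s) % 2 ^ w
  | div e f => e.eval w s / f.eval w s

noncomputable def RExp.eval (w : ℕ) (s : State) : RExp → ℝ
  | const c => c
  | get a e => s.real a (e.eval w s)
  | add e f => e.eval w s + f.eval w s
  | sub e f => e.eval w s - f.eval w s
  | mul e f => e.eval w s * f.eval w s
  | div e f => e.eval w s / f.eval w s

def Test.Holds (w : ℕ) (s : State) : Test → Prop
  | wordLt e f => e.eval w s < f.eval w s
  | wordEq e f => e.eval w s = f.eval w s
  | realLt e f => e.eval w s < f.eval w s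

def WExp.cost : WExp → ℕ
  | const _ => 1
  | reg _ => 1
  | get _ e => e.cost + 1
  | add e f => e.cost + f.cost + 1
  | sub e f => e.cost + f.cost + 1
  | mul e f => e.cost + f.cost + 1
  | div e f => e.cost + f.cost + 1

def RExp.cost : RExp → ℕ
  | const _ => 1
  | get _ e => e.cost + 1
  | add e f => e.cost + f.cost + 1
  | sub e f => e.cost + f.cost + 1
  | mul e f => e.cost + f.cost + 1
  | div e f => e.cost + f.cost + 1

def Test.cost : Test → ℕ
  | wordLt e f => e.cost + f.cost + 1
  | wordEq e f => e.cost + f.cost + 1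
  | realLt e f => e.cost + f.cost + 1

inductive Cmd where
  | skip
  | setReg (r : ℕ) (e : WExp)
  | setWord (a : ℕ) (i e : WExp)
  | setReal (a : ℕ) (i : WExp) (e : RExp)
  | seq (c d : Cmd)
  | ite (b : Test) (c d : Cmd)
  | loop (b : Test) (c : Cmd)
  | call (f : ℕ)

/-- A program: a main command and a finite list of (possibly recursive) procedures, which act on
the global state. -/
structure Program where
  main : Cmd
  procs : List Cmd

def State.setReg (s : State) (r v : ℕ) : State :=
  { s with reg := Function.update s.reg r v }

def State.setWord (s : State) (a i v : ℕ) : State :=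
  { s with word := Function.update s.word a (Function.update (s.word a) i v) }

def State.setReal (s : State) (a i : ℕ) (v : ℝ) : State :=
  { s with real := Function.update s.real a (Function.update (s.real a) i v) }

/-- The record of one activation of procedure `0`: the states on entry and on return, and the
activations of procedure `0` nested directly in it, in temporal order. -/
inductive CallTree where
  | node (pre post : State) (children : List CallTree)

/-- `Exec w procs c s t tr s'`: on `w`-bit words, command `c` started in state `s` halts in state
`s'` after exactly `t` steps; `tr` records the outermost activations of procedure `0` on the way,
in temporal order. -/
inductive Exec (w : ℕ) (procs : List Cmd) :
    Cmd → State → ℕ → List CallTree → State → Prop where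
  | skip (s : State) : Exec w procs .skip s 1 [] s
  | setReg (s : State) (r : ℕ) (e : WExp) :
      Exec w procs (.setReg r e) s (e.cost + 1) [] (s.setReg r (e.eval w s))
  | setWord (s : State) (a : ℕ) (i e : WExp) :
      Exec w procs (.setWord a i e) s (i.cost + e.cost + 1) []
        (s.setWord a (i.eval w s) (e.eval w s))
  | setReal (s : State) (a : ℕ) (i : WExp) (e : RExp) :
      Exec w procs (.setReal a i e) s (i.cost + e.cost + 1) []
        (s.setReal a (i.eval w s) (e.eval w s))
  | seq {c d : Cmd} {s s₁ s₂ : State} {t₁ t₂ : ℕ} {tr₁ tr₂ : List CallTree} :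
      Exec w procs c s t₁ tr₁ s₁ → Exec w procs d s₁ t₂ tr₂ s₂ →
      Exec w procs (.seq c d) s (t₁ + t₂) (tr₁ ++ tr₂) s₂
  | ite_true {b : Test} {c d : Cmd} {s s₁ : State} {t : ℕ} {tr : List CallTree} :
      b.Holds w s → Exec w procs c s t tr s₁ →
      Exec w procs (.ite b c d) s (b.cost + t) tr s₁
  | ite_false {b : Test} {c d : Cmd} {s s₁ : State} {t : ℕ} {tr : List CallTree} :
      ¬ b.Holds w s → Exec w procs d s t tr s₁ →
      Exec w procs (.ite b c d) s (b.cost + t) tr s₁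
  | loop_true {b : Test} {c : Cmd} {s s₁ s₂ : State} {t₁ t₂ : ℕ} {tr₁ tr₂ : List CallTree} :
      b.Holds w s → Exec w procs c s t₁ tr₁ s₁ → Exec w procs (.loop b c) s₁ t₂ tr₂ s₂ →
      Exec w procs (.loop b c) s (b.cost + t₁ + t₂) (tr₁ ++ tr₂) s₂
  | loop_false {b : Test} {c : Cmd} {s : State} :
      ¬ b.Holds w s → Exec w procs (.loop b c) s b.cost [] s
  | call_zero {c : Cmd} {s s₁ : State} {t : ℕ} {tr : List CallTree} :
      procs[0]? = some c → Exec w procs c s t tr s₁ →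
      Exec w procs (.call 0) s (t + 1) [.node s s₁ tr] s₁
  | call_succ {f : ℕ} {c : Cmd} {s s₁ : State} {t : ℕ} {tr : List CallTree} :
      procs[f + 1]? = some c → Exec w procs c s t tr s₁ →
      Exec w procs (.call (f + 1)) s (t + 1) tr s₁

/-- The machine is deterministic. -/
theorem Exec.deterministic {w : ℕ} {procs : List Cmd} {c : Cmd} {s s₁ s₂ : State} {t₁ t₂ : ℕ}
    {tr₁ tr₂ : List CallTree} (h₁ : Exec w procs c s t₁ tr₁ s₁)
    (h₂ : Exec w procs c s t₂ tr₂ s₂) : t₁ = t₂ ∧ tr₁ = tr₂ ∧ s₁ = s₂ := by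
  induction h₁ generalizing t₂ tr₂ s₂ with
  | skip | setReg | setWord | setReal => cases h₂; exact ⟨rfl, rfl, rfl⟩
  | seq _ _ ih₁ ih₂ =>
    cases h₂ with
    | seq a b =>
      obtain ⟨rfl, rfl, rfl⟩ := ih₁ a
      obtain ⟨rfl, rfl, rfl⟩ := ih₂ b
      exact ⟨rfl, rfl, rfl⟩
  | ite_true hb _ ih =>
    cases h₂ with
    | ite_true _ a => obtain ⟨rfl, rfl, rfl⟩ := ih a; exact ⟨rfl, rfl, rfl⟩
    | ite_false hn _ => exact absurd hb hn
  | ite_false hb _ ih =>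
    cases h₂ with
    | ite_true hn _ => exact absurd hn hb
    | ite_false _ a => obtain ⟨rfl, rfl, rfl⟩ := ih a; exact ⟨rfl, rfl, rfl⟩
  | loop_true hb _ _ ih₁ ih₂ =>
    cases h₂ with
    | loop_true _ a b =>
      obtain ⟨rfl, rfl, rfl⟩ := ih₁ a
      obtain ⟨rfl, rfl, rfl⟩ := ih₂ b
      exact ⟨rfl, rfl, rfl⟩
    | loop_false hn => exact absurd hb hn
  | loop_false hb =>
    cases h₂ with
    | loop_true hn _ _ => exact absurd hn hb
    | loop_false _ => exact ⟨rfl, rfl, rfl⟩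
  | call_zero hp _ ih =>
    cases h₂ with
    | call_zero hq a =>
      cases hp.symm.trans hq
      obtain ⟨rfl, rfl, rfl⟩ := ih a
      exact ⟨rfl, rfl, rfl⟩
  | call_succ hp _ ih =>
    cases h₂ with
    | call_succ hq a =>
      cases hp.symm.trans hq
      obtain ⟨rfl, rfl, rfl⟩ := ih a
      exact ⟨rfl, rfl, rfl⟩

/-- Initial state for the input sequence `P`: register `0` holds the number `n` of points, real
arrays `0` and `1` hold their `x`- and `y`-coordinates in index order, all else is `0`. -/
noncomputable def init {n : ℕ} (P : Fin n → ℝ × ℝ) : State where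
  reg r := if r = 0 then n else 0
  word _ _ := 0
  real a i :=
    if h : i < n then (if a = 0 then (P ⟨i, h⟩).1 else if a = 1 then (P ⟨i, h⟩).2 else 0) else 0

/-- The argument of an activation of procedure `0`, a list of point indices: the segment of word
array `0` whose start and length are in registers `0` and `1`. -/
def State.argument (s : State) : List ℕ :=
  (List.range (s.reg 1)).map fun k => s.word 0 (s.reg 0 + k)

/-- The result of an activation of procedure `0`, or of the program, a list of point indices: the
segment of word array `1` whose start and length are in registers `2` and `3`. -/
def State.result (s : State) : List ℕ :=
  (List.range (s.reg 3)).map fun k => s.word 1 (s.reg 2 + k)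

end RealRAM

/-! ### The recursive algorithm -/

namespace PlanarHull

open RealRAM

/-- `HullRun P K b Q H T`: the activation `T` of procedure `0` is a run of the recursive upper hull
algorithm with parameter `b` on the subsequence `Q` of `P`, and it returns `H`.
* If `Q` has at most `b` points, its upper hull is computed directly.
* Otherwise a set `L` of at most `K * b` vertical lines is found such that every slab of `L`
  contains at most `K * |Q| / b` points of `Q`; there is one recursive call for every slab, in
  order from left to right, on exactly the safe points of `Q` in that slab; and the concatenation
  of the results is returned. (The bridges across the lines of `L` are the edges that join the last
  vertex of a nonempty result to the first vertex of the next nonempty one.) -/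
inductive HullRun {n : ℕ} (P : Fin n → ℝ × ℝ) (K b : ℕ) :
    List (Fin n) → List (Fin n) → CallTree → Prop where
  | base {Q H : List (Fin n)} {s s' : State} :
      s.argument = Q.map Fin.val → s'.result = H.map Fin.val →
      Q.length ≤ b → IsUpperHull P Q H →
      HullRun P K b Q H (.node s s' [])
  | step {Q : List (Fin n)} {s s' : State} (L : List ℝ) (H : ℕ → List (Fin n))
      (T : ℕ → CallTree) :
      s.argument = Q.map Fin.val →
      s'.result = ((List.range (L.length + 1)).flatMap H).map Fin.val →
      b < Q.length →
      L.Pairwise (· < ·) → L.length ≤ K * b →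
      (∀ i ≤ L.length, b * (slab P Q L i).length ≤ K * Q.length) →
      (∀ i ≤ L.length, HullRun P K b (safe P Q L i) (H i) (T i)) →
      HullRun P K b Q ((List.range (L.length + 1)).flatMap H)
        (.node s s' ((List.range (L.length + 1)).map T))

end PlanarHull

/-! ### A program logic for the real RAM -/

namespace RealRAM

-- Correctness rests on one invariant. A subsequence `Q` is `Closed` if every point of `Q` has
-- vertices of the upper hull of `P` that belong to `Q` weakly to its left and weakly to its right,
-- and if `Q` contains every vertex of that hull between two of its own. For a closed `Q`, bridges
-- are bridges of `P` (`Closed.bridge`) and hull vertices are exactly the vertices of `P` that lie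
-- in `Q` (`Closed.up_iff`). On these the promise makes index order agree with `x`-order, so
-- discarding points that are on the wrong side of a bridge endpoint, by index or by `x`, loses no
-- vertex. The safe sets are closed again (`Closed.block`), and their hulls concatenate to the hull
-- of `Q`.
--
-- Let `e` be the least number with `n ≤ 2 ^ (e * e)`, `b = 2 ^ e` and `c = b ^ 3`. Every slab
-- receives at most `|Q| / b` points, so `e` levels of recursion suffice. Before the recursion, the
-- index sequence is cut into chunks of `c` consecutive indices; each chunk is sorted by `x` and its
-- hull is computed, at a cost of `O(log c) = O(e)` per point. Two charging schemes bound the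
-- recursion (`hullSpec`). A call on at most `c` points sorts directly and is charged to its points,
-- `O(e)` each; this is used on at most three levels besides the direct case. A call on more than
-- `c` points costs `O(R * c)`, where `R` is the number of chunks between its first and last index.
-- It is charged to the range of its indices: `R * c` is less than three times the length of that
-- range, since the range is longer than `c`. The ranges of the blocks of one call are disjoint,
-- because indices in block `i` lie between the right endpoint of one bridge and that of the next.
-- Hence a level of large calls costs `O(n)`, and the total is `O(n * e)`.
--
-- It remains to do a large call in time `O(R * c)` (`split_runs`). Note `log n ≤ e * e ≤ 2 * b`, so
-- `R * b ^ 2` items can be sorted. If `|Q| < 2 * R * b ^ 2`, then `Q` itself is sorted. Otherwise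
-- the lines come from a sample: every `b`-th point of `Q`, read chunk by chunk in sorted order, is
-- sorted, and lines are drawn at regular distances. Passing from the sample back to `Q` loses at
-- most `b - 1` points per chunk and slab, which density makes affordable (`linesDense_runs`).
--
-- The bridges of a dense `Q` are bridges of `P`, hence of the union of the chunks, for which chunk
-- hulls are at hand (`candidates_runs`). Every `b`-th edge of each chunk hull is taken, these edges
-- are sorted by slope, and every `R`-th of them gives at most `b ^ 2` sampled slopes. A
-- simultaneous walk along each chunk hull and the slopes finds the extreme points of the union in
-- the sampled directions; their position relative to a line tells between which two sampled slopes
-- the slope of its bridge lies (`slope_mem_interval`). The endpoints of the bridge are vertices of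
-- chunk hulls with a supporting line in that slope interval. At most `3 * R * b` vertices qualify
-- for each of the at most `4 * b` lines (`length_collectedAll_le`), so the hull of all of them is
-- affordable, and it contains the bridges.
--
-- The step count is carried through as credit: loop invariants contain the number of steps still
-- available, and amortization is the choice of that number.

notation:60 c:61 "⨾" d:60 => Cmd.seq c d

@[simp] theorem State.setReg_reg (s : State) (r v r' : ℕ) :
    (s.setReg r v).reg r' = if r' = r then v else s.reg r' := by
  simp [State.setReg, Function.update_apply]

@[simp] theorem State.setReg_word (s : State) (r v : ℕ) : (s.setReg r v).word = s.word := rfl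

@[simp] theorem State.setReg_real (s : State) (r v : ℕ) : (s.setReg r v).real = s.real := rfl

@[simp] theorem State.setWord_reg (s : State) (a i v : ℕ) : (s.setWord a i v).reg = s.reg := rfl

@[simp] theorem State.setWord_word (s : State) (a i v a' : ℕ) :
    (s.setWord a i v).word a' = if a' = a then Function.update (s.word a) i v else s.word a' := by
  simp only [State.setWord, Function.update_apply]

@[simp] theorem State.setWord_real (s : State) (a i v : ℕ) : (s.setWord a i v).real = s.real := rfl

@[simp] theorem State.setReal_reg (s : State) (a i : ℕ) (v : ℝ) :
    (s.setReal a i v).reg = s.reg := rfl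

@[simp] theorem State.setReal_word (s : State) (a i : ℕ) (v : ℝ) :
    (s.setReal a i v).word = s.word := rfl

@[simp] theorem State.setReal_real (s : State) (a i : ℕ) (v : ℝ) (a' : ℕ) :
    (s.setReal a i v).real a' = if a' = a then Function.update (s.real a) i v else s.real a' := by
  simp only [State.setReal, Function.update_apply]

/-- `Runs w procs c s T post`: started in `s`, command `c` halts within `T` steps, without an
activation of procedure `0`, in a state that satisfies `post`. -/
def Runs (w : ℕ) (procs : List Cmd) (c : Cmd) (s : State) (T : ℕ) (post : State → Prop) : Prop :=
  ∃ t s', Exec w procs c s t [] s' ∧ t ≤ T ∧ post s'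

/-- Weakest precondition of a command without loops and calls. -/
def Cmd.wp (w : ℕ) : Cmd → (State → Prop) → State → Prop
  | .skip, post, s => post s
  | .setReg r e, post, s => post (s.setReg r (e.eval w s))
  | .setWord a i e, post, s => post (s.setWord a (i.eval w s) (e.eval w s))
  | .setReal a i e, post, s => post (s.setReal a (i.eval w s) (e.eval w s))
  | .seq c d, post, s => c.wp w (d.wp w post) s
  | .ite b c d, post, s => (b.Holds w s → c.wp w post s) ∧ (¬ b.Holds w s → d.wp w post s)
  | .loop _ _, _, _ => False
  | .call _, _, _ => False

/-- Upper bound for the number of steps of a command without loops and calls. -/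
def Cmd.worst : Cmd → ℕ
  | .skip => 1
  | .setReg _ e => e.cost + 1
  | .setWord _ i e => i.cost + e.cost + 1
  | .setReal _ i e => i.cost + e.cost + 1
  | .seq c d => c.worst + d.worst
  | .ite b c d => b.cost + max c.worst d.worst
  | .loop _ _ => 0
  | .call _ => 0

section
variable {w : ℕ} {procs : List Cmd}

theorem Runs.mono {c : Cmd} {s : State} {T T' : ℕ} {post post' : State → Prop}
    (h : Runs w procs c s T post) (hT : T ≤ T') (hp : ∀ s', post s' → post' s') :
    Runs w procs c s T' post' := by
  obtain ⟨t, s', he, ht, hs⟩ := h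
  exact ⟨t, s', he, ht.trans hT, hp _ hs⟩

theorem Runs.seq {c d : Cmd} {s : State} {T₁ T₂ : ℕ} {post : State → Prop}
    (h : Runs w procs c s T₁ (fun s₁ => Runs w procs d s₁ T₂ post)) :
    Runs w procs (c ⨾ d) s (T₁ + T₂) post := by
  obtain ⟨t, s', he, ht, t', s'', he', ht', hs⟩ := h
  exact ⟨t + t', s'', by simpa using Exec.seq he he', by omega, hs⟩

/-- Straight-line code is executed symbolically through `Cmd.wp`, while its length is bounded by its
syntax. The value `0` of `Cmd.worst` on loops and calls is harmless, since `Cmd.wp` is `False`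
there. -/
theorem Runs.of_wp {c : Cmd} : ∀ {s : State} {post : State → Prop}, c.wp w post s →
    Runs w procs c s c.worst post := by
  induction c with
  | skip => exact fun h => ⟨_, _, Exec.skip _, le_rfl, h⟩
  | setReg r e => exact fun h => ⟨_, _, Exec.setReg _ _ _, le_rfl, h⟩
  | setWord a i e => exact fun h => ⟨_, _, Exec.setWord _ _ _ _, le_rfl, h⟩
  | setReal a i e => exact fun h => ⟨_, _, Exec.setReal _ _ _ _, le_rfl, h⟩
  | seq c d ihc ihd =>
    intro s post h
    exact Runs.seq ((ihc h).mono le_rfl fun s' hs => ihd hs)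
  | ite b c d ihc ihd =>
    intro s post h
    by_cases hb : b.Holds w s
    · obtain ⟨t, s', he, ht, hs⟩ := ihc (h.1 hb)
      exact ⟨_, s', Exec.ite_true hb he, by simp only [Cmd.worst]; omega, hs⟩
    · obtain ⟨t, s', he, ht, hs⟩ := ihd (h.2 hb)
      exact ⟨_, s', Exec.ite_false hb he, by simp only [Cmd.worst]; omega, hs⟩
  | loop b c => exact fun h => h.elim
  | call f => exact fun h => h.elim

/-- A command without loops and calls, followed by another command. -/
theorem Runs.wp_seq {c d : Cmd} {s : State} {T T₂ : ℕ} {post : State → Prop}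
    (h : c.wp w (fun s₁ => Runs w procs d s₁ T₂ post) s) (hT : c.worst + T₂ ≤ T) :
    Runs w procs (c ⨾ d) s T post :=
  (Runs.seq (Runs.of_wp h)).mono hT fun _ h => h

theorem Runs.ite {b : Test} {c d : Cmd} {s : State} {T : ℕ} {post : State → Prop}
    (h₁ : b.Holds w s → Runs w procs c s T post) (h₂ : ¬ b.Holds w s → Runs w procs d s T post) :
    Runs w procs (.ite b c d) s (b.cost + T) post := by
  by_cases hb : b.Holds w s
  · obtain ⟨t, s', he, ht, hs⟩ := h₁ hb
    exact ⟨_, s', Exec.ite_true hb he, by omega, hs⟩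
  · obtain ⟨t, s', he, ht, hs⟩ := h₂ hb
    exact ⟨_, s', Exec.ite_false hb he, by omega, hs⟩

theorem Runs.call {f : ℕ} {c : Cmd} {s : State} {T : ℕ} {post : State → Prop}
    (hf : procs[f + 1]? = some c) (h : Runs w procs c s T post) :
    Runs w procs (.call (f + 1)) s (T + 1) post := by
  obtain ⟨t, s', he, ht, hs⟩ := h
  exact ⟨_, s', Exec.call_succ hf he, by omega, hs⟩

/-- Each round of a loop pays at least for its test. The credit in the loop rule therefore drops
strictly and doubles as the termination measure. -/
theorem Test.cost_pos (b : Test) : 0 < b.cost := by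
  cases b <;> simp [Test.cost]

/-- Loop rule: `I T s` is the invariant together with the credit `T` for the steps to come. -/
theorem Runs.loop_of_credit {b : Test} {c : Cmd} (I : ℕ → State → Prop) {post : State → Prop}
    (hstep : ∀ T s, I T s → (b.Holds w s → ∃ T₁ T₂, b.cost + T₁ + T₂ ≤ T ∧
      Runs w procs c s T₁ (I T₂)) ∧ (¬ b.Holds w s → b.cost ≤ T ∧ post s)) :
    ∀ T s, I T s → Runs w procs (.loop b c) s T post := by
  intro T
  induction T using Nat.strong_induction_on with
  | _ T ih =>
    intro s hI
    by_cases hb : b.Holds w s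
    · obtain ⟨T₁, T₂, hT, t, s', he, ht, hs⟩ := (hstep T s hI).1 hb
      obtain ⟨t', s'', he', ht', hs'⟩ := ih T₂ (by have := b.cost_pos; omega) s' hs
      exact ⟨_, s'', by simpa using Exec.loop_true hb he he', by omega, hs'⟩
    · obtain ⟨hT, hs⟩ := (hstep T s hI).2 hb
      exact ⟨_, s, Exec.loop_false hb, hT, hs⟩

end

end RealRAM

/-! ### The program -/

namespace HullRAM

open RealRAM

/-- `r := r + 1`. -/
abbrev inc (r : ℕ) : Cmd := .setReg r (.add (.reg r) (.const 1))

/-- Copies `reg 32` cells of word array `a` from `reg 30` on to word array `d` from `reg 31` on. -/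
def copyCmd (d a : ℕ) : Cmd :=
  .setReg 33 (.const 0) ⨾
  .loop (.wordLt (.reg 33) (.reg 32))
    (.setWord d (.add (.reg 31) (.reg 33)) (.get a (.add (.reg 30) (.reg 33))) ⨾ inc 33)

/-- One step of merging `[reg 12, reg 14)` and `[reg 13, reg 15)` of word array `3` into word
array `4` at `reg 16`; keys are in real array `a`. -/
def mergeStep (a : ℕ) : Cmd :=
  .ite (.wordLt (.reg 12) (.reg 14))
    (.ite (.wordLt (.reg 13) (.reg 15))
      (.ite (.realLt (.get a (.get 3 (.reg 13))) (.get a (.get 3 (.reg 12))))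
        (.setWord 4 (.reg 16) (.get 3 (.reg 13)) ⨾ inc 13)
        (.setWord 4 (.reg 16) (.get 3 (.reg 12)) ⨾ inc 12))
      (.setWord 4 (.reg 16) (.get 3 (.reg 12)) ⨾ inc 12))
    (.setWord 4 (.reg 16) (.get 3 (.reg 13)) ⨾ inc 13) ⨾
  inc 16

/-- Merges the two halves of the segment of word array `3` with start `reg 10` and length
`reg 11`. -/
def mergeCmd (a : ℕ) : Cmd :=
  (.setReg 12 (.reg 10) ⨾ .setReg 14 (.add (.reg 10) (.div (.reg 11) (.const 2))) ⨾
    .setReg 13 (.reg 14) ⨾ .setReg 15 (.add (.reg 10) (.reg 11)) ⨾ .setReg 16 (.reg 10)) ⨾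
  .loop (.wordLt (.reg 16) (.reg 15)) (mergeStep a) ⨾
  .setReg 16 (.reg 10) ⨾
  .loop (.wordLt (.reg 16) (.reg 15)) (.setWord 3 (.reg 16) (.get 4 (.reg 16)) ⨾ inc 16)

/-- Body of the merge sort procedure `f` for keys in real array `a`: sorts the segment of word array
`3` with start `reg 10` and length `reg 11`; `reg 9` is the stack pointer for word array `5`. -/
def msortBody (f a : ℕ) : Cmd :=
  .ite (.wordLt (.const 1) (.reg 11))
    ((.setWord 5 (.reg 9) (.reg 10) ⨾ .setWord 5 (.add (.reg 9) (.const 1)) (.reg 11) ⨾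
        .setReg 9 (.add (.reg 9) (.const 2)) ⨾ .setReg 11 (.div (.reg 11) (.const 2))) ⨾
      .call f ⨾
      (.setReg 10 (.add (.get 5 (.sub (.reg 9) (.const 2)))
          (.div (.get 5 (.sub (.reg 9) (.const 1))) (.const 2))) ⨾
        .setReg 11 (.sub (.get 5 (.sub (.reg 9) (.const 1)))
          (.div (.get 5 (.sub (.reg 9) (.const 1))) (.const 2)))) ⨾
      .call f ⨾
      (.setReg 9 (.sub (.reg 9) (.const 2)) ⨾ .setReg 10 (.get 5 (.reg 9)) ⨾
        .setReg 11 (.get 5 (.add (.reg 9) (.const 1)))) ⨾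
      mergeCmd a)
    .skip

/-- Sorts the first `reg 17` cells of word array `3` by means of procedure `f`. -/
def sortCmd (f : ℕ) : Cmd :=
  (.setReg 9 (.const 0) ⨾ .setReg 10 (.const 0) ⨾ .setReg 11 (.reg 17)) ⨾ .call f

/-- The `x`-coordinate of the point with index `e`. -/
abbrev xOf (e : WExp) : RExp := .get 0 e

/-- The `y`-coordinate of the point with index `e`. -/
abbrev yOf (e : WExp) : RExp := .get 1 e

/-- Upper hull of the first `reg 17` entries of word array `3`, which are sorted by `x`, into the
first `reg 18` cells of word array `6`. -/
def grahamCmd : Cmd :=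
  let q : WExp := .get 3 (.reg 19)
  let v : WExp := .get 6 (.sub (.reg 18) (.const 1))
  let u : WExp := .get 6 (.sub (.reg 18) (.const 2))
  let push : Cmd := .setWord 6 (.reg 18) q ⨾ inc 18 ⨾ inc 19
  (.setReg 18 (.const 0) ⨾ .setReg 19 (.const 0)) ⨾
  .loop (.wordLt (.reg 19) (.reg 17))
    (.ite (.wordLt (.const 1) (.reg 18))
      (.ite (.realLt (.mul (.sub (yOf q) (yOf u)) (.sub (xOf v) (xOf u)))
          (.mul (.sub (yOf v) (yOf u)) (.sub (xOf q) (xOf u))))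
        push
        (.setReg 18 (.sub (.reg 18) (.const 1))))
      push)

/-- Every `reg 29`-th of the first `reg 17` cells of word array `3` into the first `reg 36` cells of
word array `d`. -/
def strideCmd (d : ℕ) : Cmd :=
  (.setReg 36 (.const 0) ⨾ .setReg 37 (.reg 29)) ⨾
  .loop (.wordLt (.reg 37) (.reg 17))
    (.setWord d (.reg 36) (.get 3 (.reg 37)) ⨾ inc 36 ⨾ .setReg 37 (.add (.reg 37) (.reg 29)))

/-- Sets the marks of all points of the argument to `v`. -/
def markCmd (v : ℕ) : Cmd :=
  .setReg 40 (.const 0) ⨾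
  .loop (.wordLt (.reg 40) (.reg 1))
    (.setWord 10 (.get 0 (.add (.reg 0) (.reg 40))) (.const v) ⨾ inc 40)

/-- Every `b`-th marked point of the chunks `reg 25, …, reg 26`, each of which is sorted by `x`,
into the first `reg 17` cells of word array `3`. -/
def sampleCmd : Cmd :=
  (.setReg 40 (.mul (.reg 6) (.reg 25)) ⨾
    .setReg 41 (.add (.mul (.reg 6) (.reg 26)) (.reg 6)) ⨾
    .ite (.wordLt (.reg 4) (.reg 41)) (.setReg 41 (.reg 4)) .skip ⨾
    .setReg 42 (.const 0) ⨾ .setReg 17 (.const 0)) ⨾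
  .loop (.wordLt (.reg 40) (.reg 41))
    (.ite (.wordEq (.get 10 (.get 7 (.reg 40))) (.const 1))
      (.ite (.wordEq (.reg 42) (.const 0)) (.setWord 3 (.reg 17) (.get 7 (.reg 40)) ⨾ inc 17) .skip ⨾
        inc 42 ⨾
        .ite (.wordEq (.reg 42) (.reg 5)) (.setReg 42 (.const 0)) .skip)
      .skip ⨾
    inc 40)

/-- Every `b`-th edge of the upper hulls of the chunks `reg 25, …, reg 26` into the first `reg 17`
cells of word array `3`. -/
def edgeSampleCmd : Cmd :=
  (.setReg 40 (.reg 25) ⨾ .setReg 41 (.const 0) ⨾ .setReg 42 (.mul (.reg 6) (.reg 25)) ⨾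
    .setReg 17 (.const 0)) ⨾
  .loop (.wordLt (.reg 40) (.add (.reg 26) (.const 1)))
    (.ite (.wordLt (.add (.reg 41) (.const 1)) (.get 9 (.reg 40)))
      (.setWord 3 (.reg 17) (.add (.reg 42) (.reg 41)) ⨾ inc 17 ⨾
        .setReg 41 (.add (.reg 41) (.reg 5)))
      (inc 40 ⨾ .setReg 41 (.const 0) ⨾ .setReg 42 (.add (.reg 42) (.reg 6))))

/-- Initializes the best points and the hot intervals of the `reg 35` sampled slopes. -/
def initBestCmd : Cmd :=
  .setReg 43 (.const 0) ⨾
  .loop (.wordLt (.reg 43) (.add (.reg 35) (.const 1)))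
    (.setWord 13 (.reg 43) (.get 8 (.mul (.reg 6) (.reg 25))) ⨾
      .setWord 14 (.reg 43) (.const 0) ⨾ inc 43)

/-- For every sampled slope, the rightmost extreme point in its normal direction of the chunks
`reg 25, …, reg 26`. -/
def walkBestCmd : Cmd :=
  let new : WExp := .get 8 (.add (.reg 42) (.reg 41))
  let best : WExp := .get 13 (.reg 43)
  let phi (p : WExp) : RExp := .add (yOf p) (.mul (.get 2 (.get 12 (.reg 43))) (xOf p))
  let set : Cmd := .setWord 13 (.reg 43) new
  let visit : Cmd :=
    .ite (.realLt (phi best) (phi new)) set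
      (.ite (.realLt (phi new) (phi best)) .skip
        (.ite (.realLt (xOf best) (xOf new)) set .skip)) ⨾
    inc 43
  (.setReg 40 (.reg 25) ⨾ .setReg 41 (.const 0) ⨾ .setReg 42 (.mul (.reg 6) (.reg 25)) ⨾
    .setReg 43 (.const 0)) ⨾
  .loop (.wordLt (.reg 40) (.add (.reg 26) (.const 1)))
    (.ite (.wordLt (.reg 41) (.get 9 (.reg 40)))
      (.ite (.wordLt (.reg 43) (.reg 35))
        (.ite (.wordEq (.add (.reg 41) (.const 1)) (.get 9 (.reg 40)))
          visit
          (.ite (.realLt (.get 2 (.get 12 (.reg 43))) (.get 2 (.add (.reg 42) (.reg 41))))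
            visit
            (inc 41)))
        (inc 41))
      (inc 40 ⨾ .setReg 41 (.const 0) ⨾ .setReg 42 (.add (.reg 42) (.reg 6)) ⨾
        .setReg 43 (.const 0)))

/-- Marks the slope intervals that contain the slopes of the bridges across the `reg 34` lines. -/
def hotCmd : Cmd :=
  let mark : Cmd := .setWord 14 (.reg 43) (.const 1) ⨾ inc 40
  (.setReg 40 (.const 0) ⨾ .setReg 43 (.const 0)) ⨾
  .loop (.wordLt (.reg 40) (.reg 34))
    (.ite (.wordLt (.reg 43) (.reg 35))
      (.ite (.realLt (xOf (.get 13 (.reg 43))) (xOf (.get 11 (.reg 40)))) (inc 43) mark)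
      mark)

/-- All vertices of the upper hulls of the chunks `reg 25, …, reg 26` with a supporting line whose
slope lies in a hot interval, into the first `reg 17` cells of word array `3`. -/
def collectCmd : Cmd :=
  let adv : Cmd := inc 43 ⨾ .ite (.wordEq (.get 14 (.reg 43)) (.const 1)) (.setReg 44 (.const 1)) .skip
  let fin : Cmd :=
    .ite (.wordEq (.reg 44) (.const 1))
      (.setWord 3 (.reg 17) (.get 8 (.add (.reg 42) (.reg 41))) ⨾ inc 17) .skip ⨾
    inc 41 ⨾ .setReg 44 (.get 14 (.reg 43))
  (.setReg 40 (.reg 25) ⨾ .setReg 41 (.const 0) ⨾ .setReg 42 (.mul (.reg 6) (.reg 25)) ⨾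
    .setReg 43 (.const 0) ⨾ .setReg 44 (.get 14 (.const 0)) ⨾ .setReg 17 (.const 0)) ⨾
  .loop (.wordLt (.reg 40) (.add (.reg 26) (.const 1)))
    (.ite (.wordLt (.reg 41) (.get 9 (.reg 40)))
      (.ite (.wordLt (.reg 43) (.reg 35))
        (.ite (.wordEq (.add (.reg 41) (.const 1)) (.get 9 (.reg 40)))
          adv
          (.ite (.realLt (.get 2 (.get 12 (.reg 43))) (.get 2 (.add (.reg 42) (.reg 41))))
            adv
            fin))
        fin)
      (inc 40 ⨾ .setReg 41 (.const 0) ⨾ .setReg 42 (.add (.reg 42) (.reg 6)) ⨾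
        .setReg 43 (.const 0) ⨾ .setReg 44 (.get 14 (.const 0))))

/-- The endpoints of the bridges across the `reg 34` lines, from the upper hull in word
array `6`. -/
def lookupCmd : Cmd :=
  (.setReg 40 (.const 0) ⨾ .setReg 41 (.const 0)) ⨾
  .loop (.wordLt (.reg 40) (.reg 34))
    (.ite (.realLt (xOf (.get 6 (.reg 41))) (xOf (.get 11 (.reg 40))))
      (inc 41)
      (.setWord 15 (.reg 40) (.get 6 (.sub (.reg 41) (.const 1))) ⨾
        .setWord 16 (.reg 40) (.get 6 (.reg 41)) ⨾ inc 40))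

/-- Moves the safe points of all slabs to consecutive blocks at the start of the argument segment;
the boundaries of the blocks are pushed onto the stack in word array `2`. -/
def distributeCmd : Cmd :=
  let write : Cmd := .setWord 0 (.reg 43) (.reg 44) ⨾ inc 43
  let right : Cmd :=
    .ite (.wordEq (.reg 40) (.reg 34)) write
      (.ite (.wordLt (.get 15 (.reg 40)) (.reg 44)) .skip
        (.ite (.realLt (xOf (.get 15 (.reg 40))) (xOf (.reg 44))) .skip write))
  let take : Cmd :=
    .setReg 44 (.get 0 (.reg 41)) ⨾
    .ite (.wordEq (.reg 40) (.const 0)) right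
      (.ite (.realLt (xOf (.reg 44)) (xOf (.get 16 (.sub (.reg 40) (.const 1))))) .skip right) ⨾
    inc 41
  let close : Cmd := inc 40 ⨾ .setWord 2 (.add (.reg 8) (.reg 40)) (.reg 43)
  (.setReg 40 (.const 0) ⨾ .setReg 41 (.reg 0) ⨾ .setReg 42 (.add (.reg 0) (.reg 1)) ⨾
    .setReg 43 (.reg 0) ⨾ .setWord 2 (.reg 8) (.reg 0)) ⨾
  .loop (.wordLt (.reg 40) (.add (.reg 34) (.const 1)))
    (.ite (.wordLt (.reg 41) (.reg 42))
      (.ite (.wordEq (.reg 40) (.reg 34)) take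
        (.ite (.wordLt (.get 0 (.reg 41)) (.get 16 (.reg 40))) take close))
      close)

/-- Upper hull of the argument, into word array `6`. -/
def directCmd : Cmd :=
  (.setReg 30 (.reg 0) ⨾ .setReg 31 (.const 0) ⨾ .setReg 32 (.reg 1) ⨾ .setReg 17 (.reg 1)) ⨾
  copyCmd 3 0 ⨾ sortCmd 1 ⨾ grahamCmd

/-- The direct case: upper hull of the argument, appended to the output. -/
def baseCmd : Cmd :=
  directCmd ⨾
  (.setReg 30 (.const 0) ⨾ .setReg 31 (.reg 7) ⨾ .setReg 32 (.reg 18)) ⨾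
  copyCmd 1 6 ⨾
  (.setReg 2 (.reg 7) ⨾ .setReg 3 (.reg 18) ⨾ .setReg 7 (.add (.reg 7) (.reg 18)))

/-- Decides whether the argument is dense in its index range; the answer is in `reg 28`, the chunks
it meets are `reg 25, …, reg 26`, their number is `reg 27`. -/
def denseCmd : Cmd :=
  .setReg 25 (.div (.get 0 (.reg 0)) (.reg 6)) ⨾
  .setReg 26 (.div (.get 0 (.sub (.add (.reg 0) (.reg 1)) (.const 1))) (.reg 6)) ⨾
  .setReg 27 (.add (.sub (.reg 26) (.reg 25)) (.const 1)) ⨾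
  .setReg 28 (.const 0) ⨾
  .ite (.wordLt (.reg 6) (.reg 1))
    (.ite (.wordLt (.reg 1) (.mul (.const 2) (.mul (.reg 27) (.mul (.reg 5) (.reg 5)))))
      .skip (.setReg 28 (.const 1)))
    .skip

/-- The vertical lines: their points are in the first `reg 34` cells of word array `11`. -/
def linesCmd : Cmd :=
  .ite (.wordEq (.reg 28) (.const 1))
    (markCmd 1 ⨾ sampleCmd ⨾ markCmd 0 ⨾
      .setReg 29 (.div (.reg 1) (.mul (.const 2) (.mul (.reg 5) (.reg 5)))))
    ((.setReg 30 (.reg 0) ⨾ .setReg 31 (.const 0) ⨾ .setReg 32 (.reg 1) ⨾ .setReg 17 (.reg 1)) ⨾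
      copyCmd 3 0 ⨾
      (.setReg 29 (.div (.reg 1) (.mul (.const 2) (.reg 5))) ⨾
        .ite (.wordEq (.reg 29) (.const 0)) (.setReg 29 (.const 1)) .skip)) ⨾
  sortCmd 1 ⨾ strideCmd 11 ⨾ .setReg 34 (.reg 36)

/-- In the dense case, the points on the upper hulls of the chunks that may be endpoints of
bridges. -/
def candidatesCmd : Cmd :=
  edgeSampleCmd ⨾ sortCmd 2 ⨾ .setReg 29 (.reg 27) ⨾ strideCmd 12 ⨾ .setReg 35 (.reg 36) ⨾
  initBestCmd ⨾ walkBestCmd ⨾ hotCmd ⨾ collectCmd ⨾ sortCmd 1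

/-- Pushes the activation record. -/
def pushCmd : Cmd :=
  .setWord 2 (.add (.add (.reg 8) (.reg 34)) (.const 2)) (.reg 7) ⨾
  .setWord 2 (.add (.add (.reg 8) (.reg 34)) (.const 3)) (.add (.reg 34) (.const 1)) ⨾
  .setWord 2 (.add (.add (.reg 8) (.reg 34)) (.const 4)) (.const 0) ⨾
  .setReg 8 (.add (.add (.reg 8) (.reg 34)) (.const 5))

/-- All that precedes the recursive calls. -/
def splitCmd : Cmd :=
  denseCmd ⨾ linesCmd ⨾ .ite (.wordEq (.reg 28) (.const 1)) candidatesCmd .skip ⨾ grahamCmd ⨾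
  lookupCmd ⨾ distributeCmd ⨾ pushCmd

/-- The next recursive call. -/
def recurseStep : Cmd :=
  (.setReg 45 (.add (.sub (.sub (.reg 8) (.const 4)) (.get 2 (.sub (.reg 8) (.const 2))))
      (.get 2 (.sub (.reg 8) (.const 1)))) ⨾
    .setReg 0 (.get 2 (.reg 45)) ⨾
    .setReg 1 (.sub (.get 2 (.add (.reg 45) (.const 1))) (.reg 0)) ⨾
    .setWord 2 (.sub (.reg 8) (.const 1)) (.add (.get 2 (.sub (.reg 8) (.const 1))) (.const 1))) ⨾
  .call 0

/-- The test whether there is another recursive call. -/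
def recurseTest : Test :=
  .wordLt (.get 2 (.sub (.reg 8) (.const 1))) (.get 2 (.sub (.reg 8) (.const 2)))

/-- Pops the activation record and sets the result. -/
def popCmd : Cmd :=
  .setReg 2 (.get 2 (.sub (.reg 8) (.const 3))) ⨾ .setReg 3 (.sub (.reg 7) (.reg 2)) ⨾
  .setReg 8 (.sub (.sub (.reg 8) (.const 4)) (.get 2 (.sub (.reg 8) (.const 2))))

/-- Body of the recursive procedure. -/
def hullBody : Cmd :=
  .ite (.wordLt (.reg 5) (.reg 1)) (splitCmd ⨾ .loop recurseTest recurseStep ⨾ popCmd) baseCmd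

/-- The parameters: `n` in `reg 4`, `b` in `reg 5`, the chunk size in `reg 6`. -/
def paramsCmd : Cmd :=
  (.setReg 4 (.reg 0) ⨾ .setReg 20 (.const 1) ⨾ .setReg 21 (.const 0)) ⨾
  .loop (.wordLt (.reg 20) (.reg 4)) (.setReg 20 (.add (.reg 20) (.reg 20)) ⨾ inc 21) ⨾
  (.setReg 22 (.const 0) ⨾ .setReg 5 (.const 1)) ⨾
  .loop (.wordLt (.mul (.reg 22) (.reg 22)) (.reg 21))
    (inc 22 ⨾ .setReg 5 (.add (.reg 5) (.reg 5))) ⨾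
  .setReg 6 (.mul (.reg 5) (.mul (.reg 5) (.reg 5)))

/-- The sequence of all indices. -/
def identityCmd : Cmd :=
  .setReg 40 (.const 0) ⨾
  .loop (.wordLt (.reg 40) (.reg 4)) (.setWord 0 (.reg 40) (.reg 40) ⨾ inc 40)

/-- The negated slopes of the edges of the upper hull of a chunk. -/
def slopesCmd : Cmd :=
  .setReg 40 (.const 0) ⨾
  .loop (.wordLt (.add (.reg 40) (.const 1)) (.reg 18))
    (.setReal 2 (.add (.reg 24) (.reg 40))
      (.div (.sub (yOf (.get 6 (.reg 40))) (yOf (.get 6 (.add (.reg 40) (.const 1)))))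
        (.sub (xOf (.get 6 (.add (.reg 40) (.const 1)))) (xOf (.get 6 (.reg 40))))) ⨾
      inc 40)

/-- Sorts chunk `reg 23` and computes its upper hull. -/
def chunkCmd : Cmd :=
  (.setReg 32 (.sub (.reg 4) (.reg 24)) ⨾
    .ite (.wordLt (.reg 6) (.reg 32)) (.setReg 32 (.reg 6)) .skip ⨾
    .setReg 17 (.reg 32) ⨾ .setReg 30 (.reg 24) ⨾ .setReg 31 (.const 0)) ⨾
  copyCmd 3 0 ⨾ sortCmd 1 ⨾
  (.setReg 30 (.const 0) ⨾ .setReg 31 (.reg 24) ⨾ .setReg 32 (.reg 17)) ⨾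
  copyCmd 7 3 ⨾ grahamCmd ⨾
  (.setReg 30 (.const 0) ⨾ .setReg 31 (.reg 24) ⨾ .setReg 32 (.reg 18)) ⨾
  copyCmd 8 6 ⨾ slopesCmd ⨾
  (.setWord 9 (.reg 23) (.reg 18) ⨾ inc 23 ⨾ .setReg 24 (.add (.reg 24) (.reg 6)))

/-- All that precedes the call of the recursive procedure. -/
def preprocessCmd : Cmd :=
  paramsCmd ⨾ identityCmd ⨾ (.setReg 23 (.const 0) ⨾ .setReg 24 (.const 0)) ⨾
  .loop (.wordLt (.reg 24) (.reg 4)) chunkCmd ⨾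
  (.setReg 0 (.const 0) ⨾ .setReg 1 (.reg 4) ⨾ .setReg 7 (.const 0) ⨾ .setReg 8 (.const 0))

/-- The program: procedure `0` is the recursive algorithm, procedures `1` and `2` sort points by
`x` and edges by slope. -/
def program : Program where
  main := preprocessCmd ⨾ .call 0
  procs := [hullBody, msortBody 1 0, msortBody 2 2]

/-! ### Frames -/

/-- Whether a call of procedure `f` may write register `r`. -/
def callReg : ℕ → ℕ → Bool
  | 0, r => ! (r == 4 || r == 5 || r == 6)
  | _ + 1, r => 9 ≤ r && r ≤ 16

/-- Whether a call of procedure `f` may write word array `a`. -/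
def callWord : ℕ → ℕ → Bool
  | 0, a => ! (a == 7 || a == 8 || a == 9)
  | _ + 1, a => 3 ≤ a && a ≤ 5

/-- Whether a command may write register `r`. -/
def writesReg : Cmd → ℕ → Bool
  | .setReg r _, r' => r' == r
  | .seq c d, r => writesReg c r || writesReg d r
  | .ite _ c d, r => writesReg c r || writesReg d r
  | .loop _ c, r => writesReg c r
  | .call f, r => callReg f r
  | _, _ => false

/-- Whether a command may write word array `a`. -/
def writesWord : Cmd → ℕ → Bool
  | .setWord a _ _, a' => a' == a
  | .seq c d, r => writesWord c r || writesWord d r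
  | .ite _ c d, r => writesWord c r || writesWord d r
  | .loop _ c, r => writesWord c r
  | .call f, r => callWord f r
  | _, _ => false

/-- Whether a command may write real array `a`. -/
def writesReal : Cmd → ℕ → Bool
  | .setReal a _ _, a' => a' == a
  | .seq c d, r => writesReal c r || writesReal d r
  | .ite _ c d, r => writesReal c r || writesReal d r
  | .loop _ c, r => writesReal c r
  | _, _ => false

/-- The states agree on all that command `c` does not write. -/
structure Frame (c : Cmd) (s s' : State) : Prop where
  reg : ∀ r, writesReg c r = false → s'.reg r = s.reg r
  word : ∀ a, writesWord c a = false → s'.word a = s.word a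
  real : ∀ a, writesReal c a = false → s'.real a = s.real a

theorem Frame.refl (c : Cmd) (s : State) : Frame c s s := ⟨fun _ _ => rfl, fun _ _ => rfl, fun _ _ => rfl⟩

theorem Frame.trans {c : Cmd} {s s' s'' : State} (h : Frame c s s') (h' : Frame c s' s'') :
    Frame c s s'' :=
  ⟨fun r hr => (h'.reg r hr).trans (h.reg r hr), fun a ha => (h'.word a ha).trans (h.word a ha),
    fun a ha => (h'.real a ha).trans (h.real a ha)⟩

theorem Frame.weaken {c d : Cmd} {s s' : State} (h : Frame c s s')
    (hr : ∀ r, writesReg d r = false → writesReg c r = false)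
    (hw : ∀ r, writesWord d r = false → writesWord c r = false)
    (hx : ∀ r, writesReal d r = false → writesReal c r = false) : Frame d s s' :=
  ⟨fun r h' => h.reg r (hr r h'), fun r h' => h.word r (hw r h'), fun r h' => h.real r (hx r h')⟩

/-- The sets `callReg` and `callWord` are postulated summaries of the procedures. They are checked
against the bodies, where inner calls are estimated by the same summaries; this consistency closes
the induction over recursive executions. -/
theorem proc_frame {f : ℕ} {c : Cmd} (h : program.procs[f]? = some c) {s s' : State}
    (hc : Frame c s s') : Frame (.call f) s s' := by
  have key : ∀ (c : Cmd) (f : ℕ), f < 3 → program.procs[f]? = some c →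
      (∀ r, callReg f r = false → writesReg c r = false) ∧
      (∀ a, callWord f a = false → writesWord c a = false) ∧
      ∀ a, writesReal c a = false := by
    intro c f hf h
    interval_cases f
    · obtain rfl : hullBody = c := by simpa [program] using h
      refine ⟨fun r hr => ?_, fun a ha => ?_, fun a => ?_⟩
      · have : r = 4 ∨ r = 5 ∨ r = 6 := by simp [callReg] at hr; omega
        rcases this with rfl | rfl | rfl <;> decide
      · have : a = 7 ∨ a = 8 ∨ a = 9 := by simp [callWord] at ha; omega
        rcases this with rfl | rfl | rfl <;> decide
      · rfl
    all_goals
      simp only [program, List.getElem?_cons_succ, List.getElem?_cons_zero, Option.some.injEq] at h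
      subst h
      refine ⟨fun r hr => ?_, fun a ha => ?_, fun a => rfl⟩
      · simp [callReg] at hr
        simp [writesReg, msortBody, mergeCmd, mergeStep, callReg]
        omega
      · simp [callWord] at ha
        simp [writesWord, msortBody, mergeCmd, mergeStep, callWord]
        omega
  have hf : f < 3 := by
    by_contra hf
    rw [List.getElem?_eq_none (by simpa [program] using hf)] at h
    cases h
  obtain ⟨h1, h2, h3⟩ := key c f hf h
  exact ⟨fun r hr => hc.reg r (h1 r hr), fun r hr => hc.word r (h2 r hr), fun r hr => hc.real r (h3 r)⟩

/-- This lets specifications mention only what changes. All other registers and arrays are recovered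
from the syntactic write set, which evaluates by `rfl`. -/
theorem frame_of_exec {w : ℕ} {c : Cmd} {s s' : State} {t : ℕ} {tr : List CallTree}
    (h : Exec w program.procs c s t tr s') : Frame c s s' := by
  induction h with
  | skip => exact Frame.refl _ _
  | setReg => exact ⟨fun r hr => by simp_all [writesReg], fun _ _ => rfl, fun _ _ => rfl⟩
  | setWord => exact ⟨fun _ _ => rfl, fun r hr => by simp_all [writesWord], fun _ _ => rfl⟩
  | setReal => exact ⟨fun _ _ => rfl, fun _ _ => rfl, fun r hr => by simp_all [writesReal]⟩
  | seq _ _ ih₁ ih₂ =>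
    refine (ih₁.weaken ?_ ?_ ?_).trans (ih₂.weaken ?_ ?_ ?_) <;> intro r hr <;>
      simp_all [writesReg, writesWord, writesReal]
  | ite_true _ _ ih => exact ih.weaken (by simp_all [writesReg]) (by simp_all [writesWord]) (by simp_all [writesReal])
  | ite_false _ _ ih => exact ih.weaken (by simp_all [writesReg]) (by simp_all [writesWord]) (by simp_all [writesReal])
  | loop_true _ _ _ ih₁ ih₂ => 
    exact Frame.trans (c := .loop _ _) (ih₁.weaken (fun _ h => h) (fun _ h => h) fun _ h => h) ih₂
  | loop_false => exact Frame.refl _ _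
  | call_zero hc _ ih => exact proc_frame hc ih
  | call_succ hc _ ih => exact proc_frame hc ih

variable {w : ℕ}

theorem runs_frame {c : Cmd} {s : State} {T : ℕ} {post : State → Prop}
    (h : Runs w program.procs c s T post) :
    Runs w program.procs c s T fun s' => post s' ∧ Frame c s s' := by
  obtain ⟨t, s', he, ht, hs⟩ := h
  exact ⟨t, s', he, ht, hs, frame_of_exec he⟩

/-- Sequential composition where the frame of the first command is known to the second. -/
theorem runs_seq {c d : Cmd} {s : State} {T T₁ T₂ : ℕ} {post₁ post : State → Prop}
    (h : Runs w program.procs c s T₁ post₁)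
    (h' : ∀ s₁, post₁ s₁ → Frame c s s₁ → Runs w program.procs d s₁ T₂ post) (hT : T₁ + T₂ ≤ T) :
    Runs w program.procs (c ⨾ d) s T post :=
  (Runs.seq ((runs_frame h).mono le_rfl fun s₁ hs => h' s₁ hs.1 hs.2)).mono hT fun _ h => h

/-- Loop rule: `I T s` is the invariant together with the credit `T` for the steps to come. -/
theorem runs_loop {b : Test} {c : Cmd} {s₀ : State} {T₀ : ℕ} {post : State → Prop}
    (I : ℕ → State → Prop) (h₀ : I T₀ s₀)
    (hstep : ∀ T s, Frame c s₀ s → I T s → (b.Holds w s → ∃ T₁ T₂, b.cost + T₁ + T₂ ≤ T ∧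
      Runs w program.procs c s T₁ (I T₂)) ∧ (¬ b.Holds w s → b.cost ≤ T ∧ post s)) :
    Runs w program.procs (.loop b c) s₀ T₀ post := by
  refine Runs.loop_of_credit (fun T s => I T s ∧ Frame c s₀ s) (fun T s h => ?_) T₀ s₀
    ⟨h₀, Frame.refl _ _⟩
  refine ⟨fun hb => ?_, (hstep T s h.2 h.1).2⟩
  obtain ⟨T₁, T₂, hT, hr⟩ := (hstep T s h.2 h.1).1 hb
  exact ⟨T₁, T₂, hT, (runs_frame hr).mono le_rfl fun s' hs => ⟨hs.1, h.2.trans hs.2⟩⟩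

/-! ### Array segments and copying -/

/-- The list of the entries `lo, …, lo + len - 1` of an array. -/
def seg (f : ℕ → ℕ) (lo len : ℕ) : List ℕ := (List.range len).map fun k => f (lo + k)

@[simp] theorem seg_length (f : ℕ → ℕ) (lo len : ℕ) : (seg f lo len).length = len := by simp [seg]

@[simp] theorem seg_zero (f : ℕ → ℕ) (lo : ℕ) : seg f lo 0 = [] := rfl

@[simp] theorem seg_getElem (f : ℕ → ℕ) (lo len k : ℕ) (h : k < (seg f lo len).length) :
    (seg f lo len)[k] = f (lo + k) := by simp [seg]

theorem seg_succ (f : ℕ → ℕ) (lo len : ℕ) : seg f lo (len + 1) = seg f lo len ++ [f (lo + len)] := by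
  simp [seg, List.range_succ]

theorem seg_add (f : ℕ → ℕ) (lo m k : ℕ) : seg f lo (m + k) = seg f lo m ++ seg f (lo + m) k := by
  induction k with
  | zero => simp
  | succ k ih => rw [← add_assoc, seg_succ, ih, seg_succ, List.append_assoc, add_assoc]

theorem seg_cons (f : ℕ → ℕ) (lo len : ℕ) : seg f lo (len + 1) = f lo :: seg f (lo + 1) len := by
  rw [add_comm, seg_add]; rfl

theorem seg_congr {f g : ℕ → ℕ} {lo lo' len : ℕ} (h : ∀ k < len, f (lo + k) = g (lo' + k)) :
    seg f lo len = seg g lo' len := by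
  simpa [seg] using h

theorem seg_update_of_not_mem (f : ℕ → ℕ) {lo len i v : ℕ} (h : i < lo ∨ lo + len ≤ i) :
    seg (Function.update f i v) lo len = seg f lo len :=
  seg_congr fun k hk => by rw [Function.update_of_ne (by omega)]

theorem mem_seg {f : ℕ → ℕ} {lo len x : ℕ} : x ∈ seg f lo len ↔ ∃ k < len, f (lo + k) = x := by
  simp [seg]

theorem copy_runs {d a : ℕ} (had : d ≠ a) {s : State} {N : ℕ} (hN : s.reg 32 = N)
    (h1 : s.reg 31 + N < 2 ^ w) (h0 : s.reg 30 + N < 2 ^ w) :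
    Runs w program.procs (copyCmd d a) s (20 * N + 10) fun s' =>
      seg (s'.word d) (s.reg 31) N = seg (s.word a) (s.reg 30) N ∧
      ∀ i, i < s.reg 31 ∨ s.reg 31 + N ≤ i → s'.word d i = s.word d i := by
  unfold copyCmd
  refine Runs.wp_seq (T₂ := 20 * N + 5) ?_ (by simp [Cmd.worst, WExp.cost]; omega)
  simp only [Cmd.wp]
  refine runs_loop (fun T s' => ∃ k ≤ N, s'.reg 33 = k ∧ s'.word a = s.word a ∧ T = 20 * (N - k) + 5 ∧
    seg (s'.word d) (s.reg 31) k = seg (s.word a) (s.reg 30) k ∧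
    ∀ i, i < s.reg 31 ∨ s.reg 31 + k ≤ i → s'.word d i = s.word d i) ?_ ?_
  · exact ⟨0, by simp [WExp.eval]⟩
  · rintro T s' hf ⟨k, hk, hk33, hwa, rfl, hseg, hout⟩
    have e32 := hf.reg 32 rfl
    have e31 := hf.reg 31 rfl
    have e30 := hf.reg 30 rfl
    simp at e32 e31 e30
    constructor
    · intro hb
      simp only [Test.Holds, WExp.eval] at hb
      refine ⟨_, 20 * (N - (k + 1)) + 5, ?_, Runs.of_wp ?_⟩
      · simp [Cmd.worst, WExp.cost, Test.cost]; omega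
      · simp (disch := omega) only [Cmd.wp, WExp.eval, Nat.mod_eq_of_lt]
        refine ⟨k + 1, by omega, ?_⟩
        simp (disch := omega) [Nat.mod_eq_of_lt, had.symm, seg_succ, seg_update_of_not_mem, *]
        intro i hi
        rw [Function.update_of_ne (by omega)]
        exact hout i (by omega)
    · intro hb
      simp only [Test.Holds, WExp.eval] at hb
      obtain rfl : k = N := by omega
      exact ⟨by simp [Test.cost, WExp.cost], hseg, hout⟩

/-! ### Merge sort -/

open Classical in
/-- Comparison by a real key, as a Boolean relation. -/
noncomputable def keyLe (κ : ℕ → ℝ) (p q : ℕ) : Bool := decide (κ p ≤ κ q)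

/-- The output still to be written is `List.merge` of the two unread segments, so a step amounts to
removing the head of that list. -/
theorem mergeStep_runs {a : ℕ} {s : State} {i j mid hi k : ℕ} (hi' : s.reg 12 = i)
    (hj' : s.reg 13 = j) (hmid : s.reg 14 = mid) (hhi : s.reg 15 = hi) (hk : s.reg 16 = k)
    (hlt : i < mid ∨ j < hi) (hij : i ≤ mid) (hjh : j ≤ hi) (hw : mid ≤ hi ∧ k < hi ∧ hi < 2 ^ w)
    (hM : 1 < 2 ^ w) :
    Runs w program.procs (mergeStep a) s 30 fun s' => s'.reg 16 = k + 1 ∧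
      ∃ i' j' x, i' ≤ mid ∧ j' ≤ hi ∧ s'.reg 12 = i' ∧ s'.reg 13 = j' ∧ i' + j' = i + j + 1 ∧
        s'.word 4 = Function.update (s.word 4) k x ∧ i ≤ i' ∧
        (seg (s.word 3) i (mid - i)).merge (seg (s.word 3) j (hi - j)) (keyLe (s.real a)) =
          x :: (seg (s.word 3) i' (mid - i')).merge (seg (s.word 3) j' (hi - j'))
            (keyLe (s.real a)) := by
  refine (Runs.of_wp ?_).mono (by simp [mergeStep, Cmd.worst, WExp.cost, RExp.cost, Test.cost])
    fun _ h => h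
  have hI : i < mid → seg (s.word 3) i (mid - i) =
      s.word 3 i :: seg (s.word 3) (i + 1) (mid - (i + 1)) := fun h => by
    rw [← seg_cons]; congr 1; omega
  have hJ : j < hi → seg (s.word 3) j (hi - j) =
      s.word 3 j :: seg (s.word 3) (j + 1) (hi - (j + 1)) := fun h => by
    rw [← seg_cons]; congr 1; omega
  simp only [mergeStep, Cmd.wp, Test.Holds, WExp.eval, RExp.eval]
  refine ⟨fun h1 => ⟨fun h2 => ⟨fun h3 => ?_, fun h3 => ?_⟩, fun h2 => ?_⟩, fun h1 => ?_⟩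
  · refine ⟨?_, i, j + 1, s.word 3 j, hij, by omega, ?_, ?_, by omega, ?_, le_rfl, ?_⟩
    rotate_right
    · rw [hI (by omega), hJ (by omega), List.cons_merge_cons_neg]
      simpa [keyLe, ← hi', ← hj'] using h3
    all_goals simp (disch := omega) [Nat.mod_eq_of_lt, *]
  · refine ⟨?_, i + 1, j, s.word 3 i, by omega, by omega, ?_, ?_, by omega, ?_, by omega, ?_⟩
    rotate_right
    · rw [hI (by omega), hJ (by omega), List.cons_merge_cons_pos]
      simpa [keyLe, ← hi', ← hj'] using h3
    all_goals simp (disch := omega) [Nat.mod_eq_of_lt, *]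
  · refine ⟨?_, i + 1, j, s.word 3 i, by omega, by omega, ?_, ?_, by omega, ?_, by omega, ?_⟩
    rotate_right
    · rw [hI (by omega)]
      simp [show hi - j = 0 by omega]
    all_goals simp (disch := omega) [Nat.mod_eq_of_lt, *]
  · refine ⟨?_, i, j + 1, s.word 3 j, by omega, by omega, ?_, ?_, by omega, ?_, by omega, ?_⟩
    rotate_right
    · rw [hJ (by omega)]
      simp [show mid - i = 0 by omega]
    all_goals simp (disch := omega) [Nat.mod_eq_of_lt, *]

theorem mergeCmd_runs {a : ℕ} {s : State} {lo len : ℕ} (hlo : s.reg 10 = lo)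
    (hlen : s.reg 11 = len) (hw : lo + len < 2 ^ w) (hM : 2 < 2 ^ w) :
    Runs w program.procs (mergeCmd a) s (60 * len + 40) fun s' =>
      seg (s'.word 3) lo len = (seg (s.word 3) lo (len / 2)).merge
        (seg (s.word 3) (lo + len / 2) (len - len / 2)) (keyLe (s.real a)) ∧
      ∀ i, i < lo ∨ lo + len ≤ i → s'.word 3 i = s.word 3 i := by
  unfold mergeCmd
  refine Runs.wp_seq (T₂ := 60 * len + 15) ?_ (by simp [Cmd.worst, WExp.cost]; omega)
  simp only [Cmd.wp]
  set s₀ := State.setReg _ 16 _ with hs₀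
  have e10 : s₀.reg 10 = lo := by simp [hs₀, hlo]
  have e12 : s₀.reg 12 = lo := by simp [hs₀, WExp.eval, hlo]
  have e13 : s₀.reg 13 = lo + len / 2 := by
    simp (disch := omega) [hs₀, WExp.eval, hlo, hlen, Nat.mod_eq_of_lt]
  have e14 : s₀.reg 14 = lo + len / 2 := by
    simp (disch := omega) [hs₀, WExp.eval, hlo, hlen, Nat.mod_eq_of_lt]
  have e15 : s₀.reg 15 = lo + len := by
    simp (disch := omega) [hs₀, WExp.eval, hlo, hlen, Nat.mod_eq_of_lt]
  have e16 : s₀.reg 16 = lo := by simp [hs₀, WExp.eval, hlo]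
  have ew : s₀.word = s.word := rfl
  have er : s₀.real = s.real := rfl
  clear_value s₀
  refine runs_seq (T₁ := 40 * len + 5) (T₂ := 20 * len + 7)
    (post₁ := fun s' => seg (s'.word 4) lo len = (seg (s.word 3) lo (len / 2)).merge
        (seg (s.word 3) (lo + len / 2) (len - len / 2)) (keyLe (s.real a))) ?_ ?_ (by omega)
  · refine runs_loop (fun T s' => ∃ i j k, s'.reg 12 = i ∧ s'.reg 13 = j ∧ s'.reg 16 = lo + k ∧
      lo ≤ i ∧ i ≤ lo + len / 2 ∧ j ≤ lo + len ∧ i + j = lo + (lo + len / 2) + k ∧ T = 40 * (len - k) + 5 ∧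
      seg (s'.word 4) lo k ++ (seg (s.word 3) i (lo + len / 2 - i)).merge
        (seg (s.word 3) j (lo + len - j)) (keyLe (s.real a)) = (seg (s.word 3) lo (len / 2)).merge
        (seg (s.word 3) (lo + len / 2) (len - len / 2)) (keyLe (s.real a))) ?_ ?_
    · refine ⟨lo, lo + len / 2, 0, e12, e13, e16, le_rfl, by omega, by omega, by omega, by omega, ?_⟩
      rw [show lo + len / 2 - lo = len / 2 by omega,
        show lo + len - (lo + len / 2) = len - len / 2 by omega]
      rfl
    · rintro T s' hf ⟨i, j, k, h12, h13, h16, hli, him, hjh, hsum, rfl, hmerge⟩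
      have h15 := (hf.reg 15 rfl).trans e15
      have h14 := (hf.reg 14 rfl).trans e14
      have h3 : s'.word 3 = s.word 3 := (hf.word 3 rfl).trans (by rw [ew])
      have hx : s'.real = s.real := by funext r; rw [hf.real r rfl, er]
      simp only [Test.Holds, WExp.eval, h16, h15]
      refine ⟨fun hb => ?_, fun hb => ?_⟩
      · refine ⟨30, 40 * (len - (k + 1)) + 5, by simp [Test.cost, WExp.cost]; omega,
          (mergeStep_runs h12 h13 h14 h15 h16 (by omega) (by omega) (by omega)
            ⟨by omega, by omega, by omega⟩ (by omega)).mono le_rfl ?_⟩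
        rintro s'' ⟨g16, i', j', x, g1, g2, g12, g13, g4, g5, g6, g7⟩
        refine ⟨i', j', k + 1, g12, g13, by omega, by omega, g1, g2, by omega, by omega, ?_⟩
        rw [← hmerge, g5, seg_succ, seg_update_of_not_mem _ (by omega), ← h3, ← hx, g7]
        simp
      · have hk : k = len := by omega
        have hi : i = lo + len / 2 := by omega
        have hj : j = lo + len := by omega
        subst hk hi hj
        refine ⟨by simp [Test.cost, WExp.cost], ?_⟩
        simpa using hmerge
  · intro s₁ h4 hf
    have h15 := (hf.reg 15 rfl).trans e15
    have h10 := (hf.reg 10 rfl).trans e10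
    have h3 : s₁.word 3 = s.word 3 := (hf.word 3 rfl).trans (by rw [ew])
    refine Runs.wp_seq (T₂ := 20 * len + 5) ?_ (by simp [Cmd.worst, WExp.cost]; omega)
    simp only [Cmd.wp]
    refine runs_loop (fun T s' => ∃ k ≤ len, s'.reg 16 = lo + k ∧ T = 20 * (len - k) + 5 ∧
      seg (s'.word 3) lo k = seg (s₁.word 4) lo k ∧
      ∀ i, i < lo ∨ lo + k ≤ i → s'.word 3 i = s.word 3 i) ?_ ?_
    · exact ⟨0, by simp [WExp.eval, h10, h3]⟩
    · rintro T s' hf ⟨k, hk, h16, rfl, hseg, hout⟩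
      have g15 := (hf.reg 15 rfl).trans h15
      have g4 : s'.word 4 = s₁.word 4 := hf.word 4 rfl
      simp only [Test.Holds, WExp.eval, h16, g15]
      refine ⟨fun hb => ⟨_, 20 * (len - (k + 1)) + 5, ?_, Runs.of_wp ?_⟩, fun hb => ?_⟩
      · simp [Cmd.worst, WExp.cost, Test.cost]; omega
      · simp (disch := omega) only [Cmd.wp, WExp.eval, Nat.mod_eq_of_lt]
        refine ⟨k + 1, by omega, ?_⟩
        simp (disch := omega) [Nat.mod_eq_of_lt, seg_succ, seg_update_of_not_mem, *]
        refine ⟨by omega, fun i hi => ?_⟩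
        rw [Function.update_of_ne (by omega)]
        exact hout i (by omega)
      · obtain rfl : k = len := by omega
        exact ⟨by simp [Test.cost, WExp.cost], hseg.trans h4, hout⟩

/-- Both halves lose a unit of the logarithm, also for odd lengths. That unit pays for the merge. -/
theorem clog_half {len : ℕ} (h : 2 ≤ len) :
    Nat.clog 2 (len / 2) + 1 ≤ Nat.clog 2 len ∧ Nat.clog 2 (len - len / 2) + 1 ≤ Nat.clog 2 len := by
  rw [Nat.clog_of_two_le (n := len) one_lt_two h]
  constructor <;> gcongr <;> omega

/-- Strong induction on the length. That cells of array `5` below the stack pointer survive a call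
protects the records of the pending outer activations. -/
theorem msort_runs {f a : ℕ} (hf : program.procs[f + 1]? = some (msortBody (f + 1) a)) (len : ℕ) :
    ∀ (s : State) (lo sp : ℕ), s.reg 10 = lo → s.reg 11 = len → s.reg 9 = sp →
    lo + len < 2 ^ w → sp + 2 * len + 2 < 2 ^ w →
    Runs w program.procs (.call (f + 1)) s (200 * len * Nat.clog 2 len + 10) fun s' =>
      (seg (s'.word 3) lo len).Perm (seg (s.word 3) lo len) ∧
      (seg (s'.word 3) lo len).Pairwise (fun p q => s.real a p ≤ s.real a q) ∧
      (∀ i, i < lo ∨ lo + len ≤ i → s'.word 3 i = s.word 3 i) ∧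
      s'.reg 9 = sp ∧ ∀ i < sp, s'.word 5 i = s.word 5 i := by
  induction len using Nat.strong_induction_on with
  | _ len ih =>
  intro s lo sp hlo hlen hsp hw1 hw2
  refine (Runs.call hf ?_ : Runs w program.procs _ s (200 * len * Nat.clog 2 len + 9 + 1) _)
  unfold msortBody
  refine (Runs.ite (T := 200 * len * Nat.clog 2 len + 6) ?_ ?_).mono
    (by simp [Test.cost, WExp.cost]; omega) fun _ h => h
  · simp (disch := omega) only [Test.Holds, WExp.eval, hlen, Nat.mod_eq_of_lt]
    intro hb
    obtain ⟨hc1, hc2⟩ := clog_half (len := len) hb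
    set L := Nat.clog 2 len with hL
    have hB1 : 200 * (len / 2) * Nat.clog 2 (len / 2) + 10 ≤ 200 * (len / 2) * (L - 1) + 10 := by
      gcongr; omega
    have hB2 : 200 * (len - len / 2) * Nat.clog 2 (len - len / 2) + 10 ≤
        200 * (len - len / 2) * (L - 1) + 10 := by
      gcongr; omega
    -- Replacing `L` by `L - 1` in both recursive calls releases `200 * len` steps for the merge and
    -- the bookkeeping.
    have hB : 200 * (len / 2) * (L - 1) + 200 * (len - len / 2) * (L - 1) + 200 * len =
        200 * len * L := by
      obtain ⟨L', hL'⟩ : ∃ L', L = L' + 1 := ⟨L - 1, by omega⟩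
      have hd : len / 2 + (len - len / 2) = len := by omega
      rw [hL', Nat.add_sub_cancel, ← add_mul, ← mul_add, hd]; ring
    refine Runs.wp_seq (T₂ := 200 * (len / 2) * (L - 1) + 10 + (30 +
      (200 * (len - len / 2) * (L - 1) + 10 + (15 + (60 * len + 40))))) ?_
      (by simp only [Cmd.worst, WExp.cost]; omega)
    simp only [Cmd.wp]
    set s₀ := State.setReg _ 11 _ with hs₀
    have e10 : s₀.reg 10 = lo := by simp [hs₀, hlo]
    have e11 : s₀.reg 11 = len / 2 := by
      simp (disch := omega) [hs₀, WExp.eval, hlen, Nat.mod_eq_of_lt]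
    have e9 : s₀.reg 9 = sp + 2 := by
      simp (disch := omega) [hs₀, WExp.eval, hsp, Nat.mod_eq_of_lt]
    have e5 : s₀.word 5 = Function.update (Function.update (s.word 5) sp lo) (sp + 1) len := by
      simp (disch := omega) [hs₀, WExp.eval, hsp, Nat.mod_eq_of_lt, hlo, hlen]
    have e3 : s₀.word 3 = s.word 3 := by simp [hs₀]
    have er : s₀.real = s.real := rfl
    clear_value s₀
    refine runs_seq ((ih (len / 2) (by omega) s₀ lo (sp + 2) e10 e11 e9 (by omega) (by omega)).mono
      hB1 fun _ h => h) (T₂ := 30 +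
      (200 * (len - len / 2) * (L - 1) + 10 + (15 + (60 * len + 40)))) ?_ le_rfl
    rintro s₁ ⟨hp1, hs1, ho1, h91, h51⟩ hf1
    have g5 : s₁.word 5 sp = lo ∧ s₁.word 5 (sp + 1) = len := by
      rw [h51 _ (by omega), h51 _ (by omega), e5]; simp
    refine Runs.wp_seq (T₂ := 
      (200 * (len - len / 2) * (L - 1) + 10 + (15 + (60 * len + 40)))) ?_
      (by simp only [Cmd.worst, WExp.cost]; omega)
    simp only [Cmd.wp]
    set s₂ := State.setReg _ 11 _ with hs₂
    have k10 : s₂.reg 10 = lo + len / 2 := by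
      simp (disch := omega) [hs₂, WExp.eval, h91, Nat.mod_eq_of_lt, g5]
    have k11 : s₂.reg 11 = len - len / 2 := by
      simp (disch := omega) [hs₂, WExp.eval, h91, Nat.mod_eq_of_lt, g5]
    have k9 : s₂.reg 9 = sp + 2 := by simp [hs₂, h91]
    have k3 : s₂.word 3 = s₁.word 3 := rfl
    have k5 : s₂.word 5 = s₁.word 5 := rfl
    have kr : s₂.real = s.real := by funext r; exact (hf1.real r rfl).trans (by rw [er])
    clear_value s₂
    refine runs_seq ((ih (len - len / 2) (by omega) s₂ (lo + len / 2) (sp + 2) k10 k11 k9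
      (by omega) (by omega)).mono hB2 fun _ h => h) (T₂ := 15 + (60 * len + 40)) ?_ le_rfl
    rintro s₃ ⟨hp3, hs3, ho3, h93, h53⟩ hf3
    have g53 : s₃.word 5 sp = lo ∧ s₃.word 5 (sp + 1) = len := by
      rw [h53 _ (by omega), h53 _ (by omega), k5]; exact g5
    refine Runs.wp_seq (T₂ := 60 * len + 40) ?_ (by simp only [Cmd.worst, WExp.cost]; omega)
    simp only [Cmd.wp]
    set s₄ := State.setReg _ 11 _ with hs₄
    have m10 : s₄.reg 10 = lo := by
      simp (disch := omega) [hs₄, WExp.eval, h93, Nat.mod_eq_of_lt, g53]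
    have m11 : s₄.reg 11 = len := by
      simp (disch := omega) [hs₄, WExp.eval, h93, Nat.mod_eq_of_lt, g53]
    have m9 : s₄.reg 9 = sp := by
      simp (disch := omega) [hs₄, WExp.eval, h93, Nat.mod_eq_of_lt]
    have m3 : s₄.word 3 = s₃.word 3 := rfl
    have m5 : s₄.word 5 = s₃.word 5 := rfl
    have mr : s₄.real = s.real := by funext r; exact (hf3.real r rfl).trans (by rw [kr])
    clear_value s₄
    refine (runs_frame (mergeCmd_runs m10 m11 hw1 (by omega))).mono le_rfl ?_
    rintro s₅ ⟨⟨hm, hmo⟩, hf5⟩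
    have a1 : seg (s₄.word 3) lo (len / 2) = seg (s₁.word 3) lo (len / 2) := by
      rw [m3, ← k3]; exact seg_congr fun k hk => ho3 _ (by omega)
    have a2 : seg (s₂.word 3) (lo + len / 2) (len - len / 2) =
        seg (s.word 3) (lo + len / 2) (len - len / 2) := by
      rw [k3, ← e3]; exact seg_congr fun k hk => ho1 _ (by omega)
    have hsplit : seg (s.word 3) lo len = seg (s.word 3) lo (len / 2) ++
        seg (s.word 3) (lo + len / 2) (len - len / 2) := by
      rw [← seg_add]; congr 1; omega
    refine ⟨?_, ?_, ?_, ?_, ?_⟩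
    · rw [hm, a1, hsplit, m3]
      refine (List.merge_perm_append _).trans (List.Perm.append ?_ ?_)
      · rw [← e3]; exact hp1
      · rw [← a2]; exact hp3
    · rw [hm, a1, m3, mr]
      rw [er] at hs1
      rw [kr] at hs3
      have := List.pairwise_merge (le := keyLe (s.real a)) (by simp only [keyLe, decide_eq_true_eq]; intro x y z; exact le_trans) (by intro x y; simpa [keyLe] using le_total _ _)
        (seg (s₁.word 3) lo (len / 2)) (seg (s₃.word 3) (lo + len / 2) (len - len / 2))
        (by simpa [keyLe] using hs1) (by simpa [keyLe] using hs3)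
      simpa [keyLe] using this
    · intro i hi
      rw [hmo i hi, m3, ho3 i (by omega), k3, ho1 i (by omega), e3]
    · rw [hf5.reg 9 rfl, m9]
    · intro i hi
      rw [hf5.word 5 rfl, m5, h53 i (by omega), k5, h51 i (by omega), e5,
        Function.update_of_ne (by omega), Function.update_of_ne (by omega)]
  · simp (disch := omega) only [Test.Holds, WExp.eval, hlen, Nat.mod_eq_of_lt]
    intro hb
    refine (Runs.of_wp (c := .skip) ?_).mono (by simp [Cmd.worst]) fun _ h => h
    refine ⟨List.Perm.refl _, ?_, fun _ _ => rfl, hsp, fun _ _ => rfl⟩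
    have : len = 0 ∨ len = 1 := by omega
    rcases this with rfl | rfl
    · simp
    · simp [seg]

/-- Sorting by the `x`-coordinate (`f = 0`, `a = 0`) or by the slope (`f = 1`, `a = 2`). -/
theorem sort_runs {f a : ℕ} (hf : program.procs[f + 1]? = some (msortBody (f + 1) a)) {s : State}
    {N : ℕ} (hN : s.reg 17 = N) (hw : 2 * N + 2 < 2 ^ w) :
    Runs w program.procs (sortCmd (f + 1)) s (200 * N * Nat.clog 2 N + 20) fun s' =>
      (seg (s'.word 3) 0 N).Perm (seg (s.word 3) 0 N) ∧
      (seg (s'.word 3) 0 N).Pairwise (fun p q => s.real a p ≤ s.real a q) := by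
  unfold sortCmd
  refine Runs.wp_seq (T₂ := 200 * N * Nat.clog 2 N + 10) ?_ (by simp [Cmd.worst, WExp.cost]; omega)
  simp only [Cmd.wp]
  refine (msort_runs hf N _ 0 0 ?_ ?_ ?_ (by omega) (by omega)).mono le_rfl ?_
  · simp [WExp.eval]
  · simp [WExp.eval, hN]
  · simp [WExp.eval]
  · rintro s' ⟨h1, h2, -⟩
    exact ⟨h1, h2⟩

theorem procs_one : program.procs[0 + 1]? = some (msortBody (0 + 1) 0) := rfl

theorem procs_two : program.procs[1 + 1]? = some (msortBody (1 + 1) 2) := rfl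

/-! ### Upper hulls by supporting lines -/

/-- The intercept of the line with slope `-α` through the point `p`. -/
def phi (x y : ℕ → ℝ) (α : ℝ) (p : ℕ) : ℝ := y p + α * x p

/-- The negated slope of the line through `u` and `v`. -/
noncomputable def tau (x y : ℕ → ℝ) (u v : ℕ) : ℝ := (y u - y v) / (x v - x u)

/-- `v` is a vertex of the upper hull of `Z`: it has a supporting line that meets no other point. -/
def Up (x y : ℕ → ℝ) (Z : Set ℕ) (v : ℕ) : Prop :=
  v ∈ Z ∧ ∃ α, ∀ p ∈ Z, p ≠ v → phi x y α p < phi x y α v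

/-- The first `h` entries of `f` are the vertices of the upper hull of `Z` from left to right. -/
structure HullArr (x y : ℕ → ℝ) (Z : Set ℕ) (f : ℕ → ℕ) (h : ℕ) : Prop where
  lt : ∀ k, k + 1 < h → x (f k) < x (f (k + 1))
  mem : ∀ v, (∃ k < h, f k = v) ↔ Up x y Z v

section
variable {x y : ℕ → ℝ} {Z : Set ℕ} {α β : ℝ}

/-- Comparing two points in the direction `α` is comparing `α` with the negated slope of their line.
All hull arguments are reduced to this. With the sign chosen, `tau` increases from left to right
along an upper hull. -/
theorem phi_sub_phi {u v : ℕ} (h : x u < x v) :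
    phi x y α v - phi x y α u = (α - tau x y u v) * (x v - x u) := by
  have : x v - x u ≠ 0 := by linarith
  unfold phi tau; field_simp; ring

theorem phi_lt_phi_iff {u v : ℕ} (h : x u < x v) :
    phi x y α u < phi x y α v ↔ tau x y u v < α := by
  rw [← sub_pos, phi_sub_phi h, mul_pos_iff_of_pos_right (by linarith), sub_pos]

theorem phi_lt_phi_iff' {u v : ℕ} (h : x u < x v) :
    phi x y α v < phi x y α u ↔ α < tau x y u v := by
  rw [← sub_neg, phi_sub_phi h, mul_neg_iff]
  constructor
  · rintro (⟨_, _⟩ | ⟨_, _⟩) <;> linarith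
  · intro h'; right; constructor <;> linarith

theorem phi_le_phi_iff {u v : ℕ} (h : x u < x v) :
    phi x y α u ≤ phi x y α v ↔ tau x y u v ≤ α := by
  rw [← not_lt, phi_lt_phi_iff' h, not_lt]

theorem phi_tau {u v : ℕ} (h : x u < x v) : phi x y (tau x y u v) u = phi x y (tau x y u v) v := by
  have := phi_sub_phi (y := y) (α := tau x y u v) h
  simp at this; linarith

/-- A point below a segment is not strictly above both ends in any direction. -/
theorem not_below {a b c : ℕ} (hab : x a < x b) (hbc : x b < x c)
    (h₁ : phi x y α b ≤ phi x y α a) (h₂ : phi x y α b ≤ phi x y α c)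
    (h₃ : phi x y β a < phi x y β b) (h₄ : phi x y β c < phi x y β b) : False := by
  unfold phi at *
  rcases le_total α β with h | h
  · nlinarith [mul_nonneg (sub_nonneg.2 h) (sub_nonneg.2 hbc.le)]
  · nlinarith [mul_nonneg (sub_nonneg.2 h) (sub_nonneg.2 hab.le)]

theorem Up.mono {Z' : Set ℕ} {v : ℕ} (h : Up x y Z v) (hZ : Z' ⊆ Z) (hv : v ∈ Z') :
    Up x y Z' v :=
  ⟨hv, h.2.imp fun _ h p hp => h p (hZ hp)⟩

/-- In every direction, the rightmost extreme point is a vertex. -/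
theorem exists_up_max (hfin : Z.Finite) (hne : Z.Nonempty) (hx : Z.InjOn x) (α : ℝ) :
    ∃ v, Up x y Z v ∧
      ∀ p ∈ Z, phi x y α p < phi x y α v ∨ phi x y α p = phi x y α v ∧ x p ≤ x v := by
  obtain ⟨v, hv, hmax⟩ := Set.exists_max_image Z (fun p => toLex (phi x y α p, x p)) hfin hne
  have hmax' : ∀ p ∈ Z, phi x y α p < phi x y α v ∨ phi x y α p = phi x y α v ∧ x p ≤ x v := by
    intro p hp
    simpa [Prod.Lex.le_iff] using hmax p hp
  refine ⟨v, ⟨hv, ?_⟩, hmax'⟩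
  -- A slightly larger direction preserves the finitely many strict inequalities and breaks ties in
  -- favour of the rightmost point, which thus becomes the unique maximum.
  have hev : ∀ᶠ ε in nhdsWithin (0 : ℝ) (Set.Ioi 0), ∀ p ∈ Z, p ≠ v →
      phi x y (α + ε) p < phi x y (α + ε) v := by
    rw [Filter.eventually_all_finite hfin]
    intro p hp
    by_cases hpv : p = v
    · exact Filter.Eventually.of_forall fun _ h => (h hpv).elim
    rcases hmax' p hp with h | ⟨h, h'⟩
    · have h1 : Filter.Tendsto (fun ε : ℝ => phi x y (α + ε) v - phi x y (α + ε) p) (nhds 0)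
          (nhds (phi x y (α + 0) v - phi x y (α + 0) p)) := by
        apply Continuous.tendsto
        unfold phi; fun_prop
      have := (h1.eventually (lt_mem_nhds (show (0 : ℝ) < _ by simpa using h)))
      filter_upwards [nhdsWithin_le_nhds this] with ε hε _
      linarith
    · have hlt : x p < x v := lt_of_le_of_ne h' fun e => hpv (hx hp hv e)
      filter_upwards [self_mem_nhdsWithin] with ε hε _
      unfold phi at *
      nlinarith [mul_pos (Set.mem_Ioi.1 hε) (sub_pos.2 hlt)]
  obtain ⟨ε, hε⟩ := hev.exists
  exact ⟨_, hε⟩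

/-- The line through two neighbouring vertices supports the whole set. -/
theorem phi_le_of_adjacent (hfin : Z.Finite) (hx : Z.InjOn x) {u v : ℕ} (hu : Up x y Z u)
    (hv : Up x y Z v) (huv : x u < x v) (hadj : ∀ p, Up x y Z p → x p ≤ x u ∨ x v ≤ x p)
    {p : ℕ} (hp : p ∈ Z) : phi x y (tau x y u v) p ≤ phi x y (tau x y u v) u := by
  -- Let `q` be an extreme vertex in the direction of the line. If it were strictly to the left of
  -- `u`, then `u` would lie on or below the segment from `q` to `v` and could not be a vertex; the
  -- other side is symmetric.
  obtain ⟨q, hq, hmax⟩ := exists_up_max hfin ⟨p, hp⟩ hx (y := y) (tau x y u v)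
  have hle : ∀ p ∈ Z, phi x y (tau x y u v) p ≤ phi x y (tau x y u v) q := fun p hp =>
    (hmax p hp).elim le_of_lt fun h => h.1.le
  refine (hle p hp).trans ?_
  have e := phi_tau (y := y) huv
  rcases hadj q hq with h | h
  · rcases h.lt_or_eq with h | h
    · obtain ⟨β, hβ⟩ := hu.2
      refine (not_below h huv (hle u hu.1) e.le (hβ q hq.1 ?_) (hβ v hv.1 ?_)).elim
      · rintro rfl; exact h.false
      · rintro rfl; exact huv.false
    · rw [hx hq.1 hu.1 h]
  · rcases h.lt_or_eq with h | h
    · obtain ⟨β, hβ⟩ := hv.2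
      refine (not_below huv h e.ge (hle v hv.1) (hβ u hu.1 ?_) (hβ q hq.1 ?_)).elim
      · rintro rfl; exact huv.false
      · rintro rfl; exact h.false
    · rw [← hx hv.1 hq.1 h, e]

/-- Neighbouring vertices remain neighbouring vertices in a subset. -/
theorem adjacent_mono (hfin : Z.Finite) (hx : Z.InjOn x) {u v : ℕ} (hu : Up x y Z u)
    (hv : Up x y Z v) (huv : x u < x v) (hadj : ∀ p, Up x y Z p → x p ≤ x u ∨ x v ≤ x p)
    {Z' : Set ℕ} (hZ : Z' ⊆ Z) (hu' : u ∈ Z') (hv' : v ∈ Z') {p : ℕ} (hp : Up x y Z' p) :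
    x p ≤ x u ∨ x v ≤ x p := by
  by_contra! h
  obtain ⟨β, hβ⟩ := hp.2
  have hle := phi_le_of_adjacent hfin hx hu hv huv hadj (hZ hp.1)
  refine not_below h.1 h.2 hle (hle.trans (phi_tau huv).le) (hβ u hu' ?_) (hβ v hv' ?_)
  · rintro rfl; exact h.1.false
  · rintro rfl; exact h.2.false

/-! Concave chains -/

variable {f : ℕ → ℕ} {h : ℕ}

theorem lt_of_chain (hf : ∀ k, k + 1 < h → x (f k) < x (f (k + 1))) {i j : ℕ} (hij : i < j)
    (hj : j < h) : x (f i) < x (f j) := by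
  induction j, hij using Nat.le_induction with
  | base => exact hf i hj
  | succ j hij ih => exact (ih (by omega)).trans (hf j hj)

theorem tau_lt_of_chain
    (hτ : ∀ k, k + 2 < h → tau x y (f k) (f (k + 1)) < tau x y (f (k + 1)) (f (k + 2)))
    {i j : ℕ} (hij : i < j) (hj : j + 1 < h) :
    tau x y (f i) (f (i + 1)) < tau x y (f j) (f (j + 1)) := by
  induction j, hij using Nat.le_induction with
  | base => exact hτ i hj
  | succ j hij ih => exact (ih (by omega)).trans (hτ j hj)

/-- In a fixed direction `phi` is unimodal along a concave chain: it grows while the negated slopes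
are at most `α` and falls afterwards. The next lemma is the falling half. -/
theorem phi_le_of_chain_left (hf : ∀ k, k + 1 < h → x (f k) < x (f (k + 1)))
    (hτ : ∀ k, k + 2 < h → tau x y (f k) (f (k + 1)) < tau x y (f (k + 1)) (f (k + 2)))
    {k : ℕ} (hk : k < h) (hα : 0 < k → tau x y (f (k - 1)) (f k) ≤ α) {i : ℕ} (hi : i ≤ k) :
    phi x y α (f i) ≤ phi x y α (f k) := by
  induction k, hi using Nat.le_induction with
  | base => exact le_rfl
  | succ k hik ih =>
    have h1 : tau x y (f k) (f (k + 1)) ≤ α := hα (by omega)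
    refine (ih (by omega) fun hk0 => ?_).trans ((phi_le_phi_iff (hf k hk)).2 h1)
    have := hτ (k - 1) (by omega)
    rw [show k - 1 + 1 = k by omega, show k - 1 + 2 = k + 1 by omega] at this
    exact this.le.trans h1

theorem phi_lt_of_chain_right (hf : ∀ k, k + 1 < h → x (f k) < x (f (k + 1)))
    (hτ : ∀ k, k + 2 < h → tau x y (f k) (f (k + 1)) < tau x y (f (k + 1)) (f (k + 2)))
    {k : ℕ} (hα : k + 1 < h → α < tau x y (f k) (f (k + 1))) {i : ℕ} (hi : k < i) (hih : i < h) :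
    phi x y α (f i) < phi x y α (f k) := by
  induction i, hi using Nat.le_induction with
  | base => exact (phi_lt_phi_iff' (hf k hih)).2 (hα hih)
  | succ i hki ih =>
    refine lt_trans ((phi_lt_phi_iff' (hf i hih)).2 ?_) (ih (by omega))
    exact (hα (by omega)).trans (tau_lt_of_chain hτ hki hih)

/-- A concave chain of points of `Z` that dominates `Z` in all directions is its upper hull. -/
theorem hullArr_of_chain (hx : Z.InjOn x) (hfZ : ∀ k < h, f k ∈ Z)
    (hf : ∀ k, k + 1 < h → x (f k) < x (f (k + 1)))
    (hτ : ∀ k, k + 2 < h → tau x y (f k) (f (k + 1)) < tau x y (f (k + 1)) (f (k + 2)))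
    (hdom : ∀ α, ∀ p ∈ Z, ∃ k < h, phi x y α p ≤ phi x y α (f k)) : HullArr x y Z f h := by
  refine ⟨hf, fun v => ⟨?_, fun hv => ?_⟩⟩
  · rintro ⟨k, hk, rfl⟩
    -- A nonempty range of directions between the slopes of the two edges at `f k`. At an end of the
    -- chain the missing slope is replaced by the other one shifted by one.
    obtain ⟨lo, hi, hlt, hlo, hhi⟩ : ∃ lo hi : ℝ, lo < hi ∧
        (0 < k → tau x y (f (k - 1)) (f k) ≤ lo) ∧ (k + 1 < h → hi ≤ tau x y (f k) (f (k + 1))) := by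
      by_cases h0 : 0 < k <;> by_cases h1 : k + 1 < h
      · refine ⟨_, _, ?_, fun _ => le_rfl, fun _ => le_rfl⟩
        have := hτ (k - 1) (by omega)
        rwa [show k - 1 + 1 = k by omega, show k - 1 + 2 = k + 1 by omega] at this
      · exact ⟨_, _, lt_add_one _, fun _ => le_rfl, fun h => (h1 h).elim⟩
      · exact ⟨_, _, sub_one_lt _, fun h => (h0 h).elim, fun _ => le_rfl⟩
      · exact ⟨0, 1, one_pos, fun h => (h0 h).elim, fun h => (h1 h).elim⟩
    have key : ∀ β, lo ≤ β → β < hi → ∀ p ∈ Z, phi x y β p ≤ phi x y β (f k) := by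
      intro β h1 h2 p hp
      obtain ⟨i, hi', hle⟩ := hdom β p hp
      refine hle.trans ?_
      rcases le_or_gt i k with h | h
      · exact phi_le_of_chain_left hf hτ hk (fun h0 => (hlo h0).trans h1) h
      · exact (phi_lt_of_chain_right hf hτ (fun h0 => h2.trans_le (hhi h0)) h hi').le
    -- The difference of `phi` at `p` and at `f k` is affine in the direction, not constant, and
    -- nonpositive at `lo` and at the midpoint. Hence it is negative strictly between them.
    refine ⟨hfZ k hk, lo + (hi - lo) / 4, fun p hp hne => ?_⟩
    have h1 := key lo le_rfl hlt p hp
    have h2 := key (lo + (hi - lo) / 2) (by linarith) (by linarith) p hp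
    have h3 : x p ≠ x (f k) := fun e => hne (hx hp (hfZ k hk) e)
    unfold phi at *
    rcases lt_or_gt_of_ne h3 with h3 | h3
    · nlinarith [mul_pos (sub_pos.2 hlt) (sub_pos.2 h3)]
    · nlinarith [mul_pos (sub_pos.2 hlt) (sub_pos.2 h3)]
  · obtain ⟨α, hα⟩ := hv.2
    obtain ⟨k, hk, hle⟩ := hdom α v hv.1
    refine ⟨k, hk, by_contra fun hne => ?_⟩
    exact (hα _ (hfZ k hk) hne).not_ge hle

namespace HullArr

/-- A direction in which the middle vertex is the strict maximum separates the slopes of its two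
edges. -/
theorem tau_lt (H : HullArr x y Z f h) (k : ℕ) (hk : k + 2 < h) :
    tau x y (f k) (f (k + 1)) < tau x y (f (k + 1)) (f (k + 2)) := by
  obtain ⟨-, β, hβ⟩ := (H.mem _).1 ⟨k + 1, by omega, rfl⟩
  have h1 := H.lt k (by omega)
  have h2 := H.lt (k + 1) hk
  refine ((phi_lt_phi_iff h1).1 (hβ _ ((H.mem _).1 ⟨k, by omega, rfl⟩).1 ?_)).trans
    ((phi_lt_phi_iff' h2).1 (hβ _ ((H.mem _).1 ⟨k + 2, by omega, rfl⟩).1 ?_))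
  · intro e; rw [e] at h1; exact h1.false
  · intro e; rw [← e] at h2; exact h2.false

theorem mem_set (H : HullArr x y Z f h) {k : ℕ} (hk : k < h) : f k ∈ Z :=
  ((H.mem _).1 ⟨k, hk, rfl⟩).1

/-- The vertex at which the slopes pass the slope `-α` is the rightmost extreme point. -/
theorem rightmost_max (H : HullArr x y Z f h) (hfin : Z.Finite) (hx : Z.InjOn x) {k : ℕ}
    (hk : k < h) (hl : 0 < k → tau x y (f (k - 1)) (f k) ≤ α)
    (hr : k + 1 < h → α < tau x y (f k) (f (k + 1))) {p : ℕ} (hp : p ∈ Z) :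
    phi x y α p < phi x y α (f k) ∨ phi x y α p = phi x y α (f k) ∧ x p ≤ x (f k) := by
  obtain ⟨v, hv, hmax⟩ := exists_up_max hfin ⟨p, hp⟩ hx (y := y) α
  obtain ⟨i, hi, rfl⟩ := (H.mem v).2 hv
  have : i = k := by
    rcases lt_trichotomy i k with h' | h' | h'
    · have h1 := phi_le_of_chain_left H.lt H.tau_lt hk hl h'.le
      have h2 := lt_of_chain H.lt h' hk
      rcases hmax _ (H.mem_set hk) with h3 | h3
      · exact (h3.not_ge h1).elim
      · exact (h2.not_ge h3.2).elim
    · exact h'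
    · have h1 := phi_lt_of_chain_right H.lt H.tau_lt hr h' hi
      rcases hmax _ (H.mem_set hk) with h3 | h3
      · exact (h3.not_gt h1).elim
      · exact (h1.ne' h3.1).elim
  exact this ▸ hmax p hp

end HullArr

end

/-! ### Graham scan -/

/-- The program tests the turn at `v` without division, with both differences taken from `u`. The
concavity of the chain is about consecutive slopes; the order of the `x`-coordinates makes the two
equivalent. -/
theorem cross_iff {x y : ℕ → ℝ} {u v q : ℕ} (h₁ : x u < x v) (h₂ : x v < x q) :
    (y q - y u) * (x v - x u) < (y v - y u) * (x q - x u) ↔ tau x y u v < tau x y v q := by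
  unfold tau
  rw [div_lt_div_iff₀ (by linarith) (by linarith)]
  constructor <;> intro h <;> nlinarith

/-- The stack is a concave chain, and in every direction each scanned point is dominated by the
stack or by the point about to be pushed; the latter alternative is needed while vertices are being
popped. The potential `2 * (N - i) + h` drops by one both for a push and for a pop. -/
theorem graham_runs {s : State} {N : ℕ} (hN : s.reg 17 = N) (hw : N + 1 < 2 ^ w)
    {x y : ℕ → ℝ} (hx : s.real 0 = x) (hy : s.real 1 = y)
    (hsort : ∀ i j, i < j → j < N → x (s.word 3 i) < x (s.word 3 j)) :
    Runs w program.procs grahamCmd s (200 * N + 20) fun s' =>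
      s'.reg 18 ≤ N ∧ HullArr x y {p | p ∈ seg (s.word 3) 0 N} (s'.word 6) (s'.reg 18) := by
  set S := s.word 3 with hS
  unfold grahamCmd
  refine Runs.wp_seq (T₂ := 200 * N + 10) ?_ (by simp [Cmd.worst, WExp.cost]; omega)
  simp only [Cmd.wp]
  refine runs_loop (fun T s' => ∃ i h, s'.reg 19 = i ∧ s'.reg 18 = h ∧ i ≤ N ∧ h ≤ i ∧
    T = 100 * (2 * (N - i) + h) + 10 ∧ (∀ k < h, ∃ i' < i, s'.word 6 k = S i') ∧
    (∀ k, k + 1 < h → x (s'.word 6 k) < x (s'.word 6 (k + 1))) ∧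
    (∀ k, k + 2 < h → tau x y (s'.word 6 k) (s'.word 6 (k + 1)) <
      tau x y (s'.word 6 (k + 1)) (s'.word 6 (k + 2))) ∧
    ∀ α, ∀ i' < i, (∃ k < h, phi x y α (S i') ≤ phi x y α (s'.word 6 k)) ∨
      i < N ∧ phi x y α (S i') ≤ phi x y α (S i)) ?_ ?_
  · refine ⟨0, 0, by simp [WExp.eval], by simp [WExp.eval], by omega, by omega, by omega, ?_⟩
    simp
  · rintro T s' hf ⟨i, h, h19, h18, hi, hh, rfl, hmem, hlt, hτ, hdom⟩
    have h17 : s'.reg 17 = N := (hf.reg 17 rfl).trans (by simpa using hN)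
    have h3 : s'.word 3 = S := hf.word 3 rfl
    have hx' : s'.real 0 = x := (hf.real 0 rfl).trans (by simpa using hx)
    have hy' : s'.real 1 = y := (hf.real 1 rfl).trans (by simpa using hy)
    have hM1 : 1 % 2 ^ w = 1 := Nat.mod_eq_of_lt (by omega)
    constructor
    · intro hb
      simp only [Test.Holds, WExp.eval, h19, h17] at hb
      have hM2 : i < N → (1 < h → 2 % 2 ^ w = 2) := fun h1 h2 => Nat.mod_eq_of_lt (by omega)
      have hpush : (1 < h → tau x y (s'.word 6 (h - 2)) (s'.word 6 (h - 1)) <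
          tau x y (s'.word 6 (h - 1)) (S i)) → ∀ s'' : State, s''.reg 19 = i + 1 →
          s''.reg 18 = h + 1 → s''.word 6 = Function.update (s'.word 6) h (S i) →
          ∃ i₁ h₁, s''.reg 19 = i₁ ∧ s''.reg 18 = h₁ ∧ i₁ ≤ N ∧ h₁ ≤ i₁ ∧
          100 * (2 * (N - (i + 1)) + (h + 1)) + 10 = 100 * (2 * (N - i₁) + h₁) + 10 ∧
          (∀ k < h₁, ∃ i' < i₁, s''.word 6 k = S i') ∧
          (∀ k, k + 1 < h₁ → x (s''.word 6 k) < x (s''.word 6 (k + 1))) ∧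
          (∀ k, k + 2 < h₁ → tau x y (s''.word 6 k) (s''.word 6 (k + 1)) <
            tau x y (s''.word 6 (k + 1)) (s''.word 6 (k + 2))) ∧
          ∀ α, ∀ i' < i₁, (∃ k < h₁, phi x y α (S i') ≤ phi x y α (s''.word 6 k)) ∨
            i₁ < N ∧ phi x y α (S i') ≤ phi x y α (S i₁) := by
        intro hc s'' e19 e18 e6
        have hold : ∀ k < h, s''.word 6 k = s'.word 6 k := fun k hk => by
          rw [e6, Function.update_of_ne (by omega)]
        have hnew : s''.word 6 h = S i := by rw [e6, Function.update_self]
        refine ⟨i + 1, h + 1, e19, e18, by omega, by omega, by omega, ?_, ?_, ?_, ?_⟩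
        · intro k hk
          rcases Nat.lt_succ_iff_lt_or_eq.1 hk with hk | rfl
          · obtain ⟨i', hi', e⟩ := hmem k hk
            exact ⟨i', by omega, (hold k hk).trans e⟩
          · exact ⟨i, by omega, hnew⟩
        · intro k hk
          rw [hold k (by omega)]
          rcases Nat.lt_succ_iff_lt_or_eq.1 hk with hk | hk
          · rw [hold _ hk]; exact hlt k hk
          · rw [hk, hnew]
            obtain ⟨i', hi', e⟩ := hmem k (by omega)
            rw [e]; exact hsort _ _ hi' hb
        · intro k hk
          rw [hold k (by omega), hold (k + 1) (by omega)]
          rcases Nat.lt_succ_iff_lt_or_eq.1 hk with hk | hk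
          · rw [hold _ hk]; exact hτ k hk
          · rw [hk, hnew]
            have := hc (by omega)
            rwa [show h - 2 = k by omega, show h - 1 = k + 1 by omega] at this
        · intro α i' hi'
          left
          rcases Nat.lt_succ_iff_lt_or_eq.1 hi' with hi' | rfl
          · rcases hdom α i' hi' with ⟨k, hk, hle⟩ | ⟨-, hle⟩
            · exact ⟨k, by omega, by rwa [hold k hk]⟩
            · exact ⟨h, by omega, by rwa [hnew]⟩
          · exact ⟨h, by omega, by rw [hnew]⟩
      by_cases h1 : 1 < h
      · have hM2 := hM2 hb h1
        have hxuv : x (s'.word 6 (h - 2)) < x (s'.word 6 (h - 1)) := by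
          have := hlt (h - 2) (by omega)
          rwa [show h - 2 + 1 = h - 1 by omega] at this
        have hxvq : x (s'.word 6 (h - 1)) < x (S i) := by
          obtain ⟨i', hi', e⟩ := hmem (h - 1) (by omega)
          rw [e]; exact hsort _ _ hi' hb
        by_cases hc : tau x y (s'.word 6 (h - 2)) (s'.word 6 (h - 1)) <
          tau x y (s'.word 6 (h - 1)) (S i)
        · refine ⟨_, 100 * (2 * (N - (i + 1)) + (h + 1)) + 10, ?_,
            Runs.of_wp ?_⟩
          · simp [Cmd.worst, WExp.cost, RExp.cost, Test.cost]; omega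
          · simp (disch := omega) only [Cmd.wp, Test.Holds, WExp.eval, RExp.eval, h18, h19, hM1,
              hM2, hx', hy', h3]
            refine ⟨fun _ => ⟨fun _ => ?_, fun hn => ?_⟩, fun hn => (hn h1).elim⟩
            · apply hpush (fun _ => hc) <;>
                simp (disch := omega) [h18, h19, Nat.mod_eq_of_lt]
            · exact (hn ((cross_iff hxuv hxvq).2 hc)).elim
        · refine ⟨_, 100 * (2 * (N - i) + (h - 1)) + 10, ?_, Runs.of_wp ?_⟩
          · simp [Cmd.worst, WExp.cost, RExp.cost, Test.cost]; omega
          · simp (disch := omega) only [Cmd.wp, Test.Holds, WExp.eval, RExp.eval, h18, h19, hM1,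
              hM2, hx', hy', h3]
            refine ⟨fun _ => ⟨fun hn => ?_, fun _ => ?_⟩, fun hn => (hn h1).elim⟩
            · exact (hc ((cross_iff hxuv hxvq).1 hn)).elim
            · refine ⟨i, h - 1, by simpa using h19, by simp, hi, by omega, rfl, ?_, ?_, ?_, ?_⟩
              · intro k hk; exact hmem k (by omega)
              · intro k hk; exact hlt k (by omega)
              · intro k hk; exact hτ k (by omega)
              · intro α i' hi'
                rcases hdom α i' hi' with ⟨k, hk, hle⟩ | hle
                · by_cases hk' : k < h - 1
                  · exact Or.inl ⟨k, hk', hle⟩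
                  · obtain rfl : k = h - 1 := by omega
                    -- A popped vertex is dominated by its predecessor or by the new point: were it
                    -- strictly above both in the direction `α`, then `α` would separate the two
                    -- slopes and the turn would have been convex.
                    by_cases hu : phi x y α (s'.word 6 (h - 1)) ≤ phi x y α (s'.word 6 (h - 2))
                    · exact Or.inl ⟨h - 2, by omega, hle.trans hu⟩
                    · refine Or.inr ⟨hb, hle.trans (le_of_not_gt fun hq => hc ?_)⟩
                      exact ((phi_lt_phi_iff hxuv).1 (not_le.1 hu)).trans
                        ((phi_lt_phi_iff' hxvq).1 hq)
                · exact Or.inr hle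
      · refine ⟨_, 100 * (2 * (N - (i + 1)) + (h + 1)) + 10, ?_,
            Runs.of_wp ?_⟩
        · simp [Cmd.worst, WExp.cost, RExp.cost, Test.cost]; omega
        · simp (disch := omega) only [Cmd.wp, Test.Holds, WExp.eval, RExp.eval, h18, h19, hM1, h3]
          refine ⟨fun h1' => (h1 h1').elim, fun _ => ?_⟩
          apply hpush (fun h => (h1 h).elim) <;>
            simp (disch := omega) [h18, h19, Nat.mod_eq_of_lt]
    · intro hb
      simp only [Test.Holds, WExp.eval, h19, h17] at hb
      obtain rfl : i = N := by omega
      refine ⟨by simp [Test.cost, WExp.cost], by omega, ?_⟩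
      rw [h18]
      have hmono : ∀ {a b}, a < i → b < i → x (S a) = x (S b) → a = b := by
        intro a b ha hb' e
        rcases lt_trichotomy a b with h' | h' | h'
        · exact ((hsort a b h' hb').ne e).elim
        · exact h'
        · exact ((hsort b a h' ha).ne' e).elim
      refine hullArr_of_chain ?_ ?_ hlt hτ ?_
      · intro p hp q hq e
        obtain ⟨a, ha, rfl⟩ := mem_seg.1 hp
        obtain ⟨b, hb', rfl⟩ := mem_seg.1 hq
        rw [hmono (by omega) (by omega) e]
      · intro k hk
        obtain ⟨i', hi', e⟩ := hmem k hk
        exact mem_seg.2 ⟨i', hi', by simp [e]⟩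
      · intro α p hp
        obtain ⟨a, ha, rfl⟩ := mem_seg.1 hp
        rcases hdom α a ha with h | h
        · simpa using h
        · exact (lt_irrefl _ h.1).elim

theorem pairwise_seg {R : ℕ → ℕ → Prop} {f : ℕ → ℕ} {lo len : ℕ} :
    (seg f lo len).Pairwise R ↔ ∀ i j, i < j → j < len → R (f (lo + i)) (f (lo + j)) := by
  rw [List.pairwise_iff_getElem]
  constructor
  · intro h i j hij hj
    have := h i j (by simp; omega) (by simpa using hj) hij
    rwa [seg_getElem, seg_getElem] at this
  · intro h i j hi hj hij
    simpa using h i j hij (by simpa using hj)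

theorem pairwise_lt_of_le {x : ℕ → ℝ} {l : List ℕ} (h : l.Pairwise fun p q => x p ≤ x q)
    (hn : l.Nodup) (hx : {p | p ∈ l}.InjOn x) : l.Pairwise fun p q => x p < x q := by
  induction l with
  | nil => exact List.Pairwise.nil
  | cons a l ih =>
    rw [List.pairwise_cons] at h ⊢
    rw [List.nodup_cons] at hn
    refine ⟨fun q hq => lt_of_le_of_ne (h.1 q hq) fun e => hn.1 ?_, ih h.2 hn.2 ?_⟩
    · have := hx (by simp) (by simp [hq]) e
      exact this ▸ hq
    · exact hx.mono fun p hp => by simp at hp ⊢; exact Or.inr hp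

/-- Sorting a list of distinct points by the `x`-coordinate. -/
theorem sortX_runs {s : State} {N : ℕ} (hN : s.reg 17 = N) (hw : 2 * N + 2 < 2 ^ w)
    {x : ℕ → ℝ} (hx : s.real 0 = x) (hnd : (seg (s.word 3) 0 N).Nodup)
    (hinj : {p | p ∈ seg (s.word 3) 0 N}.InjOn x) :
    Runs w program.procs (sortCmd 1) s (200 * N * Nat.clog 2 N + 20) fun s' =>
      (seg (s'.word 3) 0 N).Perm (seg (s.word 3) 0 N) ∧
      ∀ i j, i < j → j < N → x (s'.word 3 i) < x (s'.word 3 j) := by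
  refine (sort_runs procs_one hN hw).mono le_rfl ?_
  rintro s' ⟨hp, hs⟩
  refine ⟨hp, ?_⟩
  rw [hx] at hs
  have := pairwise_lt_of_le hs (hp.nodup_iff.2 hnd)
    (hinj.mono fun p hpm => by simpa using hp.mem_iff.1 hpm)
  simpa using pairwise_seg.1 this

/-! ### Preprocessing: parameters, sorted chunks and their hulls -/

theorem identity_runs {s : State} {n : ℕ} (hn : s.reg 4 = n) (hw : n + 1 < 2 ^ w) :
    Runs w program.procs identityCmd s (20 * n + 10) fun s' => ∀ i < n, s'.word 0 i = i := by
  unfold identityCmd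
  refine Runs.wp_seq (T₂ := 20 * n + 5) ?_ (by simp [Cmd.worst, WExp.cost]; omega)
  simp only [Cmd.wp]
  refine runs_loop (fun T s' => ∃ k ≤ n, s'.reg 40 = k ∧ T = 20 * (n - k) + 5 ∧
    ∀ i < k, s'.word 0 i = i) ⟨0, by simp [WExp.eval]⟩ ?_
  rintro T s' hf ⟨k, hk, h40, rfl, hid⟩
  have h4 : s'.reg 4 = n := (hf.reg 4 rfl).trans (by simpa using hn)
  simp only [Test.Holds, WExp.eval, h40, h4]
  refine ⟨fun hb => ⟨_, 20 * (n - (k + 1)) + 5, ?_, Runs.of_wp ?_⟩, fun hb => ?_⟩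
  · simp [Cmd.worst, WExp.cost, Test.cost]; omega
  · simp (disch := omega) only [Cmd.wp, WExp.eval, Nat.mod_eq_of_lt]
    refine ⟨k + 1, by omega, ?_⟩
    simp (disch := omega) [Nat.mod_eq_of_lt, *]
    intro i hi
    rcases eq_or_ne i k with rfl | h
    · simp
    · rw [Function.update_of_ne h]; exact hid i (by omega)
  · exact ⟨by simp [Test.cost, WExp.cost], fun i hi => hid i (by omega)⟩

/-- Doubling finds the least `l` with `n ≤ 2 ^ l`, and counting finds the least `e` with `l ≤ e *
e`. The last two clauses are these two minimalities; they give the lower and the upper bound on `b`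
in terms of `√(log₂ n)`. -/
theorem params_runs {s : State} {n : ℕ} (hn : s.reg 0 = n) (hw : (2 * n + 2) ^ 3 < 2 ^ w) :
    Runs w program.procs paramsCmd s (50 * n + 100) fun s' =>
      s'.reg 4 = n ∧ ∃ e, s'.reg 5 = 2 ^ e ∧ s'.reg 6 = (2 ^ e) ^ 3 ∧ n ≤ 2 ^ (e * e) ∧
        (0 < e → 2 ^ ((e - 1) * (e - 1)) < n) := by
  have hw1 : 2 * n + 2 < 2 ^ w := lt_of_le_of_lt (Nat.le_self_pow (by norm_num) _) hw
  unfold paramsCmd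
  refine Runs.wp_seq (T₂ := 20 * n + 10 + (5 + (20 * n + 40 + 10))) ?_ (by simp [Cmd.worst, WExp.cost]; omega)
  simp only [Cmd.wp]
  set s₀ := State.setReg _ 21 _ with hs₀
  have e4 : s₀.reg 4 = n := by simp [hs₀, WExp.eval, hn]
  have e20 : s₀.reg 20 = 1 := by simp (disch := omega) [hs₀, WExp.eval, Nat.mod_eq_of_lt]
  have e21 : s₀.reg 21 = 0 := by simp [hs₀, WExp.eval]
  clear_value s₀
  refine runs_seq (T₁ := 20 * n + 10) (T₂ := 5 + (20 * n + 40 + 10)) (post₁ := fun s' =>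
    s'.reg 4 = n ∧ s'.reg 21 ≤ n ∧ n ≤ 2 ^ s'.reg 21 ∧ ∀ l < s'.reg 21, 2 ^ l < n) ?_ ?_ le_rfl
  · refine runs_loop (fun T s' => ∃ l ≤ n, s'.reg 21 = l ∧ s'.reg 20 = 2 ^ l ∧
      T = 20 * (n - l) + 5 ∧ ∀ l' < l, 2 ^ l' < n) ⟨0, by omega, e21, by simpa using e20, ?_⟩ ?_ |>.mono
        (T := 20 * n + 5) (by omega) fun _ h => h
    · simp
    · rintro T s' hf ⟨l, hl, h21, h20, rfl, hlt⟩
      have h4 : s'.reg 4 = n := (hf.reg 4 rfl).trans e4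
      simp only [Test.Holds, WExp.eval, h20, h4]
      refine ⟨fun hb => ⟨_, 20 * (n - (l + 1)) + 5, ?_, Runs.of_wp ?_⟩, fun hb => ?_⟩
      · have := Nat.lt_two_pow_self (n := l)
        simp [Cmd.worst, WExp.cost, Test.cost]; omega
      · have := Nat.lt_two_pow_self (n := l)
        simp only [Cmd.wp, WExp.eval]
        refine ⟨l + 1, by omega, ?_⟩
        simp (disch := omega) [Nat.mod_eq_of_lt, h20, h21, pow_succ]
        refine ⟨by omega, fun l' hl' => ?_⟩
        rcases hl'.lt_or_eq with h | rfl
        · exact hlt l' h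
        · exact hb
      · refine ⟨by simp [Test.cost, WExp.cost], ?_⟩
        simp only [h21]
        exact ⟨trivial, hl, by omega, hlt⟩
  rintro s₁ ⟨h4, h21n, h21, hlog⟩ -
  set l := s₁.reg 21 with hl
  refine Runs.wp_seq (T₂ := 20 * n + 40 + 10) ?_ (by simp [Cmd.worst, WExp.cost])
  simp only [Cmd.wp]
  set s₂ := State.setReg _ 5 _ with hs₂
  have k4 : s₂.reg 4 = n := by simp [hs₂, h4]
  have k5 : s₂.reg 5 = 1 := by simp (disch := omega) [hs₂, WExp.eval, Nat.mod_eq_of_lt]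
  have k21 : s₂.reg 21 = l := by simp [hs₂, hl]
  have k22 : s₂.reg 22 = 0 := by simp [hs₂, WExp.eval]
  clear_value s₂
  -- Every value that the counter can reach is bounded in terms of `n`, so the squares and powers
  -- computed on the way do not overflow.
  have hbd : ∀ e, (0 < e → (e - 1) * (e - 1) < l) → e * e ≤ 2 * n + 2 ∧ e ≤ n + 1 ∧ 2 ^ e ≤ 2 * n + 2 := by
    intro e he
    rcases Nat.eq_zero_or_pos e with rfl | h0
    · simp
    · obtain ⟨d, rfl⟩ : ∃ d, e = d + 1 := ⟨e - 1, by omega⟩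
      have h1 := he h0
      simp only [Nat.add_sub_cancel] at h1
      have h2 : d ≤ d * d := Nat.le_mul_self d
      have h3 : 2 ^ d < n := lt_of_le_of_lt (Nat.pow_le_pow_right (by norm_num) h2) (hlog _ h1)
      have h4 : d < 2 ^ d := Nat.lt_two_pow_self
      refine ⟨?_, by omega, by rw [pow_succ]; omega⟩
      nlinarith [Nat.zero_le ((d - 1) * (d - 1)), sq_nonneg ((d : ℤ) - 1)]
  refine runs_seq (T₁ := 20 * n + 40) (T₂ := 10) (post₁ := fun s' =>
    s'.reg 4 = n ∧ ∃ e, s'.reg 5 = 2 ^ e ∧ l ≤ e * e ∧ (0 < e → (e - 1) * (e - 1) < l)) ?_ ?_ le_rfl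
  · refine (runs_loop (T₀ := 20 * (n + 1 - 0) + 10) (fun T s' => ∃ e, s'.reg 22 = e ∧ s'.reg 5 = 2 ^ e ∧ 
      T = 20 * (n + 1 - e) + 10 ∧ (0 < e → (e - 1) * (e - 1) < l)) ⟨0, k22, by simpa using k5, rfl, by simp⟩ ?_).mono
        (by omega) fun _ h => h
    rintro T s' hf ⟨e, h22, h5, rfl, he⟩
    have h4 : s'.reg 4 = n := (hf.reg 4 rfl).trans k4
    have h21 : s'.reg 21 = l := (hf.reg 21 rfl).trans k21
    obtain ⟨hb1, hb2, hb3⟩ := hbd e he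
    simp (disch := omega) only [Test.Holds, WExp.eval, h22, h21, Nat.mod_eq_of_lt]
    refine ⟨fun hb => ⟨_, 20 * (n + 1 - (e + 1)) + 10, ?_, Runs.of_wp ?_⟩, fun hb => ?_⟩
    · have := (hbd (e + 1) fun _ => by simpa using hb).2.1
      simp [Cmd.worst, WExp.cost, Test.cost]; omega
    · have h3 := (hbd (e + 1) fun _ => by simpa using hb).2.2
      rw [pow_succ] at h3
      simp only [Cmd.wp, WExp.eval]
      refine ⟨e + 1, ?_⟩
      simp (disch := omega) [Nat.mod_eq_of_lt, h22, h5, pow_succ]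
      exact ⟨by omega, hb⟩
    · exact ⟨by simp [Test.cost, WExp.cost], h4, e, h5, by omega, he⟩
  rintro s₃ ⟨h4, e, h5, hle, he⟩ -
  refine (Runs.of_wp ?_).mono (by simp [Cmd.worst, WExp.cost]) fun _ h => h
  have h3 := (hbd e he).2.2
  have hc : 2 ^ e * (2 ^ e * 2 ^ e) < 2 ^ w := by
    refine lt_of_le_of_lt ?_ hw
    calc 2 ^ e * (2 ^ e * 2 ^ e) = (2 ^ e) ^ 3 := by ring
      _ ≤ _ := Nat.pow_le_pow_left h3 3
  have hc' : 2 ^ e * 2 ^ e < 2 ^ w :=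
    lt_of_le_of_lt (Nat.le_mul_of_pos_left _ (by positivity)) hc
  simp only [Cmd.wp, WExp.eval, h5]
  refine ⟨by simpa using h4, e, by simpa using h5, ?_, ?_, fun h0 => hlog _ (he h0)⟩
  · rw [Nat.mod_eq_of_lt hc', Nat.mod_eq_of_lt hc]
    simp; ring
  · exact h21.trans (Nat.pow_le_pow_right (by norm_num) hle)

theorem slopes_runs {s : State} {o h : ℕ} (ho : s.reg 24 = o) (hh : s.reg 18 = h)
    (hw : o + h + 1 < 2 ^ w) {x y : ℕ → ℝ} (hx : s.real 0 = x) (hy : s.real 1 = y) :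
    Runs w program.procs slopesCmd s (50 * h + 20) fun s' =>
      (∀ k, k + 1 < h → s'.real 2 (o + k) = tau x y (s.word 6 k) (s.word 6 (k + 1))) ∧
      ∀ i < o, s'.real 2 i = s.real 2 i := by
  unfold slopesCmd
  refine Runs.wp_seq (T₂ := 50 * h + 10) ?_ (by simp [Cmd.worst, WExp.cost]; omega)
  simp only [Cmd.wp]
  refine runs_loop (fun T s' => ∃ k, s'.reg 40 = k ∧ T = 50 * (h - k) + 10 ∧ k ≤ h ∧
    (∀ i, i < k → s'.real 2 (o + i) = tau x y (s.word 6 i) (s.word 6 (i + 1))) ∧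
    ∀ i < o, s'.real 2 i = s.real 2 i) ⟨0, by simp [WExp.eval]⟩ ?_
  rintro T s' hf ⟨k, h40, rfl, hk, hval, hout⟩
  have h24 : s'.reg 24 = o := (hf.reg 24 rfl).trans (by simpa using ho)
  have h18 : s'.reg 18 = h := (hf.reg 18 rfl).trans (by simpa using hh)
  have h6 : s'.word 6 = s.word 6 := hf.word 6 rfl
  have hx' : s'.real 0 = x := (hf.real 0 rfl).trans (by simpa using hx)
  have hy' : s'.real 1 = y := (hf.real 1 rfl).trans (by simpa using hy)
  simp (disch := omega) only [Test.Holds, WExp.eval, h40, h18, Nat.mod_eq_of_lt]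
  refine ⟨fun hb => ⟨_, 50 * (h - (k + 1)) + 10, ?_, Runs.of_wp ?_⟩, fun hb => ?_⟩
  · simp [Cmd.worst, WExp.cost, RExp.cost, Test.cost]; omega
  · simp (disch := omega) only [Cmd.wp, WExp.eval, RExp.eval, h40, h24, h6, hx', hy',
      Nat.mod_eq_of_lt]
    refine ⟨k + 1, by simp (disch := omega) [h40, Nat.mod_eq_of_lt], rfl, by omega, ?_, ?_⟩
    · intro i hi
      rcases eq_or_ne i k with rfl | hne
      · simp [tau]
      · simp only [State.setReg_real, State.setReal_real, if_true]
        rw [Function.update_of_ne (by omega)]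
        exact hval i (by omega)
    · intro i hi
      simp only [State.setReg_real, State.setReal_real, if_true]
      rw [Function.update_of_ne (by omega)]
      exact hout i hi
  · exact ⟨by simp [Test.cost, WExp.cost], fun i hi => hval i (by omega), hout⟩

/-- The number of indices below `n` in chunk `j`. -/
def chunkLen (n c j : ℕ) : ℕ := min c (n - c * j)

/-- The indices of chunk `j`. -/
def chunk (n c j : ℕ) : Set ℕ := {p | c * j ≤ p ∧ p < c * j + chunkLen n c j}

/-- The data on chunk `j`: the array `srt` holds its points sorted by `x`, `hc` and `hl` hold its
upper hull, `ta` the negated slopes of the edges. -/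
structure ChunkOK (n c : ℕ) (x y : ℕ → ℝ) (srt hc hl : ℕ → ℕ) (ta : ℕ → ℝ) (j : ℕ) : Prop where
  perm : (seg srt (c * j) (chunkLen n c j)).Perm (seg id (c * j) (chunkLen n c j))
  sorted : ∀ i k, i < k → k < chunkLen n c j → x (srt (c * j + i)) < x (srt (c * j + k))
  hull : HullArr x y (chunk n c j) (fun k => hc (c * j + k)) (hl j)
  hl_le : hl j ≤ chunkLen n c j
  slope : ∀ k, k + 1 < hl j → ta (c * j + k) = tau x y (hc (c * j + k)) (hc (c * j + k + 1))

theorem mem_seg_id {lo len p : ℕ} : p ∈ seg id lo len ↔ lo ≤ p ∧ p < lo + len := by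
  rw [mem_seg]
  constructor
  · rintro ⟨k, hk, rfl⟩; simp; omega
  · rintro ⟨h1, h2⟩; exact ⟨p - lo, by omega, by simp; omega⟩

theorem nodup_seg_id (lo len : ℕ) : (seg id lo len).Nodup :=
  List.Pairwise.imp (fun h => Nat.ne_of_lt h)
    (pairwise_seg.2 fun i j hij _ => by simpa using hij)

theorem ChunkOK.congr {n c : ℕ} {x y : ℕ → ℝ} {srt hc hl srt' hc' hl' : ℕ → ℕ} {ta ta' : ℕ → ℝ}
    {j : ℕ} (H : ChunkOK n c x y srt hc hl ta j) (h₁ : ∀ i < c * (j + 1), srt' i = srt i)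
    (h₂ : ∀ i < c * (j + 1), hc' i = hc i) (h₃ : hl' j = hl j)
    (h₄ : ∀ i < c * (j + 1), ta' i = ta i) : ChunkOK n c x y srt' hc' hl' ta' j := by
  have hlen : ∀ k < chunkLen n c j, c * j + k < c * (j + 1) := fun k hk => by
    have : chunkLen n c j ≤ c := min_le_left _ _
    rw [mul_add, mul_one]; omega
  have hl := H.hl_le
  have e : seg srt' (c * j) (chunkLen n c j) = seg srt (c * j) (chunkLen n c j) :=
    seg_congr fun k hk => h₁ _ (hlen k hk)
  refine ⟨e ▸ H.perm, fun i k hik hk => ?_, ⟨fun k hk => ?_, fun v => ?_⟩, h₃ ▸ hl, fun k hk => ?_⟩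
  · rw [h₁ _ (hlen _ (by omega)), h₁ _ (hlen _ hk)]; exact H.sorted i k hik hk
  · simp only [h₃] at hk ⊢
    rw [h₂ _ (hlen _ (by omega)), h₂ _ (hlen _ (by omega))]; exact H.hull.lt k hk
  · rw [← H.hull.mem v, h₃]
    refine exists_congr fun k => and_congr_right fun hk => ?_
    rw [h₂ _ (hlen _ (by omega))]
  · rw [h₃] at hk
    have := hlen (k + 1) (by omega)
    rw [h₄ _ (by omega), h₂ _ (by omega), h₂ _ (by omega)]; exact H.slope k hk

theorem HullArr.congr {x y : ℕ → ℝ} {Z : Set ℕ} {f g : ℕ → ℕ} {h : ℕ} (H : HullArr x y Z f h)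
    (e : ∀ k < h, g k = f k) : HullArr x y Z g h := by
  refine ⟨fun k hk => ?_, fun v => ?_⟩
  · rw [e _ (by omega), e _ (by omega)]; exact H.lt k hk
  · rw [← H.mem v]
    exact exists_congr fun k => and_congr_right fun hk => by rw [e k hk]

theorem seg_eq_iff {f g : ℕ → ℕ} {lo lo' len : ℕ} :
    seg f lo len = seg g lo' len ↔ ∀ k < len, f (lo + k) = g (lo' + k) := by
  simp [seg]

/-- The results of earlier chunks survive because the arrays for chunk data are written at addresses
from `c * j` on only, and array `9` at `j` only. -/
theorem chunk_runs {s : State} {n c j : ℕ} (hn : s.reg 4 = n) (hc : s.reg 6 = c)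
    (hj : s.reg 23 = j) (ho : s.reg 24 = c * j) (hjn : c * j < n) (hc0 : 0 < c)
    (hw : 3 * n + 2 * c + 10 < 2 ^ w) {x y : ℕ → ℝ} (hx : s.real 0 = x) (hy : s.real 1 = y)
    (hinj : {p | p < n}.InjOn x) (hid : ∀ i < n, s.word 0 i = i)
    (H : ∀ i < j, ChunkOK n c x y (s.word 7) (s.word 8) (s.word 9) (s.real 2) i) :
    Runs w program.procs chunkCmd s
      (200 * chunkLen n c j * Nat.clog 2 (chunkLen n c j) + 310 * chunkLen n c j + 200) fun s' =>
      s'.reg 23 = j + 1 ∧ s'.reg 24 = c * (j + 1) ∧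
      ∀ i < j + 1, ChunkOK n c x y (s'.word 7) (s'.word 8) (s'.word 9) (s'.real 2) i := by
  set N := chunkLen n c j with hNdef
  have hN1 : N ≤ n - c * j := min_le_right _ _
  have hN2 : N ≤ c := min_le_left _ _
  have hN0 : 0 < N := by simp [hNdef, chunkLen]; omega
  have hjn' : j < n := lt_of_le_of_lt (Nat.le_mul_of_pos_left j hc0) hjn
  have hinjN : {p | p ∈ seg id (c * j) N}.InjOn x := hinj.mono fun p hp => by
    have := mem_seg_id.1 hp; simp; omega
  unfold chunkCmd
  refine Runs.wp_seq (T₂ := 200 * N * Nat.clog 2 N + 310 * N + 170) ?_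
    (by simp [Cmd.worst, WExp.cost, Test.cost]; omega)
  -- The two branches of the length computation are treated together. The command in `Frame` is
  -- never executed; it only names the registers in which the states may differ.
  have key : ∀ s₁ : State, Frame (.setReg 32 (.const 0) ⨾ .setReg 17 (.const 0) ⨾
      .setReg 30 (.const 0) ⨾ .setReg 31 (.const 0)) s s₁ →
      s₁.reg 32 = N → s₁.reg 17 = N → s₁.reg 30 = c * j → s₁.reg 31 = 0 →
      Runs w program.procs (copyCmd 3 0 ⨾ sortCmd 1 ⨾
  (.setReg 30 (.const 0) ⨾ .setReg 31 (.reg 24) ⨾ .setReg 32 (.reg 17)) ⨾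
  copyCmd 7 3 ⨾ grahamCmd ⨾
  (.setReg 30 (.const 0) ⨾ .setReg 31 (.reg 24) ⨾ .setReg 32 (.reg 18)) ⨾
  copyCmd 8 6 ⨾ slopesCmd ⨾
  (.setWord 9 (.reg 23) (.reg 18) ⨾ inc 23 ⨾ .setReg 24 (.add (.reg 24) (.reg 6)))) s₁
      (200 * N * Nat.clog 2 N + 310 * N + 170) fun s' =>
      s'.reg 23 = j + 1 ∧ s'.reg 24 = c * (j + 1) ∧
      ∀ i < j + 1, ChunkOK n c x y (s'.word 7) (s'.word 8) (s'.word 9) (s'.real 2) i := by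
    intro s₁ hf1 e32 e17 e30 e31
    refine runs_seq (copy_runs (by norm_num) e32 (by omega) (by omega))
      (T₂ := 200 * N * Nat.clog 2 N + 290 * N + 160) ?_ (by omega)
    rintro s₂ ⟨hcopy, -⟩ hf2
    rw [e31, e30, hf1.word 0 rfl] at hcopy
    have hcopy' : seg (s₂.word 3) 0 N = seg id (c * j) N := by
      rw [hcopy]; exact seg_congr fun k hk => hid _ (by omega)
    refine runs_seq (sortX_runs (s := s₂) ((hf2.reg 17 rfl).trans e17) (by omega)
      (x := x) (by rw [hf2.real 0 rfl, hf1.real 0 rfl, hx]) (by rw [hcopy']; exact nodup_seg_id _ _)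
      (by rw [hcopy']; exact hinjN)) (T₂ := 290 * N + 140) ?_ (by omega)
    rintro s₃ ⟨hperm, hsorted⟩ hf3
    rw [hcopy'] at hperm
    refine Runs.wp_seq (T₂ := 290 * N + 130) ?_ (by simp [Cmd.worst, WExp.cost]; omega)
    simp only [Cmd.wp, WExp.eval, State.setReg_reg, Nat.zero_mod]
    have e24 : s₃.reg 24 = c * j := by
      rw [hf3.reg 24 rfl, hf2.reg 24 rfl, hf1.reg 24 rfl, ho]
    have e17' : s₃.reg 17 = N := by rw [hf3.reg 17 rfl, hf2.reg 17 rfl, e17]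
    simp only [e24, e17', show (24 : ℕ) ≠ 30 by norm_num, show (17 : ℕ) ≠ 30 by norm_num,
      show (17 : ℕ) ≠ 31 by norm_num, if_false]
    set s₄ := State.setReg _ 32 _ with hs₄
    have g30 : s₄.reg 30 = 0 := by simp [hs₄]
    have g31 : s₄.reg 31 = c * j := by simp [hs₄]
    have g32 : s₄.reg 32 = N := by simp [hs₄]
    have g17 : s₄.reg 17 = N := by simp [hs₄, e17']
    have g24 : s₄.reg 24 = c * j := by simp [hs₄, e24]
    have g23 : s₄.reg 23 = j := by
      simp [hs₄, hf3.reg 23 rfl, hf2.reg 23 rfl, hf1.reg 23 rfl, hj]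
    have g6 : s₄.reg 6 = c := by
      simp [hs₄, hf3.reg 6 rfl, hf2.reg 6 rfl, hf1.reg 6 rfl, hc]
    have gw : s₄.word = s₃.word := rfl
    have gr : ∀ a, s₄.real a = s.real a := fun a => by
      simp [hs₄, hf3.real a rfl, hf2.real a rfl, hf1.real a rfl]
    have g7 : s₄.word 7 = s.word 7 := by rw [gw, hf3.word 7 rfl, hf2.word 7 rfl, hf1.word 7 rfl]
    have g8 : s₄.word 8 = s.word 8 := by rw [gw, hf3.word 8 rfl, hf2.word 8 rfl, hf1.word 8 rfl]
    have g9 : s₄.word 9 = s.word 9 := by rw [gw, hf3.word 9 rfl, hf2.word 9 rfl, hf1.word 9 rfl]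
    clear_value s₄
    refine runs_seq (copy_runs (d := 7) (a := 3) (by norm_num) g32 (by omega) (by omega))
      (T₂ := 270 * N + 120) ?_ (by omega)
    rintro s₅ ⟨hcopy7, hout7⟩ hf5
    rw [g31, g30, gw] at hcopy7
    rw [g31] at hout7
    have k3 : s₅.word 3 = s₃.word 3 := by rw [hf5.word 3 rfl, gw]
    refine runs_seq (graham_runs (s := s₅) ((hf5.reg 17 rfl).trans g17) (by omega) (x := x) (y := y)
      (by rw [hf5.real 0 rfl, gr, hx]) (by rw [hf5.real 1 rfl, gr, hy])
      (by rw [k3]; exact hsorted)) (T₂ := 70 * N + 100) ?_ (by omega)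
    rintro s₆ ⟨hhN, hull⟩ hf6
    set h := s₆.reg 18 with hh
    refine Runs.wp_seq (T₂ := 70 * N + 90) ?_ (by simp [Cmd.worst, WExp.cost]; omega)
    simp only [Cmd.wp, WExp.eval, State.setReg_reg, Nat.zero_mod]
    have e24 : s₆.reg 24 = c * j := by rw [hf6.reg 24 rfl, hf5.reg 24 rfl, g24]
    simp only [e24, ← hh, show (24 : ℕ) ≠ 30 by norm_num, show (18 : ℕ) ≠ 30 by norm_num,
      show (18 : ℕ) ≠ 31 by norm_num, if_false]
    set s₇ := State.setReg _ 32 _ with hs₇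
    have m30 : s₇.reg 30 = 0 := by simp [hs₇]
    have m31 : s₇.reg 31 = c * j := by simp [hs₇]
    have m32 : s₇.reg 32 = h := by simp [hs₇]
    have m18 : s₇.reg 18 = h := by simp [hs₇, hh]
    have m24 : s₇.reg 24 = c * j := by simp [hs₇, e24]
    have m23 : s₇.reg 23 = j := by simp [hs₇, hf6.reg 23 rfl, hf5.reg 23 rfl, g23]
    have m6 : s₇.reg 6 = c := by simp [hs₇, hf6.reg 6 rfl, hf5.reg 6 rfl, g6]
    have mw : s₇.word = s₆.word := rfl
    have mr : ∀ a, s₇.real a = s.real a := fun a => by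
      simp [hs₇, hf6.real a rfl, hf5.real a rfl, gr]
    have m7 : s₇.word 7 = s₅.word 7 := by rw [mw, hf6.word 7 rfl]
    have m8 : s₇.word 8 = s.word 8 := by rw [mw, hf6.word 8 rfl, hf5.word 8 rfl, g8]
    have m9 : s₇.word 9 = s.word 9 := by rw [mw, hf6.word 9 rfl, hf5.word 9 rfl, g9]
    clear_value s₇
    refine runs_seq (copy_runs (d := 8) (a := 6) (by norm_num) m32 (by omega) (by omega))
      (T₂ := 50 * N + 80) ?_ (by omega)
    rintro s₈ ⟨hcopy8, hout8⟩ hf8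
    rw [m31, m30, mw] at hcopy8
    rw [m31, m8] at hout8
    refine runs_seq (slopes_runs (s := s₈) ((hf8.reg 24 rfl).trans m24) ((hf8.reg 18 rfl).trans m18)
      (by omega) (x := x) (y := y) (by rw [hf8.real 0 rfl, mr, hx])
      (by rw [hf8.real 1 rfl, mr, hy])) (T₂ := 30) ?_ (by omega)
    rintro s₉ ⟨hsl, hslout⟩ hf9
    have q23 : s₉.reg 23 = j := by rw [hf9.reg 23 rfl, hf8.reg 23 rfl, m23]
    have q24 : s₉.reg 24 = c * j := by rw [hf9.reg 24 rfl, hf8.reg 24 rfl, m24]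
    have q6 : s₉.reg 6 = c := by rw [hf9.reg 6 rfl, hf8.reg 6 rfl, m6]
    have q18 : s₉.reg 18 = h := by rw [hf9.reg 18 rfl, hf8.reg 18 rfl, m18]
    refine (Runs.of_wp ?_).mono (by simp [Cmd.worst, WExp.cost]) fun _ h => h
    simp (disch := omega) only [Cmd.wp, WExp.eval, State.setReg_reg, State.setWord_reg, q23, q24,
      q6, q18, State.setReg_word, State.setWord_word, State.setReg_real, State.setWord_real,
      Nat.mod_eq_of_lt]
    simp only [show (24 : ℕ) ≠ 23 by norm_num, show (6 : ℕ) ≠ 23 by norm_num,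
      show (23 : ℕ) ≠ 24 by norm_num, show (8 : ℕ) ≠ 9 by norm_num, show (7 : ℕ) ≠ 9 by norm_num,
      if_true, if_false]
    have w7 : s₉.word 7 = s₅.word 7 := by rw [hf9.word 7 rfl, hf8.word 7 rfl, m7]
    have w8 : s₉.word 8 = s₈.word 8 := hf9.word 8 rfl
    have w9 : s₉.word 9 = s.word 9 := by rw [hf9.word 9 rfl, hf8.word 9 rfl, m9]
    have w6 : s₈.word 6 = s₆.word 6 := by rw [hf8.word 6 rfl, mw]
    rw [w7, w8, w9]
    refine ⟨trivial, by rw [Nat.mod_eq_of_lt (by omega)]; ring, fun i hi => ?_⟩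
    rcases Nat.lt_succ_iff_lt_or_eq.1 hi with hi | rfl
    · have hlt : c * (i + 1) ≤ c * j := Nat.mul_le_mul_left c hi
      refine (H i hi).congr (fun k hk => ?_) (fun k hk => ?_) ?_ (fun k hk => ?_)
      · rw [hout7 k (by omega), g7]
      · rw [hout8 k (by omega)]
      · rw [Function.update_of_ne (by omega)]
      · rw [hslout k (by omega), hf8.real 2 rfl, mr]
    · have hcp : ∀ k < h, s₈.word 8 (c * i + k) = s₆.word 6 k := by
        simpa using seg_eq_iff.1 hcopy8
      refine ⟨?_, ?_, ?_, ?_, ?_⟩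
      · rw [← hNdef, hcopy7]; exact hperm
      · rw [← hNdef]
        intro a k hak hk
        rw [seg_eq_iff.1 hcopy7 a (by omega), seg_eq_iff.1 hcopy7 k hk]
        simpa using hsorted a k hak hk
      · rw [Function.update_self]
        have hset : {p | p ∈ seg (s₅.word 3) 0 N} = chunk n c i := by
          ext p
          rw [k3]
          simp only [Set.mem_ofPred_eq, chunk, ← hNdef]
          rw [hperm.mem_iff, mem_seg_id]
        rw [hset] at hull
        exact hull.congr hcp
      · rw [Function.update_self]; exact hhN
      · rw [Function.update_self]
        intro k hk
        rw [hsl k hk, hcp k (by omega), add_assoc, hcp (k + 1) hk, w6]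
  simp only [Cmd.wp, Test.Holds, WExp.eval, State.setReg_reg, hn, ho, hc]
  refine ⟨fun hlt => ?_, fun hlt => ?_⟩
  all_goals
    simp at hlt
    refine key _ ⟨fun r hr => ?_, fun a ha => ?_, fun a ha => ?_⟩ ?_ ?_ ?_ ?_
  any_goals rfl
  any_goals
    simp [writesReg] at hr
    simp [hr]
  all_goals
    simp [hNdef, chunkLen]
  all_goals omega

/-- The data that the recursive procedure does not change: the parameters, the input, and the data
on the chunks. -/
structure Static (n b c : ℕ) (x y : ℕ → ℝ) (srt hc hl : ℕ → ℕ) (ta : ℕ → ℝ) (s : State) :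
    Prop where
  n_eq : s.reg 4 = n
  b_eq : s.reg 5 = b
  c_eq : s.reg 6 = c
  x_eq : s.real 0 = x
  y_eq : s.real 1 = y
  ta_eq : s.real 2 = ta
  srt_eq : s.word 7 = srt
  hc_eq : s.word 8 = hc
  hl_eq : s.word 9 = hl

theorem Static.frame {n b c : ℕ} {x y : ℕ → ℝ} {srt hc hl : ℕ → ℕ} {ta : ℕ → ℝ} {s s' : State}
    (h : Static n b c x y srt hc hl ta s) {cmd : Cmd} (hf : Frame cmd s s')
    (h₁ : writesReg cmd 4 = false) (h₂ : writesReg cmd 5 = false) (h₃ : writesReg cmd 6 = false)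
    (h₄ : writesReal cmd 0 = false) (h₅ : writesReal cmd 1 = false) (h₆ : writesReal cmd 2 = false)
    (h₇ : writesWord cmd 7 = false) (h₈ : writesWord cmd 8 = false)
    (h₉ : writesWord cmd 9 = false) : Static n b c x y srt hc hl ta s' :=
  ⟨(hf.reg 4 h₁).trans h.n_eq, (hf.reg 5 h₂).trans h.b_eq, (hf.reg 6 h₃).trans h.c_eq,
    (hf.real 0 h₄).trans h.x_eq, (hf.real 1 h₅).trans h.y_eq, (hf.real 2 h₆).trans h.ta_eq,
    (hf.word 7 h₇).trans h.srt_eq, (hf.word 8 h₈).trans h.hc_eq, (hf.word 9 h₉).trans h.hl_eq⟩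

/-- Each chunk is sorted at a cost of `log c = 3 * e` per point, which is where the factor `e` in
front of `n` comes from. The credit of the loop is proportional to the number of points not yet
processed. -/
theorem preprocess_runs {s : State} {n : ℕ} (hn : s.reg 0 = n) (hw : 30 * (2 * n + 2) ^ 3 < 2 ^ w)
    {x y : ℕ → ℝ} (hx : s.real 0 = x) (hy : s.real 1 = y) (hinj : {p | p < n}.InjOn x) :
    ∃ e, n ≤ 2 ^ (e * e) ∧ (0 < e → 2 ^ ((e - 1) * (e - 1)) < n) ∧
    Runs w program.procs preprocessCmd s ((600 * e + 700) * n + 200) fun s' =>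
      s'.reg 0 = 0 ∧ s'.reg 1 = n ∧ s'.reg 7 = 0 ∧ s'.reg 8 = 0 ∧ (∀ i < n, s'.word 0 i = i) ∧
      ∃ srt hc hl ta, Static n (2 ^ e) ((2 ^ e) ^ 3) x y srt hc hl ta s' ∧
        ∀ j, (2 ^ e) ^ 3 * j < n → ChunkOK n ((2 ^ e) ^ 3) x y srt hc hl ta j := by
  have hw' : (2 * n + 2) ^ 3 < 2 ^ w := by omega
  have hw1 : 30 * (2 * n + 2) < 2 ^ w :=
    lt_of_le_of_lt (Nat.mul_le_mul_left _ (Nat.le_self_pow (by norm_num) _)) hw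
  obtain ⟨t₁, s₁, he₁, ht₁, ⟨h4, e, h5, h6, hne, hen⟩⟩ := params_runs (s := s) hn hw'
  have hf₁ := frame_of_exec he₁
  refine ⟨e, hne, hen, ?_⟩
  have hb2 : 2 ^ e ≤ 2 * n + 2 := by
    rcases Nat.eq_zero_or_pos e with rfl | h0
    · simp
    · have h2 := hen h0
      have h3 : 2 ^ (e - 1) < n :=
        lt_of_le_of_lt (Nat.pow_le_pow_right (by norm_num) (Nat.le_mul_self _)) h2
      have h4 : 2 ^ e = 2 * 2 ^ (e - 1) := by rw [← pow_succ', show e - 1 + 1 = e by omega]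
      omega
  set c := (2 ^ e) ^ 3 with hcdef
  have hc0 : 0 < c := by positivity
  have hcw : 30 * c < 2 ^ w := lt_of_le_of_lt (Nat.mul_le_mul_left _ (Nat.pow_le_pow_left hb2 3)) hw
  unfold preprocessCmd
  refine runs_seq (T₂ := (600 * e + 600) * n + 60) (T₁ := 50 * n + 100) (post₁ := fun s' => s' = s₁)
    ⟨t₁, s₁, he₁, ht₁, rfl⟩ ?_ ?_
  swap
  · have : (600 * e + 700) * n = (600 * e + 600) * n + 100 * n := by ring
    omega
  rintro _ rfl -
  refine runs_seq (identity_runs h4 (by omega)) (T₂ := (600 * e + 560) * n + 50) ?_ ?_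
  swap
  · have : (600 * e + 600) * n = (600 * e + 560) * n + 40 * n := by ring
    omega
  intro s₂ hid hf₂
  refine Runs.wp_seq (T₂ := (600 * e + 560) * n + 20 + 10) ?_ (by simp [Cmd.worst, WExp.cost]; omega)
  simp only [Cmd.wp]
  set s₃ := State.setReg _ 24 _ with hs₃
  have g4 : s₃.reg 4 = n := by simp [hs₃, hf₂.reg 4 rfl, h4]
  have g5 : s₃.reg 5 = 2 ^ e := by simp [hs₃, hf₂.reg 5 rfl, h5]
  have g6 : s₃.reg 6 = c := by simp [hs₃, hf₂.reg 6 rfl, h6]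
  have g23 : s₃.reg 23 = 0 := by simp [hs₃, WExp.eval]
  have g24 : s₃.reg 24 = 0 := by simp [hs₃, WExp.eval]
  have gx : s₃.real 0 = x := by simp [hs₃, hf₂.real 0 rfl, hf₁.real 0 rfl, hx]
  have gy : s₃.real 1 = y := by simp [hs₃, hf₂.real 1 rfl, hf₁.real 1 rfl, hy]
  have gid : ∀ i < n, s₃.word 0 i = i := by simpa [hs₃] using hid
  clear_value s₃
  refine runs_seq (T₁ := (600 * e + 560) * n + 20) (post₁ := fun s' => ∃ J, n ≤ c * J ∧
    ∀ i < J, ChunkOK n c x y (s'.word 7) (s'.word 8) (s'.word 9) (s'.real 2) i) (T₂ := 10) ?_ ?_ le_rfl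
  · refine runs_loop (fun T s' => ∃ j, s'.reg 23 = j ∧ s'.reg 24 = c * j ∧
      T = (600 * e + 560) * (n - c * j) + 20 ∧
      ∀ i < j, ChunkOK n c x y (s'.word 7) (s'.word 8) (s'.word 9) (s'.real 2) i)
      ⟨0, by simp [g23, g24]⟩ ?_
    rintro T s' hf ⟨j, h23, h24, rfl, hok⟩
    have k4 := (hf.reg 4 rfl).trans g4
    have k6 := (hf.reg 6 rfl).trans g6
    simp only [Test.Holds, WExp.eval, h24, k4]
    refine ⟨fun hb => ⟨_, (600 * e + 560) * (n - c * (j + 1)) + 20, ?_,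
      (chunk_runs k4 k6 h23 h24 hb hc0 (by omega) ((hf.real 0 rfl).trans gx)
        ((hf.real 1 rfl).trans gy) hinj ?_ hok).mono le_rfl ?_⟩, fun hb => ⟨?_, j, by omega, hok⟩⟩
    · set N := chunkLen n c j with hN
      have hNc : N ≤ c := min_le_left _ _
      have hN0 : 0 < N := by simp [hN, chunkLen]; omega
      have hsub : n - c * j = N + (n - c * (j + 1)) := by
        rw [mul_add, mul_one, hN, chunkLen]; omega
      have hlog : Nat.clog 2 N ≤ 3 * e := by
        calc Nat.clog 2 N ≤ Nat.clog 2 c := Nat.clog_mono_right 2 hNc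
          _ = 3 * e := by rw [hcdef, ← pow_mul, Nat.clog_pow 2 _ (by norm_num), mul_comm]
      have hle : 200 * N * Nat.clog 2 N ≤ 200 * N * (3 * e) := Nat.mul_le_mul_left _ hlog
      have e1 : (600 * e + 560) * (n - c * j) =
          200 * N * (3 * e) + 560 * N + (600 * e + 560) * (n - c * (j + 1)) := by rw [hsub]; ring
      simp only [Test.cost, WExp.cost]
      omega
    · intro i hi; rw [hf.word 0 rfl]; exact gid i hi
    · rintro s'' ⟨h1, h2, h3⟩; exact ⟨j + 1, h1, h2, rfl, h3⟩
    · simp [Test.cost, WExp.cost]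
  · rintro s₄ ⟨J, hJ, hok⟩ hf₄
    refine (Runs.of_wp ?_).mono (by simp [Cmd.worst, WExp.cost]) fun _ h => h
    simp only [Cmd.wp, WExp.eval]
    refine ⟨by simp, by simp [hf₄.reg 4 rfl, g4], by simp, by simp, fun i hi => ?_,
      s₄.word 7, s₄.word 8, s₄.word 9, s₄.real 2, ⟨?_, ?_, ?_, ?_, ?_, rfl, rfl, rfl, rfl⟩, ?_⟩
    · simp [hf₄.word 0 rfl, gid i hi]
    · simp [hf₄.reg 4 rfl, g4]
    · simp [hf₄.reg 5 rfl, g5]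
    · simp [hf₄.reg 6 rfl, g6]
    · simp [hf₄.real 0 rfl, gx]
    · simp [hf₄.real 1 rfl, gy]
    · intro j hj
      exact hok j (lt_of_mul_lt_mul_left (hj.trans_le hJ) (Nat.zero_le c))

/-! ### The direct case -/

theorem direct_runs {s : State} {m n : ℕ} (hm : s.reg 1 = m) {x y : ℕ → ℝ} (hx : s.real 0 = x)
    (hy : s.real 1 = y) (hinj : {p | p < n}.InjOn x) {Q : List ℕ}
    (hQ : seg (s.word 0) (s.reg 0) m = Q) (hnd : Q.Nodup) (hlt : ∀ p ∈ Q, p < n)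
    (hw : s.reg 0 + 2 * m + 2 < 2 ^ w) :
    Runs w program.procs directCmd s (200 * m * Nat.clog 2 m + 220 * m + 80) fun s' =>
      s'.reg 18 ≤ m ∧ HullArr x y {p | p ∈ Q} (s'.word 6) (s'.reg 18) := by
  unfold directCmd
  refine Runs.wp_seq (T₂ := 200 * m * Nat.clog 2 m + 220 * m + 60) ?_
    (by simp [Cmd.worst, WExp.cost]; omega)
  simp only [Cmd.wp]
  set s₀ := State.setReg _ 17 _ with hs₀
  have e30 : s₀.reg 30 = s.reg 0 := by simp [hs₀, WExp.eval]
  have e31 : s₀.reg 31 = 0 := by simp [hs₀, WExp.eval]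
  have e32 : s₀.reg 32 = m := by simp [hs₀, WExp.eval, hm]
  have e17 : s₀.reg 17 = m := by simp [hs₀, WExp.eval, hm]
  have ew : s₀.word = s.word := rfl
  have er : s₀.real = s.real := rfl
  clear_value s₀
  refine runs_seq (copy_runs (by norm_num) e32 (by omega) (by omega))
    (T₂ := 200 * m * Nat.clog 2 m + 200 * m + 50) ?_ (by omega)
  rintro s₁ ⟨hcopy, -⟩ hf1
  rw [e31, e30, ew, hQ] at hcopy
  have hinjQ : {p | p ∈ Q}.InjOn x := hinj.mono hlt
  refine runs_seq (sortX_runs (s := s₁) ((hf1.reg 17 rfl).trans e17) (by omega) (x := x)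
    (by rw [hf1.real 0 rfl, er, hx]) (by rw [hcopy]; exact hnd) (by rw [hcopy]; exact hinjQ))
    (T₂ := 200 * m + 20) ?_ (by omega)
  rintro s₂ ⟨hperm, hsort⟩ hf2
  rw [hcopy] at hperm
  refine (graham_runs (s := s₂) (by rw [hf2.reg 17 rfl, hf1.reg 17 rfl, e17]) (by omega)
    (by rw [hf2.real 0 rfl, hf1.real 0 rfl, er, hx]) (by rw [hf2.real 1 rfl, hf1.real 1 rfl, er, hy])
    hsort).mono le_rfl ?_
  rintro s₃ ⟨h1, h2⟩
  refine ⟨h1, ?_⟩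
  have : {p | p ∈ seg (s₂.word 3) 0 m} = {p | p ∈ Q} := by ext p; exact hperm.mem_iff
  rwa [this] at h2

theorem base_runs {s : State} {m n : ℕ} (hm : s.reg 1 = m) {x y : ℕ → ℝ} (hx : s.real 0 = x)
    (hy : s.real 1 = y) (hinj : {p | p < n}.InjOn x) {Q : List ℕ}
    (hQ : seg (s.word 0) (s.reg 0) m = Q) (hnd : Q.Nodup) (hlt : ∀ p ∈ Q, p < n)
    (hw : s.reg 0 + 2 * m + 2 < 2 ^ w) (hw' : s.reg 7 + m < 2 ^ w) :
    Runs w program.procs baseCmd s (200 * m * Nat.clog 2 m + 240 * m + 120) fun s' =>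
      s'.reg 2 = s.reg 7 ∧ s'.reg 7 = s.reg 7 + s'.reg 3 ∧ s'.reg 3 ≤ m ∧
      (∀ i < s.reg 7, s'.word 1 i = s.word 1 i) ∧
      HullArr x y {p | p ∈ Q} (fun k => s'.word 1 (s.reg 7 + k)) (s'.reg 3) := by
  unfold baseCmd
  refine runs_seq (direct_runs hm hx hy hinj hQ hnd hlt hw) (T₂ := 20 * m + 40) ?_ (by omega)
  rintro s₁ ⟨hh, hull⟩ hf1
  refine Runs.wp_seq (T₂ := 20 * m + 30) ?_ (by simp [Cmd.worst, WExp.cost]; omega)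
  simp only [Cmd.wp]
  set s₂ := State.setReg _ 32 _ with hs₂
  have e30 : s₂.reg 30 = 0 := by simp [hs₂, WExp.eval]
  have e31 : s₂.reg 31 = s.reg 7 := by simp [hs₂, WExp.eval, hf1.reg 7 rfl]
  have e32 : s₂.reg 32 = s₁.reg 18 := by simp [hs₂, WExp.eval]
  have e18 : s₂.reg 18 = s₁.reg 18 := by simp [hs₂]
  have e7 : s₂.reg 7 = s.reg 7 := by simp [hs₂, hf1.reg 7 rfl]
  have ew : s₂.word = s₁.word := rfl
  clear_value s₂
  refine runs_seq (copy_runs (d := 1) (a := 6) (by norm_num) e32 (by omega) (by omega))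
    (T₂ := 15) ?_ (by omega)
  rintro s₃ ⟨hcopy, hout⟩ hf3
  refine (Runs.of_wp ?_).mono (by simp [Cmd.worst, WExp.cost]) fun _ h => h
  have k7 : s₃.reg 7 = s.reg 7 := (hf3.reg 7 rfl).trans e7
  have k18 : s₃.reg 18 = s₁.reg 18 := (hf3.reg 18 rfl).trans e18
  rw [e31, e30, ew] at hcopy
  simp (disch := omega) [Cmd.wp, WExp.eval, k7, k18, Nat.mod_eq_of_lt]
  refine ⟨hh, fun i hi => ?_, ?_⟩
  · rw [hout i (by omega), ew, hf1.word 1 rfl]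
  · exact hull.congr (by simpa using seg_eq_iff.1 hcopy)

/-! ### Strides and marks -/

/-- Position `0` is never selected. Every selected entry thus has a predecessor in the sorted
sequence, so there are points strictly to the left of every line. -/
theorem stride_runs {d : ℕ} (hd : d ≠ 3) {s : State} {N t : ℕ} (hN : s.reg 17 = N)
    (ht : s.reg 29 = t) (ht0 : 0 < t) (hw : N + t + 1 < 2 ^ w) :
    Runs w program.procs (strideCmd d) s (30 * N + 20) fun s' =>
      (∀ i < s'.reg 36, s'.word d i = s.word 3 ((i + 1) * t)) ∧
      ∀ i, i < s'.reg 36 ↔ (i + 1) * t < N := by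
  unfold strideCmd
  refine Runs.wp_seq (T₂ := 30 * N + 10) ?_ (by simp [Cmd.worst, WExp.cost]; omega)
  simp only [Cmd.wp]
  refine runs_loop (fun T s' => ∃ l, s'.reg 36 = l ∧ s'.reg 37 = (l + 1) * t ∧ s'.word 3 = s.word 3 ∧
    T = 30 * (N - l) + 10 ∧ (∀ i < l, s'.word d i = s.word 3 ((i + 1) * t)) ∧
    ∀ i < l, (i + 1) * t < N) ⟨0, by simp [WExp.eval, ht]⟩ ?_
  rintro T s' hf ⟨l, h36, h37, h3, rfl, hval, hlt⟩
  have h17 : s'.reg 17 = N := (hf.reg 17 rfl).trans (by simpa using hN)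
  have h29 : s'.reg 29 = t := (hf.reg 29 rfl).trans (by simpa using ht)
  have hmul : l + 1 ≤ (l + 1) * t := Nat.le_mul_of_pos_right _ ht0
  simp only [Test.Holds, WExp.eval, h37, h17]
  refine ⟨fun hb => ⟨_, 30 * (N - (l + 1)) + 10, ?_, Runs.of_wp ?_⟩, fun hb => ?_⟩
  · simp [Cmd.worst, WExp.cost, Test.cost]; omega
  · simp only [Cmd.wp, WExp.eval]
    refine ⟨l + 1, ?_⟩
    simp (disch := omega) [Nat.mod_eq_of_lt, h36, h37, h29, h3, hd.symm]
    refine ⟨by ring, fun i hi => ?_, fun i hi => ?_⟩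
    · rcases eq_or_ne i l with rfl | hne
      · simp
      · rw [Function.update_of_ne hne]; exact hval i (by omega)
    · rcases hi.lt_or_eq with h | rfl
      · exact hlt i h
      · exact hb
  · refine ⟨by simp [Test.cost, WExp.cost], by rw [h36]; exact hval, fun i => ?_⟩
    rw [h36]
    refine ⟨hlt i, fun h => lt_of_not_ge fun hle => hb (lt_of_le_of_lt ?_ h)⟩
    exact Nat.mul_le_mul_right t (by omega)

theorem mark_runs {v : ℕ} {s : State} {m : ℕ} (hm : s.reg 1 = m) {Q : List ℕ}
    (hQ : seg (s.word 0) (s.reg 0) m = Q) (hw : s.reg 0 + m + 1 < 2 ^ w) :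
    Runs w program.procs (markCmd v) s (30 * m + 10) fun s' =>
      ∀ p, s'.word 10 p = if p ∈ Q then v % 2 ^ w else s.word 10 p := by
  unfold markCmd
  refine Runs.wp_seq (T₂ := 30 * m + 5) ?_ (by simp [Cmd.worst, WExp.cost]; omega)
  simp only [Cmd.wp]
  refine runs_loop (fun T s' => ∃ k ≤ m, s'.reg 40 = k ∧ T = 30 * (m - k) + 5 ∧
    ∀ p, s'.word 10 p = if p ∈ seg (s.word 0) (s.reg 0) k then v % 2 ^ w else s.word 10 p)
    ⟨0, by simp [WExp.eval]⟩ ?_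
  rintro T s' hf ⟨k, hk, h40, rfl, hval⟩
  have h1 : s'.reg 1 = m := (hf.reg 1 rfl).trans (by simpa using hm)
  have h0 : s'.reg 0 = s.reg 0 := (hf.reg 0 rfl).trans (by simp)
  have hw0 : s'.word 0 = s.word 0 := hf.word 0 rfl
  simp only [Test.Holds, WExp.eval, h40, h1]
  refine ⟨fun hb => ⟨_, 30 * (m - (k + 1)) + 5, ?_, Runs.of_wp ?_⟩, fun hb => ?_⟩
  · simp [Cmd.worst, WExp.cost, Test.cost]; omega
  · simp only [Cmd.wp, WExp.eval]
    refine ⟨k + 1, by omega, ?_⟩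
    simp (disch := omega) [Nat.mod_eq_of_lt, h40, h0, hw0, seg_succ, Function.update_apply, hval]
    intro p
    by_cases h : p = s.word 0 (s.reg 0 + k) <;> simp [h]
  · obtain rfl : k = m := by omega
    rw [hQ] at hval
    exact ⟨by simp [Test.cost, WExp.cost], hval⟩

/-! Regular samples of a list -/

/-- The entries of a list whose position, counted from `o` on, is divisible by `g`. -/
def every (g o : ℕ) : List ℕ → List ℕ
  | [] => []
  | a :: l => if o % g = 0 then a :: every g (o + 1) l else every g (o + 1) l

theorem every_append (g : ℕ) (l l' : List ℕ) : ∀ o,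
    every g o (l ++ l') = every g o l ++ every g (o + l.length) l' := by
  induction l with
  | nil => simp [every]
  | cons a l ih =>
    intro o
    have : o + 1 + l.length = o + (l.length + 1) := by ring
    simp only [List.cons_append, every, ih, List.length_cons, this]
    split <;> simp

theorem every_sublist (g : ℕ) (l : List ℕ) : ∀ o, (every g o l).Sublist l := by
  induction l with
  | nil => simp [every]
  | cons a l ih =>
    intro o
    rw [every]
    split
    · exact (ih _).cons_cons a
    · exact (ih _).cons a

/-- The number `d` is the distance to the next sampled position. Carrying it along makes the
rounding exact and the induction immediate. -/
theorem mul_length_every {g : ℕ} (l : List ℕ) : ∀ o d, d < g → (o + d) % g = 0 →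
    g * (every g o l).length + d ≤ l.length + (g - 1) := by
  induction l with
  | nil => intro o d hd _; simp [every]; omega
  | cons a l ih =>
    intro o d hd ho
    rw [every]
    split
    · rename_i h
      have h1 := ih (o + 1) (g - 1) (by omega) (by
        rw [show o + 1 + (g - 1) = o + g by omega]; simpa using h)
      have h2 : d = 0 := by
        rw [Nat.add_mod, h, zero_add, Nat.mod_mod, Nat.mod_eq_of_lt hd] at ho; exact ho
      simp only [List.length_cons, mul_add, mul_one]; omega
    · rename_i h
      have h2 : d ≠ 0 := by rintro rfl; exact h (by simpa using ho)
      have h1 := ih (o + 1) (d - 1) (by omega) (by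
        rw [show o + 1 + (d - 1) = o + d by omega]; exact ho)
      simp only [List.length_cons]; omega

/-- Where `I` holds on an initial part of the list, at most `d` elements precede the first sampled
position, and each sampled element pays for itself and the `g - 1` elements after it. -/
theorem countP_le_every_of_initial {g : ℕ} (hg : 0 < g) {I : ℕ → Bool} (l : List ℕ) :
    l.Pairwise (fun a b => I b → I a) → ∀ o d, (o + d) % g = 0 →
    l.countP I ≤ g * (every g o l).countP I + d := by
  induction l with
  | nil => simp
  | cons a l ih =>
    intro hp o d ho
    rw [List.pairwise_cons] at hp
    by_cases ha : I a
    · rw [List.countP_cons_of_pos ha, every]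
      split
      · rename_i h
        have h1 := ih hp.2 (o + 1) (g - 1) (by
          rw [show o + 1 + (g - 1) = o + g by omega]; simpa using h)
        rw [List.countP_cons_of_pos ha, mul_add]; omega
      · rename_i h
        have h2 : d ≠ 0 := by rintro rfl; exact h (by simpa using ho)
        have h1 := ih hp.2 (o + 1) (d - 1) (by
          rw [show o + 1 + (d - 1) = o + d by omega]; exact ho)
        omega
    · rw [List.countP_eq_zero.2]
      · omega
      · intro b hb hIb
        rcases List.mem_cons.1 hb with rfl | hb
        · exact ha hIb
        · exact ha (hp.1 b hb hIb)

/-- An interval contains few points of an increasing sequence between the points of a sample. -/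
theorem countP_le_every_of_sorted {g : ℕ} (hg : 0 < g) {I : ℕ → Bool} {x : ℕ → ℝ}
    (hI : ∀ a b c, x a < x b → x b < x c → I a → I c → I b) (l : List ℕ) :
    l.Pairwise (fun a b => x a < x b) → ∀ o, l.countP I ≤ g * (every g o l).countP I + (g - 1) := by
  induction l with
  | nil => simp
  | cons a l ih =>
    intro hp o
    by_cases ha : I a
    -- From the first element of the interval on, membership is an initial part of the list, and `d`
    -- is the distance to the next sampled position.
    · obtain ⟨d, hd, ho⟩ : ∃ d, d ≤ g - 1 ∧ (o + d) % g = 0 := by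
        refine ⟨(g - o % g) % g, Nat.le_sub_one_of_lt (Nat.mod_lt _ hg), ?_⟩
        have := Nat.mod_lt o hg
        rw [Nat.add_mod, Nat.mod_mod, ← Nat.add_mod, Nat.add_mod, ← Nat.mod_mod o g,
          ← Nat.add_mod, Nat.mod_mod, show o % g + (g - o % g) = g by omega, Nat.mod_self]
      refine (countP_le_every_of_initial hg (a :: l) ?_ o d ho).trans (by omega)
      rw [List.pairwise_cons] at hp ⊢
      refine ⟨fun b _ _ => ha, ?_⟩
      rw [List.pairwise_iff_forall_sublist] at hp ⊢
      intro b c hbc hc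
      exact hI a b c (hp.1 b (hbc.subset (by simp))) (hp.2 hbc) ha hc
    · rw [List.countP_cons_of_neg ha, every]
      refine (ih (List.pairwise_cons.1 hp).2 (o + 1)).trans ?_
      split
      · rw [List.countP_cons_of_neg ha]
      · exact le_rfl

/-- The rounding error `g - 1` occurs once for each sorted run. The phase of the sample is carried
over from run to run. -/
theorem countP_flatten_le_every {g : ℕ} (hg : 0 < g) {I : ℕ → Bool} {x : ℕ → ℝ}
    (hI : ∀ a b c, x a < x b → x b < x c → I a → I c → I b) (L : List (List ℕ)) :
    (∀ l ∈ L, l.Pairwise (fun a b => x a < x b)) → ∀ o,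
    L.flatten.countP I ≤ g * (every g o L.flatten).countP I + L.length * (g - 1) := by
  induction L with
  | nil => simp
  | cons l L ih =>
    intro hL o
    have h1 := countP_le_every_of_sorted hg hI l (hL l (by simp)) o
    have h2 := ih (fun l' hl' => hL l' (by simp [hl'])) (o + l.length)
    rw [List.flatten_cons, every_append, List.countP_append, List.countP_append, mul_add,
      List.length_cons, add_mul]
    omega

/-! ### The points of a subsequence in chunk order, and their sample -/

/-- What the recursive procedure may rely on. -/
structure Setup (w n b c : ℕ) (x y : ℕ → ℝ) (srt hc hl : ℕ → ℕ) (ta : ℕ → ℝ) : Prop where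
  b_pos : 0 < b
  c_eq : c = b ^ 3
  inj : {p | p < n}.InjOn x
  chunk_ok : ∀ j, c * j < n → ChunkOK n c x y srt hc hl ta j
  big : 40 * (n + c + n * (b * b) + 10) ≤ 2 ^ w

section
variable {n b c : ℕ} {x y : ℕ → ℝ} {srt hc hl : ℕ → ℕ} {ta : ℕ → ℝ}

theorem Setup.bb_le (S : Setup w n b c x y srt hc hl ta) : b * b ≤ c ∧ b ≤ b * b := by
  have := S.b_pos
  rw [S.c_eq]
  constructor
  · nlinarith [Nat.mul_le_mul_right (b * b) this]
  · exact Nat.le_mul_self b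

theorem Setup.c_pos (S : Setup w n b c x y srt hc hl ta) : 0 < c := by
  rw [S.c_eq]; exact pow_pos S.b_pos 3

/-- The number of entries of the chunks `j₀, …, j₁`. -/
def span (n c j₀ j₁ : ℕ) : ℕ := min n (c * j₁ + c) - c * j₀

theorem span_le {j₀ j₁ : ℕ} (h : j₀ ≤ j₁) : span n c j₀ j₁ ≤ (j₁ - j₀ + 1) * c := by
  obtain ⟨r, rfl⟩ := Nat.exists_eq_add_of_le h
  have : (j₀ + r - j₀ + 1) * c = r * c + c := by rw [Nat.add_sub_cancel_left]; ring
  have h2 : c * (j₀ + r) = c * j₀ + r * c := by ring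
  rw [span, this, h2]; omega

theorem span_succ {j₀ r : ℕ} (h : c * (j₀ + (r + 1)) < n) :
    span n c j₀ (j₀ + (r + 1)) = span n c j₀ (j₀ + r) + chunkLen n c (j₀ + (r + 1)) ∧
    c * j₀ + span n c j₀ (j₀ + r) = c * (j₀ + (r + 1)) := by
  have h1 : c * (j₀ + (r + 1)) = c * (j₀ + r) + c := by ring
  have h2 : c * j₀ ≤ c * (j₀ + r) := Nat.mul_le_mul_left c (by omega)
  unfold span chunkLen
  rw [h1] at h ⊢
  omega

theorem span_self {j : ℕ} : span n c j j = chunkLen n c j := by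
  unfold span chunkLen; omega

/-- The sorted sequences of the chunks `j₀, …, j₀ + r` form one segment. -/
theorem seg_chunks (j₀ r : ℕ) (h : c * (j₀ + r) < n) :
    seg srt (c * j₀) (span n c j₀ (j₀ + r)) =
      ((List.range (r + 1)).map fun i => seg srt (c * (j₀ + i)) (chunkLen n c (j₀ + i))).flatten := by
  induction r with
  | zero => simp [span_self]
  | succ r ih =>
    have h1 := span_succ h
    rw [h1.1, seg_add, h1.2, ih (lt_of_le_of_lt (Nat.mul_le_mul_left c (by omega)) h),
      List.range_succ (n := r + 1)]
    simp

theorem perm_chunks (S : Setup w n b c x y srt hc hl ta) (j₀ r : ℕ) (h : c * (j₀ + r) < n) :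
    (seg srt (c * j₀) (span n c j₀ (j₀ + r))).Perm (seg id (c * j₀) (span n c j₀ (j₀ + r))) := by
  induction r with
  | zero => simpa [span_self] using (S.chunk_ok j₀ (by simpa using h)).perm
  | succ r ih =>
    have h1 := span_succ h
    rw [h1.1, seg_add, seg_add, h1.2]
    exact (ih (lt_of_le_of_lt (Nat.mul_le_mul_left c (by omega)) h)).append (S.chunk_ok _ h).perm

/-- The points of `Q` in the order of the sorted chunks. -/
def byChunk (n c : ℕ) (srt : ℕ → ℕ) (Q : List ℕ) (j₀ j₁ : ℕ) : List ℕ :=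
  (seg srt (c * j₀) (span n c j₀ j₁)).filter (· ∈ Q)

theorem byChunk_perm (S : Setup w n b c x y srt hc hl ta) {Q : List ℕ} (hnd : Q.Nodup)
    {j₀ j₁ : ℕ} (hj : j₀ ≤ j₁) (hjn : c * j₁ < n)
    (hQ : ∀ p ∈ Q, p < n ∧ c * j₀ ≤ p ∧ p < c * j₁ + c) :
    (byChunk n c srt Q j₀ j₁).Perm Q := by
  obtain ⟨r, rfl⟩ := Nat.exists_eq_add_of_le hj
  have hp := perm_chunks S j₀ r hjn
  unfold byChunk
  rw [List.perm_ext_iff_of_nodup ((hp.nodup_iff.2 (nodup_seg_id _ _)).filter _) hnd]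
  intro p
  simp only [List.mem_filter, decide_eq_true_eq]
  rw [hp.mem_iff, mem_seg_id]
  refine ⟨And.right, fun h => ⟨?_, h⟩⟩
  obtain ⟨h1, h2, h3⟩ := hQ p h
  unfold span; omega

/-- An interval contains few points of `Q` between the points of a sample. -/
theorem countP_byChunk_le (S : Setup w n b c x y srt hc hl ta) {I : ℕ → Bool}
    (hI : ∀ a b c, x a < x b → x b < x c → I a → I c → I b) (Q : List ℕ) {j₀ j₁ : ℕ} (hj : j₀ ≤ j₁)
    (hjn : c * j₁ < n) :
    (byChunk n c srt Q j₀ j₁).countP I ≤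
      b * (every b 0 (byChunk n c srt Q j₀ j₁)).countP I + (j₁ - j₀ + 1) * (b - 1) := by
  obtain ⟨r, rfl⟩ := Nat.exists_eq_add_of_le hj
  have e : byChunk n c srt Q j₀ (j₀ + r) = ((List.range (r + 1)).map fun i =>
      (seg srt (c * (j₀ + i)) (chunkLen n c (j₀ + i))).filter (· ∈ Q)).flatten := by
    rw [byChunk, seg_chunks j₀ r hjn, List.filter_flatten, List.map_map]; rfl
  rw [e]
  refine (countP_flatten_le_every S.b_pos hI _ ?_ 0).trans (by simp)
  intro l hl
  simp only [List.mem_map, List.mem_range] at hl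
  obtain ⟨i, hi, rfl⟩ := hl
  have hok := S.chunk_ok (j₀ + i) (lt_of_le_of_lt (Nat.mul_le_mul_left c (by omega)) hjn)
  exact (pairwise_seg.2 hok.sorted).filter _

/-- Register `42` counts the marked points modulo `b` and is not reset between chunks, in agreement
with `every` on the concatenation. The time is the number of entries of the chunks, marked or not,
which is why it is charged to ranges of indices. -/
theorem sample_runs {s : State} (S : Setup w n b c x y srt hc hl ta)
    (hs : Static n b c x y srt hc hl ta s) {Q : List ℕ} {j₀ j₁ : ℕ} (h25 : s.reg 25 = j₀)
    (h26 : s.reg 26 = j₁) (hj : j₀ ≤ j₁) (hjn : c * j₁ < n)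
    (hmark : ∀ p, s.word 10 p = if p ∈ Q then 1 else 0) :
    Runs w program.procs sampleCmd s (60 * span n c j₀ j₁ + 50) fun s' =>
      seg (s'.word 3) 0 (s'.reg 17) = every b 0 (byChunk n c srt Q j₀ j₁) := by
  have hbig := S.big
  have hb := S.b_pos
  have hbb := S.bb_le
  have hc0 := S.c_pos
  have hj0 : c * j₀ ≤ c * j₁ := Nat.mul_le_mul_left c hj
  set M := span n c j₀ j₁ with hM
  have hMn : c * j₀ + M = min n (c * j₁ + c) := by rw [hM, span]; omega
  unfold sampleCmd
  refine Runs.wp_seq (T₂ := 60 * M + 20) ?_ (by simp [Cmd.worst, WExp.cost, Test.cost]; omega)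
  -- Both branches of the truncation at `n` lead to such a state; the command in `Frame` merely
  -- names the registers that may have changed.
  have key : ∀ s₁ : State, Frame (.setReg 40 (.const 0) ⨾ .setReg 41 (.const 0) ⨾
      .setReg 42 (.const 0) ⨾ .setReg 17 (.const 0)) s s₁ →
      s₁.reg 40 = c * j₀ → s₁.reg 41 = c * j₀ + M → s₁.reg 42 = 0 → s₁.reg 17 = 0 →
      Runs w program.procs (.loop (.wordLt (.reg 40) (.reg 41))
    (.ite (.wordEq (.get 10 (.get 7 (.reg 40))) (.const 1))
      (.ite (.wordEq (.reg 42) (.const 0)) (.setWord 3 (.reg 17) (.get 7 (.reg 40)) ⨾ inc 17) .skip ⨾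
        inc 42 ⨾
        .ite (.wordEq (.reg 42) (.reg 5)) (.setReg 42 (.const 0)) .skip)
      .skip ⨾
    inc 40)) s₁ (60 * M + 20) fun s' =>
      seg (s'.word 3) 0 (s'.reg 17) = every b 0 (byChunk n c srt Q j₀ j₁) := by
    intro s₁ hf1 e40 e41 e42 e17
    refine runs_loop (fun T s' => ∃ k ≤ M, s'.reg 40 = c * j₀ + k ∧ T = 60 * (M - k) + 20 ∧
      s'.reg 17 ≤ k ∧ s'.reg 42 = ((seg srt (c * j₀) k).filter (· ∈ Q)).length % b ∧
      seg (s'.word 3) 0 (s'.reg 17) = every b 0 ((seg srt (c * j₀) k).filter (· ∈ Q)))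
      ⟨0, by simp [e40, e42, e17, every]⟩ ?_
    rintro T s' hf ⟨k, hk, h40, rfl, h17, h42, hseg⟩
    have h41 : s'.reg 41 = c * j₀ + M := (hf.reg 41 rfl).trans e41
    have h7 : s'.word 7 = srt := ((hf.word 7 rfl).trans (hf1.word 7 rfl)).trans hs.srt_eq
    have h5 : s'.reg 5 = b := ((hf.reg 5 rfl).trans (hf1.reg 5 rfl)).trans hs.b_eq
    have h10 : s'.word 10 = s.word 10 := (hf.word 10 rfl).trans (hf1.word 10 rfl)
    simp only [Test.Holds, WExp.eval, h40, h41]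
    refine ⟨fun hlt => ⟨_, 60 * (M - (k + 1)) + 20, ?_, Runs.of_wp ?_⟩, fun hlt => ?_⟩
    · simp [Cmd.worst, WExp.cost, Test.cost]; omega
    · have hm1 : 1 % 2 ^ w = 1 := Nat.mod_eq_of_lt (by omega)
      have hmod := Nat.mod_lt ((seg srt (c * j₀) k).filter (· ∈ Q)).length hb
      set F := (seg srt (c * j₀) k).filter (· ∈ Q) with hF
      have hsucc : (seg srt (c * j₀) (k + 1)).filter (· ∈ Q) =
          F ++ if srt (c * j₀ + k) ∈ Q then [srt (c * j₀ + k)] else [] := by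
        rw [seg_succ, List.filter_append, hF]
        by_cases h : srt (c * j₀ + k) ∈ Q <;> simp [h]
      simp only [Cmd.wp, Test.Holds, WExp.eval, h40, h7, h10, hm1, h42, hmark, Nat.zero_mod]
      refine ⟨fun hin => ⟨fun h0 => ⟨fun hbe => ?_, fun hbe => ?_⟩,
        fun h0 => ⟨fun hbe => ?_, fun hbe => ?_⟩⟩, fun hin => ?_⟩
      all_goals
        refine ⟨k + 1, by omega, ?_⟩
        simp only [hsucc, every_append]
      · have hin' : srt (c * j₀ + k) ∈ Q := by by_contra h; simp [h] at hin
        simp (disch := omega) [h42, h0, h5, h40, Nat.mod_eq_of_lt, add_assoc] at hbe ⊢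
        simp (disch := omega) [hin', every, seg_succ, seg_update_of_not_mem, hseg, ← hbe]
        omega
      · have hin' : srt (c * j₀ + k) ∈ Q := by by_contra h; simp [h] at hin
        simp (disch := omega) [h42, h0, h5, h40, Nat.mod_eq_of_lt, add_assoc] at hbe ⊢
        have : (F.length + 1) % b = 1 := by
          rw [← Nat.mod_add_mod, h0, Nat.mod_eq_of_lt]; omega
        simp (disch := omega) [hin', every, h0, seg_succ, seg_update_of_not_mem, hseg, this]
        omega
      · have hin' : srt (c * j₀ + k) ∈ Q := by by_contra h; simp [h] at hin
        simp (disch := omega) [h5, h40, Nat.mod_eq_of_lt, add_assoc] at hbe ⊢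
        have : (F.length + 1) % b = 0 := by
          rw [← Nat.mod_add_mod, hbe, Nat.mod_self]
        simp [hin', every, h0, hseg, this]
        omega
      · have hin' : srt (c * j₀ + k) ∈ Q := by by_contra h; simp [h] at hin
        simp (disch := omega) [h5, h40, Nat.mod_eq_of_lt, add_assoc] at hbe ⊢
        have : (F.length + 1) % b = F.length % b + 1 := by
          rw [← Nat.mod_add_mod, Nat.mod_eq_of_lt]; omega
        simp [hin', every, h0, hseg, this]
        omega
      · have hin' : srt (c * j₀ + k) ∉ Q := by intro h; simp [h] at hin
        simp (disch := omega) [h42, Nat.mod_eq_of_lt, add_assoc, hin', every, hseg]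
        omega
    · obtain rfl : k = M := by omega
      exact ⟨by simp [Test.cost, WExp.cost], hseg⟩
  have hmul1 : c * j₀ % 2 ^ w = c * j₀ := Nat.mod_eq_of_lt (by omega)
  have hmul2 : c * j₁ % 2 ^ w = c * j₁ := Nat.mod_eq_of_lt (by omega)
  have hmul3 : (c * j₁ + c) % 2 ^ w = c * j₁ + c := Nat.mod_eq_of_lt (by omega)
  simp only [Cmd.wp, Test.Holds, WExp.eval, State.setReg_reg, hs.n_eq, hs.c_eq, h25, h26, hmul1,
    show (6 : ℕ) ≠ 40 by norm_num, show (26 : ℕ) ≠ 40 by norm_num, show (4 : ℕ) ≠ 40 by norm_num,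
    show (4 : ℕ) ≠ 41 by norm_num, if_false, if_true, hmul2, hmul3]
  refine ⟨fun hlt => ?_, fun hlt => ?_⟩
  all_goals
    refine key _ ⟨fun r hr => ?_, fun a ha => ?_, fun a ha => ?_⟩ ?_ ?_ ?_ ?_
  any_goals rfl
  any_goals
    simp [writesReg] at hr
    simp [hr]
  all_goals simp [hMn]
  all_goals omega

end

/-! ### Vertical lines that split evenly -/

/-- The argument of the recursive procedure is the index-sorted sequence `Q`. -/
structure Arg (n : ℕ) (Q : List ℕ) (s : State) : Prop where
  len : s.reg 1 = Q.length
  eq : seg (s.word 0) (s.reg 0) Q.length = Q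
  sorted : Q.Pairwise (· < ·)
  lt : ∀ p ∈ Q, p < n
  pos : s.reg 0 + Q.length ≤ n
  unmarked : ∀ p, s.word 10 p = 0

theorem Arg.nodup {n : ℕ} {Q : List ℕ} {s : State} (h : Arg n Q s) : Q.Nodup :=
  h.sorted.imp fun h => h.ne

theorem Arg.frame {n : ℕ} {Q : List ℕ} {s s' : State} (h : Arg n Q s) {cmd : Cmd}
    (hf : Frame cmd s s') (h₁ : writesReg cmd 0 = false) (h₂ : writesReg cmd 1 = false)
    (h₃ : writesWord cmd 0 = false) (h₄ : writesWord cmd 10 = false) : Arg n Q s' where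
  len := (hf.reg 1 h₂).trans h.len
  eq := by rw [hf.reg 0 h₁, hf.word 0 h₃]; exact h.eq
  sorted := h.sorted
  lt := h.lt
  pos := by rw [hf.reg 0 h₁]; exact h.pos
  unmarked := by rw [hf.word 10 h₄]; exact h.unmarked

/-- The point `p` lies in the `i`-th slab of the lines through the points `ln 0, …, ln (ℓ - 1)`. -/
def MemSlab (x : ℕ → ℝ) (ln : ℕ → ℕ) (ℓ i p : ℕ) : Prop :=
  (0 < i → x (ln (i - 1)) ≤ x p) ∧ (i < ℓ → x p < x (ln i))

/-- The points `ln 0, …, ln (ℓ - 1)` define vertical lines that split `Q` evenly. -/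
structure LinesOK (x : ℕ → ℝ) (b : ℕ) (Q : List ℕ) (ln : ℕ → ℕ) (ℓ : ℕ) : Prop where
  mono : ∀ i j, i < j → j < ℓ → x (ln i) < x (ln j)
  mem : ∀ i < ℓ, ln i ∈ Q
  left : ∀ i < ℓ, ∃ p ∈ Q, x p < x (ln i)
  le : ℓ ≤ 4 * b
  slab : ∀ i ≤ ℓ, ∀ I : ℕ → Bool, (∀ p ∈ Q, I p → MemSlab x ln ℓ i p) →
    b * Q.countP I ≤ Q.length

/-- Lines through every `t`-th point of a sorted sequence. -/
theorem countP_stride_le {x : ℕ → ℝ} {S ln : ℕ → ℕ} {N t ℓ : ℕ}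
    (hS : ∀ i j, i < j → j < N → x (S i) < x (S j)) (hln : ∀ i < ℓ, ln i = S ((i + 1) * t))
    (hℓ : ∀ i, i < ℓ ↔ (i + 1) * t < N) {i : ℕ} (hi : i ≤ ℓ) {I : ℕ → Bool}
    (hI : ∀ k < N, I (S k) → MemSlab x ln ℓ i (S k)) : (seg S 0 N).countP I ≤ t := by
  have hmono : ∀ i j, j < N → i < N → x (S i) ≤ x (S j) → i ≤ j := by
    intro i j hj hi h
    by_contra hc
    exact absurd (hS j i (by omega) hi) (not_lt.2 h)
  rw [seg, List.countP_map, List.countP_eq_length_filter]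
  have hnd : ((List.range N).filter (I ∘ fun k => S (0 + k))).Nodup := List.nodup_range.filter _
  rw [← List.toFinset_card_of_nodup hnd]
  -- The points of slab `i` occupy positions from `i * t` to `(i + 1) * t - 1`: a point on a line
  -- belongs to the slab on its right.
  have hsub : ((List.range N).filter (I ∘ fun k => S (0 + k))).toFinset ⊆
      Finset.Ico (i * t) ((i + 1) * t) := by
    intro k hk
    simp only [List.mem_toFinset, List.mem_filter, List.mem_range, Function.comp_apply,
      Nat.zero_add] at hk
    obtain ⟨h1, h2⟩ := hI k hk.1 hk.2
    rw [Finset.mem_Ico]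
    constructor
    · rcases Nat.eq_zero_or_pos i with rfl | h0
      · simp
      · have h3 := h1 h0
        have h4 := (hℓ (i - 1)).1 (by omega)
        rw [hln (i - 1) (by omega)] at h3
        rw [Nat.sub_add_cancel h0] at h3 h4
        exact hmono _ _ hk.1 h4 h3
    · rcases Nat.lt_or_ge i ℓ with h0 | h0
      · have h3 := h2 h0
        have h4 := (hℓ i).1 h0
        rw [hln i h0] at h3
        by_contra hc
        rcases (not_lt.1 hc).eq_or_lt with h5 | h5
        · rw [← h5] at h3; exact lt_irrefl _ h3
        · exact lt_asymm h3 (hS _ _ h5 hk.1)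
      · have := mt (hℓ i).2 (by omega)
        exact hk.1.trans_le (not_lt.1 this)
  refine (Finset.card_le_card hsub).trans ?_
  rw [Nat.card_Ico, ← Nat.sub_mul]; simp

section
variable {n b c : ℕ} {x y : ℕ → ℝ} {srt hc hl : ℕ → ℕ} {ta : ℕ → ℝ}

/-- The chunks `j₀, …, j₁` are those met by `Q`. -/
structure Chunks (n c : ℕ) (Q : List ℕ) (j₀ j₁ : ℕ) : Prop where
  le : j₀ ≤ j₁
  lt : c * j₁ < n
  mem : ∀ p ∈ Q, p < n ∧ c * j₀ ≤ p ∧ p < c * j₁ + c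
  first : ∃ p ∈ Q, p < c * j₀ + c
  last : ∃ p ∈ Q, c * j₁ ≤ p

theorem Chunks.length_le_span {Q : List ℕ} {j₀ j₁ : ℕ} (h : Chunks n c Q j₀ j₁) (hn : Q.Nodup) :
    Q.length ≤ span n c j₀ j₁ := by
  rw [← List.toFinset_card_of_nodup hn]
  refine (Finset.card_le_card (t := Finset.Ico (c * j₀) (min n (c * j₁ + c))) ?_).trans ?_
  · intro p hp
    have := h.mem p (by simpa using hp)
    rw [Finset.mem_Ico]; omega
  · rw [Nat.card_Ico, span]

/-- The argument is sorted by index, so its first and last entries determine the chunks it meets.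
Density means that sorting all of `Q` would be too expensive and that a loss of `b` points per chunk
and slab is affordable. -/
theorem dense_runs {s : State} (S : Setup w n b c x y srt hc hl ta)
    (hs : Static n b c x y srt hc hl ta s) {Q : List ℕ} (hQ : Arg n Q s) (hm : b < Q.length) :
    ∃ j₀ j₁, Chunks n c Q j₀ j₁ ∧ Runs w program.procs denseCmd s 60 fun s' =>
      s'.reg 25 = j₀ ∧ s'.reg 26 = j₁ ∧ s'.reg 27 = j₁ - j₀ + 1 ∧
      s'.reg 28 = if c < Q.length ∧ 2 * ((j₁ - j₀ + 1) * (b * b)) ≤ Q.length then 1 else 0 := by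
  have hbig := S.big
  have hc0 := S.c_pos
  have hpos := hQ.pos
  obtain ⟨m, hm'⟩ : ∃ m, Q.length = m + 1 := ⟨Q.length - 1, by omega⟩
  have hget : ∀ k (h : k < Q.length), s.word 0 (s.reg 0 + k) = Q[k] := by
    intro k h
    have := seg_getElem (s.word 0) (s.reg 0) Q.length k (by simpa using h)
    rw [← this]; congr 1; exact hQ.eq
  have hle : ∀ i j (hi : i < Q.length) (hj : j < Q.length), i ≤ j → Q[i] ≤ Q[j] := by
    intro i j hi hj hij
    rcases hij.eq_or_lt with rfl | h
    · rfl
    · exact (List.pairwise_iff_getElem.1 hQ.sorted i j hi hj h).le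
  have hfl := hle 0 m (by omega) (by omega) (by omega)
  have hln := hQ.lt Q[m] (List.getElem_mem _)
  have hdm0 := Nat.div_add_mod Q[0] c
  have hdm1 := Nat.div_add_mod Q[m] c
  have hml0 := Nat.mod_lt Q[0] hc0
  have hml1 := Nat.mod_lt Q[m] hc0
  have hR : Q[m] / c - Q[0] / c + 1 ≤ n := by
    have h1 := Nat.div_le_self Q[m] c
    have h2 := Nat.sub_le (Q[m] / c) (Q[0] / c)
    have h3 := h2.trans h1
    exact (Nat.add_le_add_right h3 1).trans hln
  refine ⟨Q[0] / c, Q[m] / c, ⟨Nat.div_le_div_right hfl, by omega, ?_, ⟨_, List.getElem_mem (n := 0)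
    (by omega), by omega⟩, ⟨_, List.getElem_mem (n := m) (by omega), by omega⟩⟩, ?_⟩
  · intro p hp
    obtain ⟨k, hk, rfl⟩ := List.getElem_of_mem hp
    have h1 := hle 0 k (by omega) hk (by omega)
    have h2 := hle k m hk (by omega) (by omega)
    have := hQ.lt _ hp
    omega
  have hRb : (Q[m] / c - Q[0] / c + 1) * (b * b) ≤ n * (b * b) := Nat.mul_le_mul_right _ hR
  have e0 : s.word 0 (s.reg 0) = Q[0] := hget 0 (by omega)
  have e1 : s.word 0 (s.reg 0 + m) = Q[m] := hget m (by omega)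
  have hlen := hQ.len
  have hbb := S.bb_le
  have hcost : denseCmd.worst ≤ 60 := by simp [denseCmd, Cmd.worst, WExp.cost, Test.cost]
  refine (Runs.of_wp ?_).mono hcost fun _ h => h
  unfold denseCmd
  have a1 : (s.reg 0 + (m + 1)) % 2 ^ w = s.reg 0 + (m + 1) := Nat.mod_eq_of_lt (by omega)
  have a2 : 1 % 2 ^ w = 1 := Nat.mod_eq_of_lt (by omega)
  have a3 : s.reg 0 + (m + 1) - 1 = s.reg 0 + m := by omega
  have a4 : (Q[m] / c - Q[0] / c + 1) % 2 ^ w = Q[m] / c - Q[0] / c + 1 :=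
    Nat.mod_eq_of_lt (by omega)
  have a5 : (b * b) % 2 ^ w = b * b := Nat.mod_eq_of_lt (by omega)
  have a6 : (Q[m] / c - Q[0] / c + 1) * (b * b) % 2 ^ w = (Q[m] / c - Q[0] / c + 1) * (b * b) :=
    Nat.mod_eq_of_lt (by omega)
  have a7 : 2 % 2 ^ w = 2 := Nat.mod_eq_of_lt (by omega)
  have a8 : 2 * ((Q[m] / c - Q[0] / c + 1) * (b * b)) % 2 ^ w =
    2 * ((Q[m] / c - Q[0] / c + 1) * (b * b)) := Nat.mod_eq_of_lt (by omega)
  simp [Cmd.wp, Test.Holds, WExp.eval, hlen, hm', hs.c_eq, hs.b_eq, e0, a1, a2, a3, a4, a5, a6, a7,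
    a8, e1]
  refine ⟨fun h1 => ⟨fun h2 => ?_, fun h2 => ?_⟩, fun h1 => ?_⟩ <;> intros <;> omega

/-- All of `Q` is sorted and every `t`-th point gives a line, with `t = max 1 (m / (2 * b))`. The
sorted sequence stays in array `3`, where the hull computation takes it up. -/
theorem linesSparse_runs {s : State} (S : Setup w n b c x y srt hc hl ta)
    (hs : Static n b c x y srt hc hl ta s) {Q : List ℕ} (hQ : Arg n Q s) (hm : b < Q.length)
    (h28 : s.reg 28 = 0) :
    Runs w program.procs linesCmd s (200 * Q.length * Nat.clog 2 Q.length + 50 * Q.length + 150)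
      fun s' => LinesOK x b Q (s'.word 11) (s'.reg 34) ∧ (∀ p, s'.word 10 p = 0) ∧
        s'.reg 17 = Q.length ∧ (seg (s'.word 3) 0 Q.length).Perm Q ∧
        ∀ i j, i < j → j < Q.length → x (s'.word 3 i) < x (s'.word 3 j) := by
  have hbig := S.big
  have hpos := hQ.pos
  have hb := S.b_pos
  have hbb := S.bb_le
  have hinj : {p | p ∈ Q}.InjOn x := S.inj.mono fun p hp => hQ.lt p hp
  set m := Q.length with hm'
  have ht0 : 0 < max 1 (m / (2 * b)) := by omega
  set t := max 1 (m / (2 * b)) with ht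
  have htm : t ≤ m := by have := Nat.div_le_self m (2 * b); omega
  unfold linesCmd
  refine runs_seq (T₁ := 20 * m + 60) (T₂ := 200 * m * Nat.clog 2 m + 30 * m + 60)
    (post₁ := fun s₁ => s₁.reg 17 = m ∧ s₁.reg 29 = t ∧ seg (s₁.word 3) 0 m = Q ∧
      ∀ p, s₁.word 10 p = 0) ?_ ?_ (by omega)
  · refine (Runs.ite (T := 20 * m + 50) (fun h => ?_) fun _ => ?_).mono
      (by simp [Test.cost, WExp.cost]; omega) fun _ h => h
    · rw [Test.Holds, WExp.eval, WExp.eval, h28, Nat.mod_eq_of_lt (by omega)] at h; omega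
    refine Runs.wp_seq (T₂ := 20 * m + 40) ?_ (by simp [Cmd.worst, WExp.cost]; omega)
    simp only [Cmd.wp]
    set s₀ := State.setReg _ 17 _ with hs₀
    have e30 : s₀.reg 30 = s.reg 0 := by simp [hs₀, WExp.eval]
    have e31 : s₀.reg 31 = 0 := by simp [hs₀, WExp.eval]
    have e32 : s₀.reg 32 = m := by simp [hs₀, WExp.eval, hQ.len, hm']
    have e17 : s₀.reg 17 = m := by simp [hs₀, WExp.eval, hQ.len, hm']
    have e1 : s₀.reg 1 = m := by simp [hs₀, WExp.eval, hQ.len, hm']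
    have e5 : s₀.reg 5 = b := by simp [hs₀, WExp.eval, hs.b_eq]
    have ew : s₀.word = s.word := by simp [hs₀]
    clear_value s₀
    refine runs_seq (copy_runs (by norm_num) e32 (by omega) (by omega)) (T₂ := 30) ?_ (by omega)
    rintro s₁ ⟨h1, -⟩ hf
    have d1 : s₁.reg 1 = m := (hf.reg 1 rfl).trans e1
    have d5 : s₁.reg 5 = b := (hf.reg 5 rfl).trans e5
    have d17 : s₁.reg 17 = m := (hf.reg 17 rfl).trans e17
    have d10 : s₁.word 10 = s.word 10 := (hf.word 10 rfl).trans (by rw [ew])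
    rw [e31, e30, ew, hQ.eq] at h1
    refine (Runs.of_wp ?_).mono (by simp [Cmd.worst, WExp.cost, Test.cost]) fun _ h => h
    have a2 : 2 % 2 ^ w = 2 := Nat.mod_eq_of_lt (by omega)
    have a3 : 2 * b % 2 ^ w = 2 * b := Nat.mod_eq_of_lt (by omega)
    have a4 : 1 % 2 ^ w = 1 := Nat.mod_eq_of_lt (by omega)
    simp [Cmd.wp, Test.Holds, WExp.eval, d1, d5, d17, d10, h1, a2, a3, a4, hQ.unmarked, -Nat.div_eq_zero_iff]
    generalize m / (2 * b) = q at ht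
    omega
  rintro s₁ ⟨e17, e29, e3, e10⟩ hf1
  have ex : s₁.real 0 = x := (hf1.real 0 rfl).trans hs.x_eq
  refine runs_seq (sortX_runs e17 (by omega) ex (by rw [e3]; exact hQ.nodup) (by rw [e3]; exact hinj))
    (T₂ := 30 * m + 40) ?_ (by omega)
  rintro s₂ ⟨hp, hsrt⟩ hf2
  rw [e3] at hp
  refine runs_seq (stride_runs (by norm_num) ((hf2.reg 17 rfl).trans e17)
    ((hf2.reg 29 rfl).trans e29) ht0 (by omega)) (T₂ := 10) ?_ (by omega)
  rintro s₃ ⟨hln, hℓ⟩ hf3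
  refine (Runs.of_wp ?_).mono (T := 2) (by omega) fun _ h => h
  have e3' : s₃.word 3 = s₂.word 3 := hf3.word 3 rfl
  have d10 : s₃.word 10 = s₁.word 10 := (hf3.word 10 rfl).trans (hf2.word 10 rfl)
  have d17 : s₃.reg 17 = m := (hf3.reg 17 rfl).trans ((hf2.reg 17 rfl).trans e17)
  simp only [Cmd.wp, State.setReg_word, WExp.eval, State.setReg_reg, if_true, d10, e10, e3',
    show (17 : ℕ) ≠ 34 by norm_num, if_false, d17, implies_true, true_and]
  refine ⟨?_, hp, hsrt⟩
  set ℓ := s₃.reg 36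
  -- For `t = 1` this is where `b < m` is used.
  have hbt : b * t ≤ m := by
    rcases le_total (m / (2 * b)) 1 with h | h
    · rw [ht, max_eq_left h]; omega
    · rw [ht, max_eq_right h]
      have := Nat.div_mul_le_self m (2 * b)
      nlinarith
  have hmem : ∀ k < m, s₂.word 3 k ∈ Q := fun k hk =>
    hp.subset (mem_seg.2 ⟨k, hk, by rw [Nat.zero_add]⟩)
  have hpos' : ∀ i, 0 < (i + 1) * t := fun i => Nat.mul_pos (by omega) ht0
  refine ⟨fun i j hij hj => ?_, fun i hi => ?_, fun i hi => ?_, ?_, fun i hi I hI => ?_⟩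
  · rw [hln i (by omega), hln j hj]
    exact hsrt _ _ (Nat.mul_lt_mul_of_pos_right (by omega) ht0) ((hℓ j).1 hj)
  · rw [hln i hi]; exact hmem _ ((hℓ i).1 hi)
  · rw [hln i hi]; exact ⟨s₂.word 3 0, hmem _ (by omega), hsrt _ _ (hpos' i) ((hℓ i).1 hi)⟩
  · by_contra hc
    have h1 := (hℓ (4 * b - 1)).1 (by omega)
    rw [Nat.sub_add_cancel (by omega)] at h1
    have h2 : m < (m / (2 * b) + 1) * (2 * b) := by
      have := Nat.div_add_mod m (2 * b)
      have := Nat.mod_lt m (show 0 < 2 * b by omega)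
      nlinarith
    -- Rounding loses at most a factor of two because `t` is positive; this is the source of the
    -- bound `4 * b` on the number of lines.
    have h3 : (m / (2 * b) + 1) * (2 * b) ≤ (2 * t) * (2 * b) :=
      Nat.mul_le_mul_right _ (by omega)
    nlinarith
  · rw [← hp.countP_eq]
    exact (Nat.mul_le_mul_left b (countP_stride_le hsrt hln hℓ hi fun k hk h =>
      hI _ (hmem k hk) h)).trans hbt

/-- Only about `m / b` sampled points are sorted. With the stride `t = m / (2 * b ^ 2)` a slab holds
at most `t` of them, hence at most `b * t + R * (b - 1)` points of `Q`. Multiplied by `b`, the first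
term is at most `m / 2` by the choice of `t` and the second at most `m / 2` by density. -/
theorem linesDense_runs {s : State} (S : Setup w n b c x y srt hc hl ta)
    (hs : Static n b c x y srt hc hl ta s) {Q : List ℕ} (hQ : Arg n Q s) {j₀ j₁ : ℕ}
    (hch : Chunks n c Q j₀ j₁) (h25 : s.reg 25 = j₀) (h26 : s.reg 26 = j₁)
    (h28 : s.reg 28 = 1) (hd : 2 * ((j₁ - j₀ + 1) * (b * b)) ≤ Q.length) :
    Runs w program.procs linesCmd s (200 * (Q.length / b + 1) * Nat.clog 2 Q.length +
      150 * span n c j₀ j₁ + 200)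
      fun s' => LinesOK x b Q (s'.word 11) (s'.reg 34) ∧ ∀ p, s'.word 10 p = 0 := by
  have hbig := S.big
  have hpos := hQ.pos
  have hb := S.b_pos
  have hbb := S.bb_le
  have hms := hch.length_le_span hQ.nodup
  have hperm := byChunk_perm S hQ.nodup hch.le hch.lt hch.mem
  set m := Q.length with hm'
  set R := j₁ - j₀ + 1 with hR
  set F := every b 0 (byChunk n c srt Q j₀ j₁) with hF
  have hFsub : F.Sublist (byChunk n c srt Q j₀ j₁) := every_sublist b _ 0
  have hFlen : b * F.length ≤ m + (b - 1) := by
    have := mul_length_every (g := b) (byChunk n c srt Q j₀ j₁) 0 0 hb (by simp)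
    rwa [hperm.length_eq, Nat.add_zero] at this
  have hFm : F.length ≤ m := by have := hFsub.length_le; rwa [hperm.length_eq] at this
  have hFb : F.length ≤ m / b + 1 := by
    rw [← Nat.add_div_right _ hb, Nat.le_div_iff_mul_le hb, mul_comm]
    omega
  have hFnd : F.Nodup := hFsub.nodup (hperm.nodup_iff.2 hQ.nodup)
  have hFQ : ∀ p ∈ F, p ∈ Q := fun p hp => hperm.subset (hFsub.subset hp)
  have hFinj : {p | p ∈ F}.InjOn x := S.inj.mono fun p hp => hQ.lt p (hFQ p hp)
  set N := F.length with hN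
  have hclog : 200 * N * Nat.clog 2 N ≤ 200 * (m / b + 1) * Nat.clog 2 m :=
    Nat.mul_le_mul (Nat.mul_le_mul_left _ hFb) (Nat.clog_mono_right 2 hFm)
  set t := m / (2 * (b * b)) with ht
  have hRt : R ≤ t := by
    rw [ht, Nat.le_div_iff_mul_le (by positivity)]
    linarith
  have ht0 : 0 < t := by omega
  have htm : t ≤ m := Nat.div_le_self _ _
  have a1 : 1 % 2 ^ w = 1 := Nat.mod_eq_of_lt (by omega)
  unfold linesCmd
  refine runs_seq (T₁ := 120 * span n c j₀ j₁ + 120)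
    (T₂ := 200 * N * Nat.clog 2 N + 30 * m + 60)
    (post₁ := fun s₁ => s₁.reg 17 = N ∧ s₁.reg 29 = t ∧ seg (s₁.word 3) 0 N = F ∧
      ∀ p, s₁.word 10 p = 0) ?_ ?_ (by omega)
  · refine (Runs.ite (T := 120 * span n c j₀ j₁ + 110) (fun _ => ?_) fun h => ?_).mono
      (by simp [Test.cost, WExp.cost]; omega) fun _ h => h
    swap
    · rw [Test.Holds, WExp.eval, WExp.eval, h28, a1] at h; omega
    refine runs_seq (mark_runs hQ.len hQ.eq (by omega)) (T₂ := 60 * span n c j₀ j₁ + 30 * m + 100)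
      ?_ (by omega)
    intro s₁ h1 hf1
    rw [a1] at h1
    simp only [hQ.unmarked] at h1
    refine runs_seq (sample_runs S (hs.frame hf1 rfl rfl rfl rfl rfl rfl rfl rfl rfl)
      ((hf1.reg 25 rfl).trans h25) ((hf1.reg 26 rfl).trans h26) hch.le hch.lt h1)
      (T₂ := 30 * m + 50) ?_ (by omega)
    intro s₂ h2 hf2
    have e17 : s₂.reg 17 = N := by rw [hN, hF, ← h2, seg_length]
    rw [e17] at h2
    have e1 : s₂.reg 1 = m := ((hf2.reg 1 rfl).trans (hf1.reg 1 rfl)).trans hQ.len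
    have e0 : s₂.reg 0 = s.reg 0 := ((hf2.reg 0 rfl).trans (hf1.reg 0 rfl))
    have ew0 : s₂.word 0 = s.word 0 := ((hf2.word 0 rfl).trans (hf1.word 0 rfl))
    have ew10 : s₂.word 10 = s₁.word 10 := hf2.word 10 rfl
    refine runs_seq (mark_runs (Q := Q) e1 (by rw [ew0, e0]; exact hQ.eq) (by omega))
      (T₂ := 30) ?_ (by omega)
    intro s₃ h3 hf3
    have d5 : s₃.reg 5 = b :=
      ((hf3.reg 5 rfl).trans (hf2.reg 5 rfl)).trans ((hf1.reg 5 rfl).trans hs.b_eq)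
    have d1 : s₃.reg 1 = m := (hf3.reg 1 rfl).trans e1
    refine (Runs.of_wp ?_).mono (by simp [Cmd.worst, WExp.cost]) fun _ h => h
    have a3 : b * b % 2 ^ w = b * b := Nat.mod_eq_of_lt (by omega)
    have a4 : 2 % 2 ^ w = 2 := Nat.mod_eq_of_lt (by omega)
    have a5 : 2 * (b * b) % 2 ^ w = 2 * (b * b) := Nat.mod_eq_of_lt (by omega)
    simp only [Cmd.wp, WExp.eval, State.setReg_reg, State.setReg_word, d5, d1, a3, a4, a5,
      show (17 : ℕ) ≠ 29 by norm_num, if_false, if_true, hf3.reg 17 rfl, e17, hf3.word 3 rfl, h2,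
      true_and]
    refine ⟨rfl, rfl, fun p => ?_⟩
    rw [h3, ew10, h1]
    split_ifs <;> simp
  rintro s₁ ⟨e17, e29, e3, e10⟩ hf1
  have ex : s₁.real 0 = x := (hf1.real 0 rfl).trans hs.x_eq
  refine runs_seq (sortX_runs e17 (by omega) ex (by rw [e3]; exact hFnd) (by rw [e3]; exact hFinj))
    (T₂ := 30 * N + 40) ?_ (by omega)
  rintro s₂ ⟨hp, hsrt⟩ hf2
  rw [e3] at hp
  refine runs_seq (stride_runs (by norm_num) ((hf2.reg 17 rfl).trans e17)
    ((hf2.reg 29 rfl).trans e29) ht0 (by omega)) (T₂ := 10) ?_ (by omega)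
  rintro s₃ ⟨hln, hℓ⟩ hf3
  refine (Runs.of_wp ?_).mono (T := 2) (by omega) fun _ h => h
  have d10 : s₃.word 10 = s₁.word 10 := (hf3.word 10 rfl).trans (hf2.word 10 rfl)
  simp only [Cmd.wp, State.setReg_word, WExp.eval, State.setReg_reg, if_true, d10, e10,
    implies_true, and_true]
  set ℓ := s₃.reg 36
  have hmem : ∀ k < N, s₂.word 3 k ∈ F := fun k hk =>
    hp.subset (mem_seg.2 ⟨k, hk, by rw [Nat.zero_add]⟩)
  have hpos' : ∀ i, 0 < (i + 1) * t := fun i => Nat.mul_pos (by omega) ht0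
  have hmono : ∀ i j, i < j → j < ℓ → x (s₃.word 11 i) < x (s₃.word 11 j) := by
    intro i j hij hj
    rw [hln i (by omega), hln j hj]
    exact hsrt _ _ (Nat.mul_lt_mul_of_pos_right (by omega) ht0) ((hℓ j).1 hj)
  refine ⟨hmono, fun i hi => ?_, fun i hi => ?_, ?_, fun i hi I hI => ?_⟩
  · rw [hln i hi]; exact hFQ _ (hmem _ ((hℓ i).1 hi))
  · rw [hln i hi]
    have := (hℓ i).1 hi
    exact ⟨s₂.word 3 0, hFQ _ (hmem _ (by omega)), hsrt _ _ (hpos' i) this⟩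
  · by_contra hc
    have h1 := (hℓ (4 * b - 1)).1 (by omega)
    rw [Nat.sub_add_cancel (by omega)] at h1
    have h2 : m < (t + 1) * (2 * (b * b)) := by
      have := Nat.div_add_mod m (2 * (b * b))
      have := Nat.mod_lt m (show 0 < 2 * (b * b) by positivity)
      nlinarith
    have h3 : (t + 1) * (2 * (b * b)) ≤ (2 * t) * (2 * (b * b)) := Nat.mul_le_mul_right _ (by omega)
    have h4 : b * (4 * b * t + 1) ≤ b * N := Nat.mul_le_mul_left b h1
    have h5 : b * (4 * b * t + 1) = 2 * t * (2 * (b * b)) + b := by ring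
    omega
  · classical
    set J : ℕ → Bool := fun p => decide (MemSlab x (s₃.word 11) ℓ i p) with hJ
    have hconv : ∀ a b c, x a < x b → x b < x c → J a → J c → J b := by
      intro a b c hab hbc ha hc
      simp only [hJ, decide_eq_true_eq] at ha hc ⊢
      exact ⟨fun h0 => (ha.1 h0).trans hab.le, fun h0 => hbc.trans (hc.2 h0)⟩
    have h1 : Q.countP I ≤ Q.countP J := List.countP_mono_left fun p hp h => by
      simpa [hJ] using hI p hp h
    have h2 := countP_byChunk_le S hconv Q hch.le hch.lt
    rw [hperm.countP_eq, ← hF, ← hR] at h2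
    have h3 : F.countP J ≤ t := by
      rw [← hp.countP_eq]
      exact countP_stride_le hsrt hln hℓ hi fun k hk h => by simpa [hJ] using h
    -- Each sampled point in the slab stands for `b` points of `Q`, and each of the `R` chunks may
    -- hide `b - 1` further ones.
    have h4 : b * Q.countP I ≤ b * (b * t + R * (b - 1)) :=
      Nat.mul_le_mul_left b (h1.trans (h2.trans (Nat.add_le_add_right (Nat.mul_le_mul_left b h3) _)))
    have h5 : b * (b * t + R * (b - 1)) ≤ b * b * t + R * (b * b) := by
      have h6 : R * (b * (b - 1)) ≤ R * (b * b) :=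
        Nat.mul_le_mul_left _ (Nat.mul_le_mul_left _ (by omega))
      have h7 : b * (b * t + R * (b - 1)) = b * b * t + R * (b * (b - 1)) := by ring
      omega
    have h6 : t * (2 * (b * b)) ≤ m := Nat.div_mul_le_self _ _
    have h7 : t * (2 * (b * b)) = 2 * (b * b * t) := by ring
    omega

end

/-! ### Sampled slopes and their extreme points -/

theorem every_eq_nil {g : ℕ} (l : List ℕ) : ∀ o, (∀ i < l.length, (o + i) % g ≠ 0) →
    every g o l = [] := by
  induction l with
  | nil => intro o _; rfl
  | cons a l ih =>
    intro o h
    rw [every, if_neg (by simpa using h 0 (by simp)), ih]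
    intro i hi
    rw [Nat.add_assoc, Nat.add_comm 1 i]
    exact h (i + 1) (by simpa using hi)

theorem every_seg_step {g : ℕ} (f : ℕ → ℕ) (lo q N : ℕ) (h : g * q < N) :
    every g 0 (seg f lo (min (g * q + g) N)) = every g 0 (seg f lo (g * q)) ++
      if g = 0 then [] else [f (lo + g * q)] := by
  rcases Nat.eq_zero_or_pos g with rfl | hg
  · simp
  obtain ⟨e, he, he'⟩ : ∃ e, min (g * q + g) N = g * q + (1 + e) ∧ e < g :=
    ⟨min (g * q + g) N - g * q - 1, by omega, by omega⟩
  rw [he, seg_add, seg_add, every_append, every_append]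
  have : every g (0 + (seg f lo (g * q)).length + (seg f (lo + g * q) 1).length)
      (seg f (lo + g * q + 1) e) = [] := by
    refine every_eq_nil _ _ fun i hi => ?_
    simp only [seg_length] at hi ⊢
    rw [show 0 + g * q + 1 + i = (1 + i) + g * q by ring, Nat.add_mul_mod_self_left,
      Nat.mod_eq_of_lt (by omega)]
    omega
  rw [this]
  simp [seg, every, hg.ne']

/-- `q` is at least as far as `p` in the direction of `α`, and to the right of `p` in case of a
tie. -/
def Dom (x y : ℕ → ℝ) (α : ℝ) (p q : ℕ) : Prop :=
  phi x y α p < phi x y α q ∨ phi x y α p = phi x y α q ∧ x p ≤ x q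

theorem Dom.trans {x y : ℕ → ℝ} {α : ℝ} {p q r : ℕ} (h : Dom x y α p q) (h' : Dom x y α q r) :
    Dom x y α p r := by
  rcases h with h | ⟨h, h2⟩ <;> rcases h' with h' | ⟨h', h2'⟩
  · exact Or.inl (h.trans h')
  · exact Or.inl (h.trans_eq h')
  · exact Or.inl (h.trans_lt h')
  · exact Or.inr ⟨h.trans h', h2.trans h2'⟩

theorem Dom.refl {x y : ℕ → ℝ} {α : ℝ} (p : ℕ) : Dom x y α p p := Or.inr ⟨rfl, le_rfl⟩

section
variable {n b c : ℕ} {x y : ℕ → ℝ} {srt hc hl : ℕ → ℕ} {ta : ℕ → ℝ}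

/-- The points of the `R` chunks from `j₀` on. -/
def chunkUnion (n c j₀ R : ℕ) : Set ℕ := {p | c * j₀ ≤ p ∧ p < n ∧ p < c * (j₀ + R)}

/-- All addresses and counters that occur in passes over the chunks fit into a word. The last chunk
may be incomplete, which accounts for the excess of `c` over `n`. -/
theorem Setup.room (S : Setup w n b c x y srt hc hl ta) {j₀ R : ℕ}
    (hjn : ∀ d < R, c * (j₀ + d) < n) (hR : 0 < R) :
    R * (c + b * b + b + 2) ≤ 3 * (n + c + n * (b * b)) ∧ c * (j₀ + R) ≤ n + c ∧ j₀ + R ≤ n + c := by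
  have hc0 := S.c_pos
  have hbb := S.bb_le
  have hb := S.b_pos
  have hj : ∀ k, k ≤ c * k := fun k => Nat.le_mul_of_pos_left k hc0
  have h := hjn (R - 1) (by omega)
  have h1 : c * (j₀ + R) = c * (j₀ + (R - 1)) + c := by
    rw [show j₀ + R = j₀ + (R - 1) + 1 by omega]; ring
  have h2 : c * (j₀ + R) = c * j₀ + R * c := by ring
  have h3 : R ≤ n := by have := hj (j₀ + (R - 1)); omega
  have h4 : R * (b * b) ≤ n * (b * b) := Nat.mul_le_mul_right _ h3
  have h5 : R * b ≤ R * (b * b) := Nat.mul_le_mul_left _ hbb.2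
  have h6 : R * (c + b * b + b + 2) = R * c + R * (b * b) + R * b + 2 * R := by ring
  have h7 : 0 < b * b := by omega
  have h8 : n ≤ n * (b * b) := Nat.le_mul_of_pos_right n h7
  have := hj (j₀ + (R - 1))
  omega

theorem ChunkOK.hl_pos {j : ℕ} (h : ChunkOK n c x y srt hc hl ta j) (hinj : {p | p < n}.InjOn x)
    (hc0 : 0 < c) (hj : c * j < n) : 0 < hl j := by
  have hsub : chunk n c j ⊆ {p | p < n} := fun p hp => by
    have := hp.2; unfold chunkLen at this; simp only [Set.mem_ofPred_eq]; omega
  obtain ⟨v, hv, -⟩ := exists_up_max (y := y) ((Set.finite_lt_nat n).subset hsub)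
    ⟨c * j, le_rfl, by unfold chunkLen; omega⟩ (hinj.mono hsub) 0
  obtain ⟨k, hk, -⟩ := (h.hull.mem v).2 hv
  omega

/-- The positions of the edges of the upper hull of chunk `j`. -/
def edges (c : ℕ) (hl : ℕ → ℕ) (j : ℕ) : List ℕ := seg id (c * j) (hl j - 1)

/-- Every `b`-th edge of each of the `R` chunks from `j₀` on. -/
def edgeSample (b c : ℕ) (hl : ℕ → ℕ) (j₀ R : ℕ) : List ℕ :=
  (List.range R).flatMap fun d => every b 0 (edges c hl (j₀ + d))

/-- Unlike the sample of points, this one restarts in every chunk. An edge is named by the address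
`c * j + k` of its left vertex, which is also the address of its slope. -/
theorem edgeSample_runs {s : State} (S : Setup w n b c x y srt hc hl ta)
    (hs : Static n b c x y srt hc hl ta s) {j₀ R : ℕ} (h25 : s.reg 25 = j₀)
    (hR : s.reg 26 + 1 = j₀ + R) (hjn : ∀ d < R, c * (j₀ + d) < n) (hR0 : 0 < R) :
    Runs w program.procs edgeSampleCmd s (60 * (R * (c + b + 1)) + 40) fun s' =>
      seg (s'.word 3) 0 (s'.reg 17) = edgeSample b c hl j₀ R := by
  have hbig := S.big
  have hb := S.b_pos
  have hbb := S.bb_le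
  have hroom := S.room hjn hR0
  unfold edgeSampleCmd
  refine Runs.wp_seq (T₂ := 60 * (R * (c + b + 1)) + 20) ?_ (by simp [Cmd.worst, WExp.cost]; omega)
  simp only [Cmd.wp]
  have hcj : c * j₀ < n := hjn 0 hR0
  refine runs_loop (fun T s' => ∃ d ≤ R, ∃ q, s'.reg 40 = j₀ + d ∧ s'.reg 41 = b * q ∧
    s'.reg 42 = c * (j₀ + d) ∧ T = 60 * ((R - d) * (c + b + 1) - b * q) + 20 ∧
    (d = R → q = 0) ∧ b * q ≤ c + b ∧ s'.reg 17 ≤ d * (c + b) + b * q ∧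
    seg (s'.word 3) 0 (s'.reg 17) = edgeSample b c hl j₀ d ++
      every b 0 (seg id (c * (j₀ + d)) (min (b * q) (hl (j₀ + d) - 1))))
    ⟨0, by omega, 0, by
      simp (disch := omega) [WExp.eval, h25, hs.c_eq, Nat.mod_eq_of_lt, edgeSample, every]⟩ ?_
  rintro T s' hf ⟨d, hd, q, h40, h41, h42, rfl, hdR, hq, h17, hseg⟩
  have h26 : s'.reg 26 = s.reg 26 := (hf.reg 26 rfl).trans (by simp)
  have h9 : s'.word 9 = hl := (hf.word 9 rfl).trans (by simpa using hs.hl_eq)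
  have h5 : s'.reg 5 = b := (hf.reg 5 rfl).trans (by simpa using hs.b_eq)
  have h6 : s'.reg 6 = c := (hf.reg 6 rfl).trans (by simpa using hs.c_eq)
  have hm1 : 1 % 2 ^ w = 1 := Nat.mod_eq_of_lt (by omega)
  have hm2 : (s.reg 26 + 1) % 2 ^ w = j₀ + R := by rw [hR]; exact Nat.mod_eq_of_lt (by omega)
  simp only [Test.Holds, WExp.eval, h40, h26, hm1, hm2]
  refine ⟨fun hlt => ?_, fun hlt => ?_⟩
  · have hlt' : d < R := by omega
    obtain ⟨e, he⟩ : ∃ e, R - d = e + 1 := ⟨R - d - 1, by omega⟩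
    have hmul : (R - d) * (c + b + 1) = e * (c + b + 1) + (c + b + 1) := by rw [he]; ring
    have he' : R - (d + 1) = e := by omega
    have hdm : (d + 1) * (c + b) ≤ R * (c + b) := Nat.mul_le_mul_right _ hlt'
    have hdm' : (d + 1) * (c + b) = d * (c + b) + (c + b) := by ring
    have hRm : R * (c + b) ≤ R * (c + b * b + b + 2) := Nat.mul_le_mul_left _ (by omega)
    have hok := S.chunk_ok _ (hjn d hlt')
    have hle := hok.hl_le
    have hlc : hl (j₀ + d) ≤ c := by unfold chunkLen at hle; omega
    have hcj := hjn d hlt'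
    have hq1 : b * (q + 1) = b * q + b := by ring
    have hm3 : (b * q + 1) % 2 ^ w = b * q + 1 := Nat.mod_eq_of_lt (by omega)
    by_cases hk : b * q + 1 < hl (j₀ + d)
    · refine ⟨_, 60 * ((R - d) * (c + b + 1) - b * (q + 1)) + 20, ?_, Runs.of_wp ?_⟩
      · simp [Cmd.worst, WExp.cost, Test.cost]
        rw [hq1]; omega
      simp only [Cmd.wp, Test.Holds, WExp.eval, h40, h41, h9, hm1, hm3, hk, not_true, true_imp_iff,
        false_imp_iff, and_true]
      have hb0 : b ≠ 0 := hb.ne'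
      have hstep := every_seg_step (g := b) id (c * (j₀ + d)) q (hl (j₀ + d) - 1) (by omega)
      have hmin : min (b * q) (hl (j₀ + d) - 1) = b * q := by omega
      refine ⟨d, hd, q + 1, ?_⟩
      rw [hmin] at hseg
      rw [if_neg hb0] at hstep
      simp (disch := omega) only [hq1, hstep, State.setReg_reg, State.setReg_word, State.setWord_word,
        State.setWord_reg, h40, h41, h42, h5, Nat.mod_eq_of_lt, seg_succ, seg_update_of_not_mem,
        hseg, if_true, reduceIte, Nat.reduceEqDiff, Nat.zero_add,
        Function.update_self, List.append_assoc, id, and_true, true_and]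
      omega
    · refine ⟨_, 60 * ((R - (d + 1)) * (c + b + 1) - b * 0) + 20, ?_, Runs.of_wp ?_⟩
      · simp [Cmd.worst, WExp.cost, Test.cost]
        rw [hmul, he']; omega
      simp only [Cmd.wp, Test.Holds, WExp.eval, h40, h41, h9, hm1, hm3, hk, not_false_iff,
        true_imp_iff, false_imp_iff, true_and]
      have hmin : min (b * q) (hl (j₀ + d) - 1) = hl (j₀ + d) - 1 := by omega
      have hcd : c * (j₀ + d) + c = c * (j₀ + (d + 1)) := by ring
      refine ⟨d + 1, hlt', 0, ?_⟩
      rw [hmin] at hseg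
      simp (disch := omega) [h42, h6, Nat.mod_eq_of_lt, hseg, edgeSample,
        List.range_succ, edges, every, hcd, add_assoc]
      omega
  · obtain rfl : d = R := by omega
    refine ⟨by simp [Test.cost, WExp.cost], ?_⟩
    simpa [hdR rfl, every] using hseg

theorem initBest_runs {s : State} (S : Setup w n b c x y srt hc hl ta)
    (hs : Static n b c x y srt hc hl ta s) {j₀ r : ℕ} (h25 : s.reg 25 = j₀) (h35 : s.reg 35 = r)
    (hj : c * j₀ < n) (hr : r ≤ b * b) :
    Runs w program.procs initBestCmd s (40 * (r + 1) + 20) fun s' =>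
      ∀ i ≤ r, s'.word 13 i = hc (c * j₀) ∧ s'.word 14 i = 0 := by
  have hbig := S.big
  have hbb := S.bb_le
  unfold initBestCmd
  refine Runs.wp_seq (T₂ := 40 * (r + 1) + 10) ?_ (by simp [Cmd.worst, WExp.cost]; omega)
  simp only [Cmd.wp]
  refine runs_loop (fun T s' => ∃ k ≤ r + 1, s'.reg 43 = k ∧ T = 40 * (r + 1 - k) + 10 ∧
    ∀ i < k, s'.word 13 i = hc (c * j₀) ∧ s'.word 14 i = 0) ⟨0, by simp [WExp.eval]⟩ ?_
  rintro T s' hf ⟨k, hk, h43, rfl, hval⟩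
  have e35 : s'.reg 35 = r := (hf.reg 35 rfl).trans (by simpa using h35)
  have e25 : s'.reg 25 = j₀ := (hf.reg 25 rfl).trans (by simpa using h25)
  have e6 : s'.reg 6 = c := (hf.reg 6 rfl).trans (by simpa using hs.c_eq)
  have e8 : s'.word 8 = hc := (hf.word 8 rfl).trans (by simpa using hs.hc_eq)
  have hm1 : 1 % 2 ^ w = 1 := Nat.mod_eq_of_lt (by omega)
  have hm2 : (r + 1) % 2 ^ w = r + 1 := Nat.mod_eq_of_lt (by omega)
  have hm3 : c * j₀ % 2 ^ w = c * j₀ := Nat.mod_eq_of_lt (by omega)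
  simp only [Test.Holds, WExp.eval, h43, e35, hm1, hm2]
  refine ⟨fun hlt => ⟨_, 40 * (r + 1 - (k + 1)) + 10, ?_, Runs.of_wp ?_⟩, fun hlt => ?_⟩
  · simp [Cmd.worst, WExp.cost, Test.cost]; omega
  · refine ⟨k + 1, by omega, ?_⟩
    simp (disch := omega) [WExp.eval, h43, e6, e25, e8, Nat.mod_eq_of_lt, hm3]
    intro i hi
    rcases eq_or_ne i k with rfl | hne
    · simp
    · rw [Function.update_of_ne hne, Function.update_of_ne hne]; exact hval i (by omega)
  · exact ⟨by simp [Test.cost, WExp.cost], fun i hi => hval i (by omega)⟩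

/-- The state of `walkBestCmd` at vertex `k` of chunk `j₀ + d` and slope `i`. -/
structure WalkInv (n c : ℕ) (x y : ℕ → ℝ) (hl : ℕ → ℕ) (ta a : ℕ → ℝ) (j₀ R r d k i : ℕ)
    (s : State) : Prop where
  le : d ≤ R
  reg_d : s.reg 40 = j₀ + d
  reg_k : s.reg 41 = k
  reg_o : s.reg 42 = c * (j₀ + d)
  reg_i : s.reg 43 = i
  done : d = R → k = 0 ∧ i = 0
  i_le : i ≤ r
  k_le : d < R → k ≤ hl (j₀ + d)
  full : d < R → k = hl (j₀ + d) → i = r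
  slope : d < R → 0 < k → i < r → ta (c * (j₀ + d) + (k - 1)) ≤ a i
  best : ∀ i' < r, s.word 13 i' ∈ chunkUnion n c j₀ R ∧
      ∀ p ∈ chunkUnion n c j₀ R, p < c * (j₀ + d) ∨ i' < i ∧ p < c * (j₀ + d) + c →
        Dom x y (a i') p (s.word 13 i')

/-- Along a chunk hull the negated slopes increase, and so do the sampled ones. A simultaneous walk
therefore meets the extreme vertex for every sampled slope in at most `c + r` moves, instead of one
search for each slope. The best point over all chunks so far is updated at each meeting. -/
theorem walkBest_runs {s : State} (S : Setup w n b c x y srt hc hl ta)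
    (hs : Static n b c x y srt hc hl ta s) {j₀ R r : ℕ} (h25 : s.reg 25 = j₀)
    (hR : s.reg 26 + 1 = j₀ + R) (hjn : ∀ d < R, c * (j₀ + d) < n) (hR0 : 0 < R)
    (h35 : s.reg 35 = r) (hr : r ≤ b * b) {a : ℕ → ℝ} (ha : ∀ i, ta (s.word 12 i) = a i)
    (hmono : ∀ i, i + 1 < r → a i ≤ a (i + 1))
    (hinit : ∀ i < r, s.word 13 i ∈ chunkUnion n c j₀ R) :
    Runs w program.procs walkBestCmd s (200 * (R * (c + r + 1)) + 40) fun s' =>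
      ∀ i < r, s'.word 13 i ∈ chunkUnion n c j₀ R ∧
        ∀ p ∈ chunkUnion n c j₀ R, Dom x y (a i) p (s'.word 13 i) := by
  have hbig := S.big
  have hb := S.b_pos
  have hbb := S.bb_le
  have hroom := S.room hjn hR0
  unfold walkBestCmd
  refine Runs.wp_seq (T₂ := 200 * (R * (c + r + 1)) + 20) ?_ (by simp [Cmd.worst, WExp.cost]; omega)
  simp only [Cmd.wp]
  have hpos : ∀ d < R, 0 < hl (j₀ + d) := fun d hd =>
    (S.chunk_ok _ (hjn d hd)).hl_pos S.inj S.c_pos (hjn d hd)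
  have hcj : c * j₀ < n := hjn 0 hR0
  have hm1 : 1 % 2 ^ w = 1 := Nat.mod_eq_of_lt (by omega)
  have hm2 : (s.reg 26 + 1) % 2 ^ w = j₀ + R := by rw [hR]; exact Nat.mod_eq_of_lt (by omega)
  have hm0 : c * j₀ % 2 ^ w = c * j₀ := Nat.mod_eq_of_lt (by omega)
  refine runs_loop (fun T s' => ∃ d k i, WalkInv n c x y hl ta a j₀ R r d k i s' ∧
    T = 200 * ((R - d) * (c + r + 1) - k - i) + 20) ⟨0, 0, 0, ⟨by omega, ?_, ?_, ?_, ?_, by omega,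
      by omega, by omega, fun h h' => ?_, by omega, fun i hi => ⟨hinit i hi, fun p hp h => ?_⟩⟩,
      by simp⟩ ?_
  iterate 4 simp [WExp.eval, h25, hs.c_eq, hm0]
  · have := hpos 0 h; omega
  · exact absurd hp.1 (not_le.2 (by simpa using h))
  rintro T s' hf ⟨d, k, i, hI, rfl⟩
  obtain ⟨hd, h40, h41, h42, h43, hdR, hir, hk, hki, hτ, hbest⟩ := id hI
  have h26 : s'.reg 26 = s.reg 26 := (hf.reg 26 rfl).trans (by simp)
  have h9 : s'.word 9 = hl := (hf.word 9 rfl).trans (by simpa using hs.hl_eq)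
  have h8 : s'.word 8 = hc := (hf.word 8 rfl).trans (by simpa using hs.hc_eq)
  have h12 : s'.word 12 = s.word 12 := (hf.word 12 rfl).trans (by simp)
  have h6 : s'.reg 6 = c := (hf.reg 6 rfl).trans (by simpa using hs.c_eq)
  have e35 : s'.reg 35 = r := (hf.reg 35 rfl).trans (by simpa using h35)
  have hx : s'.real 0 = x := (hf.real 0 rfl).trans (by simpa using hs.x_eq)
  have hy : s'.real 1 = y := (hf.real 1 rfl).trans (by simpa using hs.y_eq)
  have ht : s'.real 2 = ta := (hf.real 2 rfl).trans (by simpa using hs.ta_eq)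
  simp only [Test.Holds, WExp.eval, h40, h26, hm1, hm2]
  refine ⟨fun hlt => ?_, fun hlt => ?_⟩
  swap
  · obtain rfl : d = R := by omega
    refine ⟨by simp [Test.cost, WExp.cost], fun i hi => ⟨(hbest i hi).1, fun p hp => ?_⟩⟩
    exact (hbest i hi).2 p hp (Or.inl hp.2.2)
  have hlt' : d < R := by omega
  obtain ⟨e, he⟩ : ∃ e, R - d = e + 1 := ⟨R - d - 1, by omega⟩
  have hmul : (R - d) * (c + r + 1) = e * (c + r + 1) + (c + r + 1) := by rw [he]; ring
  have he' : R - (d + 1) = e := by omega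
  replace hk := hk hlt'
  replace hki := hki hlt'
  replace hτ := hτ hlt'
  have hcj := hjn d hlt'
  have hok := S.chunk_ok _ hcj
  have hle := hok.hl_le
  have hlc : hl (j₀ + d) ≤ c := by unfold chunkLen at hle; omega
  have hcd : c * (j₀ + d) + c = c * (j₀ + (d + 1)) := by ring
  have hcd' : c * (j₀ + (d + 1)) ≤ c * (j₀ + R) := Nat.mul_le_mul_left _ (by omega)
  have hcd'' : c * j₀ ≤ c * (j₀ + d) := Nat.mul_le_mul_left _ (by omega)
  have hm3 : (c * (j₀ + d) + k) % 2 ^ w = c * (j₀ + d) + k := Nat.mod_eq_of_lt (by omega)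
  have hm4 : (k + 1) % 2 ^ w = k + 1 := Nat.mod_eq_of_lt (by omega)
  have hm5 : (i + 1) % 2 ^ w = i + 1 := Nat.mod_eq_of_lt (by omega)
  have hm6 : (j₀ + d + 1) % 2 ^ w = j₀ + (d + 1) := Nat.mod_eq_of_lt (by omega)
  have hm7 : c * (j₀ + (d + 1)) % 2 ^ w = c * (j₀ + (d + 1)) := Nat.mod_eq_of_lt (by omega)
  have hm8 : 0 % 2 ^ w = 0 := Nat.zero_mod _
  by_cases hkl : k < hl (j₀ + d)
  swap
  · have hik := hki (by omega)
    refine ⟨_, 200 * ((R - (d + 1)) * (c + r + 1) - 0 - 0) + 20, ?_, Runs.of_wp ?_⟩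
    · simp [Cmd.worst, WExp.cost, Test.cost, RExp.cost]
      rw [hmul, he']; omega
    simp only [Cmd.wp, Test.Holds, WExp.eval, h41, h40, h9, hkl, not_false_iff, true_imp_iff,
      false_imp_iff, true_and]
    refine ⟨d + 1, 0, 0, ⟨hlt', ?_, ?_, ?_, ?_, by omega, by omega, by omega, fun h1 h2 => ?_,
      by omega, fun i' hi' => ⟨(hbest i' hi').1, fun p hp hor => ?_⟩⟩, rfl⟩
    iterate 4 simp [h42, h6, hcd, hm1, hm6, hm7, hm8]
    · have := hpos _ h1; omega
    · exact (hbest i' hi').2 p hp (Or.inr ⟨by omega, by omega⟩)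
  -- The walk moves to the next vertex if no slope is left or the next edge does not descend in the
  -- direction `a i`. Otherwise vertex `k` is the rightmost extreme point of its chunk in that
  -- direction.
  by_cases hinc : i = r ∨ k + 1 < hl (j₀ + d) ∧ ¬ a i < ta (c * (j₀ + d) + k)
  · refine ⟨_, 200 * ((R - d) * (c + r + 1) - (k + 1) - i) + 20, ?_, Runs.of_wp ?_⟩
    · simp [Cmd.worst, WExp.cost, Test.cost, RExp.cost]
      rw [hmul]; omega
    have hgoal : ∃ d' k' i', WalkInv n c x y hl ta a j₀ R r d' k' i' (s'.setReg 41 (k + 1)) ∧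
        200 * ((R - d) * (c + r + 1) - (k + 1) - i) + 20 =
          200 * ((R - d') * (c + r + 1) - k' - i') + 20 := by
      refine ⟨d, k + 1, i, ⟨hd, ?_, ?_, ?_, ?_, by omega, hir, by omega, fun h1 h2 => by omega,
        fun _ _ h2 => ?_, hbest⟩, rfl⟩
      iterate 4 simp [h40, h42, h43]
      · rw [Nat.add_sub_cancel]; exact not_lt.1 (hinc.resolve_left (by omega)).2
    rcases hinc with h | ⟨h, h'⟩
    · have h0 : ¬ i < r := by omega
      simpa only [Cmd.wp, Test.Holds, WExp.eval, h41, h40, h9, h43, e35, hkl, h0, hm1, hm4,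
        not_true, not_false_iff, true_imp_iff, false_imp_iff, and_true, true_and] using hgoal
    · have h0 : k + 1 ≠ hl (j₀ + d) := by omega
      simp only [Cmd.wp, Test.Holds, WExp.eval, RExp.eval, h41, h40, h9, h43, e35, hkl, h0, hm1,
        hm3, hm4, ht, h12, h42, ha, h', not_true, not_false_iff, true_imp_iff, false_imp_iff,
        and_true, true_and]
      exact ⟨fun _ => hgoal, fun _ => hgoal⟩
  · have hi : i < r := by omega
    have hri : k + 1 < hl (j₀ + d) → a i < ta (c * (j₀ + d) + k) := fun h => by
      by_contra h'; exact hinc (Or.inr ⟨h, h'⟩)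
    have hsub : chunk n c (j₀ + d) ⊆ {p | p < n} := fun p hp => by
      have := hp.2; unfold chunkLen at this; simp only [Set.mem_ofPred_eq]; omega
    set v := hc (c * (j₀ + d) + k) with hv
    have hdom : ∀ p ∈ chunk n c (j₀ + d), Dom x y (a i) p v := by
      refine fun p hp => hok.hull.rightmost_max ((Set.finite_lt_nat n).subset hsub)
        (S.inj.mono hsub) hkl (fun h0 => ?_) (fun h0 => ?_) hp
      · have := hok.slope (k - 1) (by omega)
        rw [show c * (j₀ + d) + (k - 1) + 1 = c * (j₀ + d) + k by omega] at this
        rw [← this]; exact hτ h0 hi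
      · have := hok.slope k h0
        rw [Nat.add_assoc] at this
        rw [← this]; exact hri h0
    have hmem : v ∈ chunkUnion n c j₀ R := by
      have := hok.hull.mem_set hkl
      have h2 := hsub this
      have h3 := this.2
      have h4 := this.1
      unfold chunkLen at h3
      simp only [Set.mem_ofPred_eq] at h2
      exact ⟨by omega, by omega, by omega⟩
    refine ⟨_, 200 * ((R - d) * (c + r + 1) - k - (i + 1)) + 20, ?_, Runs.of_wp ?_⟩
    · simp [Cmd.worst, WExp.cost, Test.cost, RExp.cost]
      rw [hmul]; omega
    -- Ties between chunks are broken by the `x`-coordinate, since the rightmost extreme point of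
    -- the union is wanted.
    set B := s'.word 13 i with hB
    have hnext : ∀ (s'' : State) (v' : ℕ), s''.word 13 = Function.update (s'.word 13) i v' →
        s''.reg 40 = j₀ + d → s''.reg 41 = k → s''.reg 42 = c * (j₀ + d) → s''.reg 43 = i + 1 →
        (v' = v ∨ v' = B) → Dom x y (a i) v v' → Dom x y (a i) B v' →
        ∃ d' k' i', WalkInv n c x y hl ta a j₀ R r d' k' i' s'' ∧
          200 * ((R - d) * (c + r + 1) - k - (i + 1)) + 20 =
            200 * ((R - d') * (c + r + 1) - k' - i') + 20 := by
      intro s'' v' e13 e40 e41 e42 e43 hv' hd1 hd2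
      refine ⟨d, k, i + 1, ⟨hd, e40, e41, e42, e43, by omega, hi, fun _ => hk, by omega,
        fun _ h0 h1 => (hτ h0 hi).trans (hmono i h1), fun i' hi' => ?_⟩, rfl⟩
      rw [e13]
      rcases eq_or_ne i' i with rfl | hne
      · rw [Function.update_self]
        refine ⟨?_, fun p hp hor => ?_⟩
        · rcases hv' with rfl | rfl
          · exact hmem
          · exact (hbest i' hi').1
        · by_cases hpc : p < c * (j₀ + d)
          · exact ((hbest i' hi').2 p hp (Or.inl hpc)).trans hd2
          · refine (hdom p ⟨by omega, ?_⟩).trans hd1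
            have := hp.2.1
            unfold chunkLen; omega
      · rw [Function.update_of_ne hne]
        exact ⟨(hbest i' hi').1, fun p hp hor => (hbest i' hi').2 p hp
          (hor.imp_right fun h => ⟨by omega, h.2⟩)⟩
    have hup : s'.word 13 = Function.update (s'.word 13) i B := by simp [hB]
    have hphi : ∀ p, y p + a i * x p = phi x y (a i) p := fun p => rfl
    refine ⟨fun _ => ⟨fun _ => ⟨fun _ => ?_, fun hne => ⟨fun _ => ?_, fun h => ?_⟩⟩, fun h => ?_⟩,
      fun h => ?_⟩
    rotate_left 2
    · simp only [Test.Holds, WExp.eval, RExp.eval, h41, h40, h9, h43, h42, ht, h12, hm1, hm3, hm4,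
        ha] at h hne
      exact absurd (hri (by omega)) h
    · simp only [Test.Holds, WExp.eval, h43, e35] at h
      exact absurd hi h
    · simp only [Test.Holds, WExp.eval, h41, h40, h9] at h
      exact absurd hkl h
    all_goals
      simp only [Cmd.wp, Test.Holds, WExp.eval, RExp.eval, h41, h43, h42, h8, hx, hy, ht, h12, hm1,
        hm3, hm5, ha, hphi, ← hB, ← hv, State.setWord_reg]
      refine ⟨fun h => ?_, fun h => ⟨fun h' => ?_, fun h' => ⟨fun h'' => ?_, fun h'' => ?_⟩⟩⟩
      · exact hnext _ v (by simp) (by simp [h40]) (by simp [h41]) (by simp [h42]) (by simp)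
          (Or.inl rfl) (Dom.refl v) (Or.inl h)
      · exact hnext _ B hup (by simp [h40]) (by simp [h41]) (by simp [h42]) (by simp)
          (Or.inr rfl) (Or.inl h') (Dom.refl B)
      · exact hnext _ v (by simp) (by simp [h40]) (by simp [h41]) (by simp [h42]) (by simp)
          (Or.inl rfl) (Dom.refl v) (Or.inr ⟨le_antisymm (not_lt.1 h') (not_lt.1 h), h''.le⟩)
      · exact hnext _ B hup (by simp [h40]) (by simp [h41]) (by simp [h42]) (by simp)
          (Or.inr rfl) (Or.inr ⟨le_antisymm (not_lt.1 h) (not_lt.1 h'), not_lt.1 h''⟩) (Dom.refl B)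

/-! ### Hot slope intervals and the collection of candidates -/

/-- The first interval that may contain the negated slope of the bridge across a line. -/
def FirstIn (x : ℕ → ℝ) (best : ℕ → ℕ) (r : ℕ) (z : ℝ) (i : ℕ) : Prop :=
  i ≤ r ∧ (∀ i' < i, x (best i') < z) ∧ (i < r → z ≤ x (best i))

/-- The lines are sorted, so a best point to the left of one line is to the left of all later ones,
and the pointer to the slopes never moves back. Different lines may share an interval, so what is
recorded is the image of `g`. -/
theorem hot_runs {s : State} {ℓ r : ℕ} (h34 : s.reg 34 = ℓ) (h35 : s.reg 35 = r)
    (hw : ℓ + r + 2 < 2 ^ w) {x : ℕ → ℝ} (hx : s.real 0 = x) (h0 : ∀ i ≤ r, s.word 14 i = 0)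
    (hmono : ∀ i j, i < j → j < ℓ → x (s.word 11 i) < x (s.word 11 j)) :
    Runs w program.procs hotCmd s (50 * (ℓ + r) + 30) fun s' =>
      ∃ g : ℕ → ℕ, (∀ l < ℓ, FirstIn x (s.word 13) r (x (s.word 11 l)) (g l)) ∧
        ∀ i ≤ r, s'.word 14 i = 1 ↔ ∃ l < ℓ, g l = i := by
  unfold hotCmd
  refine Runs.wp_seq (T₂ := 50 * (ℓ + r) + 20) ?_ (by simp [Cmd.worst, WExp.cost]; omega)
  simp only [Cmd.wp]
  refine runs_loop (fun T s' => ∃ l i, ∃ g : ℕ → ℕ, s'.reg 40 = l ∧ s'.reg 43 = i ∧ l ≤ ℓ ∧ i ≤ r ∧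
    T = 50 * (ℓ + r - l - i) + 20 ∧
    (l < ℓ → ∀ i' < i, x (s.word 13 i') < x (s.word 11 l)) ∧
    (∀ l' < l, FirstIn x (s.word 13) r (x (s.word 11 l')) (g l')) ∧
    ∀ i ≤ r, s'.word 14 i = 1 ↔ ∃ l' < l, g l' = i)
    ⟨0, 0, fun _ => 0, by simp [WExp.eval]; exact fun i hi => by rw [h0 i hi]; omega⟩ ?_
  rintro T s' hf ⟨l, i, g, h40, h43, hl, hi, rfl, hlt, hfirst, hhot⟩
  have h13 : s'.word 13 = s.word 13 := (hf.word 13 rfl).trans (by simp)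
  have h11 : s'.word 11 = s.word 11 := (hf.word 11 rfl).trans (by simp)
  have e34 : s'.reg 34 = ℓ := (hf.reg 34 rfl).trans (by simpa using h34)
  have e35 : s'.reg 35 = r := (hf.reg 35 rfl).trans (by simpa using h35)
  have hx' : s'.real 0 = x := (hf.real 0 rfl).trans (by simpa using hx)
  have hm1 : 1 % 2 ^ w = 1 := Nat.mod_eq_of_lt (by omega)
  have hm2 : (l + 1) % 2 ^ w = l + 1 := Nat.mod_eq_of_lt (by omega)
  have hm3 : (i + 1) % 2 ^ w = i + 1 := Nat.mod_eq_of_lt (by omega)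
  simp only [Test.Holds, WExp.eval, h40, e34]
  refine ⟨fun hb => ?_, fun hb => ?_⟩
  swap
  · obtain rfl : l = ℓ := by omega
    exact ⟨by simp [Test.cost, WExp.cost], g, hfirst, hhot⟩
  by_cases hinc : i < r ∧ x (s.word 13 i) < x (s.word 11 l)
  · refine ⟨_, 50 * (ℓ + r - l - (i + 1)) + 20, ?_, Runs.of_wp ?_⟩
    · simp [Cmd.worst, WExp.cost, Test.cost, RExp.cost]; omega
    simp only [Cmd.wp, Test.Holds, WExp.eval, RExp.eval, h40, h43, e35, hx', h13, h11, hinc.1,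
      hinc.2, hm1, hm3, not_true, true_imp_iff, false_imp_iff, and_true]
    refine ⟨l, i + 1, g, by simp [h40], by simp, hl, hinc.1, rfl, fun h i' hi' => ?_, hfirst, hhot⟩
    rcases eq_or_ne i' i with rfl | hne
    · exact hinc.2
    · exact hlt h i' (by omega)
  · refine ⟨_, 50 * (ℓ + r - (l + 1) - i) + 20, ?_, Runs.of_wp ?_⟩
    · simp [Cmd.worst, WExp.cost, Test.cost, RExp.cost]; omega
    have hgoal : ∀ s'' : State, s''.reg 40 = l + 1 → s''.reg 43 = i →
        s''.word 14 = Function.update (s'.word 14) i 1 →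
        ∃ l' i', ∃ g : ℕ → ℕ, s''.reg 40 = l' ∧ s''.reg 43 = i' ∧ l' ≤ ℓ ∧ i' ≤ r ∧
        50 * (ℓ + r - (l + 1) - i) + 20 = 50 * (ℓ + r - l' - i') + 20 ∧
        (l' < ℓ → ∀ i'' < i', x (s.word 13 i'') < x (s.word 11 l')) ∧
        (∀ l'' < l', FirstIn x (s.word 13) r (x (s.word 11 l'')) (g l'')) ∧
        ∀ i ≤ r, s''.word 14 i = 1 ↔ ∃ l'' < l', g l'' = i := by
      intro s'' e40 e43 e14
      refine ⟨l + 1, i, Function.update g l i, e40, e43, hb, hi, rfl,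
        fun h i' hi' => (hlt hb i' hi').trans (hmono l (l + 1) (by omega) h), fun l' hl' => ?_,
        fun j hj => ?_⟩
      · rcases eq_or_ne l' l with rfl | hne
        · rw [Function.update_self]
          exact ⟨hi, hlt hb, fun h => not_lt.1 fun h' => hinc ⟨h, h'⟩⟩
        · rw [Function.update_of_ne hne]; exact hfirst l' (by omega)
      · rw [e14]
        rcases eq_or_ne j i with rfl | hne
        · rw [Function.update_self]
          exact ⟨fun _ => ⟨l, by omega, by simp⟩, fun _ => rfl⟩
        · rw [Function.update_of_ne hne, hhot j hj]
          constructor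
          · rintro ⟨l', hl', h⟩
            exact ⟨l', by omega, by rw [Function.update_of_ne (by omega)]; exact h⟩
          · rintro ⟨l', hl', h⟩
            rcases eq_or_ne l' l with rfl | hne'
            · rw [Function.update_self] at h; exact absurd h.symm hne
            · rw [Function.update_of_ne hne'] at h; exact ⟨l', by omega, h⟩
    simp only [Cmd.wp, Test.Holds, WExp.eval, RExp.eval, h40, h43, e35, hx', h13, h11, hm1, hm2,
      State.setWord_reg]
    refine ⟨fun h => ⟨fun h' => absurd ⟨h, h'⟩ hinc, fun _ => ?_⟩, fun _ => ?_⟩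
    all_goals exact hgoal _ (by simp) (by simp [h43]) (by simp)

end

/-- Vertex `k` of a chunk hull with `h` vertices and slopes `ta (o + ·)` has a supporting line
whose negated slope is in the `i`-th of the intervals between `a 0 ≤ … ≤ a (r - 1)`. -/
def Covers (ta a : ℕ → ℝ) (r h o k i : ℕ) : Prop :=
  i ≤ r ∧ (0 < k → i < r → ta (o + (k - 1)) ≤ a i) ∧ (k + 1 < h → 0 < i → a (i - 1) < ta (o + k))

open Classical in
/-- The vertices of the hull of a chunk that cover a hot interval. -/
noncomputable def collected (ta a : ℕ → ℝ) (r : ℕ) (hot : ℕ → Prop) (hc : ℕ → ℕ) (h o k : ℕ) :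
    List ℕ :=
  ((List.range k).filter fun k => decide (∃ i, Covers ta a r h o k i ∧ hot i)).map
    fun k => hc (o + k)

/-- The vertices that cover a hot interval, of the `R` chunks from `j₀` on. -/
noncomputable def collectedAll (c : ℕ) (ta a : ℕ → ℝ) (r : ℕ) (hot : ℕ → Prop) (hc hl : ℕ → ℕ)
    (j₀ R : ℕ) : List ℕ :=
  (List.range R).flatMap fun d => collected ta a r hot hc (hl (j₀ + d)) (c * (j₀ + d)) (hl (j₀ + d))

/-- The state of `collectCmd` at vertex `k` of chunk `j₀ + d` and interval `i`. -/
structure CollectInv (c : ℕ) (ta a : ℕ → ℝ) (hot : ℕ → Prop) (hc hl : ℕ → ℕ) (j₀ R r d k i : ℕ)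
    (s : State) : Prop where
  le : d ≤ R
  reg_d : s.reg 40 = j₀ + d
  reg_k : s.reg 41 = k
  reg_o : s.reg 42 = c * (j₀ + d)
  reg_i : s.reg 43 = i
  done : d = R → k = 0 ∧ i = 0
  i_le : i ≤ r
  k_le : d < R → k ≤ hl (j₀ + d)
  len : s.reg 17 ≤ d * c + k
  slope : d < R → 0 < k → k < hl (j₀ + d) → i < r → ta (c * (j₀ + d) + (k - 1)) ≤ a i
  below : d < R → k + 1 < hl (j₀ + d) → ∀ i' < i, a i' < ta (c * (j₀ + d) + k)
  flag : d < R → k < hl (j₀ + d) → (s.reg 44 = 1 ↔ ∃ i' ≤ i, hot i' ∧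
    (0 < k → i' < r → ta (c * (j₀ + d) + (k - 1)) ≤ a i'))
  list : seg (s.word 3) 0 (s.reg 17) = collectedAll c ta a r hot hc hl j₀ d ++
    collected ta a r hot hc (hl (j₀ + d)) (c * (j₀ + d)) k

section
variable {n b c : ℕ} {x y : ℕ → ℝ} {srt hc hl : ℕ → ℕ} {ta : ℕ → ℝ}

theorem ChunkOK.slope_lt {j : ℕ} (h : ChunkOK n c x y srt hc hl ta j) {i k : ℕ} (hik : i < k)
    (hk : k + 1 < hl j) : ta (c * j + i) < ta (c * j + k) := by
  rw [h.slope i (by omega), h.slope k hk]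
  exact tau_lt_of_chain (f := fun k => hc (c * j + k)) h.hull.tau_lt hik hk

/-- The same walk as for the best points. The intervals that a vertex covers are consecutive, and
two neighbouring vertices share the interval at which the walk passes from one to the other. The
flag in register `44` records whether a hot interval has been met at the current vertex; on leaving
a vertex it is reset to the mark of the shared interval. -/
theorem collect_runs {s : State} (S : Setup w n b c x y srt hc hl ta)
    (hs : Static n b c x y srt hc hl ta s) {j₀ R r : ℕ} (h25 : s.reg 25 = j₀)
    (hR : s.reg 26 + 1 = j₀ + R) (hjn : ∀ d < R, c * (j₀ + d) < n) (hR0 : 0 < R)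
    (h35 : s.reg 35 = r) (hr : r ≤ b * b) {a : ℕ → ℝ} (ha : ∀ i, ta (s.word 12 i) = a i)
    (hmono : ∀ i j, i ≤ j → j < r → a i ≤ a j) {hot : ℕ → Prop}
    (hhot : ∀ i ≤ r, s.word 14 i = 1 ↔ hot i) :
    Runs w program.procs collectCmd s (200 * (R * (c + r + 1)) + 40) fun s' =>
      seg (s'.word 3) 0 (s'.reg 17) = collectedAll c ta a r hot hc hl j₀ R := by
  have hbig := S.big
  have hb := S.b_pos
  have hbb := S.bb_le
  have hroom := S.room hjn hR0
  unfold collectCmd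
  refine Runs.wp_seq (T₂ := 200 * (R * (c + r + 1)) + 20) ?_ (by simp [Cmd.worst, WExp.cost]; omega)
  simp only [Cmd.wp]
  have hpos : ∀ d < R, 0 < hl (j₀ + d) := fun d hd =>
    (S.chunk_ok _ (hjn d hd)).hl_pos S.inj S.c_pos (hjn d hd)
  have hcj : c * j₀ < n := hjn 0 hR0
  have hm1 : 1 % 2 ^ w = 1 := Nat.mod_eq_of_lt (by omega)
  have hm2 : (s.reg 26 + 1) % 2 ^ w = j₀ + R := by rw [hR]; exact Nat.mod_eq_of_lt (by omega)
  have hm0 : c * j₀ % 2 ^ w = c * j₀ := Nat.mod_eq_of_lt (by omega)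
  have hm8 : 0 % 2 ^ w = 0 := Nat.zero_mod _
  refine runs_loop (fun T s' => ∃ d k i, CollectInv c ta a hot hc hl j₀ R r d k i s' ∧
    T = 200 * ((R - d) * (c + r + 1) - k - i) + 20) ⟨0, 0, 0, ⟨by omega, ?_, ?_, ?_, ?_, by omega,
      by omega, by omega, ?_, by omega, by omega, fun _ _ => ?_, ?_⟩, by simp⟩ ?_
  iterate 5 simp [WExp.eval, h25, hs.c_eq, hm0]
  · simp [WExp.eval, hhot]
  · simp [WExp.eval, collectedAll, collected]
  rintro T s' hf ⟨d, k, i, hI, rfl⟩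
  obtain ⟨hd, h40, h41, h42, h43, hdR, hir, hk, h17, hτ, hbelow, hflag, hlist⟩ := id hI
  have h26 : s'.reg 26 = s.reg 26 := (hf.reg 26 rfl).trans (by simp)
  have h9 : s'.word 9 = hl := (hf.word 9 rfl).trans (by simpa using hs.hl_eq)
  have h8 : s'.word 8 = hc := (hf.word 8 rfl).trans (by simpa using hs.hc_eq)
  have h12 : s'.word 12 = s.word 12 := (hf.word 12 rfl).trans (by simp)
  have h14 : s'.word 14 = s.word 14 := (hf.word 14 rfl).trans (by simp)
  have h6 : s'.reg 6 = c := (hf.reg 6 rfl).trans (by simpa using hs.c_eq)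
  have e35 : s'.reg 35 = r := (hf.reg 35 rfl).trans (by simpa using h35)
  have ht : s'.real 2 = ta := (hf.real 2 rfl).trans (by simpa using hs.ta_eq)
  simp only [Test.Holds, WExp.eval, h40, h26, hm1, hm2]
  refine ⟨fun hlt => ?_, fun hlt => ?_⟩
  swap
  · obtain rfl : d = R := by omega
    refine ⟨by simp [Test.cost, WExp.cost], ?_⟩
    rw [hlist, (hdR rfl).1]; simp [collected]
  have hlt' : d < R := by omega
  obtain ⟨e, he⟩ : ∃ e, R - d = e + 1 := ⟨R - d - 1, by omega⟩
  have hmul : (R - d) * (c + r + 1) = e * (c + r + 1) + (c + r + 1) := by rw [he]; ring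
  have he' : R - (d + 1) = e := by omega
  replace hk := hk hlt'
  replace hτ := hτ hlt'
  replace hbelow := hbelow hlt'
  replace hflag := hflag hlt'
  have hcj := hjn d hlt'
  have hok := S.chunk_ok _ hcj
  have hle := hok.hl_le
  have hlc : hl (j₀ + d) ≤ c := by unfold chunkLen at hle; omega
  have hcd : c * (j₀ + d) + c = c * (j₀ + (d + 1)) := by ring
  have hcd' : c * (j₀ + (d + 1)) ≤ c * (j₀ + R) := Nat.mul_le_mul_left _ (by omega)
  have hdc : d * c ≤ R * (c + b * b + b + 2) := Nat.mul_le_mul hd (by omega)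
  have hdc' : (d + 1) * c = d * c + c := by ring
  have hm3 : (c * (j₀ + d) + k) % 2 ^ w = c * (j₀ + d) + k := Nat.mod_eq_of_lt (by omega)
  have hm4 : (k + 1) % 2 ^ w = k + 1 := Nat.mod_eq_of_lt (by omega)
  have hm5 : (i + 1) % 2 ^ w = i + 1 := Nat.mod_eq_of_lt (by omega)
  have hm6 : (j₀ + d + 1) % 2 ^ w = j₀ + (d + 1) := Nat.mod_eq_of_lt (by omega)
  have hm7 : c * (j₀ + (d + 1)) % 2 ^ w = c * (j₀ + (d + 1)) := Nat.mod_eq_of_lt (by omega)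
  have hm9 : (s'.reg 17 + 1) % 2 ^ w = s'.reg 17 + 1 := Nat.mod_eq_of_lt (by omega)
  by_cases hkl : k < hl (j₀ + d)
  swap
  · refine ⟨_, 200 * ((R - (d + 1)) * (c + r + 1) - 0 - 0) + 20, ?_, Runs.of_wp ?_⟩
    · simp [Cmd.worst, WExp.cost, Test.cost, RExp.cost]
      rw [hmul, he']; omega
    simp only [Cmd.wp, Test.Holds, WExp.eval, h41, h40, h9, hkl, not_false_iff, true_imp_iff,
      false_imp_iff, true_and]
    have hkeq : k = hl (j₀ + d) := by omega
    refine ⟨d + 1, 0, 0, ⟨hlt', ?_, ?_, ?_, ?_, by omega, by omega, by omega, ?_, by omega,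
      by omega, fun h1 h2 => ?_, ?_⟩, rfl⟩
    iterate 4 simp [h42, h6, hcd, hm1, hm6, hm7, hm8]
    · simp; omega
    · simp [hm8, h14, hhot]
    · simp [hlist, hkeq, collectedAll, List.range_succ, collected]
  by_cases hinc : i = r ∨ k + 1 < hl (j₀ + d) ∧ ¬ a i < ta (c * (j₀ + d) + k)
  · refine ⟨_, 200 * ((R - d) * (c + r + 1) - (k + 1) - i) + 20, ?_, Runs.of_wp ?_⟩
    · simp [Cmd.worst, WExp.cost, Test.cost, RExp.cost]
      rw [hmul]; omega
    -- When the walk leaves vertex `k`, all intervals covered by `k` have been passed: beyond `i`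
    -- the lower end of the interval is already at or above the slope of the next edge.
    have hcov : (∃ i, Covers ta a r (hl (j₀ + d)) (c * (j₀ + d)) k i ∧ hot i) ↔ s'.reg 44 = 1 := by
      rw [hflag hkl]
      constructor
      · rintro ⟨i', ⟨h1, h2, h3⟩, h4⟩
        refine ⟨i', ?_, h4, h2⟩
        by_contra hlt
        obtain ⟨h5, h6⟩ := hinc.resolve_left (by omega)
        exact h6 ((hmono i (i' - 1) (by omega) (by omega)).trans_lt (h3 h5 (by omega)))
      · rintro ⟨i', h1, h2, h3⟩
        exact ⟨i', ⟨by omega, h3, fun h4 h5 => hbelow h4 _ (by omega)⟩, h2⟩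
    have hcol : collected ta a r hot hc (hl (j₀ + d)) (c * (j₀ + d)) (k + 1) =
        collected ta a r hot hc (hl (j₀ + d)) (c * (j₀ + d)) k ++
          if s'.reg 44 = 1 then [hc (c * (j₀ + d) + k)] else [] := by
      unfold collected
      rw [List.range_succ, List.filter_append, List.map_append]
      congr 1
      by_cases h : s'.reg 44 = 1
      · rw [if_pos h]; simp [hcov.2 h]
      · rw [if_neg h]; simp [mt hcov.1 h]
    have hgoal : ∀ s'' : State, s''.reg 40 = j₀ + d → s''.reg 41 = k + 1 →
        s''.reg 42 = c * (j₀ + d) → s''.reg 43 = i → s''.reg 44 = s.word 14 i →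
        s''.reg 17 ≤ s'.reg 17 + 1 →
        seg (s''.word 3) 0 (s''.reg 17) = seg (s'.word 3) 0 (s'.reg 17) ++
          (if s'.reg 44 = 1 then [hc (c * (j₀ + d) + k)] else []) →
        ∃ d' k' i', CollectInv c ta a hot hc hl j₀ R r d' k' i' s'' ∧
        200 * ((R - d) * (c + r + 1) - (k + 1) - i) + 20 =
          200 * ((R - d') * (c + r + 1) - k' - i') + 20 := by
      intro s'' e40 e41 e42 e43 e44 e17 e3
      refine ⟨d, k + 1, i, ⟨hd, e40, e41, e42, e43, by omega, hir, by omega, by omega,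
        fun _ _ h2 h3 => ?_, fun _ h2 i' hi' => ?_, fun _ h2 => ?_, ?_⟩, rfl⟩
      · rw [Nat.add_sub_cancel]; exact not_lt.1 (hinc.resolve_left (by omega)).2
      · exact (hbelow (by omega) i' hi').trans (hok.slope_lt (by omega) h2)
      · rw [e44, hhot i hir]
        constructor
        · intro h
          refine ⟨i, le_rfl, h, fun _ h4 => ?_⟩
          rw [Nat.add_sub_cancel]; exact not_lt.1 (hinc.resolve_left (by omega)).2
        · rintro ⟨i', h3, h4, h5⟩
          rcases h3.eq_or_lt with rfl | h6
          · exact h4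
          · exact absurd (h5 (by omega) (by omega)) (not_le.2 (by
              rw [Nat.add_sub_cancel]; exact hbelow h2 i' h6))
      · rw [e3, hlist, hcol, List.append_assoc]
    have hfin : ∀ h : s'.reg 44 = 1, _ := fun h => hgoal
      ((((s'.setWord 3 (s'.reg 17) (hc (c * (j₀ + d) + k))).setReg 17 (s'.reg 17 + 1)).setReg 41
        (k + 1)).setReg 44 (s.word 14 i)) (by simp [h40]) (by simp) (by simp [h42]) (by simp [h43])
        (by simp) (by simp) (by simp [h, seg_succ, seg_update_of_not_mem])
    have hfin' : ∀ h : ¬ s'.reg 44 = 1, _ := fun h => hgoal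
      ((s'.setReg 41 (k + 1)).setReg 44 (s.word 14 i)) (by simp [h40]) (by simp) (by simp [h42])
        (by simp [h43]) (by simp) (by simp) (by simp [h])
    rcases hinc with h | ⟨h, h'⟩
    · have h0 : ¬ i < r := by omega
      simp (disch := decide) only [Cmd.wp, Test.Holds, WExp.eval, h41, h40, h9, h43, e35, hkl, h0,
        hm1, hm3, hm4, hm9, h42, h8, h14, State.setReg_reg, State.setWord_reg, State.setReg_word,
        State.setWord_word, if_neg, not_true, not_false_iff, true_imp_iff, false_imp_iff, and_true,
        true_and]
      exact ⟨hfin, hfin'⟩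
    · have h0 : k + 1 ≠ hl (j₀ + d) := by omega
      simp (disch := decide) only [Cmd.wp, Test.Holds, WExp.eval, RExp.eval, h41, h40, h9, h43, e35,
        hkl, h0, hm1, hm3, hm4, hm9, h42, h8, h14, ht, h12, ha, h', State.setReg_reg,
        State.setWord_reg, State.setReg_word,
        State.setWord_word, if_neg, not_true, not_false_iff, true_imp_iff, false_imp_iff, and_true,
        true_and]
      exact ⟨fun _ => ⟨hfin, hfin'⟩, fun _ => ⟨hfin, hfin'⟩⟩
  · have hi : i < r := by omega
    have hri : k + 1 < hl (j₀ + d) → a i < ta (c * (j₀ + d) + k) := fun h => by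
      by_contra h'; exact hinc (Or.inr ⟨h, h'⟩)
    refine ⟨_, 200 * ((R - d) * (c + r + 1) - k - (i + 1)) + 20, ?_, Runs.of_wp ?_⟩
    · simp [Cmd.worst, WExp.cost, Test.cost, RExp.cost]
      rw [hmul]; omega
    have hgoal : ∀ s'' : State, s''.reg 40 = j₀ + d → s''.reg 41 = k →
        s''.reg 42 = c * (j₀ + d) → s''.reg 43 = i + 1 →
        (s''.reg 44 = 1 ↔ s'.reg 44 = 1 ∨ s.word 14 (i + 1) = 1) →
        s''.reg 17 = s'.reg 17 → s''.word 3 = s'.word 3 →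
        ∃ d' k' i', CollectInv c ta a hot hc hl j₀ R r d' k' i' s'' ∧
        200 * ((R - d) * (c + r + 1) - k - (i + 1)) + 20 =
          200 * ((R - d') * (c + r + 1) - k' - i') + 20 := by
      intro s'' e40 e41 e42 e43 e44 e17 e3
      refine ⟨d, k, i + 1, ⟨hd, e40, e41, e42, e43, by omega, hi, fun _ => hk, by omega,
        fun _ h1 h2 h3 => (hτ h1 h2 hi).trans (hmono _ _ (by omega) h3),
        fun _ h2 i' hi' => ?_, fun _ h2 => ?_, by rw [e3, e17, hlist]⟩, rfl⟩
      · rcases eq_or_ne i' i with rfl | hne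
        · exact hri h2
        · exact hbelow h2 i' (by omega)
      · rw [e44, hhot _ hi, hflag h2]
        constructor
        · rintro (⟨i', h3, h4⟩ | h3)
          · exact ⟨i', by omega, h4⟩
          · exact ⟨i + 1, le_rfl, h3, fun h4 h5 =>
              (hτ h4 h2 hi).trans (hmono _ _ (by omega) h5)⟩
        · rintro ⟨i', h3, h4⟩
          rcases h3.eq_or_lt with rfl | h6
          · exact Or.inr h4.1
          · exact Or.inl ⟨i', by omega, h4⟩
    have hadv : ∀ h : s.word 14 (i + 1) = 1, _ := fun h => hgoal
      ((s'.setReg 43 (i + 1)).setReg 44 1) (by simp [h40]) (by simp [h41]) (by simp [h42])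
        (by simp) (by simp [h]) (by simp) (by simp)
    have hadv' : ∀ h : ¬ s.word 14 (i + 1) = 1, _ := fun h => hgoal
      (s'.setReg 43 (i + 1)) (by simp [h40]) (by simp [h41]) (by simp [h42])
        (by simp) (by simp [h]) (by simp) (by simp)
    simp (disch := decide) only [Cmd.wp, Test.Holds, WExp.eval, RExp.eval, h41, h40, h9, h43, e35,
      hkl, hi, hm1, hm3, hm4, hm5, h42, h14, ht, h12, ha, State.setReg_reg, if_true,
      State.setReg_word, not_true, true_imp_iff, false_imp_iff, and_true]
    exact ⟨fun _ => ⟨hadv, hadv'⟩, fun h => ⟨fun _ => ⟨hadv, hadv'⟩,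
      fun h' => absurd (hri (by omega)) h'⟩⟩

end

/-! ### Counting the candidates -/

/-- The edge `e` is in the `i`-th of the intervals between `a 0 ≤ … ≤ a (r - 1)`. -/
def InInterval (ta a : ℕ → ℝ) (r i e : ℕ) : Prop :=
  (i < r → ta e ≤ a i) ∧ (0 < i → a (i - 1) < ta e)

section
variable {ta a : ℕ → ℝ} {r : ℕ}

open Classical in
/-- Between two consecutive vertices of a hull that cover the interval there is an edge in the
interval. -/
theorem countP_covers_le {h o : ℕ} (hτ : ∀ i k, i < k → k + 1 < h → ta (o + i) < ta (o + k))
    (i : ℕ) : (List.range h).countP (fun k => decide (Covers ta a r h o k i)) ≤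
      1 + (seg id o (h - 1)).countP fun e => decide (InInterval ta a r i e) := by
  rw [seg, List.countP_map, List.countP_eq_length_filter, List.countP_eq_length_filter,
    ← List.toFinset_card_of_nodup (List.nodup_range.filter _),
    ← List.toFinset_card_of_nodup (List.nodup_range.filter _)]
  set F := ((List.range h).filter fun k => decide (Covers ta a r h o k i)).toFinset with hF
  have hmem : ∀ k, k ∈ F ↔ k < h ∧ Covers ta a r h o k i := by intro k; simp [hF]
  rcases F.eq_empty_or_nonempty with h0 | hne
  · rw [h0]; simp
  set k₀ := F.min' hne with hk₀
  have hk₀F : k₀ ∈ F := F.min'_mem hne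
  rw [← Finset.card_erase_add_one hk₀F, Nat.add_comm]
  -- Every covering vertex other than the first is mapped to the edge on its left, whose slope is in
  -- the interval because both the first vertex and this one cover it.
  refine Nat.add_le_add_left (Finset.card_le_card_of_injOn (fun k => k - 1) ?_ ?_) 1
  · intro k hk
    have hk' : k ≠ k₀ ∧ k ∈ F := and_comm.1 (by simpa using hk)
    have hlt : k₀ < k := lt_of_le_of_ne (F.min'_le k hk'.2) (Ne.symm hk'.1)
    obtain ⟨h1, h2⟩ := (hmem k).1 hk'.2
    obtain ⟨h3, h4⟩ := (hmem k₀).1 hk₀F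
    simp only [List.coe_toFinset, List.mem_filter, List.mem_range, Function.comp_apply, id,
      decide_eq_true_eq, Set.mem_ofPred_eq]
    refine ⟨by omega, fun hi => h2.2.1 (by omega) hi, fun hi => ?_⟩
    have h5 := h4.2.2 (by omega) hi
    rcases (show k₀ ≤ k - 1 by omega).eq_or_lt with h6 | h6
    · rw [← h6]; exact h5
    · exact h5.trans (hτ _ _ h6 (by omega))
  · intro k hk k' hk' he
    have h1 : k ≠ k₀ ∧ k ∈ F := and_comm.1 (by simpa using hk)
    have h2 : k' ≠ k₀ ∧ k' ∈ F := and_comm.1 (by simpa using hk')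
    have := lt_of_le_of_ne (F.min'_le k h1.2) (Ne.symm h1.1)
    have := lt_of_le_of_ne (F.min'_le k' h2.2) (Ne.symm h2.1)
    simp only at he
    omega

/-- The union bound. -/
theorem countP_exists_le (l : List ℕ) (ℓ : ℕ) (p : ℕ → ℕ → Bool) (q : ℕ → Bool)
    (hq : ∀ k ∈ l, q k → ∃ t < ℓ, p t k) :
    l.countP q ≤ ∑ t ∈ Finset.range ℓ, l.countP (p t) := by
  induction l with
  | nil => simp
  | cons k l ih =>
    have ih := ih fun k hk => hq k (by simp [hk])
    simp only [List.countP_cons, Finset.sum_add_distrib]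
    refine Nat.add_le_add ih ?_
    by_cases h : q k
    · obtain ⟨t, ht, hp⟩ := hq k (by simp) h
      rw [if_pos h]
      refine le_trans ?_ (Finset.single_le_sum (f := fun t => if p t k = true then 1 else 0)
        (fun _ _ => Nat.zero_le _) (Finset.mem_range.2 ht))
      simp [hp]
    · simp [h]

/-- Along one hull the slopes are distinct. A sampled value is therefore attained at most once for
each chunk, even though different chunks may share it. -/
theorem countP_eq_le_one {l : List ℕ} (h : l.Pairwise fun p q => ta p < ta q) (z : ℝ)
    (I : ℕ → Bool) (hI : ∀ e, I e → ta e = z) : l.countP I ≤ 1 := by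
  induction l with
  | nil => simp
  | cons e l ih =>
    rw [List.pairwise_cons] at h
    rw [List.countP_cons]
    by_cases he : I e
    · have : l.countP I = 0 := by
        rw [List.countP_eq_zero]
        intro e' he' hI'
        have := h.1 e' he'
        rw [hI e he, hI e' hI'] at this
        exact lt_irrefl _ this
      simp [this, he]
    · simpa [he] using ih h.2

/-- Open intervals between every `t`-th entry of a weakly sorted sequence. -/
theorem countP_open_stride_le {S : ℕ → ℕ} {N t : ℕ} (hS : ∀ i j, i < j → j < N → ta (S i) ≤ ta (S j))
    (ha : ∀ i < r, a i = ta (S ((i + 1) * t))) (hr : ∀ i, i < r ↔ (i + 1) * t < N) {i : ℕ}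
    (hi : i ≤ r) {I : ℕ → Bool} (hI : ∀ e, I e → (i < r → ta e < a i) ∧ (0 < i → a (i - 1) < ta e)) :
    (seg S 0 N).countP I ≤ t := by
  rw [seg, List.countP_map, List.countP_eq_length_filter,
    ← List.toFinset_card_of_nodup (List.nodup_range.filter _)]
  have hsub : ((List.range N).filter (I ∘ fun k => S (0 + k))).toFinset ⊆
      Finset.Ico (i * t) ((i + 1) * t) := by
    intro k hk
    simp only [List.mem_toFinset, List.mem_filter, List.mem_range, Function.comp_apply,
      Nat.zero_add] at hk
    obtain ⟨h1, h2⟩ := hI _ hk.2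
    rw [Finset.mem_Ico]
    constructor
    · rcases Nat.eq_zero_or_pos i with rfl | h0
      · simp
      · have h3 := h2 h0
        have h4 := (hr (i - 1)).1 (by omega)
        rw [ha (i - 1) (by omega)] at h3
        rw [Nat.sub_add_cancel h0] at h3 h4
        by_contra hc
        exact absurd (hS _ _ (not_le.1 hc) h4) (not_le.2 h3)
    · rcases Nat.lt_or_ge i r with h0 | h0
      · have h3 := h1 h0
        rw [ha i h0] at h3
        by_contra hc
        rcases (not_lt.1 hc).eq_or_lt with h5 | h5
        · rw [← h5] at h3; exact lt_irrefl _ h3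
        · exact absurd (hS _ _ h5 hk.1) (not_le.2 h3)
      · exact hk.1.trans_le (not_lt.1 (mt (hr i).2 (by omega)))
  refine (Finset.card_le_card hsub).trans ?_
  rw [Nat.card_Ico, ← Nat.sub_mul]; simp

end

section
variable {n b c : ℕ} {x y : ℕ → ℝ} {srt hc hl : ℕ → ℕ} {ta : ℕ → ℝ}

theorem ChunkOK.pairwise_edges {j : ℕ} (h : ChunkOK n c x y srt hc hl ta j) :
    (edges c hl j).Pairwise fun p q => ta p < ta q :=
  pairwise_seg.2 fun i k hik hk => h.slope_lt hik (by omega)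

theorem countP_flatMap_range (R : ℕ) (f : ℕ → List ℕ) (I : ℕ → Bool) :
    ((List.range R).flatMap f).countP I = ∑ d ∈ Finset.range R, (f d).countP I := by
  induction R with
  | zero => simp
  | succ R ih => rw [List.range_succ, Finset.sum_range_succ, ← ih]; simp

theorem length_flatMap_range (R : ℕ) (f : ℕ → List ℕ) :
    ((List.range R).flatMap f).length = ∑ d ∈ Finset.range R, (f d).length := by
  induction R with
  | zero => simp
  | succ R ih => rw [List.range_succ, Finset.sum_range_succ, ← ih]; simp

/-- A chunk hull has at most `c - 1` edges and `c = b * b ^ 2`, so every `b`-th edge makes at most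
`b ^ 2`. -/
theorem length_edgeSample_le (S : Setup w n b c x y srt hc hl ta) {j₀ R : ℕ}
    (hjn : ∀ d < R, c * (j₀ + d) < n) : (edgeSample b c hl j₀ R).length ≤ R * (b * b) := by
  rw [edgeSample, length_flatMap_range]
  refine (Finset.sum_le_card_nsmul _ _ (b * b) fun d hd => ?_).trans (by simp)
  have hok := S.chunk_ok _ (hjn d (Finset.mem_range.1 hd))
  have h1 := mul_length_every (g := b) (edges c hl (j₀ + d)) 0 0 S.b_pos (by simp)
  have h2 := hok.hl_le
  unfold chunkLen at h2
  have h3 : c = b * (b * b) := by rw [S.c_eq]; ring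
  have hb := S.b_pos
  simp only [edges, seg_length] at h1 ⊢
  by_contra hlt
  have h4 : b * (b * b + 1) ≤ b * (every b 0 (seg id (c * (j₀ + d)) (hl (j₀ + d) - 1))).length :=
    Nat.mul_le_mul_left b (by omega)
  rw [mul_add, mul_one] at h4
  have h5 : 0 < c := S.c_pos
  omega

open Classical in
/-- Few edges of the chunk hulls have slopes between two consecutive samples. -/
theorem sum_countP_edges_le (S : Setup w n b c x y srt hc hl ta) {j₀ R r : ℕ}
    (hjn : ∀ d < R, c * (j₀ + d) < n) {A : ℕ → ℕ} {N : ℕ} {a : ℕ → ℝ}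
    (hp : (seg A 0 N).Perm (edgeSample b c hl j₀ R))
    (hS : ∀ i j, i < j → j < N → ta (A i) ≤ ta (A j))
    (ha : ∀ i < r, a i = ta (A ((i + 1) * R))) (hr : ∀ i, i < r ↔ (i + 1) * R < N) {i : ℕ}
    (hi : i ≤ r) :
    ∑ d ∈ Finset.range R, (edges c hl (j₀ + d)).countP (fun e => decide (InInterval ta a r i e)) ≤
      3 * (R * b) - R := by
  have hb := S.b_pos
  set I : ℕ → Bool := fun e => decide (InInterval ta a r i e) with hI
  -- The interval is closed on the right. Its interior contains at most `R` sampled edges by the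
  -- choice of every `R`-th; ties with its upper end contribute at most one edge for each of the `R`
  -- chunks.
  have h1 : (edgeSample b c hl j₀ R).countP I ≤ 2 * R := by
    set I₁ : ℕ → Bool := fun e => decide ((i < r → ta e < a i) ∧ (0 < i → a (i - 1) < ta e))
    set I₂ : ℕ → Bool := fun e => decide (ta e = a i)
    have h2 : (edgeSample b c hl j₀ R).countP I ≤ ∑ t ∈ Finset.range 2,
        (edgeSample b c hl j₀ R).countP ((fun t => if t = 0 then I₁ else I₂) t) := by
      refine countP_exists_le _ 2 (fun t => if t = 0 then I₁ else I₂) I fun e _ he => ?_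
      have he' : InInterval ta a r i e := by simpa [hI] using he
      by_cases h : ta e = a i
      · exact ⟨1, by norm_num, by simpa [I₂] using h⟩
      · refine ⟨0, by norm_num, ?_⟩
        simp only [if_true, I₁, decide_eq_true_eq]
        exact ⟨fun h' => lt_of_le_of_ne (he'.1 h') h, he'.2⟩
    rw [Finset.sum_range_succ, Finset.sum_range_one] at h2
    simp only [if_true, one_ne_zero, if_false] at h2
    have h3 : (edgeSample b c hl j₀ R).countP I₁ ≤ R := by
      rw [← hp.countP_eq]
      exact countP_open_stride_le hS ha hr hi fun e he => by
        simpa only [I₁, decide_eq_true_eq] using he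
    have h4 : (edgeSample b c hl j₀ R).countP I₂ ≤ R := by
      rw [edgeSample, countP_flatMap_range]
      refine (Finset.sum_le_card_nsmul _ _ 1 fun d hd => ?_).trans (by simp)
      exact countP_eq_le_one (((S.chunk_ok _ (hjn d (Finset.mem_range.1 hd))).pairwise_edges).sublist
        (every_sublist _ _ _)) (a i) _ fun e he => by simpa [I₂] using he
    omega
  have h2 : ∀ d ∈ Finset.range R, (edges c hl (j₀ + d)).countP I ≤
      b * (every b 0 (edges c hl (j₀ + d))).countP I + (b - 1) := fun d hd =>
    countP_le_every_of_sorted hb (x := ta) (fun e₁ e₂ e₃ h12 h23 h1 h3 => by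
      simp only [hI, decide_eq_true_eq] at h1 h3 ⊢
      exact ⟨fun h => h23.le.trans (h3.1 h), fun h => (h1.2 h).trans h12⟩) _
      (S.chunk_ok _ (hjn d (Finset.mem_range.1 hd))).pairwise_edges 0
  refine (Finset.sum_le_sum h2).trans ?_
  rw [Finset.sum_add_distrib, ← Finset.mul_sum, ← countP_flatMap_range]
  simp only [Finset.sum_const, Finset.card_range, smul_eq_mul]
  have h3 : b * (edgeSample b c hl j₀ R).countP I ≤ b * (2 * R) := Nat.mul_le_mul_left b h1
  have h4 : R * (b - 1) + R = R * b := by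
    obtain ⟨b', rfl⟩ : ∃ b', b = b' + 1 := ⟨b - 1, by omega⟩
    simp; ring
  have h5 : b * (2 * R) = 2 * (R * b) := by ring
  rw [edgeSample] at h3
  omega

/-- For one hot interval, each chunk contributes at most one vertex more than it has edges in the
interval. Over the `R` chunks this is `R` more than the number of edges, which uses up the `- R` in
the bound on the edges. -/
theorem length_collectedAll_le (S : Setup w n b c x y srt hc hl ta) {j₀ R r : ℕ}
    (hjn : ∀ d < R, c * (j₀ + d) < n) {A : ℕ → ℕ} {N : ℕ} {a : ℕ → ℝ}
    (hp : (seg A 0 N).Perm (edgeSample b c hl j₀ R))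
    (hS : ∀ i j, i < j → j < N → ta (A i) ≤ ta (A j))
    (ha : ∀ i < r, a i = ta (A ((i + 1) * R))) (hr : ∀ i, i < r ↔ (i + 1) * R < N) {g : ℕ → ℕ}
    {ℓ : ℕ} (hg : ∀ l < ℓ, g l ≤ r) {hot : ℕ → Prop} (hhot : ∀ i ≤ r, hot i ↔ ∃ l < ℓ, g l = i) :
    (collectedAll c ta a r hot hc hl j₀ R).length ≤ ℓ * (3 * (R * b)) := by
  classical
  have hb := S.b_pos
  rw [collectedAll, length_flatMap_range]
  have h1 : ∀ d ∈ Finset.range R,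
      (collected ta a r hot hc (hl (j₀ + d)) (c * (j₀ + d)) (hl (j₀ + d))).length ≤
        ∑ l ∈ Finset.range ℓ, (1 + (edges c hl (j₀ + d)).countP
          fun e => decide (InInterval ta a r (g l) e)) := by
    intro d hd
    have hok := S.chunk_ok _ (hjn d (Finset.mem_range.1 hd))
    unfold collected
    rw [List.length_map, ← List.countP_eq_length_filter]
    refine (countP_exists_le _ ℓ (fun l k => decide (Covers ta a r (hl (j₀ + d)) (c * (j₀ + d)) k
      (g l))) _ fun k _ hk => ?_).trans (Finset.sum_le_sum fun l _ =>
        countP_covers_le (fun i k hik hk => hok.slope_lt hik hk) (g l))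
    simp only [decide_eq_true_eq] at hk ⊢
    obtain ⟨i, hi, hh⟩ := hk
    obtain ⟨l, hl, rfl⟩ := (hhot i hi.1).1 hh
    exact ⟨l, hl, hi⟩
  refine (Finset.sum_le_sum h1).trans ?_
  rw [Finset.sum_comm]
  refine (Finset.sum_le_card_nsmul _ _ (3 * (R * b)) fun l hl => ?_).trans (by simp)
  rw [Finset.sum_add_distrib]
  have h2 := sum_countP_edges_le S hjn hp hS ha hr (hg l (Finset.mem_range.1 hl))
  have h3 : R ≤ R * b := Nat.le_mul_of_pos_right R hb
  simp only [Finset.sum_const, Finset.card_range, smul_eq_mul]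
  omega

theorem chunk_subset_chunkUnion {j₀ R d : ℕ} (hd : d < R) (hdn : c * (j₀ + d) < n) :
    chunk n c (j₀ + d) ⊆ chunkUnion n c j₀ R := by
  intro p hp
  have h1 := hp.1
  have h2 := hp.2
  have h3 : c * j₀ ≤ c * (j₀ + d) := Nat.mul_le_mul_left _ (by omega)
  have h4 : c * (j₀ + (d + 1)) ≤ c * (j₀ + R) := Nat.mul_le_mul_left _ (by omega)
  have h5 : c * (j₀ + (d + 1)) = c * (j₀ + d) + c := by ring
  unfold chunkLen at h2
  exact ⟨by omega, by omega, by omega⟩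

theorem exists_chunk {j₀ R p : ℕ} (hc0 : 0 < c) (hp : p ∈ chunkUnion n c j₀ R) :
    ∃ d < R, p ∈ chunk n c (j₀ + d) := by
  obtain ⟨h1, h2, h3⟩ := hp
  have h4 := Nat.div_add_mod p c
  have h5 := Nat.mod_lt p hc0
  have h6 : j₀ ≤ p / c := (Nat.le_div_iff_mul_le hc0).2 (by linarith [mul_comm c j₀])
  have h7 : p / c < j₀ + R := (Nat.div_lt_iff_lt_mul hc0).2 (by linarith [mul_comm c (j₀ + R)])
  refine ⟨p / c - j₀, by omega, ?_⟩
  rw [Nat.add_sub_cancel' h6]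
  unfold chunk chunkLen
  exact ⟨by omega, by omega⟩

theorem mem_collectedAll_subset (S : Setup w n b c x y srt hc hl ta) {j₀ R r : ℕ} {a : ℕ → ℝ}
    (hjn : ∀ d < R, c * (j₀ + d) < n) {hot : ℕ → Prop} {p : ℕ}
    (hp : p ∈ collectedAll c ta a r hot hc hl j₀ R) : p ∈ chunkUnion n c j₀ R := by
  simp only [collectedAll, collected, List.mem_flatMap, List.mem_range, List.mem_map,
    List.mem_filter] at hp
  obtain ⟨d, hd, k, ⟨hk, -⟩, rfl⟩ := hp
  exact chunk_subset_chunkUnion hd (hjn d hd) ((S.chunk_ok _ (hjn d hd)).hull.mem_set hk)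

theorem nodup_collectedAll (S : Setup w n b c x y srt hc hl ta) {j₀ R r : ℕ} {a : ℕ → ℝ}
    (hjn : ∀ d < R, c * (j₀ + d) < n) {hot : ℕ → Prop} :
    (collectedAll c ta a r hot hc hl j₀ R).Nodup := by
  rw [collectedAll, List.nodup_flatMap]
  refine ⟨fun d hd => ?_, ?_⟩
  · have hH := (S.chunk_ok _ (hjn d (List.mem_range.1 hd))).hull
    refine List.Nodup.map_on ?_ (List.nodup_range.filter _)
    intro k hk k' hk' he
    have hk1 := List.mem_range.1 (List.mem_of_mem_filter hk)
    have hk2 := List.mem_range.1 (List.mem_of_mem_filter hk')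
    rcases lt_trichotomy k k' with h | h | h
    · have := lt_of_chain (f := fun k => hc (c * (j₀ + d) + k)) hH.lt h hk2
      simp only [he, lt_irrefl] at this
    · exact h
    · have := lt_of_chain (f := fun k => hc (c * (j₀ + d) + k)) hH.lt h hk1
      simp only [he, lt_irrefl] at this
  · refine List.Pairwise.imp_of_mem ?_ (List.pairwise_lt_range (n := R))
    intro d d' hd hd' hlt
    have hd := List.mem_range.1 hd
    have hd' := List.mem_range.1 hd'
    intro p hp hp'
    simp only [collected, List.mem_map, List.mem_filter, List.mem_range] at hp hp'
    obtain ⟨k, ⟨hk, -⟩, rfl⟩ := hp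
    obtain ⟨k', ⟨hk', -⟩, he⟩ := hp'
    have h1 := (S.chunk_ok _ (hjn d hd)).hull.mem_set hk
    have h2 := (S.chunk_ok _ (hjn d' hd')).hull.mem_set hk'
    simp only [he] at h2
    have h3 := h1.2
    have h4 := h2.1
    have h5 : c * (j₀ + (d + 1)) ≤ c * (j₀ + d') := Nat.mul_le_mul_left _ (by omega)
    have h6 : c * (j₀ + (d + 1)) = c * (j₀ + d) + c := by ring
    unfold chunkLen at h3
    omega

/-! ### Bridges and the slope intervals -/

/-- `u` and `v` are the endpoints of an edge of the upper hull of `Z` that crosses the vertical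
line with `x`-value `z`. -/
structure Bridge (x y : ℕ → ℝ) (Z : Set ℕ) (z : ℝ) (u v : ℕ) : Prop where
  up_left : Up x y Z u
  up_right : Up x y Z v
  lt : x u < z
  le : z ≤ x v
  adj : ∀ p, Up x y Z p → x p ≤ x u ∨ x v ≤ x p

/-- The slope of a bridge lies in the interval found for its line. -/
theorem slope_mem_interval {Z : Set ℕ} {z : ℝ} {u v r i : ℕ} {a : ℕ → ℝ} {best : ℕ → ℕ}
    (hfin : Z.Finite) (hx : Z.InjOn x) (hB : Bridge x y Z z u v)
    (hbest : ∀ i < r, best i ∈ Z ∧ ∀ p ∈ Z, Dom x y (a i) p (best i))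
    (hi : FirstIn x best r z i) :
    (0 < i → a (i - 1) < tau x y u v) ∧ (i < r → tau x y u v ≤ a i) := by
  have huv : x u < x v := hB.lt.trans_le hB.le
  have hmax : ∀ p ∈ Z, phi x y (tau x y u v) p ≤ phi x y (tau x y u v) u := fun p hp =>
    phi_le_of_adjacent hfin hx hB.up_left hB.up_right huv hB.adj hp
  have heq := phi_tau (x := x) (y := y) huv
  have key : ∀ (α β : ℝ) (p q : ℕ), phi x y β p - phi x y β q =
      phi x y α p - phi x y α q + (β - α) * (x p - x q) := by
    intro α β p q; unfold phi; ring
  constructor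
  · intro h0
    have hir := hi.1
    have h1 := hi.2.1 (i - 1) (by omega)
    obtain ⟨hq, hdom⟩ := hbest (i - 1) (by omega)
    -- Suppose the bridge's negated slope is at most `a (i - 1)`. Tilting up to `a (i - 1)` favours
    -- points further to the right, so `v` would beat `best (i - 1)`, which lies to its left, or tie
    -- with it. Both are excluded by the choice of the rightmost extreme point.
    by_contra hle
    have h2 := key (tau x y u v) (a (i - 1)) v (best (i - 1))
    have h3 := hmax _ hq
    have h4 : 0 ≤ (a (i - 1) - tau x y u v) * (x v - x (best (i - 1))) :=
      mul_nonneg (by linarith) (by linarith [hB.le])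
    rcases hdom v hB.up_right.1 with h5 | ⟨h5, h6⟩
    · linarith
    · linarith [hB.le]
  · intro hr
    have h1 := hi.2.2 hr
    obtain ⟨hq, hdom⟩ := hbest i hr
    by_contra hle
    have h2 := key (tau x y u v) (a i) u (best i)
    have h3 := hmax _ hq
    have h4 : 0 < (tau x y u v - a i) * (x (best i) - x u) :=
      mul_pos (by linarith) (by linarith [hB.lt])
    rcases hdom u hB.up_left.1 with h5 | ⟨h5, h6⟩
    · nlinarith
    · nlinarith

/-- Vertices of the upper hull that are extreme in a direction of the `i`-th interval are found. -/
theorem mem_collectedAll (S : Setup w n b c x y srt hc hl ta) {j₀ R r i : ℕ} {a : ℕ → ℝ}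
    (hjn : ∀ d < R, c * (j₀ + d) < n) {hot : ℕ → Prop} {p : ℕ} {α : ℝ}
    (hp : Up x y (chunkUnion n c j₀ R) p)
    (hmax : ∀ q ∈ chunkUnion n c j₀ R, phi x y α q ≤ phi x y α p) (hir : i ≤ r)
    (h₁ : 0 < i → a (i - 1) < α) (h₂ : i < r → α ≤ a i) (hhot : hot i) :
    p ∈ collectedAll c ta a r hot hc hl j₀ R := by
  obtain ⟨d, hd, hpd⟩ := exists_chunk S.c_pos hp.1
  have hsub := chunk_subset_chunkUnion hd (hjn d hd)
  have hok := S.chunk_ok _ (hjn d hd)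
  -- A vertex of the union is a vertex of its own chunk. Since it is extreme in the direction `α`,
  -- the slopes of its two edges in the chunk hull enclose `α`.
  obtain ⟨k, hk, hkp⟩ := (hok.hull.mem p).2 (hp.mono hsub hpd)
  simp only [collectedAll, collected, List.mem_flatMap, List.mem_range, List.mem_map,
    List.mem_filter, decide_eq_true_eq]
  refine ⟨d, hd, k, ⟨hk, i, ⟨hir, fun h0 hi => ?_, fun h0 hi => ?_⟩, hhot⟩, hkp⟩
  · have h3 := hok.slope (k - 1) (by omega)
    have h4 := hok.hull.lt (k - 1) (by omega)
    rw [show c * (j₀ + d) + (k - 1) + 1 = c * (j₀ + d) + k by omega] at h3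
    simp only [Nat.sub_add_cancel h0] at h4
    rw [h3, hkp]
    rw [hkp] at h4
    refine le_trans ?_ (h₂ hi)
    refine (phi_le_phi_iff h4).1 (hmax _ (hsub (hok.hull.mem_set (by omega))))
  · have h3 := hok.slope k h0
    have h4 := hok.hull.lt k h0
    simp only [← Nat.add_assoc] at h4
    rw [h3, hkp]
    rw [hkp] at h4
    refine (h₁ hi).trans_le (not_lt.1 fun h5 => ?_)
    have := hmax _ (hsub (hok.hull.mem_set h0))
    simp only [← Nat.add_assoc] at this
    exact absurd ((phi_lt_phi_iff h4).2 h5) (not_lt.2 this)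

/-- The candidates for the endpoints of the bridges: they contain the endpoints of all bridges of
the chunks met by `Q`. -/
theorem candidates_runs {s : State} (S : Setup w n b c x y srt hc hl ta)
    (hs : Static n b c x y srt hc hl ta s) {j₀ R ℓ : ℕ} (h25 : s.reg 25 = j₀)
    (hR : s.reg 26 + 1 = j₀ + R) (h27 : s.reg 27 = R) (hjn : ∀ d < R, c * (j₀ + d) < n)
    (hR0 : 0 < R) (h34 : s.reg 34 = ℓ) (hℓ : ℓ ≤ 4 * b) (hRn : R * (b * b) ≤ n)
    (hmono : ∀ i j, i < j → j < ℓ → x (s.word 11 i) < x (s.word 11 j)) :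
    Runs w program.procs candidatesCmd s
      (2600 * (R * (b * b)) * Nat.clog 2 n + 3000 * (R * c)) fun s' =>
      ∃ N, s'.reg 17 = N ∧ N ≤ 12 * (R * (b * b)) ∧ N ≤ n ∧
        (∀ i j, i < j → j < N → x (s'.word 3 i) < x (s'.word 3 j)) ∧
        (∀ p ∈ seg (s'.word 3) 0 N, p ∈ chunkUnion n c j₀ R) ∧
        ∀ l < ℓ, ∀ u v, Bridge x y (chunkUnion n c j₀ R) (x (s.word 11 l)) u v →
          u ∈ seg (s'.word 3) 0 N ∧ v ∈ seg (s'.word 3) 0 N := by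
  have hbig := S.big
  have hb := S.b_pos
  have hbb := S.bb_le
  have hroom := S.room hjn hR0
  have hN := length_edgeSample_le S hjn
  have hsub : chunkUnion n c j₀ R ⊆ {p | p < n} := fun p hp => hp.2.1
  have hfin : (chunkUnion n c j₀ R).Finite := (Set.finite_lt_nat n).subset hsub
  have hinj : (chunkUnion n c j₀ R).InjOn x := S.inj.mono hsub
  have t1 : R * b ≤ R * c := Nat.mul_le_mul_left _ (by omega)
  have t2 : R * (b * b) ≤ R * c := Nat.mul_le_mul_left _ hbb.1
  have t3 : R ≤ R * b := Nat.le_mul_of_pos_right _ hb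
  have t4 : b * b ≤ R * (b * b) := Nat.le_mul_of_pos_left _ hR0
  have t5 : R * (c + b + 1) = R * c + R * b + R := by ring
  unfold candidatesCmd
  refine runs_seq (edgeSample_runs S hs h25 hR hjn hR0)
    (T₂ := 2600 * (R * (b * b)) * Nat.clog 2 n + 2780 * (R * c)) ?_ (by omega)
  intro s₁ h1 hf1
  set N := (edgeSample b c hl j₀ R).length with hNdef
  have e17 : s₁.reg 17 = N := by rw [hNdef, ← h1, seg_length]
  rw [e17] at h1
  have hlog : 200 * N * Nat.clog 2 N ≤ 200 * (R * (b * b)) * Nat.clog 2 n :=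
    Nat.mul_le_mul (Nat.mul_le_mul_left _ hN) (Nat.clog_mono_right 2 (hN.trans hRn))
  have hsplit : 2600 * (R * (b * b)) * Nat.clog 2 n =
      200 * (R * (b * b)) * Nat.clog 2 n + 2400 * (R * (b * b)) * Nat.clog 2 n := by ring
  refine runs_seq (sort_runs procs_two e17 (by omega))
    (T₂ := 2400 * (R * (b * b)) * Nat.clog 2 n + 2760 * (R * c)) ?_ (by omega)
  rintro s₂ ⟨hp, hsrt⟩ hf2
  rw [h1] at hp
  rw [hf1.real 2 rfl, hs.ta_eq] at hsrt
  have hsrt' : ∀ i j, i < j → j < N → ta (s₂.word 3 i) ≤ ta (s₂.word 3 j) := by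
    have := pairwise_seg.1 hsrt; simpa using this
  refine Runs.wp_seq (T₂ := 2400 * (R * (b * b)) * Nat.clog 2 n + 2750 * (R * c)) ?_
    (by simp [Cmd.worst, WExp.cost]; omega)
  simp only [Cmd.wp, WExp.eval]
  set s₃ := State.setReg s₂ 29 _ with hs₃
  have d17 : s₃.reg 17 = N := by simp [hs₃, hf2.reg 17 rfl, e17]
  have d29 : s₃.reg 29 = R := by simp [hs₃, hf2.reg 27 rfl, hf1.reg 27 rfl, h27]
  have d25 : s₃.reg 25 = j₀ := by simp [hs₃, hf2.reg 25 rfl, hf1.reg 25 rfl, h25]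
  have d26 : s₃.reg 26 = s.reg 26 := by simp [hs₃, hf2.reg 26 rfl, hf1.reg 26 rfl]
  have d34 : s₃.reg 34 = ℓ := by simp [hs₃, hf2.reg 34 rfl, hf1.reg 34 rfl, h34]
  have d3 : s₃.word 3 = s₂.word 3 := by simp [hs₃]
  have d11 : s₃.word 11 = s.word 11 := by simp [hs₃, hf2.word 11 rfl, hf1.word 11 rfl]
  have hst3 : Static n b c x y srt hc hl ta s₃ := by
    have := (hs.frame hf1 rfl rfl rfl rfl rfl rfl rfl rfl rfl).frame hf2 rfl rfl rfl rfl rfl rfl rfl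
      rfl rfl
    exact ⟨by simpa [hs₃] using this.n_eq, by simpa [hs₃] using this.b_eq,
      by simpa [hs₃] using this.c_eq, this.x_eq, this.y_eq, this.ta_eq, this.srt_eq, this.hc_eq,
      this.hl_eq⟩
  clear_value s₃
  refine runs_seq (stride_runs (by norm_num) d17 d29 hR0 (by omega))
    (T₂ := 2400 * (R * (b * b)) * Nat.clog 2 n + 2700 * (R * c)) ?_ (by omega)
  rintro s₄ ⟨hA, hr⟩ hf4
  rw [d3] at hA
  refine Runs.wp_seq (T₂ := 2400 * (R * (b * b)) * Nat.clog 2 n + 2690 * (R * c)) ?_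
    (by simp [Cmd.worst, WExp.cost]; omega)
  simp only [Cmd.wp, WExp.eval]
  set r := s₄.reg 36 with hrdef
  -- The last selected position is `r * R`, which is smaller than `N ≤ R * b ^ 2`.
  have hrb : r ≤ b * b := by
    rcases Nat.eq_zero_or_pos r with h0 | h0
    · omega
    · have := (hr (r - 1)).1 (by omega)
      rw [Nat.sub_add_cancel h0, mul_comm] at this
      exact (Nat.lt_of_mul_lt_mul_left (this.trans_le hN)).le
  set s₅ := State.setReg s₄ 35 _ with hs₅
  have c25 : s₅.reg 25 = j₀ := by simp [hs₅, hf4.reg 25 rfl, d25]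
  have c26 : s₅.reg 26 + 1 = j₀ + R := by simp [hs₅, hf4.reg 26 rfl, d26, hR]
  have c34 : s₅.reg 34 = ℓ := by simp [hs₅, hf4.reg 34 rfl, d34]
  have c35 : s₅.reg 35 = r := by simp [hs₅, hrdef]
  have c12 : s₅.word 12 = s₄.word 12 := by simp [hs₅]
  have c11 : s₅.word 11 = s.word 11 := by simp [hs₅, hf4.word 11 rfl, d11]
  have hst5 : Static n b c x y srt hc hl ta s₅ := by
    have := hst3.frame hf4 rfl rfl rfl rfl rfl rfl rfl rfl rfl
    exact ⟨by simpa [hs₅] using this.n_eq, by simpa [hs₅] using this.b_eq,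
      by simpa [hs₅] using this.c_eq, this.x_eq, this.y_eq, this.ta_eq, this.srt_eq, this.hc_eq,
      this.hl_eq⟩
  clear_value s₅
  set a : ℕ → ℝ := fun i => ta (s₄.word 12 i) with ha
  have ha' : ∀ i < r, a i = ta (s₂.word 3 ((i + 1) * R)) := fun i hi => by rw [ha]; simp only; rw [hA i hi]
  have hamono : ∀ i j, i ≤ j → j < r → a i ≤ a j := by
    intro i j hij hj
    rcases hij.eq_or_lt with rfl | hlt
    · exact le_rfl
    · rw [ha' i (by omega), ha' j hj]
      exact hsrt' _ _ (Nat.mul_lt_mul_of_pos_right (by omega) hR0) ((hr j).1 hj)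
  have hcj : c * j₀ < n := hjn 0 hR0
  refine runs_seq (initBest_runs S hst5 c25 c35 hcj hrb)
    (T₂ := 2400 * (R * (b * b)) * Nat.clog 2 n + 2590 * (R * c)) ?_ (by omega)
  intro s₆ hinit hf6
  have hst6 := hst5.frame hf6 rfl rfl rfl rfl rfl rfl rfl rfl rfl
  have hpos0 : 0 < hl (j₀ + 0) := (S.chunk_ok _ (hjn 0 hR0)).hl_pos S.inj S.c_pos (hjn 0 hR0)
  have hinit' : hc (c * j₀) ∈ chunkUnion n c j₀ R :=
    chunk_subset_chunkUnion hR0 (hjn 0 hR0) ((S.chunk_ok _ (hjn 0 hR0)).hull.mem_set hpos0)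
  have t6 : R * (c + r + 1) ≤ 3 * (R * c) := by
    have : R * (c + r + 1) ≤ R * (c + b * b + 1) := Nat.mul_le_mul_left _ (by omega)
    have h' : R * (c + b * b + 1) = R * c + R * (b * b) + R := by ring
    omega
  refine runs_seq (walkBest_runs S hst6 ((hf6.reg 25 rfl).trans c25)
    ((congrArg (· + 1) (hf6.reg 26 rfl)).trans c26) hjn hR0 ((hf6.reg 35 rfl).trans c35) hrb
    (a := a) (fun i => by rw [hf6.word 12 rfl, c12]) (fun i hi => hamono i (i + 1) (by omega) hi)
    (fun i hi => by rw [(hinit i hi.le).1]; exact hinit'))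
    (T₂ := 2400 * (R * (b * b)) * Nat.clog 2 n + 1950 * (R * c)) ?_ (by omega)
  intro s₇ hbest hf7
  have hst7 := hst6.frame hf7 rfl rfl rfl rfl rfl rfl rfl rfl rfl
  have b11 : s₇.word 11 = s.word 11 := ((hf7.word 11 rfl).trans (hf6.word 11 rfl)).trans c11
  refine runs_seq (hot_runs ((hf7.reg 34 rfl).trans ((hf6.reg 34 rfl).trans c34))
    ((hf7.reg 35 rfl).trans ((hf6.reg 35 rfl).trans c35)) (by omega) hst7.x_eq
    (fun i hi => by rw [hf7.word 14 rfl]; exact (hinit i hi).2) (by rw [b11]; exact hmono))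
    (T₂ := 2400 * (R * (b * b)) * Nat.clog 2 n + 1600 * (R * c)) ?_ (by omega)
  rintro s₈ ⟨g, hg, hhot⟩ hf8
  rw [b11] at hg
  have hst8 := hst7.frame hf8 rfl rfl rfl rfl rfl rfl rfl rfl rfl
  set hot : ℕ → Prop := fun i => ∃ l < ℓ, g l = i with hhotdef
  refine runs_seq (collect_runs S hst8
    ((hf8.reg 25 rfl).trans ((hf7.reg 25 rfl).trans ((hf6.reg 25 rfl).trans c25)))
    ((congrArg (· + 1) ((hf8.reg 26 rfl).trans ((hf7.reg 26 rfl).trans (hf6.reg 26 rfl)))).trans c26)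
    hjn hR0 ((hf8.reg 35 rfl).trans ((hf7.reg 35 rfl).trans ((hf6.reg 35 rfl).trans c35))) hrb
    (a := a) (fun i => by rw [hf8.word 12 rfl, hf7.word 12 rfl, hf6.word 12 rfl, c12]) hamono
    (hot := hot) hhot)
    (T₂ := 2400 * (R * (b * b)) * Nat.clog 2 n + 900 * (R * c)) ?_ (by omega)
  intro s₉ hZ hf9
  set Z := collectedAll c ta a r hot hc hl j₀ R with hZdef
  have hZlen : s₉.reg 17 = Z.length := by rw [← hZ, seg_length]
  rw [hZlen] at hZ
  have hZnd : Z.Nodup := nodup_collectedAll S hjn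
  have hZsub : ∀ p ∈ Z, p ∈ chunkUnion n c j₀ R := fun p hp => mem_collectedAll_subset S hjn hp
  have hZn : Z.length ≤ n := by
    rw [← List.toFinset_card_of_nodup hZnd]
    refine (Finset.card_le_card (t := Finset.range n) fun p hp => ?_).trans (by simp)
    exact Finset.mem_range.2 (hZsub p (by simpa using hp)).2.1
  have hZb : Z.length ≤ 12 * (R * (b * b)) := by
    have h1 := length_collectedAll_le (hc := hc) S hjn hp hsrt' ha' hr (fun l hl => (hg l hl).1)
      (hot := hot) fun i _ => Iff.rfl
    refine h1.trans ((Nat.mul_le_mul_right _ hℓ).trans (le_of_eq ?_))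
    ring
  have hlog2 : 200 * Z.length * Nat.clog 2 Z.length ≤ 2400 * (R * (b * b)) * Nat.clog 2 n :=
    Nat.mul_le_mul (by omega) (Nat.clog_mono_right 2 hZn)
  refine (runs_frame (sortX_runs hZlen (by omega) (((hf9.real 0 rfl)).trans hst8.x_eq)
    (by rw [hZ]; exact hZnd) (by rw [hZ]; exact hinj.mono hZsub))).mono (by omega) ?_
  rintro s' ⟨⟨hperm, hsorted⟩, hf⟩
  rw [hZ] at hperm
  refine ⟨Z.length, (hf.reg 17 rfl).trans hZlen, hZb, hZn, hsorted,
    fun p hp => hZsub p (hperm.subset hp), fun l hl u v hB => ?_⟩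
  have hslope := slope_mem_interval hfin hinj hB hbest
    (hg l hl)
  have huv : x u < x v := hB.lt.trans_le hB.le
  have hmax : ∀ p ∈ chunkUnion n c j₀ R, phi x y (tau x y u v) p ≤ phi x y (tau x y u v) u :=
    fun p hp => phi_le_of_adjacent hfin hinj hB.up_left hB.up_right huv hB.adj hp
  have heq := phi_tau (x := x) (y := y) huv
  refine ⟨hperm.symm.subset (mem_collectedAll S hjn hB.up_left hmax (hg l hl).1 hslope.1 hslope.2
    ⟨l, hl, rfl⟩), hperm.symm.subset (mem_collectedAll S hjn hB.up_right (fun q hq => ?_)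
    (hg l hl).1 hslope.1 hslope.2 ⟨l, hl, rfl⟩)⟩
  rw [← heq]; exact hmax q hq

end

/-! ### Reading off the bridges and distributing the safe points -/

/-- A simultaneous walk along the sorted lines and the hull. A hull vertex strictly left of each
line ensures that the found right endpoint has a predecessor. -/
theorem lookup_runs {s : State} {ℓ h : ℕ} (h34 : s.reg 34 = ℓ) (hw : ℓ + h + 2 < 2 ^ w)
    {x : ℕ → ℝ} (hx : s.real 0 = x)
    (hmono : ∀ i j, i < j → j < ℓ → x (s.word 11 i) < x (s.word 11 j))
    (hf : ∀ k, k + 1 < h → x (s.word 6 k) < x (s.word 6 (k + 1)))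
    (hleft : ∀ l < ℓ, ∃ k < h, x (s.word 6 k) < x (s.word 11 l))
    (hright : ∀ l < ℓ, ∃ k < h, x (s.word 11 l) ≤ x (s.word 6 k)) :
    Runs w program.procs lookupCmd s (60 * (ℓ + h) + 30) fun s' =>
      ∀ l < ℓ, ∃ k, k + 1 < h ∧ s'.word 15 l = s.word 6 k ∧ s'.word 16 l = s.word 6 (k + 1) ∧
        x (s.word 6 k) < x (s.word 11 l) ∧ x (s.word 11 l) ≤ x (s.word 6 (k + 1)) := by
  unfold lookupCmd
  refine Runs.wp_seq (T₂ := 60 * (ℓ + h) + 20) ?_ (by simp [Cmd.worst, WExp.cost]; omega)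
  simp only [Cmd.wp]
  refine runs_loop (fun T s' => ∃ l k, s'.reg 40 = l ∧ s'.reg 41 = k ∧ l ≤ ℓ ∧ k ≤ h ∧
    T = 60 * (ℓ + h - l - k) + 20 ∧
    (l < ℓ → ∀ k' < k, x (s.word 6 k') < x (s.word 11 l)) ∧
    ∀ l' < l, ∃ k, k + 1 < h ∧ s'.word 15 l' = s.word 6 k ∧ s'.word 16 l' = s.word 6 (k + 1) ∧
        x (s.word 6 k) < x (s.word 11 l') ∧ x (s.word 11 l') ≤ x (s.word 6 (k + 1)))
    ⟨0, 0, by simp [WExp.eval]⟩ ?_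
  rintro T s' hfr ⟨l, k, h40, h41, hl, hk, rfl, hlt, hdone⟩
  have h6 : s'.word 6 = s.word 6 := (hfr.word 6 rfl).trans (by simp)
  have h11 : s'.word 11 = s.word 11 := (hfr.word 11 rfl).trans (by simp)
  have e34 : s'.reg 34 = ℓ := (hfr.reg 34 rfl).trans (by simpa using h34)
  have hx' : s'.real 0 = x := (hfr.real 0 rfl).trans (by simpa using hx)
  have hm1 : 1 % 2 ^ w = 1 := Nat.mod_eq_of_lt (by omega)
  have hm2 : (l + 1) % 2 ^ w = l + 1 := Nat.mod_eq_of_lt (by omega)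
  have hm3 : (k + 1) % 2 ^ w = k + 1 := Nat.mod_eq_of_lt (by omega)
  simp only [Test.Holds, WExp.eval, h40, e34]
  refine ⟨fun hb => ?_, fun hb => ?_⟩
  swap
  · obtain rfl : l = ℓ := by omega
    exact ⟨by simp [Test.cost, WExp.cost], hdone⟩
  have hkh : k < h := by
    obtain ⟨k', hk', hle⟩ := hright l hb
    by_contra hc
    exact absurd (hlt hb k' (by omega)) (not_lt.2 hle)
  by_cases hinc : x (s.word 6 k) < x (s.word 11 l)
  · refine ⟨_, 60 * (ℓ + h - l - (k + 1)) + 20, ?_, Runs.of_wp ?_⟩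
    · simp [Cmd.worst, WExp.cost, Test.cost, RExp.cost]; omega
    simp only [Cmd.wp, Test.Holds, WExp.eval, RExp.eval, h40, h41, hx', h6, h11, hinc, hm1, hm3,
      not_true, true_imp_iff, false_imp_iff, and_true]
    refine ⟨l, k + 1, by simp [h40], by simp, hl, hkh, rfl, fun h k' hk' => ?_, hdone⟩
    rcases eq_or_ne k' k with rfl | hne
    · exact hinc
    · exact hlt h k' (by omega)
  · have hk0 : k ≠ 0 := by
      rintro rfl
      obtain ⟨k', hk', hlt'⟩ := hleft l hb
      rcases Nat.eq_zero_or_pos k' with rfl | h0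
      · exact hinc hlt'
      · exact hinc ((lt_of_chain hf h0 hk').trans hlt')
    refine ⟨_, 60 * (ℓ + h - (l + 1) - k) + 20, ?_, Runs.of_wp ?_⟩
    · simp [Cmd.worst, WExp.cost, Test.cost, RExp.cost]; omega
    simp only [Cmd.wp, Test.Holds, WExp.eval, RExp.eval, h40, h41, hx', h6, h11, hinc, hm1,
      not_false_iff, true_imp_iff, false_imp_iff, true_and]
    refine ⟨l + 1, k, by simp [h40, hm2], by simp [h41], hb, hk, rfl,
      fun h k' hk' => (hlt hb k' hk').trans (hmono l (l + 1) (by omega) h), fun l' hl' => ?_⟩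
    rcases eq_or_ne l' l with rfl | hne
    · refine ⟨k - 1, by omega, by simp [h40, h41, h6], by
        simp [h40, h41, h6, Nat.sub_add_cancel (Nat.pos_of_ne_zero hk0)], hlt hb _ (by omega), ?_⟩
      rw [Nat.sub_add_cancel (by omega)]; exact not_lt.1 hinc
    · obtain ⟨k', h1, h2, h3, h4⟩ := hdone l' (by omega)
      exact ⟨k', h1, by simp [h40, hne, h2], by simp [h40, hne, h3], h4⟩

/-- The condition for the point `p` to be safe in slab `i`, where the endpoints of the bridges
across the lines are `U 0, …, U (ℓ - 1)` and `V 0, …, V (ℓ - 1)`. -/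
def SafeIn (x : ℕ → ℝ) (U V : ℕ → ℕ) (ℓ i p : ℕ) : Prop :=
  (0 < i → V (i - 1) ≤ p ∧ x (V (i - 1)) ≤ x p) ∧ (i < ℓ → p ≤ U i ∧ x p ≤ x (U i))

open Classical in
/-- The safe points of slab `i`. -/
noncomputable def block (x : ℕ → ℝ) (U V : ℕ → ℕ) (ℓ : ℕ) (Q : List ℕ) (i : ℕ) : List ℕ :=
  Q.filter fun p => decide (SafeIn x U V ℓ i p)

/-- The number of safe points of the first `i` slabs. -/
noncomputable def offset (x : ℕ → ℝ) (U V : ℕ → ℕ) (ℓ : ℕ) (Q : List ℕ) (i : ℕ) : ℕ :=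
  ((List.range i).flatMap (block x U V ℓ Q)).length

theorem offset_succ (x : ℕ → ℝ) (U V : ℕ → ℕ) (ℓ : ℕ) (Q : List ℕ) (i : ℕ) :
    offset x U V ℓ Q (i + 1) = offset x U V ℓ Q i + (block x U V ℓ Q i).length := by
  simp [offset, List.range_succ]

theorem offset_mono (x : ℕ → ℝ) (U V : ℕ → ℕ) (ℓ : ℕ) (Q : List ℕ) :
    Monotone (offset x U V ℓ Q) :=
  monotone_nat_of_le_succ fun i => by rw [offset_succ]; omega

/-- Once the concatenation of all blocks is known to be in the array, this extracts a single block.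
-/
theorem seg_middle {f : ℕ → ℕ} {lo : ℕ} {A B C : List ℕ}
    (h : seg f lo (A ++ B ++ C).length = A ++ B ++ C) : seg f (lo + A.length) B.length = B := by
  rw [List.length_append, List.length_append, seg_add, seg_add] at h
  exact (List.append_inj (List.append_inj h (by simp)).1 (by simp)).2

open Classical in
/-- The state of `distributeCmd` in slab `i` after `k` points. -/
structure DistInv (x : ℕ → ℝ) (U V : ℕ → ℕ) (ℓ : ℕ) (Q : List ℕ) (s₀ : State) (i k : ℕ)
    (s : State) : Prop where
  reg_i : s.reg 40 = i
  reg_k : s.reg 41 = s₀.reg 0 + k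
  i_le : i ≤ ℓ + 1
  k_le : k ≤ Q.length
  done : i = ℓ + 1 → k = Q.length
  write : ∃ e ≤ k, s.reg 43 = s₀.reg 0 + e ∧ seg (s.word 0) (s₀.reg 0) e =
    (List.range i).flatMap (block x U V ℓ Q) ++
      if i = ℓ + 1 then [] else (Q.take k).filter fun p => decide (SafeIn x U V ℓ i p)
  rest : ∀ k' (h : k' < Q.length), k ≤ k' → s.word 0 (s₀.reg 0 + k') = Q[k']
  out : ∀ j, j < s₀.reg 0 ∨ s₀.reg 0 + Q.length ≤ j → s.word 0 j = s₀.word 0 j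
  stack : ∀ i' ≤ i, s.word 2 (s₀.reg 8 + i') = s₀.reg 0 + offset x U V ℓ Q i'
  stack_lt : ∀ j < s₀.reg 8, s.word 2 j = s₀.word 2 j
  taken : i < ℓ → ∀ p ∈ Q.take k, p < V i
  untaken : 0 < i → i ≤ ℓ → ∀ k' (h : k' < Q.length), k ≤ k' → V (i - 1) ≤ Q[k']

/-- One pass in index order suffices, without any search: since `U l < V l` and the `V l` are weakly
increasing, a point with index in `[V (i - 1), V i)` can only be safe in slab `i`. Each point is
kept at most once, so the write position never overtakes the read position and the blocks may
overwrite the argument in place. Membership in the slab need not be tested; the bounds by the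
endpoints of the bridges imply it. -/
theorem distribute_runs {n : ℕ} {s : State} {Q : List ℕ} (hQ : Arg n Q s) {ℓ : ℕ}
    (h34 : s.reg 34 = ℓ) (hw : n + s.reg 8 + ℓ + 5 < 2 ^ w) {x : ℕ → ℝ} (hx : s.real 0 = x)
    {U V : ℕ → ℕ} (hU : s.word 15 = U) (hV : s.word 16 = V) (hUV : ∀ l < ℓ, U l < V l)
    (hVV : ∀ l, l + 1 < ℓ → V l ≤ V (l + 1)) :
    Runs w program.procs distributeCmd s (100 * (Q.length + ℓ + 1) + 60) fun s' =>
      s.reg 0 + offset x U V ℓ Q (ℓ + 1) ≤ s.reg 0 + Q.length ∧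
      (∀ i ≤ ℓ, seg (s'.word 0) (s.reg 0 + offset x U V ℓ Q i) (block x U V ℓ Q i).length =
        block x U V ℓ Q i) ∧
      (∀ j, j < s.reg 0 ∨ s.reg 0 + Q.length ≤ j → s'.word 0 j = s.word 0 j) ∧
      (∀ i ≤ ℓ + 1, s'.word 2 (s.reg 8 + i) = s.reg 0 + offset x U V ℓ Q i) ∧
      ∀ j < s.reg 8, s'.word 2 j = s.word 2 j := by
  classical
  have hpos := hQ.pos
  have hget : ∀ k (h : k < Q.length), s.word 0 (s.reg 0 + k) = Q[k] := by
    intro k h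
    have := seg_getElem (s.word 0) (s.reg 0) Q.length k (by simpa using h)
    rw [← this]; congr 1; exact hQ.eq
  set m := Q.length with hm
  unfold distributeCmd
  refine Runs.wp_seq (T₂ := 100 * (m + ℓ + 1) + 20) ?_ (by simp [Cmd.worst, WExp.cost]; omega)
  simp only [Cmd.wp]
  have hm1 : 1 % 2 ^ w = 1 := Nat.mod_eq_of_lt (by omega)
  have hm0 : 0 % 2 ^ w = 0 := Nat.zero_mod _
  have hm2 : (s.reg 0 + m) % 2 ^ w = s.reg 0 + m := Nat.mod_eq_of_lt (by omega)
  have hm3 : (ℓ + 1) % 2 ^ w = ℓ + 1 := Nat.mod_eq_of_lt (by omega)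
  refine runs_loop (fun T s' => ∃ i k, DistInv x U V ℓ Q s i k s' ∧
    T = 100 * (m + ℓ + 1 - i - k) + 20) ⟨0, 0, ⟨?_, ?_, by omega, by omega, by omega,
      ⟨0, le_rfl, ?_⟩, ?_, ?_, ?_, ?_, by simp, by omega⟩, by simp⟩ ?_
  · simp [WExp.eval]
  · simp [WExp.eval]
  · simp [WExp.eval]
  · intro k' hk' _; simpa [WExp.eval] using hget k' hk'
  · simp [WExp.eval]
  · simp [WExp.eval, offset]
  · intro j hj; simp [WExp.eval, hj.ne]
  rintro T s' hf ⟨i, k, hI, rfl⟩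
  obtain ⟨h40, h41, hi, hk, hdone, ⟨e, hek, h43, hseg⟩, hrest, hout, hstack, hslt, htaken, hunt⟩ := id hI
  have h34' : s'.reg 34 = ℓ := (hf.reg 34 rfl).trans (by simpa using h34)
  have h42 : s'.reg 42 = s.reg 0 + m := (hf.reg 42 rfl).trans (by simp [WExp.eval, hQ.len, hm2, ← hm])
  have h8 : s'.reg 8 = s.reg 8 := (hf.reg 8 rfl).trans (by simp)
  have h15 : s'.word 15 = U := (hf.word 15 rfl).trans (by simpa using hU)
  have h16 : s'.word 16 = V := (hf.word 16 rfl).trans (by simpa using hV)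
  have hx' : s'.real 0 = x := (hf.real 0 rfl).trans (by simpa using hx)
  simp only [Test.Holds, WExp.eval, h40, h34', hm1, hm3]
  refine ⟨fun hb => ?_, fun hb => ?_⟩
  swap
  · obtain rfl : i = ℓ + 1 := by omega
    refine ⟨by simp [Test.cost, WExp.cost], ?_⟩
    rw [if_pos rfl, List.append_nil] at hseg
    have he : e = offset x U V ℓ Q (ℓ + 1) := by
      rw [offset, ← hseg, seg_length]
    refine ⟨by omega, fun i hi => ?_, hout, hstack, hslt⟩
    obtain ⟨d, hd⟩ := Nat.exists_eq_add_of_le (show i + 1 ≤ ℓ + 1 by omega)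
    have hsplit : (List.range (ℓ + 1)).flatMap (block x U V ℓ Q) =
        (List.range i).flatMap (block x U V ℓ Q) ++ block x U V ℓ Q i ++
          ((List.range d).map (i + 1 + ·)).flatMap (block x U V ℓ Q) := by
      rw [hd, List.range_add, List.flatMap_append, List.range_succ, List.flatMap_append]
      simp
    rw [he, offset, hsplit] at hseg
    exact seg_middle hseg
  have hbi : i ≤ ℓ := by omega
  have hne : i ≠ ℓ + 1 := by omega
  rw [if_neg hne] at hseg
  -- The default of `Q[k]!` plays no role, since it is read under `k < m` only.
  by_cases htake : k < m ∧ (i = ℓ ∨ Q[k]! < V i)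
  · obtain ⟨hkm, htk⟩ := htake
    have hq : Q[k]! = Q[k] := getElem!_pos Q k hkm
    rw [hq] at htk
    set p := Q[k] with hp
    have hpw : s'.word 0 (s.reg 0 + k) = p := hrest k hkm le_rfl
    have htake1 : Q.take (k + 1) = Q.take k ++ [p] := by rw [List.take_succ_eq_append_getElem hkm]
    have hm4 : (s.reg 0 + k + 1) % 2 ^ w = s.reg 0 + (k + 1) := Nat.mod_eq_of_lt (by omega)
    have hm5 : (s.reg 0 + e + 1) % 2 ^ w = s.reg 0 + (e + 1) := Nat.mod_eq_of_lt (by omega)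
    refine ⟨_, 100 * (m + ℓ + 1 - i - (k + 1)) + 20, ?_, Runs.of_wp ?_⟩
    · simp [Cmd.worst, WExp.cost, Test.cost, RExp.cost]; omega
    have hVp : 0 < i → V (i - 1) ≤ p := fun h0 => hunt h0 hbi k hkm le_rfl
    have htaken' : i < ℓ → ∀ p' ∈ Q.take (k + 1), p' < V i := by
      intro h0 p' hp'
      rw [htake1, List.mem_append, List.mem_singleton] at hp'
      rcases hp' with hp' | rfl
      · exact htaken h0 p' hp'
      · exact htk.resolve_left (by omega)
    have hskip : ¬ SafeIn x U V ℓ i p → ∀ s'' : State, s''.reg 40 = i →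
        s''.reg 41 = s.reg 0 + (k + 1) → s''.reg 43 = s.reg 0 + e → s''.word = s'.word →
        ∃ i' k', DistInv x U V ℓ Q s i' k' s'' ∧
          100 * (m + ℓ + 1 - i - (k + 1)) + 20 = 100 * (m + ℓ + 1 - i' - k') + 20 := by
      intro hns s'' e40 e41 e43 ew
      refine ⟨i, k + 1, ⟨e40, e41, hi, by omega, by omega, ⟨e, by omega, e43, ?_⟩, ?_, ?_, ?_, ?_,
        htaken', fun h0 h1 k' hk' hkk => hunt h0 h1 k' hk' (by omega)⟩, rfl⟩
      · rw [ew, hseg, if_neg hne, htake1, List.filter_append]; simp [hns]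
      · rw [ew]; exact fun k' hk' hkk => hrest k' hk' (by omega)
      · rw [ew]; exact hout
      · rw [ew]; exact hstack
      · rw [ew]; exact hslt
    have hwrite : SafeIn x U V ℓ i p → ∀ s'' : State, s''.reg 40 = i →
        s''.reg 41 = s.reg 0 + (k + 1) → s''.reg 43 = s.reg 0 + (e + 1) →
        s''.word 0 = Function.update (s'.word 0) (s.reg 0 + e) p → s''.word 2 = s'.word 2 →
        ∃ i' k', DistInv x U V ℓ Q s i' k' s'' ∧
          100 * (m + ℓ + 1 - i - (k + 1)) + 20 = 100 * (m + ℓ + 1 - i' - k') + 20 := by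
      intro hns s'' e40 e41 e43 ew e2
      refine ⟨i, k + 1, ⟨e40, e41, hi, by omega, by omega, ⟨e + 1, by omega, e43, ?_⟩, ?_, ?_, ?_, ?_,
        htaken', fun h0 h1 k' hk' hkk => hunt h0 h1 k' hk' (by omega)⟩, rfl⟩
      · rw [ew, seg_succ, seg_update_of_not_mem _ (by omega), hseg, if_neg hne, htake1,
          List.filter_append]
        simp [hns]
      · intro k' hk' hkk
        rw [ew, Function.update_of_ne (by omega)]; exact hrest k' hk' (by omega)
      · intro j hj
        rw [ew, Function.update_of_ne (by omega)]; exact hout j hj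
      · rw [e2]; exact hstack
      · rw [e2]; exact hslt
    have hlt42 : s.reg 0 + k < s.reg 0 + m := by omega
    have ew0 : s'.word 0 (s'.reg 41) = p := by rw [h41, hpw]
    have hinner : Cmd.wp w
        (.setReg 44 (.get 0 (.reg 41)) ⨾
    .ite (.wordEq (.reg 40) (.const 0)) (.ite (.wordEq (.reg 40) (.reg 34)) (.setWord 0 (.reg 43) (.reg 44) ⨾ inc 43)
      (.ite (.wordLt (.get 15 (.reg 40)) (.reg 44)) .skip
        (.ite (.realLt (xOf (.get 15 (.reg 40))) (xOf (.reg 44))) .skip (.setWord 0 (.reg 43) (.reg 44) ⨾ inc 43))))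
      (.ite (.realLt (xOf (.reg 44)) (xOf (.get 16 (.sub (.reg 40) (.const 1))))) .skip (.ite (.wordEq (.reg 40) (.reg 34)) (.setWord 0 (.reg 43) (.reg 44) ⨾ inc 43)
      (.ite (.wordLt (.get 15 (.reg 40)) (.reg 44)) .skip
        (.ite (.realLt (xOf (.get 15 (.reg 40))) (xOf (.reg 44))) .skip (.setWord 0 (.reg 43) (.reg 44) ⨾ inc 43))))) ⨾
    inc 41) (fun s'' => ∃ i' k', DistInv x U V ℓ Q s i' k' s'' ∧
          100 * (m + ℓ + 1 - i - (k + 1)) + 20 = 100 * (m + ℓ + 1 - i' - k') + 20) s' := by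
      have W : SafeIn x U V ℓ i p → _ := fun h => hwrite h
        ((((s'.setReg 44 p).setWord 0 (s.reg 0 + e) p).setReg 43 (s.reg 0 + (e + 1))).setReg 41
          (s.reg 0 + (k + 1))) (by simp [h40]) (by simp) (by simp) (by simp) (by simp)
      have K : ¬ SafeIn x U V ℓ i p → _ := fun h => hskip h
        ((s'.setReg 44 p).setReg 41 (s.reg 0 + (k + 1))) (by simp [h40]) (by simp) (by simp [h43])
          (by simp)
      simp (disch := decide) only [Cmd.wp, Test.Holds, WExp.eval, RExp.eval, State.setReg_reg,
        State.setReg_word, State.setReg_real, State.setWord_reg, if_neg, if_true, h40, hpw, h41,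
        h43, h34', hm0, hm1, hm4, hm5, h15, h16, hx']
      refine ⟨fun h0 => ⟨fun h1 => ?_, fun h1 => ⟨fun h2 => ?_, fun h2 => ⟨fun h3 => ?_,
        fun h3 => ?_⟩⟩⟩, fun h0 => ⟨fun h4 => ?_, fun h4 => ⟨fun h1 => ?_, fun h1 => ⟨fun h2 => ?_,
        fun h2 => ⟨fun h3 => ?_, fun h3 => ?_⟩⟩⟩⟩⟩
      · exact W ⟨fun h => by omega, fun h => by omega⟩
      · exact K fun h => absurd (h.2 (by omega)).1 (by omega)
      · exact K fun h => absurd (h.2 (by omega)).2 (not_le.2 h3)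
      · exact W ⟨fun h => by omega, fun h => ⟨by omega, not_lt.1 h3⟩⟩
      · exact K fun h => absurd (h.1 (by omega)).2 (not_le.2 h4)
      · exact W ⟨fun h => ⟨hVp h, not_lt.1 h4⟩, fun h => by omega⟩
      · exact K fun h => absurd (h.2 (by omega)).1 (by omega)
      · exact K fun h => absurd (h.2 (by omega)).2 (not_le.2 h3)
      · exact W ⟨fun h => ⟨hVp h, not_lt.1 h4⟩, fun h => ⟨by omega, not_lt.1 h3⟩⟩
    refine ⟨fun _ => ⟨fun _ => hinner, fun hnl => ⟨fun _ => hinner, fun hnt => ?_⟩⟩, fun hnt => ?_⟩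
    · simp only [Test.Holds, WExp.eval, h40, h34', ew0, h16] at hnl hnt
      exact absurd (htk.resolve_left hnl) hnt
    · simp only [Test.Holds, WExp.eval, h41, h42] at hnt
      omega
  · have hclose : (k = m ∨ i ≠ ℓ) ∧ (k < m → i < ℓ ∧ V i ≤ Q[k]!) := by
      refine ⟨?_, fun h => ?_⟩
      · by_contra h
        exact htake ⟨by omega, Or.inl (by omega)⟩
      · refine ⟨?_, ?_⟩
        · by_contra h'; exact htake ⟨h, Or.inl (by omega)⟩
        · by_contra h'; exact htake ⟨h, Or.inr (by omega)⟩
    have hge : i < ℓ → ∀ k' (h : k' < Q.length), k ≤ k' → V i ≤ Q[k'] := by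
      intro h0 k' hk' hkk
      have hkm : k < m := by omega
      have h1 := (hclose.2 hkm).2
      rw [getElem!_pos Q k hkm] at h1
      rcases hkk.eq_or_lt with rfl | hlt
      · exact h1
      · exact h1.trans (List.pairwise_iff_getElem.1 hQ.sorted k k' hkm hk' hlt).le
    -- When slab `i` is closed, the points not yet read have indices at least `V i > U i`, so none
    -- of them is safe in it.
    have hblock : (Q.take k).filter (fun p => decide (SafeIn x U V ℓ i p)) = block x U V ℓ Q i := by
      suffices hnil : (Q.drop k).filter (fun p => decide (SafeIn x U V ℓ i p)) = [] by
        conv_rhs => rw [block, ← List.take_append_drop k Q, List.filter_append]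
        rw [hnil, List.append_nil]
      rw [List.filter_eq_nil_iff]
      intro p hp
      simp only [decide_eq_true_eq]
      intro hsafe
      obtain ⟨k', hk', rfl⟩ := List.getElem_of_mem hp
      rw [List.length_drop] at hk'
      rw [List.getElem_drop] at hsafe
      have hil : i < ℓ := (hclose.2 (by omega)).1
      have h1 := hge hil (k + k') (by omega) (by omega)
      have h2 := (hsafe.2 hil).1
      have h3 := hUV i hil
      omega
    rw [hblock] at hseg
    have he : e = offset x U V ℓ Q (i + 1) := by
      rw [offset_succ, offset, ← List.length_append, ← hseg, seg_length]
    refine ⟨_, 100 * (m + ℓ + 1 - (i + 1) - k) + 20, ?_, Runs.of_wp ?_⟩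
    · simp [Cmd.worst, WExp.cost, Test.cost, RExp.cost]; omega
    have hm4 : (i + 1) % 2 ^ w = i + 1 := Nat.mod_eq_of_lt (by omega)
    have hm5 : (s.reg 8 + (i + 1)) % 2 ^ w = s.reg 8 + (i + 1) := Nat.mod_eq_of_lt (by omega)
    have hgoal : ∃ i' k', DistInv x U V ℓ Q s i' k'
        ((s'.setReg 40 (i + 1)).setWord 2 (s.reg 8 + (i + 1)) (s.reg 0 + e)) ∧
          100 * (m + ℓ + 1 - (i + 1) - k) + 20 = 100 * (m + ℓ + 1 - i' - k') + 20 := by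
      refine ⟨i + 1, k, ⟨by simp, by simp [h41], by omega, hk, fun h => ?_, ⟨e, hek, by simp [h43], ?_⟩,
        by simpa using hrest, by simpa using hout, fun i' hi' => ?_, fun j hj => ?_,
        fun h0 p hp => ?_, fun _ h1 => ?_⟩, rfl⟩
      · rcases hclose.1 with h1 | h1 <;> omega
      -- Points read before have indices below `V i`, so the block of slab `i + 1` starts empty.
      · have : (if i + 1 = ℓ + 1 then []
            else (Q.take k).filter fun p => decide (SafeIn x U V ℓ (i + 1) p)) = [] := by
          split_ifs with hif
          · rfl
          · rw [List.filter_eq_nil_iff]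
            intro p hp
            simp only [decide_eq_true_eq]
            intro hsafe
            have h1 := (hsafe.1 (by omega)).1
            have h2 := htaken (by omega) p hp
            rw [Nat.add_sub_cancel] at h1
            omega
        rw [this, List.append_nil, List.range_succ, List.flatMap_append]
        simpa using hseg
      · rcases hi'.eq_or_lt with rfl | hlt
        · simp [he]
        · have : s.reg 8 + i' ≠ s.reg 8 + (i + 1) := by omega
          simp [Function.update_of_ne this, hstack i' (by omega)]
      · have : j ≠ s.reg 8 + (i + 1) := by omega
        simp [this, hslt j hj]
      · exact (htaken (by omega) p hp).trans_le (hVV i h0)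
      · rw [Nat.add_sub_cancel]; exact hge (by omega)
    have hend : Cmd.wp w (inc 40 ⨾ .setWord 2 (.add (.reg 8) (.reg 40)) (.reg 43))
        (fun s'' => ∃ i' k', DistInv x U V ℓ Q s i' k' s'' ∧
          100 * (m + ℓ + 1 - (i + 1) - k) + 20 = 100 * (m + ℓ + 1 - i' - k') + 20) s' := by
      simpa (disch := decide) only [Cmd.wp, WExp.eval, State.setReg_reg, if_neg, if_true, h40, h8,
        h43, hm1, hm4, hm5] using hgoal
    refine ⟨fun hkm => ?_, fun _ => hend⟩
    simp only [Test.Holds, WExp.eval, h41, h42] at hkm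
    have hkm' : k < m := by omega
    obtain ⟨hil, hVi⟩ := hclose.2 hkm'
    rw [getElem!_pos Q k hkm'] at hVi
    refine ⟨fun h => ?_, fun _ => ⟨fun h => ?_, fun _ => hend⟩⟩
    · simp only [Test.Holds, WExp.eval, h40, h34'] at h; omega
    · simp only [Test.Holds, WExp.eval, h41, h40, h16, hrest k hkm' le_rfl] at h; omega

/-! ### Bridges of subsets -/

section
variable {x y : ℕ → ℝ} {Z : Set ℕ} {z : ℝ} {u v : ℕ}

/-- A subset that contains both endpoints keeps the edge: a vertex strictly between them would have
to lie above the line through them, which supports the larger set. This carries bridges between all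
points, the union of the chunks, `Q` and the candidates. -/
theorem Bridge.mono (h : Bridge x y Z z u v) (hfin : Z.Finite) (hx : Z.InjOn x) {Z' : Set ℕ}
    (hZ : Z' ⊆ Z) (hu : u ∈ Z') (hv : v ∈ Z') : Bridge x y Z' z u v :=
  ⟨h.up_left.mono hZ hu, h.up_right.mono hZ hv, h.lt, h.le, fun _ hp =>
    adjacent_mono hfin hx h.up_left h.up_right (h.lt.trans_le h.le) h.adj hZ hu hv hp⟩

/-- The half-open convention at the line and the distinct `x`-coordinates make the bridge unique.
Whatever edge the program finds is therefore the one in the definition of the safe set. -/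
theorem Bridge.unique (h : Bridge x y Z z u v) (hx : Z.InjOn x) {u' v' : ℕ}
    (h' : Bridge x y Z z u' v') : u' = u ∧ v' = v := by
  constructor
  · refine hx h'.up_left.1 h.up_left.1 (le_antisymm ?_ ?_)
    · exact (h.adj _ h'.up_left).resolve_right (not_le.2 (h'.lt.trans_le h.le))
    · exact (h'.adj _ h.up_left).resolve_right (not_le.2 (h.lt.trans_le h'.le))
  · refine hx h'.up_right.1 h.up_right.1 (le_antisymm ?_ ?_)
    · exact (h'.adj _ h.up_right).resolve_left (not_le.2 (h'.lt.trans_le h.le))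
    · exact (h.adj _ h'.up_right).resolve_left (not_le.2 (h.lt.trans_le h'.le))

theorem HullArr.bridge {f : ℕ → ℕ} {h k : ℕ} (H : HullArr x y Z f h) (hk : k + 1 < h)
    (h₁ : x (f k) < z) (h₂ : z ≤ x (f (k + 1))) : Bridge x y Z z (f k) (f (k + 1)) := by
  refine ⟨(H.mem _).1 ⟨k, by omega, rfl⟩, (H.mem _).1 ⟨k + 1, hk, rfl⟩, h₁, h₂, fun p hp => ?_⟩
  obtain ⟨i, hi, rfl⟩ := (H.mem p).2 hp
  rcases lt_trichotomy i k with h | rfl | h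
  · exact Or.inl (lt_of_chain H.lt h (by omega)).le
  · exact Or.inl le_rfl
  · rcases (show k + 1 ≤ i by omega).eq_or_lt with rfl | h'
    · exact Or.inr le_rfl
    · exact Or.inr (lt_of_chain H.lt h' hi).le

end

/-! ### The work of a call before its recursive calls -/

/-- What holds before the recursive calls: the lines through the points `ln l` with the bridges
`U l`, `V l`, the safe points of the slabs in consecutive blocks, and the activation record. -/
structure SplitOK (x y : ℕ → ℝ) (b : ℕ) (Q : List ℕ) (ℓ : ℕ) (ln U V : ℕ → ℕ) (s s' : State) :
    Prop where
  lines : LinesOK x b Q ln ℓ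
  bridge : ∀ l < ℓ, Bridge x y {p | p ∈ Q} (x (ln l)) (U l) (V l)
  offset_le : offset x U V ℓ Q (ℓ + 1) ≤ Q.length
  blocks : ∀ i ≤ ℓ, seg (s'.word 0) (s.reg 0 + offset x U V ℓ Q i) (block x U V ℓ Q i).length =
    block x U V ℓ Q i
  out : ∀ j, j < s.reg 0 ∨ s.reg 0 + Q.length ≤ j → s'.word 0 j = s.word 0 j
  bounds : ∀ i ≤ ℓ + 1, s'.word 2 (s.reg 8 + i) = s.reg 0 + offset x U V ℓ Q i
  below : ∀ j < s.reg 8, s'.word 2 j = s.word 2 j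
  sp : s'.reg 8 = s.reg 8 + ℓ + 5
  saved : s'.word 2 (s.reg 8 + ℓ + 2) = s.reg 7
  count : s'.word 2 (s.reg 8 + ℓ + 3) = ℓ + 1
  next : s'.word 2 (s.reg 8 + ℓ + 4) = 0
  unmarked : ∀ p, s'.word 10 p = 0

/-- From the candidates to the activation record. -/
theorem bridges_runs {n b : ℕ} {s : State} {x y : ℕ → ℝ} (hx : s.real 0 = x) (hy : s.real 1 = y)
    (hinj : {p | p < n}.InjOn x) {Q : List ℕ} (hQ : Arg n Q s) {N ℓ : ℕ} (h17 : s.reg 17 = N)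
    (hNn : N ≤ n) (h34 : s.reg 34 = ℓ) (hL : LinesOK x b Q (s.word 11) ℓ)
    (hw : 2 * n + s.reg 8 + ℓ + 10 < 2 ^ w)
    (hsort : ∀ i j, i < j → j < N → x (s.word 3 i) < x (s.word 3 j))
    (hlt : ∀ p ∈ seg (s.word 3) 0 N, p < n)
    (hbr : ∀ l < ℓ, ∃ u v, Bridge x y {p | p ∈ Q} (x (s.word 11 l)) u v ∧
      Bridge x y {p | p ∈ seg (s.word 3) 0 N} (x (s.word 11 l)) u v)
    (hord : ∀ u v, Up x y {p | p ∈ Q} u → Up x y {p | p ∈ Q} v → x u < x v → u < v) :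
    Runs w program.procs (grahamCmd ⨾ lookupCmd ⨾ distributeCmd ⨾ pushCmd) s
      (260 * N + 160 * ℓ + 100 * Q.length + 300) fun s' =>
        ∃ U V, SplitOK x y b Q ℓ (s.word 11) U V s s' := by
  refine runs_seq (graham_runs h17 (by omega) hx hy hsort)
    (T₂ := 60 * N + 160 * ℓ + 100 * Q.length + 280) ?_ (by omega)
  rintro s₁ ⟨hle, H⟩ hf1
  have e11 : s₁.word 11 = s.word 11 := hf1.word 11 rfl
  refine runs_seq (lookup_runs ((hf1.reg 34 rfl).trans h34) (h := s₁.reg 18) (by omega)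
    ((hf1.real 0 rfl).trans hx) (by rw [e11]; exact hL.mono) H.lt ?_ ?_)
    (T₂ := 100 * ℓ + 100 * Q.length + 240) ?_ (by omega)
  · intro l hl
    obtain ⟨u, v, -, hB⟩ := hbr l hl
    obtain ⟨k, hk, hku⟩ := (H.mem u).2 hB.up_left
    exact ⟨k, hk, by rw [hku, e11]; exact hB.lt⟩
  · intro l hl
    obtain ⟨u, v, -, hB⟩ := hbr l hl
    obtain ⟨k, hk, hkv⟩ := (H.mem v).2 hB.up_right
    exact ⟨k, hk, by rw [hkv, e11]; exact hB.le⟩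
  intro s₂ hUV hf2
  have hQinj : {p | p ∈ Q}.InjOn x := hinj.mono fun p hp => hQ.lt p hp
  have hbridge : ∀ l < ℓ, Bridge x y {p | p ∈ Q} (x (s.word 11 l)) (s₂.word 15 l) (s₂.word 16 l) := by
    intro l hl
    obtain ⟨u, v, hB, hB'⟩ := hbr l hl
    obtain ⟨k, hk, h1, h2, h3, h4⟩ := hUV l hl
    rw [e11] at h3 h4
    -- The edge found on the hull of the candidates is the bridge of the candidates, which has the
    -- same endpoints as the bridge of `Q`.
    have := hB'.unique (hinj.mono fun p hp => hlt p hp) (H.bridge hk h3 h4)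
    rw [h1, h2, this.1, this.2]
    exact hB
  have hQ2 : Arg n Q s₂ := (hQ.frame hf1 rfl rfl rfl rfl).frame hf2 rfl rfl rfl rfl
  have e8 : s₂.reg 8 = s.reg 8 := (hf2.reg 8 rfl).trans (hf1.reg 8 rfl)
  have e0 : s₂.reg 0 = s.reg 0 := (hf2.reg 0 rfl).trans (hf1.reg 0 rfl)
  have e7 : s₂.reg 7 = s.reg 7 := (hf2.reg 7 rfl).trans (hf1.reg 7 rfl)
  have e34 : s₂.reg 34 = ℓ := ((hf2.reg 34 rfl).trans (hf1.reg 34 rfl)).trans h34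
  have ew0 : s₂.word 0 = s.word 0 := (hf2.word 0 rfl).trans (hf1.word 0 rfl)
  have ew2 : s₂.word 2 = s.word 2 := (hf2.word 2 rfl).trans (hf1.word 2 rfl)
  refine runs_seq (distribute_runs hQ2 e34 (by omega)
    ((hf2.real 0 rfl).trans ((hf1.real 0 rfl).trans hx)) rfl rfl (fun l hl => ?_) fun l hl => ?_)
    (T₂ := 70) ?_ (by omega)
  · exact hord _ _ (hbridge l hl).up_left (hbridge l hl).up_right
      ((hbridge l hl).lt.trans_le (hbridge l hl).le)
  · have B := hbridge l (by omega)
    have B' := hbridge (l + 1) hl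
    have hz := hL.mono l (l + 1) (by omega) hl
    have hxv := (B.adj _ B'.up_right).resolve_left
      (not_le.2 (B.lt.trans (hz.trans_le B'.le)))
    rcases hxv.eq_or_lt with h | h
    · exact (hQinj B.up_right.1 B'.up_right.1 h).le
    · exact (hord _ _ B.up_right B'.up_right h).le
  rintro s₃ ⟨h1, h2, h3, h4, h5⟩ hf3
  rw [e0] at h1 h2 h3 h4
  rw [e8] at h4 h5
  rw [ew0] at h3
  rw [ew2] at h5
  have d8 : s₃.reg 8 = s.reg 8 := (hf3.reg 8 rfl).trans e8
  have d7 : s₃.reg 7 = s.reg 7 := (hf3.reg 7 rfl).trans e7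
  have d34 : s₃.reg 34 = ℓ := (hf3.reg 34 rfl).trans e34
  refine (Runs.of_wp ?_).mono (by simp [pushCmd, Cmd.worst, WExp.cost]) fun _ h => h
  unfold pushCmd
  simp only [Cmd.wp]
  have m0 : (s.reg 8 + ℓ) % 2 ^ w = s.reg 8 + ℓ := Nat.mod_eq_of_lt (by omega)
  have m1 : 1 % 2 ^ w = 1 := Nat.mod_eq_of_lt (by omega)
  have m2 : 2 % 2 ^ w = 2 := Nat.mod_eq_of_lt (by omega)
  have m3 : 3 % 2 ^ w = 3 := Nat.mod_eq_of_lt (by omega)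
  have m4 : 4 % 2 ^ w = 4 := Nat.mod_eq_of_lt (by omega)
  have m5 : 5 % 2 ^ w = 5 := Nat.mod_eq_of_lt (by omega)
  have k2 : (s.reg 8 + ℓ + 2) % 2 ^ w = s.reg 8 + ℓ + 2 := Nat.mod_eq_of_lt (by omega)
  have k3 : (s.reg 8 + ℓ + 3) % 2 ^ w = s.reg 8 + ℓ + 3 := Nat.mod_eq_of_lt (by omega)
  have k4 : (s.reg 8 + ℓ + 4) % 2 ^ w = s.reg 8 + ℓ + 4 := Nat.mod_eq_of_lt (by omega)
  have k5 : (s.reg 8 + ℓ + 5) % 2 ^ w = s.reg 8 + ℓ + 5 := Nat.mod_eq_of_lt (by omega)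
  have k1 : (ℓ + 1) % 2 ^ w = ℓ + 1 := Nat.mod_eq_of_lt (by omega)
  have hup : ∀ j, j < s.reg 8 + ℓ + 2 → (Function.update (Function.update (Function.update (s₃.word 2)
      (s.reg 8 + ℓ + 2) (s.reg 7)) (s.reg 8 + ℓ + 3) (ℓ + 1)) (s.reg 8 + ℓ + 4) 0) j =
      s₃.word 2 j := by
    intro j hj
    rw [Function.update_of_ne (by omega), Function.update_of_ne (by omega),
      Function.update_of_ne (by omega)]
  simp (disch := decide) only [WExp.eval, State.setWord_reg, d8, d7, d34, m0, m1, m2, m3, m4, m5, k1, k2, k3, k4, k5, Nat.zero_mod]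
  refine ⟨s₂.word 15, s₂.word 16, hL, hbridge, by omega, ?_, ?_, ?_, ?_, ?_, ?_, ?_, ?_, ?_⟩
  · simpa using h2
  · simpa using h3
  · intro i hi
    simp only [State.setReg_word, State.setWord_word, if_true]
    rw [hup _ (by omega)]; exact h4 i hi
  · intro j hj
    simp only [State.setReg_word, State.setWord_word, if_true]
    rw [hup _ (by omega)]; exact h5 j hj
  · simp
  · simp
  · simp
  · simp
  · simpa [hf3.word 10 rfl] using hQ2.unmarked

section
variable {n b c : ℕ} {x y : ℕ → ℝ} {srt hc hl : ℕ → ℕ} {ta : ℕ → ℝ}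

/-- In the dense case every sort involves `O(R * b ^ 2)` items, and every walk is linear in `R * c`.
In the other case `Q` is sorted as a whole, either because it has at most `c` points or because it
has fewer than `2 * R * b ^ 2`; it then serves as its own set of candidates. -/
theorem split_runs {s : State} (S : Setup w n b c x y srt hc hl ta)
    (hs : Static n b c x y srt hc hl ta s) {Q : List ℕ} (hQ : Arg n Q s) (hm : b < Q.length)
    (hlog : Nat.clog 2 n ≤ 2 * b) (hw : 2 * n + s.reg 8 + 4 * b + 10 < 2 ^ w)
    (hbr : ∀ z, (∃ p ∈ Q, x p < z) → (∃ p ∈ Q, z ≤ x p) →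
      ∃ u v, Bridge x y {p | p ∈ Q} z u v ∧ Bridge x y {p | p < n} z u v)
    (hord : ∀ u v, Up x y {p | p ∈ Q} u → Up x y {p | p ∈ Q} v → x u < x v → u < v) :
    ∃ j₀ j₁, Chunks n c Q j₀ j₁ ∧ Runs w program.procs splitCmd s
      (if Q.length ≤ c then 200 * Q.length * Nat.clog 2 Q.length + 2000 * Q.length
        else 18000 * ((j₁ - j₀ + 1) * c)) fun s' =>
        ∃ ℓ ln U V, SplitOK x y b Q ℓ ln U V s s' := by
  obtain ⟨j₀, j₁, hch, hdense⟩ := dense_runs S hs hQ hm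
  refine ⟨j₀, j₁, hch, ?_⟩
  have hb := S.b_pos
  have hbb := S.bb_le
  have hbig := S.big
  have hpos := hQ.pos
  have hspan := hch.length_le_span hQ.nodup
  have hspan' := span_le (n := n) (c := c) hch.le
  set R := j₁ - j₀ + 1 with hRdef
  set m := Q.length with hmdef
  have hR0 : 0 < R := by omega
  have hc3 : c = b * b * b := by rw [S.c_eq]; ring
  have hmlog : Nat.clog 2 m ≤ Nat.clog 2 n := Nat.clog_mono_right 2 (by omega)
  -- The hypothesis `log n ≤ 2 * b` turns a sort of `R * b ^ 2` items into time linear in `R * c`.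
  -- This determines the choice `c = b ^ 3`.
  have hA : R * (b * b) * Nat.clog 2 n ≤ 2 * (R * c) := by
    refine (Nat.mul_le_mul_left _ hlog).trans (le_of_eq ?_)
    rw [hc3]; ring
  unfold splitCmd
  have hbrL : ∀ ln ℓ, LinesOK x b Q ln ℓ → ∀ l < ℓ,
      ∃ u v, Bridge x y {p | p ∈ Q} (x (ln l)) u v ∧ Bridge x y {p | p < n} (x (ln l)) u v :=
    fun ln ℓ hL l hl => hbr _ (hL.left l hl) ⟨_, hL.mem l hl, le_rfl⟩
  by_cases hd : c < m ∧ 2 * (R * (b * b)) ≤ m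
  · rw [if_neg (by omega)]
    have hRn : R * (b * b) ≤ n := by omega
    have t1 : R * (b * b) ≤ R * c := Nat.mul_le_mul_left _ hbb.1
    have t2 : b * b ≤ R * (b * b) := Nat.le_mul_of_pos_left _ hR0
    have t3 : m / b + 1 ≤ 2 * (R * (b * b)) := by
      have h1 : m / b ≤ R * (b * b) := by
        refine Nat.div_le_of_le_mul (hspan.trans (hspan'.trans (le_of_eq ?_)))
        rw [hc3]; ring
      omega
    have t4 : 200 * (m / b + 1) * Nat.clog 2 m ≤ 800 * (R * c) := by
      have : 200 * (m / b + 1) * Nat.clog 2 m ≤ 200 * (2 * (R * (b * b))) * Nat.clog 2 n :=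
        Nat.mul_le_mul (Nat.mul_le_mul_left _ t3) hmlog
      have h' : 200 * (2 * (R * (b * b))) * Nat.clog 2 n = 400 * (R * (b * b) * Nat.clog 2 n) := by
        ring
      omega
    have t5 : 2600 * (R * (b * b)) * Nat.clog 2 n ≤ 5200 * (R * c) := by
      rw [Nat.mul_assoc 2600]; omega
    refine runs_seq hdense (T₂ := 17900 * (R * c)) ?_ (by omega)
    rintro s₁ ⟨h25, h26, h27, h28⟩ hf1
    rw [if_pos hd] at h28
    have hs1 := hs.frame hf1 rfl rfl rfl rfl rfl rfl rfl rfl rfl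
    have hQ1 := hQ.frame hf1 rfl rfl rfl rfl
    refine runs_seq (linesDense_runs S hs1 hQ1 hch h25 h26 h28 hd.2) (T₂ := 16600 * (R * c)) ?_
      (by simp only [← hmdef]; omega)
    rintro s₂ ⟨hL, hmark⟩ hf2
    have hs2 := hs1.frame hf2 rfl rfl rfl rfl rfl rfl rfl rfl rfl
    have hQ2 : Arg n Q s₂ := ⟨(hf2.reg 1 rfl).trans hQ1.len, by
      rw [hf2.word 0 rfl, hf2.reg 0 rfl]; exact hQ1.eq, hQ1.sorted, hQ1.lt, by
      rw [hf2.reg 0 rfl]; exact hQ1.pos, hmark⟩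
    set ℓ := s₂.reg 34 with hℓ
    have hℓb := hL.le
    have d28 : s₂.reg 28 = 1 := (hf2.reg 28 rfl).trans h28
    have hjn : ∀ d < R, c * (j₀ + d) < n := fun d hd =>
      (Nat.mul_le_mul_left c (show j₀ + d ≤ j₁ by have := hch.le; omega)).trans_lt hch.lt
    have d8 : s₂.reg 8 = s.reg 8 := (hf2.reg 8 rfl).trans (hf1.reg 8 rfl)
    have d0 : s₂.reg 0 = s.reg 0 := (hf2.reg 0 rfl).trans (hf1.reg 0 rfl)
    have d7 : s₂.reg 7 = s.reg 7 := (hf2.reg 7 rfl).trans (hf1.reg 7 rfl)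
    have dw0 : s₂.word 0 = s.word 0 := (hf2.word 0 rfl).trans (hf1.word 0 rfl)
    have dw2 : s₂.word 2 = s.word 2 := (hf2.word 2 rfl).trans (hf1.word 2 rfl)
    have hcand := candidates_runs S hs2 ((hf2.reg 25 rfl).trans h25)
      (by rw [hf2.reg 26 rfl, h26]; have := hch.le; omega) ((hf2.reg 27 rfl).trans h27) hjn hR0
      hℓ.symm hℓb hRn hL.mono
    have hite := Runs.ite (w := w) (procs := program.procs) (b := .wordEq (.reg 28) (.const 1))
      (d := .skip) (s := s₂) (fun _ => hcand) fun h => absurd (by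
        rw [Test.Holds, WExp.eval, WExp.eval, d28, Nat.mod_eq_of_lt (by omega)]) h
    refine runs_seq hite (T₂ := 8300 * (R * c)) ?_ (by simp only [Test.cost, WExp.cost]; omega)
    rintro s₃ ⟨N, h17, hN, hNn, hsort, hsub, hcover⟩ hf3
    have e11 : s₃.word 11 = s₂.word 11 := hf3.word 11 rfl
    have e8 : s₃.reg 8 = s.reg 8 := (hf3.reg 8 rfl).trans d8
    have e0 : s₃.reg 0 = s.reg 0 := (hf3.reg 0 rfl).trans d0
    have e7 : s₃.reg 7 = s.reg 7 := (hf3.reg 7 rfl).trans d7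
    have ew0 : s₃.word 0 = s.word 0 := (hf3.word 0 rfl).trans dw0
    have ew2 : s₃.word 2 = s.word 2 := (hf3.word 2 rfl).trans dw2
    have hfinn : {p | p < n}.Finite := Set.finite_lt_nat n
    refine (bridges_runs (y := y) (b := b) ((hf3.real 0 rfl).trans hs2.x_eq) ((hf3.real 1 rfl).trans hs2.y_eq)
      S.inj (hQ2.frame hf3 rfl rfl rfl rfl) h17 hNn ((hf3.reg 34 rfl).trans hℓ.symm)
      (by rw [e11]; exact hL) (by omega) hsort (fun p hp => (hsub p hp).2.1) (fun l hl => ?_)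
      hord).mono (by omega) ?_
    · rw [e11]
      obtain ⟨u, v, h1, h2⟩ := hbrL _ _ hL l hl
      have hsubQ : ∀ p ∈ Q, p ∈ chunkUnion n c j₀ R := by
        intro p hp
        obtain ⟨k1, k2, k3⟩ := hch.mem p hp
        have hle := hch.le
        have : c * (j₀ + R) = c * j₁ + c := by
          rw [show j₀ + R = j₁ + 1 by omega]; ring
        exact ⟨k2, k1, by omega⟩
      have hWn : chunkUnion n c j₀ R ⊆ {p | p < n} := fun p hp => hp.2.1
      -- The candidates need not belong to `Q`, and `Q` need not contain them. The passage is
      -- through the bridge of all points, restricted to the union of the chunks and then to the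
      -- candidates; its endpoints lie in every one of these sets.
      have h3 := h2.mono hfinn S.inj hWn (hsubQ u h1.up_left.1) (hsubQ v h1.up_right.1)
      obtain ⟨h4, h5⟩ := hcover l hl u v h3
      exact ⟨u, v, h1, h2.mono hfinn S.inj (fun p hp => (hsub p hp).2.1) h4 h5⟩
    · rintro s' ⟨U, V, hok⟩
      refine ⟨ℓ, s₃.word 11, U, V, ⟨hok.lines, hok.bridge, hok.offset_le, ?_, ?_, ?_, ?_, ?_, ?_,
        ?_, ?_, hok.unmarked⟩⟩
      · rw [← e0]; exact hok.blocks
      · rw [← e0, ← ew0]; exact hok.out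
      · rw [← e0, ← e8]; exact hok.bounds
      · rw [← e8, ← ew2]; exact hok.below
      · rw [← e8]; exact hok.sp
      · rw [← e8, ← e7]; exact hok.saved
      · rw [← e8]; exact hok.count
      · rw [← e8]; exact hok.next
  · have hT : 200 * m * Nat.clog 2 m + 2000 * m ≤
        if m ≤ c then 200 * m * Nat.clog 2 m + 2000 * m else 18000 * (R * c) := by
      split_ifs with hmc
      · exact le_rfl
      · have h1 : m ≤ 2 * (R * (b * b)) := by
          by_contra h; exact hd ⟨by omega, by omega⟩
        have h2 : 200 * m * Nat.clog 2 m ≤ 200 * (2 * (R * (b * b))) * Nat.clog 2 n :=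
          Nat.mul_le_mul (Nat.mul_le_mul_left _ h1) hmlog
        have h3 : 200 * (2 * (R * (b * b))) * Nat.clog 2 n =
          400 * (R * (b * b) * Nat.clog 2 n) := by ring
        omega
    refine Runs.mono ?_ hT fun _ h => h
    refine runs_seq hdense (T₂ := 200 * m * Nat.clog 2 m + 1970 * m) ?_ (by omega)
    rintro s₁ ⟨h25, h26, h27, h28⟩ hf1
    rw [if_neg hd] at h28
    have hs1 := hs.frame hf1 rfl rfl rfl rfl rfl rfl rfl rfl rfl
    have hQ1 := hQ.frame hf1 rfl rfl rfl rfl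
    refine runs_seq (linesSparse_runs S hs1 hQ1 hm h28) (T₂ := 1820 * m) ?_
      (by simp only [← hmdef]; omega)
    rintro s₂ ⟨hL, hmark, h17, hperm, hsort⟩ hf2
    have hs2 := hs1.frame hf2 rfl rfl rfl rfl rfl rfl rfl rfl rfl
    have hQ2 : Arg n Q s₂ := ⟨(hf2.reg 1 rfl).trans hQ1.len, by
      rw [hf2.word 0 rfl, hf2.reg 0 rfl]; exact hQ1.eq, hQ1.sorted, hQ1.lt, by
      rw [hf2.reg 0 rfl]; exact hQ1.pos, hmark⟩
    set ℓ := s₂.reg 34 with hℓ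
    have hℓb := hL.le
    have d28 : s₂.reg 28 = 0 := (hf2.reg 28 rfl).trans h28
    have d8 : s₂.reg 8 = s.reg 8 := (hf2.reg 8 rfl).trans (hf1.reg 8 rfl)
    have d0 : s₂.reg 0 = s.reg 0 := (hf2.reg 0 rfl).trans (hf1.reg 0 rfl)
    have d7 : s₂.reg 7 = s.reg 7 := (hf2.reg 7 rfl).trans (hf1.reg 7 rfl)
    have dw0 : s₂.word 0 = s.word 0 := (hf2.word 0 rfl).trans (hf1.word 0 rfl)
    have dw2 : s₂.word 2 = s.word 2 := (hf2.word 2 rfl).trans (hf1.word 2 rfl)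
    refine runs_seq (T₁ := 10) (T₂ := 1810 * m) (post₁ := fun s₃ => s₂ = s₃)
      ((Runs.ite (T := 1) (fun h => ?_) fun h => Runs.of_wp (c := .skip) (by exact rfl)).mono
        (by simp [Test.cost, WExp.cost]) fun _ h => h) ?_ (by omega)
    · rw [Test.Holds, WExp.eval, WExp.eval, d28, Nat.mod_eq_of_lt (by omega)] at h
      exact absurd h (by norm_num)
    rintro _ rfl -
    have hset : {p | p ∈ seg (s₂.word 3) 0 m} = {p | p ∈ Q} := by
      ext p; exact hperm.mem_iff
    refine (bridges_runs (y := y) (b := b) hs2.x_eq hs2.y_eq S.inj hQ2 h17 (by omega) hℓ.symm hL (by omega)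
      hsort (fun p hp => hQ.lt p (hperm.subset hp)) (fun l hl => ?_) hord).mono (by omega) ?_
    · obtain ⟨u, v, h1, -⟩ := hbrL _ _ hL l hl
      exact ⟨u, v, h1, by rw [hset]; exact h1⟩
    · rintro s' ⟨U, V, hok⟩
      refine ⟨ℓ, s₂.word 11, U, V, ⟨hok.lines, hok.bridge, hok.offset_le, ?_, ?_, ?_, ?_, ?_, ?_,
        ?_, ?_, hok.unmarked⟩⟩
      · rw [← d0]; exact hok.blocks
      · rw [← d0, ← dw0]; exact hok.out
      · rw [← d0, ← d8]; exact hok.bounds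
      · rw [← d8, ← dw2]; exact hok.below
      · rw [← d8]; exact hok.sp
      · rw [← d8, ← d7]; exact hok.saved
      · rw [← d8]; exact hok.count
      · rw [← d8]; exact hok.next

end

open PlanarHull

/-! ### Existence of bridges -/

section
variable {x y : ℕ → ℝ} {Z : Set ℕ}

/-- The leftmost point is the unique maximum in all sufficiently negative directions. The next lemma
is the mirror image. -/
theorem exists_up_le (hfin : Z.Finite) (hx : Z.InjOn x) {p : ℕ} (hp : p ∈ Z) :
    ∃ u, Up x y Z u ∧ x u ≤ x p := by
  obtain ⟨u, hu, hmin⟩ := Set.exists_min_image Z x hfin ⟨p, hp⟩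
  have hev : ∀ᶠ α in Filter.atBot, ∀ q ∈ Z, q ≠ u → phi x y α q < phi x y α u := by
    rw [Filter.eventually_all_finite hfin]
    intro q hq
    by_cases hqu : q = u
    · exact Filter.Eventually.of_forall fun _ h => (h hqu).elim
    have hlt : x u < x q := lt_of_le_of_ne (hmin q hq) fun e => hqu (hx hu hq e).symm
    filter_upwards [Filter.eventually_lt_atBot (tau x y u q)] with α hα _
    exact (phi_lt_phi_iff' hlt).2 hα
  obtain ⟨α, hα⟩ := hev.exists
  exact ⟨u, ⟨hu, α, hα⟩, hmin p hp⟩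

theorem exists_le_up (hfin : Z.Finite) (hx : Z.InjOn x) {p : ℕ} (hp : p ∈ Z) :
    ∃ v, Up x y Z v ∧ x p ≤ x v := by
  obtain ⟨v, hv, hmax⟩ := Set.exists_max_image Z x hfin ⟨p, hp⟩
  have hev : ∀ᶠ α in Filter.atTop, ∀ q ∈ Z, q ≠ v → phi x y α q < phi x y α v := by
    rw [Filter.eventually_all_finite hfin]
    intro q hq
    by_cases hqu : q = v
    · exact Filter.Eventually.of_forall fun _ h => (h hqu).elim
    have hlt : x q < x v := lt_of_le_of_ne (hmax q hq) fun e => hqu (hx hq hv e)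
    filter_upwards [Filter.eventually_gt_atTop (tau x y q v)] with α hα _
    exact (phi_lt_phi_iff hlt).2 hα
  obtain ⟨α, hα⟩ := hev.exists
  exact ⟨v, ⟨hv, α, hα⟩, hmax p hp⟩

/-- The endpoints are the last vertex to the left of the line and the first vertex on or to the
right of it. -/
theorem exists_bridge (hfin : Z.Finite) {i j : ℕ} {z : ℝ} (hi : Up x y Z i) (hj : Up x y Z j)
    (hiz : x i < z) (hzj : z ≤ x j) : ∃ u v, Bridge x y Z z u v ∧ x i ≤ x u ∧ x v ≤ x j := by
  have hf : {p | Up x y Z p}.Finite := hfin.subset fun p hp => hp.1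
  obtain ⟨u, ⟨hu, huz⟩, humax⟩ := Set.exists_max_image {p | Up x y Z p ∧ x p < z} x
    (hf.subset fun p hp => hp.1) ⟨i, hi, hiz⟩
  obtain ⟨v, ⟨hv, hzv⟩, hvmin⟩ := Set.exists_min_image {p | Up x y Z p ∧ z ≤ x p} x
    (hf.subset fun p hp => hp.1) ⟨j, hj, hzj⟩
  refine ⟨u, v, ⟨hu, hv, huz, hzv, fun p hp => ?_⟩, humax i ⟨hi, hiz⟩, hvmin j ⟨hj, hzj⟩⟩
  rcases lt_or_ge (x p) z with h | h
  · exact Or.inl (humax p ⟨hp, h⟩)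
  · exact Or.inr (hvmin p ⟨hp, h⟩)

end

/-! ### Subsequences that agree with the whole sequence on the upper hull -/

/-- The upper hull of `Q` is a contiguous part of the upper hull of all points. -/
structure Closed (n : ℕ) (x y : ℕ → ℝ) (Q : List ℕ) : Prop where
  lt : ∀ p ∈ Q, p < n
  left : ∀ p ∈ Q, ∃ i ∈ Q, Up x y {p | p < n} i ∧ x i ≤ x p
  right : ∀ p ∈ Q, ∃ j ∈ Q, Up x y {p | p < n} j ∧ x p ≤ x j
  conv : ∀ i ∈ Q, ∀ j ∈ Q, Up x y {p | p < n} i → Up x y {p | p < n} j →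
    ∀ v, Up x y {p | p < n} v → x i ≤ x v → x v ≤ x j → v ∈ Q

section
variable {n b ℓ : ℕ} {x y : ℕ → ℝ} {Q : List ℕ} {ln U V : ℕ → ℕ}

theorem closed_of_mem_iff (hx : {p | p < n}.InjOn x) (hQ : ∀ p, p ∈ Q ↔ p < n) :
    Closed n x y Q := by
  refine ⟨fun p => (hQ p).1, fun p hp => ?_, fun p hp => ?_, fun i _ j _ _ _ v hv _ _ => ?_⟩
  · obtain ⟨u, hu, h⟩ := exists_up_le (y := y) (Set.finite_lt_nat n) hx ((hQ p).1 hp)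
    exact ⟨u, (hQ u).2 hu.1, hu, h⟩
  · obtain ⟨u, hu, h⟩ := exists_le_up (y := y) (Set.finite_lt_nat n) hx ((hQ p).1 hp)
    exact ⟨u, (hQ u).2 hu.1, hu, h⟩
  · exact (hQ v).2 hv.1

/-- Points of `Q` on both sides of the line force global vertices in `Q` on both sides. The
endpoints of the global bridge lie between these two, hence in `Q`, and they remain neighbours
there. -/
theorem Closed.bridge (h : Closed n x y Q) (hx : {p | p < n}.InjOn x) {z : ℝ}
    (h₁ : ∃ p ∈ Q, x p < z) (h₂ : ∃ p ∈ Q, z ≤ x p) :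
    ∃ u v, Bridge x y {p | p ∈ Q} z u v ∧ Bridge x y {p | p < n} z u v := by
  obtain ⟨p, hp, hpz⟩ := h₁
  obtain ⟨q, hq, hqz⟩ := h₂
  obtain ⟨i, hi, hiU, hip⟩ := h.left p hp
  obtain ⟨j, hj, hjU, hqj⟩ := h.right q hq
  obtain ⟨u, v, hB, hu, hv⟩ := exists_bridge (Set.finite_lt_nat n) hiU hjU (hip.trans_lt hpz)
    (hqz.trans hqj)
  have huv := hB.lt.trans_le hB.le
  refine ⟨u, v, hB.mono (Set.finite_lt_nat n) hx (fun p hp => h.lt p hp) ?_ ?_, hB⟩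
  · exact h.conv i hi j hj hiU hjU u hB.up_left hu (huv.le.trans hv)
  · exact h.conv i hi j hj hiU hjU v hB.up_right (hu.trans huv.le) hv

/-- If a vertex `v` of `Q` has a global vertex of `Q` to its left, the bridge of `Q` across the
vertical line through `v` is global and, by the half-open convention, ends in `v`. Otherwise the
global vertex to its left is `v` itself. -/
theorem Closed.up_iff (h : Closed n x y Q) (hx : {p | p < n}.InjOn x) {v : ℕ} :
    Up x y {p | p ∈ Q} v ↔ v ∈ Q ∧ Up x y {p | p < n} v := by
  refine ⟨fun hv => ⟨hv.1, ?_⟩, fun hv => hv.2.mono (fun p hp => h.lt p hp) hv.1⟩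
  obtain ⟨i, hi, hiU, hiv⟩ := h.left v hv.1
  rcases hiv.eq_or_lt with e | hlt
  · rwa [← hx (h.lt i hi) (h.lt v hv.1) e]
  obtain ⟨u, u', hB, hB'⟩ := h.bridge hx ⟨i, hi, hlt⟩ ⟨v, hv.1, le_rfl⟩
  have h1 : x u' ≤ x v := (hB.adj v hv).resolve_left (not_le.2 hB.lt)
  rw [hx (h.lt v hv.1) hB'.up_right.1 (le_antisymm hB.le h1)]
  exact hB'.up_right

theorem mem_block {i p : ℕ} : p ∈ block x U V ℓ Q i ↔ p ∈ Q ∧ SafeIn x U V ℓ i p := by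
  simp [block]

theorem SafeIn.memSlab (hB : ∀ l < ℓ, Bridge x y {p | p ∈ Q} (x (ln l)) (U l) (V l)) {i p : ℕ}
    (hi : i ≤ ℓ) (h : SafeIn x U V ℓ i p) : MemSlab x ln ℓ i p :=
  ⟨fun h0 => (hB (i - 1) (by omega)).le.trans (h.1 h0).2, fun h0 => (h.2 h0).2.trans_lt (hB i h0).lt⟩

/-- Which slab a point lies in. -/
theorem exists_memSlab (x : ℕ → ℝ) (ln : ℕ → ℕ) (ℓ p : ℕ) : ∃ i ≤ ℓ, MemSlab x ln ℓ i p := by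
  classical
  have hex : ∃ i, i < ℓ → x p < x (ln i) := ⟨ℓ, fun h => (lt_irrefl _ h).elim⟩
  refine ⟨Nat.find hex, Nat.find_min' hex fun h => (lt_irrefl _ h).elim, fun h0 => ?_,
    Nat.find_spec hex⟩
  have := Nat.find_min hex (Nat.sub_lt h0 one_pos)
  push Not at this
  exact this.2

/-- The safe set is designed for this: a vertex in the slab is not strictly before the right
endpoint of the left bridge in `x`-order, and the promise transfers this to index order; likewise on
the right. -/
theorem safeIn_of_up (hB : ∀ l < ℓ, Bridge x y {p | p ∈ Q} (x (ln l)) (U l) (V l))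
    (hord : ∀ u v, Up x y {p | p ∈ Q} u → Up x y {p | p ∈ Q} v → x u ≤ x v → u ≤ v) {i p : ℕ}
    (hi : i ≤ ℓ) (hp : Up x y {p | p ∈ Q} p) (h : MemSlab x ln ℓ i p) : SafeIn x U V ℓ i p := by
  refine ⟨fun h0 => ?_, fun h0 => ?_⟩
  · have B := hB (i - 1) (by omega)
    have := (B.adj p hp).resolve_left (not_le.2 (B.lt.trans_le (h.1 h0)))
    exact ⟨hord _ _ B.up_right hp this, this⟩
  · have B := hB i h0
    have := (B.adj p hp).resolve_right (not_le.2 ((h.2 h0).trans_le B.le))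
    exact ⟨hord _ _ hp B.up_left this, this⟩

/-- The promise for subsequences. -/
theorem Closed.ord (h : Closed n x y Q) (hx : {p | p < n}.InjOn x)
    (hpr : ∀ u v, Up x y {p | p < n} u → Up x y {p | p < n} v → x u < x v → u < v) {u v : ℕ}
    (hu : Up x y {p | p ∈ Q} u) (hv : Up x y {p | p ∈ Q} v) (huv : x u ≤ x v) : u ≤ v := by
  rcases huv.eq_or_lt with e | hlt
  · exact (hx (h.lt u hu.1) (h.lt v hv.1) e).le
  · exact (hpr u v ((h.up_iff hx).1 hu).2 ((h.up_iff hx).1 hv).2 hlt).le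

/-- The endpoints `V (i - 1)` and `U i` are global vertices that bound the block on either side; in
the outermost slabs the bounding vertices of `Q` take their place. Both orders agree on vertices, so
every vertex between two vertices of the block satisfies the inequalities in index and in `x`. -/
theorem Closed.block (h : Closed n x y Q) (hx : {p | p < n}.InjOn x)
    (hpr : ∀ u v, Up x y {p | p < n} u → Up x y {p | p < n} v → x u < x v → u < v)
    (hB : ∀ l < ℓ, Bridge x y {p | p ∈ Q} (x (ln l)) (U l) (V l)) {i : ℕ} (hi : i ≤ ℓ) :
    Closed n x y (block x U V ℓ Q i) := by
  refine ⟨fun p hp => h.lt p (mem_block.1 hp).1, fun p hp => ?_, fun p hp => ?_, ?_⟩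
  · obtain ⟨hpQ, hs⟩ := mem_block.1 hp
    rcases Nat.eq_zero_or_pos i with rfl | h0
    · obtain ⟨u, hu, huU, hup⟩ := h.left p hpQ
      have huQ := (h.up_iff hx).2 ⟨hu, huU⟩
      refine ⟨u, mem_block.2 ⟨hu, fun h => absurd h (lt_irrefl _), fun h0 => ?_⟩, huU, hup⟩
      have := hup.trans (hs.2 h0).2
      exact ⟨h.ord hx hpr huQ (hB 0 h0).up_left this, this⟩
    · have B := (hB (i - 1) (by omega)).up_right
      refine ⟨V (i - 1), mem_block.2 ⟨B.1, fun _ => ⟨le_rfl, le_rfl⟩, fun h1 => ?_⟩,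
        ((h.up_iff hx).1 B).2, (hs.1 h0).2⟩
      have := (hs.1 h0).2.trans (hs.2 h1).2
      exact ⟨h.ord hx hpr B (hB i h1).up_left this, this⟩
  · obtain ⟨hpQ, hs⟩ := mem_block.1 hp
    rcases hi.eq_or_lt with rfl | h1
    · obtain ⟨u, hu, huU, hup⟩ := h.right p hpQ
      have huQ := (h.up_iff hx).2 ⟨hu, huU⟩
      refine ⟨u, mem_block.2 ⟨hu, fun h0 => ?_, fun h => absurd h (lt_irrefl _)⟩, huU, hup⟩
      have := (hs.1 h0).2.trans hup
      exact ⟨h.ord hx hpr (hB (i - 1) (by omega)).up_right huQ this, this⟩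
    · have B := (hB i h1).up_left
      refine ⟨U i, mem_block.2 ⟨B.1, fun h0 => ?_, fun _ => ⟨le_rfl, le_rfl⟩⟩,
        ((h.up_iff hx).1 B).2, (hs.2 h1).2⟩
      have := (hs.1 h0).2.trans (hs.2 h1).2
      exact ⟨h.ord hx hpr (hB (i - 1) (by omega)).up_right B this, this⟩
  · intro u hu v hv huU hvU p hp hup hpv
    obtain ⟨huQ, hus⟩ := mem_block.1 hu
    obtain ⟨hvQ, hvs⟩ := mem_block.1 hv
    have hpQ := h.conv u huQ v hvQ huU hvU p hp hup hpv
    have hpU := (h.up_iff hx).2 ⟨hpQ, hp⟩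
    have hoL := h.ord hx hpr ((h.up_iff hx).2 ⟨huQ, huU⟩) hpU hup
    have hoR := h.ord hx hpr hpU ((h.up_iff hx).2 ⟨hvQ, hvU⟩) hpv
    exact mem_block.2 ⟨hpQ, fun h0 => ⟨(hus.1 h0).1.trans hoL, (hus.1 h0).2.trans hup⟩,
      fun h1 => ⟨hoR.trans (hvs.2 h1).1, hpv.trans (hvs.2 h1).2⟩⟩

/-- The vertices of `Q` are those of the blocks. -/
theorem Closed.up_iff_block (h : Closed n x y Q) (hx : {p | p < n}.InjOn x)
    (hpr : ∀ u v, Up x y {p | p < n} u → Up x y {p | p < n} v → x u < x v → u < v)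
    (hB : ∀ l < ℓ, Bridge x y {p | p ∈ Q} (x (ln l)) (U l) (V l)) {p : ℕ} :
    Up x y {p | p ∈ Q} p ↔ ∃ i ≤ ℓ, Up x y {p | p ∈ HullRAM.block x U V ℓ Q i} p := by
  constructor
  · intro hp
    obtain ⟨i, hi, hs⟩ := exists_memSlab x ln ℓ p
    have hp' := (h.up_iff hx).1 hp
    exact ⟨i, hi, ((h.block hx hpr hB hi).up_iff hx).2 ⟨mem_block.2 ⟨hp'.1,
      safeIn_of_up hB (fun u v hu hv => h.ord hx hpr hu hv) hi hp hs⟩, hp'.2⟩⟩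
  · rintro ⟨i, hi, hp⟩
    have hp' := ((h.block hx hpr hB hi).up_iff hx).1 hp
    exact (h.up_iff hx).2 ⟨(mem_block.1 hp'.1).1, hp'.2⟩

theorem lt_of_memSlab (hL : LinesOK x b Q ln ℓ) {i j p q : ℕ} (hij : i < j) (hj : j ≤ ℓ)
    (hp : MemSlab x ln ℓ i p) (hq : MemSlab x ln ℓ j q) : x p < x q := by
  refine (hp.2 (by omega)).trans_le (le_trans ?_ (hq.1 (by omega)))
  rcases (show i ≤ j - 1 by omega).eq_or_lt with e | h
  · rw [← e]
  · exact (hL.mono _ _ h (by omega)).le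

end

/-! ### Upper hulls of point sequences -/

section
variable {n : ℕ} {P : Fin n → ℝ × ℝ}

/-- The points with an index in `Q`, as natural numbers. -/
abbrev idx (Q : List (Fin n)) : List ℕ := Q.map Fin.val

noncomputable abbrev xs (P : Fin n → ℝ × ℝ) : ℕ → ℝ := (init P).real 0

noncomputable abbrev ys (P : Fin n → ℝ × ℝ) : ℕ → ℝ := (init P).real 1

@[simp] theorem xs_val (i : Fin n) : (init P).real 0 i = (P i).1 := by simp [init]

@[simp] theorem ys_val (i : Fin n) : (init P).real 1 i = (P i).2 := by simp [init]

theorem xs_injOn (hP : GeneralPosition P) : {p | p < n}.InjOn (xs P) := by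
  intro p hp q hq h
  have := @hP.1 ⟨p, hp⟩ ⟨q, hq⟩ (by
    have h1 := xs_val (P := P) ⟨p, hp⟩
    have h2 := xs_val (P := P) ⟨q, hq⟩
    simp only at h1 h2
    simpa [h1, h2] using h)
  simpa using this

/-- An open half-plane together with one point of its boundary is convex. Hence a strict supporting
line of a finite set at `q` meets the whole convex hull in `q` only. -/
theorem convex_insert_halfPlane (α : ℝ) (q : ℝ × ℝ) :
    Convex ℝ {r : ℝ × ℝ | r.2 + α * r.1 < q.2 + α * q.1 ∨ r = q} := by
  rw [convex_iff_forall_pos]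
  rintro a ha c hc s t hs ht hst
  have hval : ∀ r : ℝ × ℝ, (r.2 + α * r.1 < q.2 + α * q.1 ∨ r = q) →
      r.2 + α * r.1 ≤ q.2 + α * q.1 := by
    rintro r (h | rfl)
    · exact h.le
    · exact le_rfl
  have e : t = 1 - s := by linarith
  by_cases h : a = q ∧ c = q
  · right; rw [h.1, h.2, Convex.combo_self hst]
  · left
    simp only [Prod.snd_add, Prod.smul_snd, Prod.fst_add, Prod.smul_fst, smul_eq_mul]
    have h1 := hval a ha
    have h2 := hval c hc
    have h3 : a.2 + α * a.1 < q.2 + α * q.1 ∨ c.2 + α * c.1 < q.2 + α * q.1 := by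
      rcases ha with ha | rfl
      · exact Or.inl ha
      · exact Or.inr (hc.resolve_right fun e => h ⟨rfl, e⟩)
    have key : s * (a.2 + α * a.1) + t * (c.2 + α * c.1) < q.2 + α * q.1 := by
      have hq : q.2 + α * q.1 = s * (q.2 + α * q.1) + t * (q.2 + α * q.1) := by rw [e]; ring
      rw [hq]
      rcases h3 with h3 | h3
      · exact add_lt_add_of_lt_of_le (mul_lt_mul_of_pos_left h3 hs) (mul_le_mul_of_nonneg_left h2 ht.le)
      · exact add_lt_add_of_le_of_lt (mul_le_mul_of_nonneg_left h1 hs.le) (mul_lt_mul_of_pos_left h3 ht)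
    linarith

theorem isUpperVertex_of_up {Q : List (Fin n)} {i : Fin n}
    (h : Up (xs P) (ys P) {p | p ∈ idx Q} i) : IsUpperVertex P Q i := by
  obtain ⟨hi, α, hα⟩ := h
  have hiQ : i ∈ Q := (List.mem_map_of_injective Fin.val_injective).1 hi
  have hsub : convexHull ℝ (pts P Q) ⊆
      {r : ℝ × ℝ | r.2 + α * r.1 < (P i).2 + α * (P i).1 ∨ r = P i} := by
    refine convexHull_min ?_ (convex_insert_halfPlane α (P i))
    rintro _ ⟨j, hj, rfl⟩
    by_cases hji : j = i
    · exact Or.inr (by rw [hji])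
    · left
      have := hα j (List.mem_map_of_mem hj) (fun h => hji (Fin.ext h))
      simpa [phi] using this
  have hmem : P i ∈ convexHull ℝ (pts P Q) := subset_convexHull _ _ ⟨i, hiQ, rfl⟩
  refine ⟨⟨hiQ, ?_⟩, fun z hz hmem' => ?_⟩
  · rw [mem_extremePoints]
    refine ⟨hmem, fun a ha c hc hac => ?_⟩
    obtain ⟨s, t, hs, ht, hst, hsum⟩ := hac
    have h1 : s * a.1 + t * c.1 = (P i).1 := by simpa using congrArg Prod.fst hsum
    have h2 : s * a.2 + t * c.2 = (P i).2 := by simpa using congrArg Prod.snd hsum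
    have hval : ∀ r ∈ convexHull ℝ (pts P Q), r.2 + α * r.1 ≤ (P i).2 + α * (P i).1 := by
      intro r hr
      rcases hsub hr with h | h
      · exact h.le
      · rw [h]
    have e : (P i).2 + α * (P i).1 = s * (a.2 + α * a.1) + t * (c.2 + α * c.1) := by
      rw [← h1, ← h2]; ring
    have e' : (P i).2 + α * (P i).1 =
        s * ((P i).2 + α * (P i).1) + t * ((P i).2 + α * (P i).1) := by
      rw [← add_mul, hst, one_mul]
    have ha' := mul_le_mul_of_nonneg_left (hval a ha) hs.le
    have hc' := mul_le_mul_of_nonneg_left (hval c hc) ht.le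
    constructor
    · refine (hsub ha).resolve_left fun h => ?_
      have := mul_lt_mul_of_pos_left h hs
      linarith
    · refine (hsub hc).resolve_left fun h => ?_
      have := mul_lt_mul_of_pos_left h ht
      linarith
  · rcases hsub hmem' with h | h
    · simp only at h; linarith
    · have := congrArg Prod.snd h; simp only at this; linarith

/-- A point that is not a vertex in the sense of `Up` lies strictly between the endpoints of a
bridge, in `x`, and on or below it. The point of the bridge at the same `x` is in the convex hull:
if it is higher, the vertex is not upper; if it is the same point, it is not extreme. -/
theorem up_of_isUpperVertex (hP : GeneralPosition P) {Q : List (Fin n)} {i : Fin n}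
    (h : IsUpperVertex P Q i) : Up (xs P) (ys P) {p | p ∈ idx Q} i := by
  by_contra hnot
  have hfin : {p | p ∈ idx Q}.Finite := List.finite_toSet _
  have hlt : ∀ p ∈ idx Q, p < n := by
    intro p hp; obtain ⟨j, -, rfl⟩ := List.mem_map.1 hp; exact j.2
  have hinj : {p | p ∈ idx Q}.InjOn (xs P) := (xs_injOn hP).mono hlt
  have hiQ : (i : ℕ) ∈ idx Q := List.mem_map_of_mem h.1.1
  obtain ⟨a, ha, hai⟩ := exists_up_le (y := ys P) hfin hinj hiQ
  obtain ⟨c, hc, hci⟩ := exists_le_up (y := ys P) hfin hinj hiQ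
  have hne : ∀ a, Up (xs P) (ys P) {p | p ∈ idx Q} a → xs P a ≠ xs P i := fun a ha e =>
    hnot (by rwa [← hinj ha.1 hiQ e])
  obtain ⟨u, v, hB, -, -⟩ := exists_bridge hfin ha hc (lt_of_le_of_ne hai (hne a ha)) hci
  have huv := hB.lt.trans_le hB.le
  have hiv : xs P i < xs P v := lt_of_le_of_ne hB.le (hne v hB.up_right).symm
  have hle := phi_le_of_adjacent hfin hinj hB.up_left hB.up_right huv hB.adj hiQ
  obtain ⟨u', hu', rfl⟩ := List.mem_map.1 hB.up_left.1
  obtain ⟨v', hv', rfl⟩ := List.mem_map.1 hB.up_right.1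
  have heq := phi_tau (y := ys P) huv
  have hui := hB.lt
  set α := tau (xs P) (ys P) u' v' with hα
  simp only [phi, xs_val, ys_val] at hle heq hui hiv huv
  have hmu : P u' ∈ convexHull ℝ (pts P Q) := subset_convexHull _ _ ⟨u', hu', rfl⟩
  have hmv : P v' ∈ convexHull ℝ (pts P Q) := subset_convexHull _ _ ⟨v', hv', rfl⟩
  set D := (P v').1 - (P u').1 with hD
  have hDpos : 0 < D := by linarith
  have hs : 0 < ((P v').1 - (P i).1) / D := div_pos (by linarith) hDpos
  have ht : 0 < ((P i).1 - (P u').1) / D := div_pos (by linarith) hDpos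
  have hst : ((P v').1 - (P i).1) / D + ((P i).1 - (P u').1) / D = 1 := by
    rw [← add_div, div_eq_one_iff_eq hDpos.ne']; ring
  set s := ((P v').1 - (P i).1) / D
  set t := ((P i).1 - (P u').1) / D
  have hsD : s * D = (P v').1 - (P i).1 := by
    simp only [s]; field_simp
  have htD : t * D = (P i).1 - (P u').1 := by
    simp only [t]; field_simp
  have es : s = 1 - t := by linarith
  have hpt : s * (P u').1 + t * (P v').1 = (P i).1 := by
    rw [es, hD] at *
    linear_combination htD
  set z := s * (P u').2 + t * (P v').2 with hz
  have hseg : s • P u' + t • P v' = ((P i).1, z) := by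
    ext
    · simpa using hpt
    · simp [hz]
  have hzmem : ((P i).1, z) ∈ convexHull ℝ (pts P Q) := by
    rw [← hseg]; exact convex_convexHull ℝ _ hmu hmv hs.le ht.le hst
  have hzval : z = (P u').2 + α * (P u').1 - α * (P i).1 := by
    rw [hz, ← hpt, es]
    linear_combination (-t) * heq
  have hge : (P i).2 ≤ z := by linarith
  rcases hge.eq_or_lt with e | hlt'
  · have := (mem_extremePoints.1 h.1.2).2 _ hmu _ hmv ⟨s, t, hs, ht, hst, by rw [hseg, ← e]⟩
    exact hui.ne (congrArg Prod.fst this.1)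
  · exact h.2 z hlt' hzmem

theorem isUpperVertex_iff (hP : GeneralPosition P) {Q : List (Fin n)} {i : Fin n} :
    IsUpperVertex P Q i ↔ Up (xs P) (ys P) {p | p ∈ idx Q} i :=
  ⟨up_of_isUpperVertex hP, isUpperVertex_of_up⟩

theorem idx_lt (Q : List (Fin n)) : ∀ p ∈ idx Q, p < n := by
  intro p hp; obtain ⟨j, -, rfl⟩ := List.mem_map.1 hp; exact j.2

theorem mem_idx_finRange {p : ℕ} : p ∈ idx (List.finRange n) ↔ p < n :=
  ⟨idx_lt _ p, fun h => List.mem_map.2 ⟨⟨p, h⟩, List.mem_finRange _, rfl⟩⟩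

theorem isUpperVertex_finRange_iff (hP : GeneralPosition P) {i : Fin n} :
    IsUpperVertex P (List.finRange n) i ↔ Up (xs P) (ys P) {p | p < n} i := by
  rw [isUpperVertex_iff hP]
  simp only [mem_idx_finRange]

theorem promise_idx (hP : GeneralPosition P) (hpr : UpperHullPromise P) (u v : ℕ)
    (hu : Up (xs P) (ys P) {p | p < n} u) (hv : Up (xs P) (ys P) {p | p < n} v)
    (huv : xs P u < xs P v) : u < v := by
  have := (hpr ⟨u, hu.1⟩ ⟨v, hv.1⟩ ((isUpperVertex_finRange_iff hP).2 hu)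
    ((isUpperVertex_finRange_iff hP).2 hv)).2 (by
      rw [← xs_val (P := P), ← xs_val (P := P)]; exact huv)
  exact this

theorem isBridge_iff (hP : GeneralPosition P) {Q : List (Fin n)} {l : ℝ} {u v : Fin n} :
    IsBridge P Q l u v ↔ Bridge (xs P) (ys P) {p | p ∈ idx Q} l u v := by
  constructor
  · rintro ⟨h1, h2, h3, h4, h5⟩
    refine ⟨(isUpperVertex_iff hP).1 h1, (isUpperVertex_iff hP).1 h2, by simpa using h3,
      by simpa using h4, fun p hp => ?_⟩
    have := h5 ⟨p, idx_lt Q p hp.1⟩ ((isUpperVertex_iff hP).2 hp)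
    rw [← xs_val (P := P), ← xs_val (P := P), ← xs_val (P := P)] at this
    exact this
  · rintro ⟨h1, h2, h3, h4, h5⟩
    refine ⟨(isUpperVertex_iff hP).2 h1, (isUpperVertex_iff hP).2 h2, by simpa using h3,
      by simpa using h4, fun p hp => ?_⟩
    simpa using h5 p ((isUpperVertex_iff hP).1 hp)

/-- The lines through the points `ln 0, …, ln (ℓ - 1)`. -/
noncomputable def lineList (P : Fin n → ℝ × ℝ) (ln : ℕ → ℕ) (ℓ : ℕ) : List ℝ :=
  (List.range ℓ).map fun l => xs P (ln l)

theorem lineList_length (ln : ℕ → ℕ) (ℓ : ℕ) : (lineList P ln ℓ).length = ℓ := by simp [lineList]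

theorem leftLine_lineList {ln : ℕ → ℕ} {ℓ i : ℕ} (hi : i ≤ ℓ) (l : ℝ) :
    leftLine (lineList P ln ℓ) i = some l ↔ 0 < i ∧ xs P (ln (i - 1)) = l := by
  rcases Nat.eq_zero_or_pos i with rfl | h
  · simp [leftLine]
  · rw [leftLine, if_neg h.ne', lineList, List.getElem?_map, List.getElem?_range (by omega)]
    simp [h]

theorem rightLine_lineList {ln : ℕ → ℕ} {ℓ i : ℕ} (hi : i ≤ ℓ) (l : ℝ) :
    rightLine (lineList P ln ℓ) i = some l ↔ i < ℓ ∧ xs P (ln i) = l := by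
  rcases hi.eq_or_lt with rfl | h
  · simp [rightLine, lineList]
  · rw [rightLine, lineList, List.getElem?_map, List.getElem?_range h]
    simp [h]

theorem inSlab_iff {ln : ℕ → ℕ} {ℓ i : ℕ} (hi : i ≤ ℓ) (p : Fin n) :
    InSlab P (lineList P ln ℓ) i p ↔ MemSlab (xs P) ln ℓ i p := by
  simp only [InSlab, leftLine_lineList hi, rightLine_lineList hi, MemSlab, xs_val, and_imp]
  constructor
  · exact fun h => ⟨fun h0 => h.1 _ h0 rfl, fun h0 => h.2 _ h0 rfl⟩
  · rintro ⟨h1, h2⟩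
    exact ⟨fun l h0 e => e ▸ h1 h0, fun l h0 e => e ▸ h2 h0⟩

/-- The definition quantifies over all bridges across a line. As there is exactly one, it may be
replaced by the endpoints in the arrays; membership in the slab is then automatic. -/
theorem isSafe_iff (hP : GeneralPosition P) {Q : List (Fin n)} {ln U V : ℕ → ℕ} {ℓ : ℕ}
    (hB : ∀ l < ℓ, Bridge (xs P) (ys P) {p | p ∈ idx Q} (xs P (ln l)) (U l) (V l)) {i : ℕ}
    (hi : i ≤ ℓ) (p : Fin n) :
    IsSafe P Q (lineList P ln ℓ) i p ↔ SafeIn (xs P) U V ℓ i p := by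
  have hinj : {p | p ∈ idx Q}.InjOn (xs P) := (xs_injOn hP).mono (idx_lt Q)
  constructor
  · rintro ⟨-, h2, h3⟩
    refine ⟨fun h0 => ?_, fun h0 => ?_⟩
    · have B := hB (i - 1) (by omega)
      have := h2 _ ⟨_, idx_lt Q _ B.up_left.1⟩ ⟨_, idx_lt Q _ B.up_right.1⟩
        ((leftLine_lineList hi _).2 ⟨h0, rfl⟩) ((isBridge_iff hP).2 B)
      rw [← xs_val (P := P), ← xs_val (P := P)] at this
      exact this
    · have B := hB i h0
      have := h3 _ ⟨_, idx_lt Q _ B.up_left.1⟩ ⟨_, idx_lt Q _ B.up_right.1⟩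
        ((rightLine_lineList hi _).2 ⟨h0, rfl⟩) ((isBridge_iff hP).2 B)
      rw [← xs_val (P := P), ← xs_val (P := P)] at this
      exact this
  · intro h
    refine ⟨(inSlab_iff hi p).2 (h.memSlab hB hi), fun l u v hl hb => ?_, fun l u v hl hb => ?_⟩
    · obtain ⟨h0, rfl⟩ := (leftLine_lineList hi l).1 hl
      have e := ((hB (i - 1) (by omega)).unique hinj ((isBridge_iff hP).1 hb)).2
      have := h.1 h0
      rw [← e] at this
      exact ⟨this.1, by simpa using this.2⟩
    · obtain ⟨h0, rfl⟩ := (rightLine_lineList hi l).1 hl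
      have e := ((hB i h0).unique hinj ((isBridge_iff hP).1 hb)).1
      have := h.2 h0
      rw [← e] at this
      exact ⟨this.1, by simpa using this.2⟩

theorem idx_safe (hP : GeneralPosition P) {Q : List (Fin n)} {ln U V : ℕ → ℕ} {ℓ : ℕ}
    (hB : ∀ l < ℓ, Bridge (xs P) (ys P) {p | p ∈ idx Q} (xs P (ln l)) (U l) (V l)) {i : ℕ}
    (hi : i ≤ ℓ) : idx (safe P Q (lineList P ln ℓ) i) = block (xs P) U V ℓ (idx Q) i := by
  rw [idx, block, List.filter_map, safe]
  congr 1
  refine List.filter_congr fun p _ => ?_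
  simp only [Function.comp, decide_eq_decide]
  exact isSafe_iff hP hB hi p

/-- The slabs satisfy the required bound with constant `1`; the constant `K = 4` is needed for the
number of lines only. -/
theorem slab_length_le {Q : List (Fin n)} {b ℓ : ℕ} {ln : ℕ → ℕ}
    (hL : LinesOK (xs P) b (idx Q) ln ℓ) {i : ℕ} (hi : i ≤ ℓ) :
    b * (slab P Q (lineList P ln ℓ) i).length ≤ Q.length := by
  classical
  have := hL.slab i hi (fun p => decide (MemSlab (xs P) ln ℓ i p)) (by simp)
  rw [List.length_map, List.countP_map] at this
  refine le_trans (le_of_eq ?_) this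
  rw [slab, List.countP_eq_length_filter]
  congr 2
  refine List.filter_congr fun p _ => ?_
  simp only [Function.comp, decide_eq_decide]
  exact inSlab_iff hi p

theorem lineList_pairwise {Q : List ℕ} {b ℓ : ℕ} {ln : ℕ → ℕ} (hL : LinesOK (xs P) b Q ln ℓ) :
    (lineList P ln ℓ).Pairwise (· < ·) := by
  rw [lineList, List.pairwise_map]
  exact List.pairwise_lt_range.imp_of_mem fun _ hj hij => hL.mono _ _ hij (by simpa using hj)

/-- The hulls of the blocks make up the hull. -/
theorem isUpperHull_flatMap (hP : GeneralPosition P) (hpr : UpperHullPromise P)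
    {Q : List (Fin n)} (hc : Closed n (xs P) (ys P) (idx Q)) {b ℓ : ℕ} {ln U V : ℕ → ℕ}
    (hL : LinesOK (xs P) b (idx Q) ln ℓ)
    (hB : ∀ l < ℓ, Bridge (xs P) (ys P) {p | p ∈ idx Q} (xs P (ln l)) (U l) (V l))
    {H : ℕ → List (Fin n)}
    (hH : ∀ i ≤ ℓ, IsUpperHull P (safe P Q (lineList P ln ℓ) i) (H i)) :
    IsUpperHull P Q ((List.range (ℓ + 1)).flatMap H) := by
  have hinj := xs_injOn hP
  have hmem : ∀ i ≤ ℓ, ∀ p ∈ H i, MemSlab (xs P) ln ℓ i p := by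
    intro i hi p hp
    have := (((hH i hi).2 p).1 hp).1.1
    simp only [safe, List.mem_filter, decide_eq_true_eq] at this
    exact (inSlab_iff hi p).1 this.2.1
  constructor
  · rw [List.pairwise_flatMap]
    refine ⟨fun i hi => (hH i (by simpa [Nat.lt_succ_iff] using hi)).1, ?_⟩
    refine List.pairwise_lt_range.imp_of_mem fun {i j} hi hj hij p hp q hq => ?_
    have hi' : i ≤ ℓ := by simpa [Nat.lt_succ_iff] using hi
    have hj' : j ≤ ℓ := by simpa [Nat.lt_succ_iff] using hj
    simpa using lt_of_memSlab hL hij hj' (hmem i hi' p hp) (hmem j hj' q hq)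
  · intro p
    rw [isUpperVertex_iff hP, hc.up_iff_block hinj (promise_idx hP hpr) hB, List.mem_flatMap]
    constructor
    · rintro ⟨i, hi, hp⟩
      have hi' : i ≤ ℓ := by simpa [Nat.lt_succ_iff] using hi
      refine ⟨i, hi', ?_⟩
      rw [← idx_safe hP hB hi', ← isUpperVertex_iff hP]
      exact ((hH i hi').2 p).1 hp
    · rintro ⟨i, hi, hp⟩
      refine ⟨i, by simpa [Nat.lt_succ_iff] using hi, ((hH i hi).2 p).2 ?_⟩
      rw [isUpperVertex_iff hP, idx_safe hP hB hi]
      exact hp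

/-- The upper hull in an array, as a list of indices. -/
theorem HullArr.isUpperHull (hP : GeneralPosition P) {Q : List (Fin n)} {f : ℕ → ℕ} {h : ℕ}
    (H : HullArr (xs P) (ys P) {p | p ∈ idx Q} f h) :
    ∃ H' : List (Fin n), H'.map Fin.val = (List.range h).map f ∧ IsUpperHull P Q H' := by
  have hlt : ∀ k < h, f k < n := fun k hk => idx_lt Q _ ((H.mem _).1 ⟨k, hk, rfl⟩).1
  refine ⟨(List.range h).pmap (fun k hk => ⟨f k, hk⟩) fun k hk => hlt k (by simpa using hk), ?_, ?_, ?_⟩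
  · rw [List.map_pmap, List.pmap_eq_map]
  · rw [List.pairwise_pmap]
    refine List.pairwise_lt_range.imp_of_mem fun {i j} hi hj hij h1 h2 => ?_
    have := lt_of_chain H.lt hij (by simpa using hj)
    rw [← xs_val (P := P), ← xs_val (P := P)]
    exact this
  · intro i
    rw [isUpperVertex_iff hP, ← H.mem, List.mem_pmap]
    simp [Fin.ext_iff]

end

/-! ### The recursive calls -/

/-- Loop rule for loops with activations of procedure `0`: `I i trs s` is the invariant after `i`
rounds with activations `trs`. -/
theorem exec_loop {b : Test} {c : Cmd} {N : ℕ} {B : ℕ → ℕ} {procs : List Cmd}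
    (I : ℕ → List CallTree → State → Prop)
    (hstep : ∀ i < N, ∀ trs s, I i trs s → b.Holds w s ∧
      ∃ t tr s', Exec w procs c s t tr s' ∧ t ≤ B i ∧ I (i + 1) (trs ++ tr) s')
    (hfin : ∀ trs s, I N trs s → ¬ b.Holds w s) {s : State} (h₀ : I 0 [] s) :
    ∃ t trs s', Exec w procs (.loop b c) s t trs s' ∧
      t ≤ ∑ i ∈ Finset.range N, (b.cost + B i) + b.cost ∧ I N trs s' := by
  suffices H : ∀ k ≤ N, ∀ trs s, I (N - k) trs s → ∃ t tr s', Exec w procs (.loop b c) s t tr s' ∧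
      t ≤ ∑ i ∈ Finset.Ico (N - k) N, (b.cost + B i) + b.cost ∧ I N (trs ++ tr) s' by
    obtain ⟨t, tr, s', h1, h2, h3⟩ := H N le_rfl [] s (by simpa using h₀)
    exact ⟨t, tr, s', h1, by simpa using h2, h3⟩
  intro k
  induction k with
  | zero => 
    intro _ trs s h
    exact ⟨_, [], s, Exec.loop_false (hfin trs s h), by simp, by simpa using h⟩
  | succ k ih =>
    intro hk trs s h
    obtain ⟨hb, t, tr, s', he, ht, h'⟩ := hstep (N - (k + 1)) (by omega) trs s h
    rw [show N - (k + 1) + 1 = N - k by omega] at h'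
    obtain ⟨t', tr', s'', he', ht', h''⟩ := ih (by omega) _ _ h'
    refine ⟨_, _, s'', Exec.loop_true hb he he', ?_, by rwa [← List.append_assoc]⟩
    rw [Finset.sum_eq_sum_Ico_succ_bot (by omega), show N - (k + 1) + 1 = N - k by omega]
    omega

/-- What a call of the recursive procedure achieves, apart from the call tree. -/
structure HullCall {n : ℕ} (P : Fin n → ℝ × ℝ) (Q H : List (Fin n)) (s s' : State) : Prop where
  start : s'.reg 2 = s.reg 7
  len : s'.reg 3 = H.length
  out : s'.reg 7 = s.reg 7 + H.length
  len_le : H.length ≤ Q.length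
  result : s'.result = H.map Fin.val
  below : ∀ i < s.reg 7, s'.word 1 i = s.word 1 i
  sp : s'.reg 8 = s.reg 8
  stack : ∀ i < s.reg 8, s'.word 2 i = s.word 2 i
  arg_out : ∀ j, j < s.reg 0 ∨ s.reg 0 + Q.length ≤ j → s'.word 0 j = s.word 0 j
  unmarked : ∀ p, s'.word 10 p = 0
  hull : IsUpperHull P Q H

section
variable {n b c : ℕ} {P : Fin n → ℝ × ℝ} {srt hc hl : ℕ → ℕ} {ta : ℕ → ℝ}

/-- What the recursive procedure requires to run on `Q` with `h` levels of recursion. -/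
structure HullPre (w : ℕ) (b c : ℕ) (P : Fin n → ℝ × ℝ) (srt hc hl : ℕ → ℕ) (ta : ℕ → ℝ) (h : ℕ)
    (Q : List (Fin n)) (lo hi : ℕ) (s : State) : Prop where
  static : Static n b c (xs P) (ys P) srt hc hl ta s
  arg : Arg n (idx Q) s
  closed : Closed n (xs P) (ys P) (idx Q)
  length_le : Q.length ≤ b ^ h
  mem : ∀ p ∈ idx Q, lo ≤ p ∧ p < hi
  out_le : s.reg 7 + Q.length ≤ n
  sp_lt : 2 * n + s.reg 8 + h * (4 * b + 5) + 4 * b + 10 < 2 ^ w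

/-- The recursive procedure works with `h` levels of recursion. -/
def HullSpec (w : ℕ) (b c : ℕ) (P : Fin n → ℝ × ℝ) (srt hc hl : ℕ → ℕ) (ta : ℕ → ℝ)
    (h α β : ℕ) : Prop :=
  ∀ Q lo hi s, HullPre w b c P srt hc hl ta h Q lo hi s →
    ∃ t tr H s', Exec w program.procs hullBody s t tr s' ∧
      t ≤ α * Q.length + β * (hi - lo) + 200 ∧ HullRun P 4 b Q H (.node s s' tr) ∧
      HullCall P Q H s s'

/-- The direct case. -/
theorem hullBody_base (hP : GeneralPosition P) (S : Setup w n b c (xs P) (ys P) srt hc hl ta)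
    {h : ℕ} {Q : List (Fin n)} {lo hi : ℕ} {s : State}
    (hpre : HullPre w b c P srt hc hl ta h Q lo hi s) (hm : Q.length ≤ b) :
    ∃ t tr H s', Exec w program.procs hullBody s t tr s' ∧
      t ≤ 200 * Q.length * Nat.clog 2 Q.length + 240 * Q.length + 130 ∧
      HullRun P 4 b Q H (.node s s' tr) ∧ HullCall P Q H s s' := by
  have hA := hpre.arg
  have hlen : s.reg 1 = Q.length := by rw [hA.len, List.length_map]
  have hQ : seg (s.word 0) (s.reg 0) Q.length = idx Q := by
    have := hA.eq
    rwa [List.length_map] at this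
  have hpos : s.reg 0 + Q.length ≤ n := by
    have := hA.pos
    rwa [List.length_map] at this
  have hsp := hpre.sp_lt
  have hout := hpre.out_le
  obtain ⟨t, s', he, ht, h1, h2, h3, h4, h5⟩ := base_runs (w := w) hlen hpre.static.x_eq
    hpre.static.y_eq S.inj hQ hA.nodup hA.lt (by omega) (by omega)
  have hf := frame_of_exec he
  obtain ⟨H, hH, hull⟩ := h5.isUpperHull hP
  have hHlen : H.length = s'.reg 3 := by simpa using congrArg List.length hH
  have hres : s'.result = H.map Fin.val := by
    rw [hH, State.result, h1]
  have hb : ¬ (Test.wordLt (.reg 5) (.reg 1)).Holds w s := by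
    simp only [Test.Holds, WExp.eval, hpre.static.b_eq, hlen]; omega
  refine ⟨_, _, H, s', Exec.ite_false hb he, by simp only [Test.cost, WExp.cost]; omega,
    HullRun.base ?_ hres hm hull, ?_⟩
  · rw [State.argument, hlen]; exact hQ
  · exact ⟨h1, hHlen.symm, by rw [h2, hHlen], by omega, hres, h4, hf.reg 8 rfl,
      fun i _ => by rw [hf.word 2 rfl], fun i _ => by rw [hf.word 0 rfl],
      by rw [hf.word 10 rfl]; exact hA.unmarked, hull⟩

/-- The recursive calls after `i` rounds. -/
structure LoopInv (P : Fin n → ℝ × ℝ) (b c : ℕ) (srt hc hl : ℕ → ℕ) (ta : ℕ → ℝ)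
    (Q : List (Fin n)) (ℓ : ℕ) (ln U V : ℕ → ℕ) (s s₁ : State) (i : ℕ) (H : ℕ → List (Fin n))
    (T : ℕ → CallTree) (σ : State) : Prop where
  static : Static n b c (xs P) (ys P) srt hc hl ta σ
  run : ∀ j < i, HullRun P 4 b (safe P Q (lineList P ln ℓ) j) (H j) (T j)
  hull : ∀ j < i, IsUpperHull P (safe P Q (lineList P ln ℓ) j) (H j)
  out : σ.reg 7 = s.reg 7 + ((List.range i).flatMap H).length
  out_le : ((List.range i).flatMap H).length ≤ offset (xs P) U V ℓ (idx Q) i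
  result : seg (σ.word 1) (s.reg 7) ((List.range i).flatMap H).length =
    ((List.range i).flatMap H).map Fin.val
  below : ∀ j < s.reg 7, σ.word 1 j = s.word 1 j
  sp : σ.reg 8 = s.reg 8 + ℓ + 5
  stack : ∀ j < s.reg 8 + ℓ + 4, σ.word 2 j = s₁.word 2 j
  next : σ.word 2 (s.reg 8 + ℓ + 4) = i
  arg_out : ∀ j, j < s.reg 0 ∨ s.reg 0 + offset (xs P) U V ℓ (idx Q) i ≤ j →
    σ.word 0 j = s₁.word 0 j
  unmarked : ∀ p, σ.word 10 p = 0

theorem LoopInv.count {Q : List (Fin n)} {ℓ : ℕ} {ln U V : ℕ → ℕ} {s s₁ σ : State} {i : ℕ}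
    {H : ℕ → List (Fin n)} {T : ℕ → CallTree}
    (I : LoopInv P b c srt hc hl ta Q ℓ ln U V s s₁ i H T σ)
    (ok : SplitOK (xs P) (ys P) b (idx Q) ℓ ln U V s s₁) : σ.word 2 (s.reg 8 + ℓ + 3) = ℓ + 1 := by
  rw [I.stack _ (by omega), ok.count]

theorem LoopInv.test_iff {Q : List (Fin n)} {ℓ : ℕ} {ln U V : ℕ → ℕ} {s s₁ σ : State} {i : ℕ}
    {H : ℕ → List (Fin n)} {T : ℕ → CallTree}
    (I : LoopInv P b c srt hc hl ta Q ℓ ln U V s s₁ i H T σ)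
    (ok : SplitOK (xs P) (ys P) b (idx Q) ℓ ln U V s s₁) (hw : 10 < 2 ^ w) :
    recurseTest.Holds w σ ↔ i < ℓ + 1 := by
  have m1 : 1 % 2 ^ w = 1 := Nat.mod_eq_of_lt (by omega)
  have m2 : 2 % 2 ^ w = 2 := Nat.mod_eq_of_lt (by omega)
  simp only [recurseTest, Test.Holds, WExp.eval, I.sp, m1, m2]
  rw [show s.reg 8 + ℓ + 5 - 1 = s.reg 8 + ℓ + 4 by omega,
    show s.reg 8 + ℓ + 5 - 2 = s.reg 8 + ℓ + 3 by omega, I.next, I.count ok]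

/-- The ranges of indices of the blocks. -/
def cut (lo hi ℓ : ℕ) (V : ℕ → ℕ) (i : ℕ) : ℕ := if i = 0 then lo else if i = ℓ + 1 then hi else V (i - 1)

/-- The callee may overwrite only its own block of the argument array, stack cells above the current
record, and output cells from the current end on. So later blocks, the record and earlier results
survive, and its result is appended just behind them. -/
theorem recurse_step (hP : GeneralPosition P) (hpr : UpperHullPromise P)
    (S : Setup w n b c (xs P) (ys P) srt hc hl ta) {h α β : ℕ}
    (IH : HullSpec w b c P srt hc hl ta h α β) {Q : List (Fin n)} {lo hi : ℕ} {s : State}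
    (hpre : HullPre w b c P srt hc hl ta (h + 1) Q lo hi s) {s₁ : State} {ℓ : ℕ}
    {ln U V : ℕ → ℕ} (ok : SplitOK (xs P) (ys P) b (idx Q) ℓ ln U V s s₁) {i : ℕ} (hi' : i ≤ ℓ)
    {H : ℕ → List (Fin n)} {T : ℕ → CallTree} {σ : State}
    (I : LoopInv P b c srt hc hl ta Q ℓ ln U V s s₁ i H T σ) :
    ∃ t H' T' σ', Exec w program.procs recurseStep σ t [T'] σ' ∧
      t ≤ α * (block (xs P) U V ℓ (idx Q) i).length +
        β * (cut lo hi ℓ V (i + 1) - cut lo hi ℓ V i) + 250 ∧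
      LoopInv P b c srt hc hl ta Q ℓ ln U V s s₁ (i + 1) (Function.update H i H')
        (Function.update T i T') σ' := by
  have hinj := xs_injOn hP
  have hpr' := promise_idx hP hpr
  have hsp := hpre.sp_lt
  have hpos := hpre.arg.pos
  have hout := hpre.out_le
  have hℓb := ok.lines.le
  rw [List.length_map] at hpos
  have hoff := ok.offset_le
  rw [List.length_map] at hoff
  have hoff' := offset_mono (xs P) U V ℓ (idx Q) (show i + 1 ≤ ℓ + 1 by omega)
  have hsucc := offset_succ (xs P) U V ℓ (idx Q) i
  set Q' := safe P Q (lineList P ln ℓ) i with hQ'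
  have hidx : idx Q' = block (xs P) U V ℓ (idx Q) i := idx_safe hP ok.bridge hi'
  have hlen : (block (xs P) U V ℓ (idx Q) i).length = Q'.length := by rw [← hidx, List.length_map]
  rw [hlen] at hsucc ⊢
  set o := offset (xs P) U V ℓ (idx Q) i with ho
  set σ₀ : State := ((((σ.setReg 45 (s.reg 8 + i)).setReg 0 (s.reg 0 + o)).setReg 1
    Q'.length).setWord 2 (s.reg 8 + ℓ + 4) (i + 1)) with hσ₀
  have hwp : Runs w program.procs (.setReg 45 (.add (.sub (.sub (.reg 8) (.const 4)) (.get 2 (.sub (.reg 8) (.const 2))))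
      (.get 2 (.sub (.reg 8) (.const 1)))) ⨾
    .setReg 0 (.get 2 (.reg 45)) ⨾
    .setReg 1 (.sub (.get 2 (.add (.reg 45) (.const 1))) (.reg 0)) ⨾
    .setWord 2 (.sub (.reg 8) (.const 1)) (.add (.get 2 (.sub (.reg 8) (.const 1))) (.const 1))) σ 45
      fun σ' => σ' = σ₀ := by
    refine (Runs.of_wp ?_).mono (by simp [Cmd.worst, WExp.cost]) fun _ h => h
    have m1 : 1 % 2 ^ w = 1 := Nat.mod_eq_of_lt (by omega)
    have m2 : 2 % 2 ^ w = 2 := Nat.mod_eq_of_lt (by omega)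
    have m4 : 4 % 2 ^ w = 4 := Nat.mod_eq_of_lt (by omega)
    have k1 : s.reg 8 + ℓ + 5 - 1 = s.reg 8 + ℓ + 4 := by omega
    have k2 : s.reg 8 + ℓ + 5 - 2 = s.reg 8 + ℓ + 3 := by omega
    have k3 : (s.reg 8 + ℓ + 5 - 4 - (ℓ + 1) + i) % 2 ^ w = s.reg 8 + i := by
      rw [Nat.mod_eq_of_lt (by omega)]; omega
    have k4 : (s.reg 8 + i + 1) % 2 ^ w = s.reg 8 + i + 1 := Nat.mod_eq_of_lt (by omega)
    have k5 : (i + 1) % 2 ^ w = i + 1 := Nat.mod_eq_of_lt (by omega)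
    have b1 : σ.word 2 (s.reg 8 + i) = s.reg 0 + o := by
      rw [I.stack _ (by omega), ok.bounds i (by omega)]
    have b2 : σ.word 2 (s.reg 8 + i + 1) = s.reg 0 + (o + Q'.length) := by
      rw [I.stack _ (by omega), add_assoc, ok.bounds (i + 1) (by omega), hsucc]
    have b3 : s.reg 0 + (o + Q'.length) - (s.reg 0 + o) = Q'.length := by omega
    simp (disch := decide) only [Cmd.wp, WExp.eval, State.setReg_reg, State.setReg_word, if_neg,
      if_true, m1, m2, m4, I.sp, k1, k2, I.next, I.count ok, k3, b1, k4, b2, b3, k5]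
    rfl
  obtain ⟨t₀, _, he₀, ht₀, rfl⟩ := hwp
  have r0 : σ₀.reg 0 = s.reg 0 + o := by simp [hσ₀]
  have r1 : σ₀.reg 1 = Q'.length := by simp [hσ₀]
  have r7 : σ₀.reg 7 = s.reg 7 + ((List.range i).flatMap H).length := by simp [hσ₀, I.out]
  have r8 : σ₀.reg 8 = s.reg 8 + ℓ + 5 := by simp [hσ₀, I.sp]
  have w0 : σ₀.word 0 = σ.word 0 := by simp [hσ₀]
  have w1 : σ₀.word 1 = σ.word 1 := by simp [hσ₀]
  have w2 : σ₀.word 2 = Function.update (σ.word 2) (s.reg 8 + ℓ + 4) (i + 1) := by simp [hσ₀]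
  have w10 : σ₀.word 10 = σ.word 10 := by simp [hσ₀]
  have hst : Static n b c (xs P) (ys P) srt hc hl ta σ₀ :=
    I.static.frame (frame_of_exec he₀) rfl rfl rfl rfl rfl rfl rfl rfl rfl
  clear_value σ₀
  have hmemU : ∀ l < ℓ, U l < V l := fun l hl => hpr' _ _
    ((hpre.closed.up_iff hinj).1 (ok.bridge l hl).up_left).2
    ((hpre.closed.up_iff hinj).1 (ok.bridge l hl).up_right).2
    ((ok.bridge l hl).lt.trans_le (ok.bridge l hl).le)
  have hpre' : HullPre w b c P srt hc hl ta h Q' (cut lo hi ℓ V i) (cut lo hi ℓ V (i + 1)) σ₀ := by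
    refine ⟨hst, ⟨by rw [r1, List.length_map], ?_, ?_, idx_lt _, ?_, by rw [w10]; exact I.unmarked⟩,
      ?_, ?_, ?_, ?_, ?_⟩
    · have := ok.blocks i hi'
      rw [← hidx, ← ho] at this
      conv_rhs => rw [← this]
      rw [r0, w0]
      exact seg_congr fun k hk => I.arg_out _ (Or.inr (by omega))
    · rw [hidx, block]; exact hpre.arg.sorted.filter _
    · rw [r0, List.length_map]; omega
    · rw [hidx]; exact hpre.closed.block hinj hpr' ok.bridge hi'
    -- Safe points lie in their slab, which holds at most `|Q| / b` points. This takes one factor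
    -- `b` off the bound `b ^ (h + 1)`.
    · classical
      have := ok.lines.slab i hi' (fun p => decide (SafeIn (xs P) U V ℓ i p))
        (fun p _ hp => (of_decide_eq_true hp).memSlab ok.bridge hi')
      rw [List.countP_eq_length_filter, List.length_map] at this
      have h2 : b * Q'.length ≤ b * b ^ h := by
        rw [← hlen, block, ← pow_succ']
        refine le_trans (le_of_eq ?_) (this.trans hpre.length_le)
        congr!
      exact Nat.le_of_mul_le_mul_left h2 S.b_pos
    -- By `U i < V i`, the indices of block `i` lie in `[V (i - 1), V i)`. The ranges charged for
    -- the blocks are thus disjoint and fill the range of `Q`.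
    · intro p hp
      rw [hidx] at hp
      obtain ⟨hpQ, hs⟩ := mem_block.1 hp
      have := hpre.mem p hpQ
      unfold cut
      constructor
      · split_ifs with h0 h1
        · exact this.1
        · omega
        · exact (hs.1 (by omega)).1
      · rw [if_neg (by omega)]
        split_ifs with h1
        · exact this.2
        · have h2 := (hs.2 (by omega)).1
          have h3 := hmemU i (by omega)
          simp only [Nat.add_sub_cancel]; omega
    · rw [r7]; have := I.out_le; omega
    · rw [r8]
      have : (h + 1) * (4 * b + 5) = h * (4 * b + 5) + (4 * b + 5) := by ring
      omega
  obtain ⟨t, tr, H', σ', he, ht, hrun, hcall⟩ := IH Q' _ _ σ₀ hpre'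
  -- The call wraps the trace of the body into one node, so each round records exactly one
  -- activation.
  have hseq := Exec.seq he₀ (Exec.call_zero (procs := program.procs) (c := hullBody) rfl he)
  refine ⟨_, H', .node σ₀ σ' tr, σ', hseq, by omega, ?_⟩
  have hHc : ∀ f : ℕ → List (Fin n), (List.range i).flatMap (Function.update f i H') =
      (List.range i).flatMap f := by
    intro f
    refine List.flatMap_congr fun j hj => ?_
    rw [Function.update_of_ne (by have := List.mem_range.1 hj; omega)]
  have hHs : (List.range (i + 1)).flatMap (Function.update H i H') =
      (List.range i).flatMap H ++ H' := by
    rw [List.range_succ, List.flatMap_append, hHc]; simp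
  have hres := hcall.result
  rw [State.result, hcall.start, hcall.len, r7] at hres
  refine ⟨hst.frame (frame_of_exec he) rfl rfl rfl rfl rfl rfl rfl rfl rfl, ?_, ?_, ?_, ?_, ?_, ?_,
    ?_, ?_, ?_, ?_, hcall.unmarked⟩
  · intro j hj
    rcases (Nat.lt_succ_iff.1 hj).eq_or_lt with rfl | hj
    · simpa using hrun
    · simpa [hj.ne] using I.run j hj
  · intro j hj
    rcases (Nat.lt_succ_iff.1 hj).eq_or_lt with rfl | hj
    · simpa using hcall.hull
    · simpa [hj.ne] using I.hull j hj
  · rw [hcall.out, hHs, List.length_append, r7, add_assoc]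
  · rw [hHs, List.length_append, hsucc]
    exact Nat.add_le_add I.out_le hcall.len_le
  · rw [hHs, List.length_append, List.map_append, seg_add]
    congr 1
    rw [← I.result]
    exact seg_congr fun k hk => by rw [hcall.below _ (by omega), w1]
  · intro j hj
    rw [hcall.below _ (by omega), w1, I.below j hj]
  · rw [hcall.sp, r8]
  · intro j hj
    rw [hcall.stack _ (by omega), w2, Function.update_of_ne (by omega), I.stack j hj]
  · rw [hcall.stack _ (by omega), w2, Function.update_self]
  · intro j hj
    rw [hcall.arg_out _ (by omega), w0, I.arg_out j (by omega)]

/-- The lengths of the ranges telescope; monotonicity is needed because subtraction is truncated. -/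
theorem sum_cut_le {V f : ℕ → ℕ} {lo hi ℓ α β K : ℕ}
    (hcut : ∀ i ≤ ℓ, cut lo hi ℓ V i ≤ cut lo hi ℓ V (i + 1)) :
    ∑ i ∈ Finset.range (ℓ + 1), (α * f i + β * (cut lo hi ℓ V (i + 1) - cut lo hi ℓ V i) + K) =
      α * ∑ i ∈ Finset.range (ℓ + 1), f i + β * (hi - lo) + K * (ℓ + 1) := by
  have key : ∀ k ≤ ℓ + 1, cut lo hi ℓ V 0 ≤ cut lo hi ℓ V k ∧
      ∑ i ∈ Finset.range k, (cut lo hi ℓ V (i + 1) - cut lo hi ℓ V i) =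
        cut lo hi ℓ V k - cut lo hi ℓ V 0 := by
    intro k hk
    induction k with
    | zero => simp
    | succ k ih =>
      obtain ⟨h1, h2⟩ := ih (by omega)
      have h3 := hcut k (by omega)
      rw [Finset.sum_range_succ, h2]
      constructor <;> omega
  rw [Finset.sum_add_distrib, Finset.sum_add_distrib, ← Finset.mul_sum, ← Finset.mul_sum,
    (key (ℓ + 1) le_rfl).2, Finset.sum_const, Finset.card_range, smul_eq_mul, mul_comm K]
  simp [cut]

/-- The recursive case. -/
theorem hullBody_step (hP : GeneralPosition P) (hpr : UpperHullPromise P)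
    (S : Setup w n b c (xs P) (ys P) srt hc hl ta) (hlog : Nat.clog 2 n ≤ 2 * b) {h α β : ℕ}
    (IH : HullSpec w b c P srt hc hl ta h α β) {Q : List (Fin n)} {lo hi : ℕ} {s : State}
    (hpre : HullPre w b c P srt hc hl ta (h + 1) Q lo hi s) (hm : b < Q.length) :
    ∃ j₀ j₁, Chunks n c (idx Q) j₀ j₁ ∧
    ∃ t tr H s', Exec w program.procs hullBody s t tr s' ∧
      t ≤ (if Q.length ≤ c then 200 * Q.length * Nat.clog 2 Q.length + 2000 * Q.length
        else 18000 * ((j₁ - j₀ + 1) * c)) + (α * Q.length + β * (hi - lo) + 1200 * Q.length) ∧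
      HullRun P 4 b Q H (.node s s' tr) ∧ HullCall P Q H s s' := by
  have hinj := xs_injOn hP
  have hpr' := promise_idx hP hpr
  have hsp := hpre.sp_lt
  have hsp' : (h + 1) * (4 * b + 5) = h * (4 * b + 5) + (4 * b + 5) := by ring
  have hA := hpre.arg
  have hlen : s.reg 1 = Q.length := by rw [hA.len, List.length_map]
  obtain ⟨j₀, j₁, hch, t₁, s₁, he₁, ht₁, ℓ, ln, U, V, ok⟩ := split_runs S hpre.static hA
    (by rw [List.length_map]; exact hm) hlog (by omega)
    (fun z h1 h2 => hpre.closed.bridge hinj h1 h2)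
    fun u v hu hv huv => hpr' u v ((hpre.closed.up_iff hinj).1 hu).2
      ((hpre.closed.up_iff hinj).1 hv).2 huv
  refine ⟨j₀, j₁, hch, ?_⟩
  rw [List.length_map] at ht₁
  have hf₁ := frame_of_exec he₁
  have hℓb := ok.lines.le
  have hoff := ok.offset_le
  rw [List.length_map] at hoff
  have I₀ : LoopInv P b c srt hc hl ta Q ℓ ln U V s s₁ 0 (fun _ => []) (fun _ => .node s s []) s₁ := by
    refine ⟨hpre.static.frame hf₁ rfl rfl rfl rfl rfl rfl rfl rfl rfl, fun j hj => by omega,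
      fun j hj => by omega, by simpa using hf₁.reg 7 rfl, by simp, by simp,
      fun j _ => by rw [hf₁.word 1 rfl], ok.sp, fun _ _ => rfl, ok.next, fun _ _ => rfl, ok.unmarked⟩
  obtain ⟨t₂, trs, s₂, he₂, ht₂, H, T, htrs, I⟩ := exec_loop (w := w) (procs := program.procs)
    (b := recurseTest) (c := recurseStep) (N := ℓ + 1)
    (B := fun i => α * (block (xs P) U V ℓ (idx Q) i).length +
        β * (cut lo hi ℓ V (i + 1) - cut lo hi ℓ V i) + 250)
    (fun i trs σ => ∃ H T, trs = (List.range i).map T ∧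
      LoopInv P b c srt hc hl ta Q ℓ ln U V s s₁ i H T σ) (by
      rintro i hi' trs σ ⟨H, T, rfl, I⟩
      refine ⟨(I.test_iff ok (by omega)).2 hi', ?_⟩
      obtain ⟨t, H', T', σ', he, ht, I'⟩ := recurse_step hP hpr S IH hpre ok (by omega) I
      refine ⟨t, _, σ', he, ht, _, _, ?_, I'⟩
      rw [List.range_succ, List.map_append]
      congr 1
      · refine List.map_congr_left fun j hj => ?_
        rw [Function.update_of_ne (by have := List.mem_range.1 hj; omega)]
      · simp) (by
      rintro trs σ ⟨H, T, -, I⟩ hb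
      exact lt_irrefl _ ((I.test_iff ok (by omega)).1 hb)) ⟨_, _, rfl, I₀⟩
  have hpop : Runs w program.procs popCmd s₂ 40 fun s' => s' = (((s₂.setReg 2 (s.reg 7)).setReg 3
      ((List.range (ℓ + 1)).flatMap H).length).setReg 8 (s.reg 8)) := by
    refine (Runs.of_wp ?_).mono (by simp [popCmd, Cmd.worst, WExp.cost]) fun _ h => h
    have m2 : 2 % 2 ^ w = 2 := Nat.mod_eq_of_lt (by omega)
    have m3 : 3 % 2 ^ w = 3 := Nat.mod_eq_of_lt (by omega)
    have m4 : 4 % 2 ^ w = 4 := Nat.mod_eq_of_lt (by omega)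
    have k2 : s.reg 8 + ℓ + 5 - 2 = s.reg 8 + ℓ + 3 := by omega
    have k3 : s.reg 8 + ℓ + 5 - 3 = s.reg 8 + ℓ + 2 := by omega
    have k4 : s.reg 8 + ℓ + 5 - 4 - (ℓ + 1) = s.reg 8 := by omega
    have hsv : s₂.word 2 (s.reg 8 + ℓ + 2) = s.reg 7 := by
      rw [I.stack _ (by omega), ok.saved]
    simp (disch := decide) only [popCmd, Cmd.wp, WExp.eval, State.setReg_reg, State.setReg_word,
      if_neg, if_true, m2, m3, m4, I.sp, k2, k3, hsv, I.count ok, k4, I.out, Nat.add_sub_cancel_left]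
  obtain ⟨t₃, s₃, he₃, ht₃, hs₃⟩ := hpop
  set HH := (List.range (ℓ + 1)).flatMap H with hHH
  have hb : (Test.wordLt (.reg 5) (.reg 1)).Holds w s := by
    simp only [Test.Holds, WExp.eval, hpre.static.b_eq, hlen]; exact hm
  have hexec := Exec.ite_true (d := baseCmd) hb (Exec.seq he₁ (Exec.seq he₂ he₃))
  have hres : s₃.result = HH.map Fin.val := by
    have := I.result
    rw [← hHH] at this
    rw [← this, hs₃]
    simp [State.result, seg]
  have hull : IsUpperHull P Q HH := isUpperHull_flatMap hP hpr hpre.closed ok.lines ok.bridge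
    fun i hi => I.hull i (by omega)
  refine ⟨_, _, HH, s₃, hexec, ?_, ?_, ?_⟩
  -- At most `4 * b + 1` calls have a constant overhead each. Since `b < |Q|`, this is covered by
  -- `1200 * |Q|`.
  · have hV : ∀ l < ℓ, lo ≤ V l ∧ V l < hi := fun l hl =>
      hpre.mem _ (ok.bridge l hl).up_right.1
    have hVV : ∀ l, l + 1 < ℓ → V l ≤ V (l + 1) := by
      intro l hl
      have B := ok.bridge l (by omega)
      have B' := ok.bridge (l + 1) hl
      refine hpre.closed.ord hinj hpr' B.up_right B'.up_right ?_
      exact (B.adj _ B'.up_right).resolve_left (not_le.2 (B.lt.trans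
        ((ok.lines.mono l (l + 1) (by omega) hl).trans_le B'.le)))
    have hlohi : lo ≤ hi := by
      obtain ⟨p, hp, -⟩ := hch.first
      have := hpre.mem p hp
      omega
    have hcut : ∀ i ≤ ℓ, cut lo hi ℓ V i ≤ cut lo hi ℓ V (i + 1) := by
      intro i hi'
      unfold cut
      rw [if_neg (show i + 1 ≠ 0 by omega)]
      split_ifs with h0 h1 h2 h3
      · exact hlohi
      · exact (hV _ (by omega)).1
      · omega
      · omega
      · exact (hV _ (by omega)).2.le
      · have := hVV (i - 1) (by omega)
        rwa [show i - 1 + 1 = i by omega] at this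
    have hsum : ∑ i ∈ Finset.range (ℓ + 1), (block (xs P) U V ℓ (idx Q) i).length =
        offset (xs P) U V ℓ (idx Q) (ℓ + 1) := by
      generalize ℓ + 1 = k
      induction k with
      | zero => simp [offset]
      | succ k ih => rw [Finset.sum_range_succ, ih, offset_succ]
    have htc : recurseTest.cost = 9 := by simp [recurseTest, Test.cost, WExp.cost]
    simp only [htc] at ht₂
    rw [Finset.sum_add_distrib, sum_cut_le hcut, hsum] at ht₂
    have h1 : α * offset (xs P) U V ℓ (idx Q) (ℓ + 1) ≤ α * Q.length := Nat.mul_le_mul_left _ hoff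
    simp only [Finset.sum_const, Finset.card_range, smul_eq_mul] at ht₂
    simp only [Test.cost, WExp.cost]
    omega
  · rw [htrs]
    simp only [List.nil_append, List.append_nil]
    have := HullRun.step (P := P) (K := 4) (b := b) (Q := Q) (s := s) (s' := s₃)
      (lineList P ln ℓ) H T
    simp only [lineList_length] at this
    refine this ?_ hres hm (lineList_pairwise ok.lines) hℓb (fun i hi => ?_) fun i hi => I.run i (by omega)
    · rw [State.argument, hlen]
      have := hA.eq
      rwa [List.length_map] at this
    · have := slab_length_le ok.lines hi
      omega
  · have hHlen := I.out_le
    rw [← hHH] at hHlen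
    refine ⟨by simp [hs₃], by simp [hs₃], by simp [hs₃, I.out, hHH], by omega, hres, ?_, by simp [hs₃],
      ?_, ?_, ?_, hull⟩
    · simpa [hs₃] using I.below
    · intro j hj
      simp only [hs₃, State.setReg_word]
      rw [I.stack _ (by omega), ok.below j hj]
    · intro j hj
      simp only [hs₃, State.setReg_word]
      rw [I.arg_out _ (by omega), ok.out j (by rw [List.length_map]; exact hj)]
    · simpa [hs₃] using I.unmarked

end

/-! ### Charging the cost of the recursion -/

theorem length_le_of_mem {Q : List ℕ} (hQ : Q.Nodup) {lo hi : ℕ} (h : ∀ p ∈ Q, lo ≤ p ∧ p < hi) :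
    Q.length ≤ hi - lo := by
  rw [← List.toFinset_card_of_nodup hQ, ← Nat.card_Ico]
  exact Finset.card_le_card fun p hp => Finset.mem_Ico.2 (h p (by simpa using hp))

section
variable {n b c e : ℕ} {P : Fin n → ℝ × ℝ} {srt hc hl : ℕ → ℕ} {ta : ℕ → ℝ}

/-- The recursive procedure is correct and fast: small arguments are charged to their points, large
ones to their ranges of indices. -/
theorem hullSpec (hP : GeneralPosition P) (hpr : UpperHullPromise P)
    (S : Setup w n b c (xs P) (ys P) srt hc hl ta) (hlog : Nat.clog 2 n ≤ 2 * b) (hbe : b = 2 ^ e)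
    (h : ℕ) : HullSpec w b c P srt hc hl ta h (4000 * (e + 1) * (min h 3 + 1)) (56000 * (h - 3)) := by
  have hbase : ∀ h Q lo hi s, HullPre w b c P srt hc hl ta h Q lo hi s → Q.length ≤ b →
      ∃ t tr H s', Exec w program.procs hullBody s t tr s' ∧
        t ≤ 4000 * (e + 1) * (min h 3 + 1) * Q.length + 56000 * (h - 3) * (hi - lo) + 200 ∧
        HullRun P 4 b Q H (.node s s' tr) ∧ HullCall P Q H s s' := by
    intro h Q lo hi s hpre hm
    obtain ⟨t, tr, H, s', he, ht, h1, h2⟩ := hullBody_base hP S hpre hm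
    refine ⟨t, tr, H, s', he, ht.trans ?_, h1, h2⟩
    have hclog : Nat.clog 2 Q.length ≤ e := Nat.clog_le_of_le_pow (hbe ▸ hm)
    have k1 : 200 * Q.length * Nat.clog 2 Q.length ≤ 200 * Q.length * e :=
      Nat.mul_le_mul_left _ hclog
    have k2 : 4000 * (e + 1) * (0 + 1) * Q.length ≤ 4000 * (e + 1) * (min h 3 + 1) * Q.length :=
      Nat.mul_le_mul_right _ (Nat.mul_le_mul_left _ (by omega))
    have k3 : 4000 * (e + 1) * (0 + 1) * Q.length =
      20 * (200 * Q.length * e) + 4000 * Q.length := by ring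
    generalize 56000 * (h - 3) * (hi - lo) = X
    omega
  induction h with
  | zero =>
    intro Q lo hi s hpre
    refine hbase 0 Q lo hi s hpre (hpre.length_le.trans ?_)
    rw [pow_zero]; exact S.b_pos
  | succ h ih =>
    intro Q lo hi s hpre
    rcases le_or_gt Q.length b with hm | hm
    · exact hbase _ _ _ _ _ hpre hm
    have hsp' : (h + 1) * (4 * b + 5) = h * (4 * b + 5) + (4 * b + 5) := by ring
    -- Arguments with at most `b ^ h` points are already handled by the induction hypothesis. The
    -- remaining ones have more than `b ^ h` points, hence more than `c` of them as soon as `h ≥ 3`.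
    rcases le_or_gt Q.length (b ^ h) with hmh | hmh
    · obtain ⟨t, tr, H, s', he, ht, h1, h2⟩ := ih Q lo hi s ⟨hpre.static, hpre.arg, hpre.closed, hmh,
        hpre.mem, hpre.out_le, by have := hpre.sp_lt; omega⟩
      refine ⟨t, tr, H, s', he, ht.trans ?_, h1, h2⟩
      gcongr <;> omega
    obtain ⟨j₀, j₁, hch, t, tr, H, s', he, ht, h1, h2⟩ := hullBody_step hP hpr S hlog ih hpre hm
    refine ⟨t, tr, H, s', he, ht.trans ?_, h1, h2⟩
    -- On the lowest three levels `|Q| ≤ c`, so sorting costs `3 * e` per point and is charged to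
    -- the points. On higher levels the cost is charged to the range of indices and the coefficient
    -- of `|Q|` no longer grows.
    rcases le_or_gt (h + 1) 3 with h3 | h3
    · have hmc : Q.length ≤ c := by
        rw [S.c_eq]
        exact hpre.length_le.trans (Nat.pow_le_pow_right S.b_pos h3)
      rw [if_pos hmc, min_eq_left h3, min_eq_left (show h ≤ 3 by omega),
        show h - 3 = 0 by omega, show h + 1 - 3 = 0 by omega]
      have hclog : Nat.clog 2 Q.length ≤ 3 * e := Nat.clog_le_of_le_pow (by
        rw [S.c_eq, hbe, ← pow_mul, mul_comm] at hmc; exact hmc)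
      have k1 : 200 * Q.length * Nat.clog 2 Q.length ≤ 200 * Q.length * (3 * e) :=
        Nat.mul_le_mul_left _ hclog
      have k2 : 4000 * (e + 1) * (h + 1 + 1) * Q.length = 4000 * (e + 1) * (h + 1) * Q.length +
        (20 * (200 * Q.length * e) + 4000 * Q.length) := by ring
      have k3 : 200 * Q.length * (3 * e) = 3 * (200 * Q.length * e) := by ring
      omega
    · have hcm : c < Q.length := by
        rw [S.c_eq]
        exact (Nat.pow_le_pow_right S.b_pos (by omega)).trans_lt hmh
      rw [if_neg (by omega), min_eq_right (show 3 ≤ h + 1 by omega),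
        min_eq_right (show 3 ≤ h by omega),
        show h + 1 - 3 = (h - 3) + 1 by omega]
      have hml : Q.length ≤ hi - lo := by
        have := length_le_of_mem hpre.arg.nodup hpre.mem
        rwa [List.length_map] at this
      obtain ⟨p, hp, hp'⟩ := hch.first
      obtain ⟨q, hq, hq'⟩ := hch.last
      have hp2 := hpre.mem p hp
      have hq2 := hpre.mem q hq
      -- The chunks met by `Q` exceed its range of indices by less than one chunk on either side. As
      -- `c < |Q| ≤ hi - lo`, they have less than `3 * (hi - lo)` entries; with `1200 * |Q|` this
      -- stays below `56000 * (hi - lo)`.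
      have k1 : (j₁ - j₀ + 1) * c = c * j₁ - c * j₀ + c := by
        rw [add_mul, one_mul, mul_comm, Nat.mul_sub]
      have k2 : 56000 * (h - 3 + 1) * (hi - lo) = 56000 * (h - 3) * (hi - lo) + 56000 * (hi - lo) := by
        ring
      rw [k1, k2]
      omega

end

/-! ### The parameter in terms of `√(log₂ n)`, and the final bound -/

/-- Together with `n ≤ 2 ^ (e * e)` this gives `log n ≤ 2 * b`, on which the cost of all sorts in
large calls depends. The factor `2` is needed at `e = 3`. -/
theorem sq_le_two_mul_two_pow (e : ℕ) : e * e ≤ 2 * 2 ^ e := by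
  have key : ∀ k : ℕ, (k + 3) * (k + 3) ≤ 2 * 2 ^ (k + 3) := by
    intro k
    induction k with
    | zero => norm_num
    | succ k ih =>
      have : 2 * 2 ^ (k + 1 + 3) = 2 * (2 * 2 ^ (k + 3)) := by ring
      nlinarith
  match e with
  | 0 => norm_num
  | 1 => norm_num
  | 2 => norm_num
  | k + 3 => exact key k

/-- The parameter is `2 ^ √(log₂ n)` up to a factor of two. -/
theorem sqrt_logb_le {n e : ℕ} (h : n ≤ 2 ^ (e * e)) : √(Real.logb 2 n) ≤ e := by
  rw [Real.sqrt_le_left (by positivity)]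
  rcases Nat.eq_zero_or_pos n with rfl | hn
  · simp
  · rw [Real.logb_le_iff_le_rpow (by norm_num) (by exact_mod_cast hn), ← Nat.cast_pow,
      Real.rpow_natCast, sq]
    exact_mod_cast h

/-- The minimality of `e`: rounding up twice, in the logarithm and in the root, still costs no more
than one, because `(e - 1) ^ 2` is an integer below the rounded logarithm. -/
theorem le_sqrt_logb {n e : ℕ} (h : 0 < e → 2 ^ ((e - 1) * (e - 1)) < n) :
    (e : ℝ) ≤ √(Real.logb 2 n) + 1 := by
  rcases Nat.eq_zero_or_pos e with rfl | he
  · have := Real.sqrt_nonneg (Real.logb 2 n)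
    simp; linarith
  · have h' := h he
    have : ((e - 1 : ℕ) : ℝ) ≤ √(Real.logb 2 n) := by
      refine Real.le_sqrt_of_sq_le ?_
      rw [Real.le_logb_iff_rpow_le (by norm_num)
        (by exact_mod_cast (Nat.zero_le _).trans_lt h'), ← Nat.cast_pow, Real.rpow_natCast, sq]
      exact_mod_cast h'.le
    rw [Nat.cast_sub he, Nat.cast_one] at this
    linarith

theorem one_le_sqrt_logb {n : ℕ} (hn : 2 ≤ n) : 1 ≤ √(Real.logb 2 n) := by
  refine Real.le_sqrt_of_sq_le ?_
  rw [Real.le_logb_iff_rpow_le (by norm_num) (by exact_mod_cast (by omega : 0 < n))]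
  norm_num
  exact_mod_cast hn

theorem idx_finRange (n : ℕ) : idx (List.finRange n) = List.range n := by
  simp [idx]

end HullRAM

open RealRAM PlanarHull HullRAM

theorem mainTheorem1 :
    ∃ (prog : RealRAM.Program) (κ K : ℕ) (C : ℝ),
      ∀ (n : ℕ) (P : Fin n → ℝ × ℝ),
        PlanarHull.GeneralPosition P → PlanarHull.UpperHullPromise P →
        ∀ w : ℕ, (n + 2) ^ κ ≤ 2 ^ w →
          ∃ (b t : ℕ) (H : List (Fin n)) (T : RealRAM.CallTree) (s : RealRAM.State),
            (2 : ℝ) ^ √(Real.logb 2 n) ≤ b ∧ (b : ℝ) ≤ 2 * (2 : ℝ) ^ √(Real.logb 2 n) ∧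
            RealRAM.Exec w prog.procs prog.main (RealRAM.init P) t [T] s ∧
            PlanarHull.HullRun P K b (List.finRange n) H T ∧
            s.result = H.map Fin.val ∧
            PlanarHull.IsUpperHull P (List.finRange n) H ∧
            (t : ℝ) ≤ C * (n * √(Real.logb 2 n) + 1) := by
  -- The exponent `13` provides `2 ^ w ≥ 1024 * (n + 2) ^ 3`: the cube accommodates `c` and `n * b ^
  -- 2`, and ten further factors `n + 2 ≥ 2` accommodate the constants.
  refine ⟨program, 13, 4, 220000, fun n P hP hpr w hw => ?_⟩
  have hinj := xs_injOn hP
  set N := n + 2 with hN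
  have hw' : 1024 * N ^ 3 ≤ 2 ^ w := by
    refine le_trans ?_ hw
    rw [show N ^ 13 = N ^ 10 * N ^ 3 by ring, show 1024 = 2 ^ 10 by norm_num]
    exact Nat.mul_le_mul_right _ (Nat.pow_le_pow_left (by omega) _)
  have hN1 : N ≤ N ^ 3 := Nat.le_self_pow (by norm_num) _
  have hN8 : 8 ≤ N ^ 3 := by
    have := Nat.pow_le_pow_left (show 2 ≤ N by omega) 3
    simpa using this
  have hN2 : N ^ 2 ≤ N ^ 3 := Nat.pow_le_pow_right (by omega) (by norm_num)
  have hpre3 : 30 * (2 * n + 2) ^ 3 < 2 ^ w := by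
    have : (2 * n + 2) ^ 3 ≤ (2 * N) ^ 3 := Nat.pow_le_pow_left (by omega) _
    have h2 : (2 * N) ^ 3 = 8 * N ^ 3 := by ring
    omega
  obtain ⟨e, hne, hen, t₁, s₁, he₁, ht₁, h0, h1, h7, h8, hid, srt, hc, hl, ta, hst, hck⟩ :=
    preprocess_runs (w := w) (s := init P) (n := n) rfl hpre3 rfl rfl hinj
  have hf₁ := frame_of_exec he₁
  have hb2 : 2 ^ e ≤ 2 * N := by
    rcases Nat.eq_zero_or_pos e with rfl | hpos
    · omega
    · have h1 : 2 ^ (e - 1) ≤ 2 ^ ((e - 1) * (e - 1)) :=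
        Nat.pow_le_pow_right (by norm_num) (Nat.le_mul_self _)
      have h2 := hen hpos
      have h3 : 2 ^ e = 2 * 2 ^ (e - 1) := by rw [← pow_succ']; congr 1; omega
      omega
  have hb3 : (2 ^ e) ^ 3 ≤ 8 * N ^ 3 := by
    have := Nat.pow_le_pow_left hb2 3
    rwa [mul_pow] at this
  have hb4 : 2 ^ e * 2 ^ e ≤ 4 * N ^ 2 := by
    have := Nat.mul_le_mul hb2 hb2
    calc _ ≤ _ := this
      _ = 4 * N ^ 2 := by ring
  have hb5 : n * (2 ^ e * 2 ^ e) ≤ 4 * N ^ 3 := by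
    have := Nat.mul_le_mul (show n ≤ N by omega) hb4
    calc _ ≤ _ := this
      _ = 4 * N ^ 3 := by ring
  have hlog : Nat.clog 2 n ≤ 2 * 2 ^ e :=
    (Nat.clog_le_of_le_pow hne).trans (sq_le_two_mul_two_pow e)
  have S : Setup w n (2 ^ e) ((2 ^ e) ^ 3) (xs P) (ys P) srt hc hl ta :=
    ⟨by positivity, rfl, hinj, hck, by omega⟩
  have hpre : HullPre w (2 ^ e) ((2 ^ e) ^ 3) P srt hc hl ta e (List.finRange n) 0 n s₁ := by
    refine ⟨hst, ⟨by simp [h1], ?_, ?_, idx_lt _, by simp [h0], ?_⟩,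
      closed_of_mem_iff hinj fun p => mem_idx_finRange, ?_, fun p hp => ⟨by omega, idx_lt _ p hp⟩,
      by simp [h7], ?_⟩
    · rw [idx_finRange, List.length_range, h0, seg]
      conv_rhs => rw [← List.map_id (List.range n)]
      exact List.map_congr_left fun k hk => by simpa using hid k (List.mem_range.1 hk)
    · rw [idx_finRange]; exact List.pairwise_lt_range
    · rw [hf₁.word 10 rfl]; exact fun _ => rfl
    · rw [List.length_finRange, ← pow_mul]; exact hne
    · rw [h8]
      have : e * (4 * 2 ^ e + 5) ≤ 2 ^ e * (4 * 2 ^ e + 5) :=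
        Nat.mul_le_mul_right _ Nat.lt_two_pow_self.le
      have h' : 2 ^ e * (4 * 2 ^ e + 5) = 4 * (2 ^ e * 2 ^ e) + 5 * 2 ^ e := by ring
      omega
  obtain ⟨t₂, tr, H, s₂, he₂, ht₂, hrun, hcall⟩ := hullSpec hP hpr S hlog rfl e _ _ _ _ hpre
  have hexec := Exec.seq he₁ (Exec.call_zero (procs := program.procs) (c := hullBody) rfl he₂)
  have hle := sqrt_logb_le hne
  have hge := le_sqrt_logb hen
  refine ⟨2 ^ e, _, H, _, s₂, ?_, ?_, hexec, hrun, hcall.result, hcall.hull, ?_⟩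
  · rw [Nat.cast_pow, Nat.cast_ofNat, ← Real.rpow_natCast]
    exact Real.rpow_le_rpow_of_exponent_le (by norm_num) hle
  · rw [Nat.cast_pow, Nat.cast_ofNat, ← Real.rpow_natCast,
      show (2 : ℝ) * 2 ^ √(Real.logb 2 n) = 2 ^ (√(Real.logb 2 n) + 1) by
        rw [Real.rpow_add (by norm_num), Real.rpow_one, mul_comm]]
    exact Real.rpow_le_rpow_of_exponent_le (by norm_num) hge
  -- With `e` as the number of levels, the parts proportional to `e * n` are `600` for the
  -- preprocessing, `16000` for small and `56000` for large calls.
  · have hT : t₁ + (t₂ + 1) ≤ 73000 * ((e + 1) * n) + 401 := by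
      rw [List.length_finRange, Nat.sub_zero] at ht₂
      have k1 : 4000 * (e + 1) * (min e 3 + 1) * n ≤ 4000 * (e + 1) * 4 * n :=
        Nat.mul_le_mul_right _ (Nat.mul_le_mul_left _ (by omega))
      have k2 : 56000 * (e - 3) * n ≤ 56000 * e * n :=
        Nat.mul_le_mul_right _ (Nat.mul_le_mul_left _ (by omega))
      have k3 : 4000 * (e + 1) * 4 * n = 16000 * (e * n) + 16000 * n := by ring
      have k4 : 56000 * e * n = 56000 * (e * n) := by ring
      have k5 : (600 * e + 700) * n = 600 * (e * n) + 700 * n := by ring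
      have k6 : (e + 1) * n = e * n + n := by ring
      omega
    have hT' : ((t₁ + (t₂ + 1) : ℕ) : ℝ) ≤ 73000 * ((e + 1) * n) + 401 := by exact_mod_cast hT
    refine hT'.trans ?_
    set r := √(Real.logb 2 n) with hr
    have hr0 : 0 ≤ r := Real.sqrt_nonneg _
    have hn0 : (0 : ℝ) ≤ n := by positivity
    have h1 : ((e : ℝ) + 1) * n ≤ (r + 2) * n := mul_le_mul_of_nonneg_right (by linarith) hn0
    -- For `n ≤ 1` the root vanishes and the additive constant takes over; for `n ≥ 2` the root is
    -- at least `1`.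
    have h2 : (n : ℝ) ≤ n * r + 1 := by
      rcases le_or_gt n 1 with h | h
      · have : (n : ℝ) ≤ 1 := by exact_mod_cast h
        have := mul_nonneg hn0 hr0
        linarith
      · have := mul_le_mul_of_nonneg_left (one_le_sqrt_logb h) hn0
        linarith
    linarith
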